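/- \textbf{Conventions.} An \emph{exact category} $(\mathcal E,\mathcal Ex)$ is a projectively complete (idempotent complete) additive category with a Quillen exact structure. $\mathcal N_{\mathcal Ex}\subseteq K(\mathcal E)$ is the class of acyclic complexes (each differential factors as a deflation $X^n\twoheadrightarrow D^n$ followed by an inflation $D^n\rightarrowtail X^{n+1}$ with every $D^n\to X^{n+1}\to D^{n+1}$ a conflation), and $D(\mathcal E,\mathcal Ex)=K(\mathcal E)/\mathcal N_{\mathcal Ex}$ is the unbounded derived category. All categories are small relative to a fixed, arbitrary universe. A \emph{$D$-kernel} of $f:A\to B$ is a morphism $i:K\to A$ with $fi=0$ such that for each $j:X\to A$ with $fj=0$ there are a deflation $\pi:N\to X$ and $k:N\to K$ with $j\pi=ik$; \emph{$D$-cokernels} are defined dually, with inflations. \textbf{$n$-quasi-abelian categories.} $(\mathcal E,\mathcal Ex)$ is $0$-quasi-abelian if $\mathcal E$ is abelian and $\mathcal Ex$ consists of all kernel-cokernel pairs. It is $1$-quasi-abelian if $\mathcal E$ has kernels and cokernels, push-outs of kernels are kernels, pull-backs of cokernels are cokernels, and $\mathcal Ex$ consists of all kernel-cokernel pairs. For $n\ge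 2$ it is $n$-quasi-abelian if all morphisms have $D$-kernels and $D$-cokernels and one of the following (equivalent) conditions holds: (1) for each sequence of $n-1$ composable morphisms $K^{-n+1}\to\cdots\to K^0$ in which every morphism but the last is a $D$-kernel of the next one, the first morphism has a kernel in $\mathcal E$; (2) for each sequence of $n-1$ composable morphisms $C^{-n+1}\to\cdots\to C^0$ in which every morphism but the first is a $D$-cokernel of the previous one, the last morphism has a cokernel in $\mathcal E$. \textbf{$n$-tilting pairs.} Let $(\mathcal D,\mathcal T)$ be a pair of $t$-structures, with hearts $\mathcal H_{\mathcal D},\mathcal H_{\mathcal T}$, on a triangulated category $\mathcal C$. It is $n$-tilting if $\mathcal D^{\le -n}\subseteq\mathcal T^{\le 0}\subseteq\mathcal D^{\le 0}$; the inclusion of $\mathcal H_{\mathcal D}$ extends to a triangulated equivalence $D(\mathcal H_{\mathcal D})\cong\mathcal C$ which identifies the standard $t$-structure with $\mathcal D$; and every object of $\mathcal H_{\mathcal D}$ is a subobject in $\mathcal H_{\mathcal D}$ of an object of $\mathcal H_{\mathcal D}\cap\mathcal H_{\mathcal T}$. \textbf{$n$-tilting torsion classes.} Let $\mathcal E$ be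 a strictly full subcategory of an abelian category $\mathcal A$. It is an $n$-tilting torsion class if: every object of $\mathcal A$ is a subobject of an object of $\mathcal E$; $\mathcal E$ is closed under extensions; every morphism of $\mathcal E$ has a $D$-kernel for the exact structure of those sequences of $\mathcal E$ that are short exact in $\mathcal A$; and for each exact sequence $0\to A\to X_n\to\cdots\to X_1\to B\to 0$ in $\mathcal A$ with $X_1,\dots,X_n\in\mathcal E$ one has $B\in\mathcal E$. It is an $n$-cotilting torsion-free class if the dual conditions hold (every object is a quotient of an object of $\mathcal E$; closure under extensions; $D$-cokernels; $A\in\mathcal E$ for each exact sequence $0\to A\to Y_1\to\cdots\to Y_n\to B\to0$ with all $Y_i\in\mathcal E$). \textbf{Equivalences.} Exact categories are considered up to additive equivalences that preserve and reflect conflations; triangulated categories with a pair of $t$-structures up to triangulated equivalences that identify the pairs; abelian categories with a strictly full subcategory up to equivalences that identify the subcategories. \textbf{Theorem.} For every integer $n\ge 0$ there are bijections between the following four classes (up to equivalence): $n$-quasi-abelian categories, $n$-tilting pairs of $t$-structures, $n$-tilting torsion classes, $n$-cotilting torsion-free classes. They are described as follows. (a) Let $(\mathcal E,\mathcal Ex)$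 be $n$-quasi-abelian. The functor $\mathcal E\to D(\mathcal E,\mathcal Ex)$ which places an object in degree $0$ is fully faithful. There are $t$-structures $\mathcal{RD}=\mathcal{RD}_{(\mathcal E,\mathcal Ex)}$ and $\mathcal{LD}=\mathcal{LD}_{(\mathcal E,\mathcal Ex)}$ on $D(\mathcal E,\mathcal Ex)$ such that, for all $m\in\mathbb Z$, $\mathcal{RD}^{\ge m}$ consists of the objects isomorphic to complexes that vanish in degrees $<m$, and $\mathcal{LD}^{\le m}$ of the objects isomorphic to complexes that vanish in degrees $>m$. The intersection $\mathcal{RH}\cap\mathcal{LH}$ of their hearts is the essential image of $\mathcal E$. The pair $(\mathcal{RD},\mathcal{LD})$ is $n$-tilting, $\mathcal E$ is an $n$-tilting torsion class in $\mathcal{RH}$ and an $n$-cotilting torsion-free class in $\mathcal{LH}$, and these are the pair, the torsion class and the torsion-free class that correspond to $(\mathcal E,\mathcal Ex)$. (b) An $n$-quasi-abelian category corresponds to an $n$-tilting pair $(\mathcal D,\mathcal T)$ on $\mathcal C$ if and only if it is equivalent to $\mathcal H_{\mathcal D}\cap\mathcal H_{\mathcal T}$ with the conflations $X\to Y\to Z$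 that extend to a distinguished triangle of $\mathcal C$. (c) An $n$-tilting pair $(\mathcal D,\mathcal T)$ corresponds to an $n$-tilting torsion class (respectively to an $n$-cotilting torsion-free class) if and only if the latter is equivalent to $\mathcal H_{\mathcal D}\cap\mathcal H_{\mathcal T}$ in $\mathcal H_{\mathcal D}$ (respectively in $\mathcal H_{\mathcal T}$). (d) An $n$-quasi-abelian category corresponds to an $n$-tilting torsion class, or to an $n$-cotilting torsion-free class, $\mathcal E$ in $\mathcal A$ if and only if it is equivalent to $\mathcal E$ with the conflations that are short exact in $\mathcal A$. -/

import Mathlib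

open CategoryTheory CategoryTheory.Limits CategoryTheory.Triangulated

universe w

namespace NQuasiAbelian

section ExactStructures

variable {E : Type w} [Category.{w} E] [Preadditive E]

/-- `X ⟶ Y ⟶ Z` is a kernel-cokernel pair. -/
def IsKernelCokernelPair (S : ShortComplex E) : Prop :=
  Nonempty (IsLimit (KernelFork.ofι S.f S.zero)) ∧
    Nonempty (IsColimit (CokernelCofork.ofπ S.g S.zero))

/-- Inflations (admissible monomorphisms) of a class of conflations. -/
def IsInflation (conf : ObjectProperty (ShortComplex E)) {X Y : E} (i : X ⟶ Y) : Prop :=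
  ∃ (Z : E) (p : Y ⟶ Z) (zero : i ≫ p = 0), conf (ShortComplex.mk i p zero)

/-- Deflations (admissible epimorphisms) of a class of conflations. -/
def IsDeflation (conf : ObjectProperty (ShortComplex E)) {Y Z : E} (p : Y ⟶ Z) : Prop :=
  ∃ (X : E) (i : X ⟶ Y) (zero : i ≫ p = 0), conf (ShortComplex.mk i p zero)

/-- Quillen's axioms for an exact structure on an additive category, given by its class
of conflations. -/
structure IsExactStructure (conf : ObjectProperty (ShortComplex E)) : Prop where
  of_iso : ∀ {S S' : ShortComplex E}, (S ≅ S') → conf S → conf S'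
  pair : ∀ {S : ShortComplex E}, conf S → IsKernelCokernelPair S
  id_zero : ∀ {Z : E}, IsZero Z → IsDeflation conf (𝟙 Z)
  deflation_comp : ∀ {X Y Z : E} {p : X ⟶ Y} {q : Y ⟶ Z},
    IsDeflation conf p → IsDeflation conf q → IsDeflation conf (p ≫ q)
  inflation_comp : ∀ {X Y Z : E} {i : X ⟶ Y} {j : Y ⟶ Z},
    IsInflation conf i → IsInflation conf j → IsInflation conf (i ≫ j)
  pullback : ∀ {Y Z Z' : E} {p : Y ⟶ Z} (f : Z' ⟶ Z), IsDeflation conf p →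
    ∃ (Y' : E) (f' : Y' ⟶ Y) (p' : Y' ⟶ Z'), IsPullback f' p' p f ∧ IsDeflation conf p'
  pushout : ∀ {X Y X' : E} {i : X ⟶ Y} (f : X ⟶ X'), IsInflation conf i →
    ∃ (Y' : E) (f' : Y ⟶ Y') (i' : X' ⟶ Y'), IsPushout i f f' i' ∧ IsInflation conf i'

variable {conf : ObjectProperty (ShortComplex E)}

namespace IsExactStructure

lemma conf_of_cokernel (h : IsExactStructure conf) {X Y Z : E} {i : X ⟶ Y} {p : Y ⟶ Z}
    (w' : i ≫ p = 0) (hi : IsInflation conf i) (hp : IsColimit (CokernelCofork.ofπ p w')) :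
    conf (ShortComplex.mk i p w') := by
  obtain ⟨Z', p', w'', hc⟩ := hi
  obtain ⟨_, ⟨hp'⟩⟩ := h.pair hc
  let e : Z' ≅ Z := hp'.coconePointUniqueUpToIso hp
  have he : p' ≫ e.hom = p := hp'.comp_coconePointUniqueUpToIso_hom hp .one
  have ee : ShortComplex.mk i p' w'' ≅ ShortComplex.mk i p w' :=
    ShortComplex.isoMk (Iso.refl _) (Iso.refl _) e (by simp) (by simp [he])
  exact h.of_iso ee hc

lemma conf_of_kernel (h : IsExactStructure conf) {X Y Z : E} {i : X ⟶ Y} {p : Y ⟶ Z}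
    (w' : i ≫ p = 0) (hp : IsDeflation conf p) (hi : IsLimit (KernelFork.ofι i w')) :
    conf (ShortComplex.mk i p w') := by
  obtain ⟨X', i', w'', hc⟩ := hp
  obtain ⟨⟨hi'⟩, _⟩ := h.pair hc
  let e : X' ≅ X := hi'.conePointUniqueUpToIso hi
  have he : e.hom ≫ i = i' := hi'.conePointUniqueUpToIso_hom_comp hi .zero
  have ee : ShortComplex.mk i' p w'' ≅ ShortComplex.mk i p w' :=
    ShortComplex.isoMk e (Iso.refl _) (Iso.refl _) (by simp [he]) (by simp)
  exact h.of_iso ee hc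

lemma deflation_iso (h : IsExactStructure conf) {Y Z Y' : E} {p : Y ⟶ Z} (e : Y' ≅ Y)
    (hp : IsDeflation conf p) : IsDeflation conf (e.hom ≫ p) := by
  obtain ⟨X, i, w', hc⟩ := hp
  refine ⟨X, i ≫ e.inv, by simp [w'], h.of_iso ?_ hc⟩
  exact ShortComplex.isoMk (Iso.refl _) e.symm (Iso.refl _) (by simp) (by simp)

lemma inflation_iso (h : IsExactStructure conf) {X Y Y' : E} {i : X ⟶ Y} (e : Y ≅ Y')
    (hi : IsInflation conf i) : IsInflation conf (i ≫ e.hom) := by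
  obtain ⟨Z, p, w', hc⟩ := hi
  refine ⟨Z, e.inv ≫ p, by simp [w'], h.of_iso ?_ hc⟩
  exact ShortComplex.isoMk (Iso.refl _) e (Iso.refl _) (by simp) (by simp)

lemma epi_of_deflation (h : IsExactStructure conf) {Y Z : E} {p : Y ⟶ Z}
    (hp : IsDeflation conf p) : Epi p := by
  obtain ⟨X, i, w', hc⟩ := hp
  obtain ⟨_, ⟨hp'⟩⟩ := h.pair hc
  exact Cofork.IsColimit.epi hp'

lemma conf_zero (h : IsExactStructure conf) {X Y Z : E} (hX : IsZero X) (hY : IsZero Y)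
    (hZ : IsZero Z) : conf (ShortComplex.mk (0 : X ⟶ Y) (0 : Y ⟶ Z) (by simp)) := by
  refine h.conf_of_kernel _ ?_ ?_
  · have := h.deflation_iso (hY.iso hZ) (h.id_zero hZ)
    rwa [Category.comp_id, hY.eq_of_src (hY.iso hZ).hom 0] at this
  · exact KernelFork.IsLimit.ofι _ _ (fun _ _ => 0) (fun _ _ => hY.eq_of_tgt _ _)
      (fun _ _ _ _ => hX.eq_of_tgt _ _)

/-- The pushout of a conflation. -/
lemma conf_pushout (h : IsExactStructure conf) {X Y Z X' P : E} {i : X ⟶ Y} {p : Y ⟶ Z}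
    (w' : i ≫ p = 0) (hc : conf (ShortComplex.mk i p w')) {f : X ⟶ X'} {f' : Y ⟶ P}
    {i' : X' ⟶ P} (sq : IsPushout i f f' i') :
    ∃ (p' : P ⟶ Z) (w'' : i' ≫ p' = 0), f' ≫ p' = p ∧ conf (ShortComplex.mk i' p' w'') := by
  obtain ⟨_, ⟨hp⟩⟩ := h.pair hc
  have : Epi p := Cofork.IsColimit.epi hp
  obtain ⟨P₀, f₀, i₀, sq₀, hi₀⟩ := h.pushout f ⟨_, _, _, hc⟩
  let e : P₀ ≅ P := sq₀.isColimit.coconePointUniqueUpToIso sq.isColimit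
  have he : i₀ ≫ e.hom = i' :=
    sq₀.isColimit.comp_coconePointUniqueUpToIso_hom sq.isColimit WalkingSpan.right
  have hi' : IsInflation conf i' := he ▸ h.inflation_iso e hi₀
  refine ⟨sq.desc p 0 (by simp [w']), by simp, by simp, h.conf_of_cokernel _ hi' ?_⟩
  have key : ∀ {T : E} (t : P ⟶ T) (_ : i' ≫ t = 0), i ≫ f' ≫ t = 0 := by
    intro T t ht
    rw [← Category.assoc, sq.w, Category.assoc, ht, comp_zero]
  refine CokernelCofork.IsColimit.ofπ _ _
    (fun t ht => hp.desc (CokernelCofork.ofπ (f' ≫ t) (key t ht))) ?_ ?_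
  · intro T t ht
    apply sq.hom_ext
    · simpa using hp.fac (CokernelCofork.ofπ (f' ≫ t) (key t ht)) .one
    · simp [ht]
  · intro T t ht m hm
    rw [← cancel_epi p]
    have h1 := hp.fac (CokernelCofork.ofπ (f' ≫ t) (key t ht)) .one
    dsimp at h1
    rw [h1, ← hm]
    simp

lemma inflation_id [HasZeroObject E] (h : IsExactStructure conf) (A : E) : IsInflation conf (𝟙 A) := by
  obtain ⟨Z, hZ⟩ := HasZeroObject.zero (C := E)
  obtain ⟨Y', f', i', sq, hi'⟩ := h.pushout (0 : Z ⟶ A) ⟨_, _, _, h.conf_zero hZ hZ hZ⟩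
  let e : Y' ≅ A :=
    { hom := sq.desc 0 (𝟙 _) (hZ.eq_of_src _ _)
      inv := i'
      hom_inv_id := sq.hom_ext (hZ.eq_of_src _ _) (by simp)
      inv_hom_id := by simp }
  have := h.inflation_iso e hi'
  simpa [e] using this

lemma deflation_to_zero [HasZeroObject E] (h : IsExactStructure conf) (A : E) {Z : E} (hZ : IsZero Z) :
    IsDeflation conf (0 : A ⟶ Z) := by
  refine ⟨A, 𝟙 A, by simp, h.conf_of_cokernel _ (h.inflation_id A) ?_⟩
  exact CokernelCofork.IsColimit.ofπ _ _ (fun _ _ => 0)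
    (fun t ht => by simpa using ht.symm) (fun _ _ _ _ => hZ.eq_of_src _ _)

lemma deflation_pullback (h : IsExactStructure conf) {Y Z Z' P : E} {p : Y ⟶ Z} {f : Z' ⟶ Z}
    {f' : P ⟶ Y} {p' : P ⟶ Z'} (sq : IsPullback f' p' p f) (hp : IsDeflation conf p) :
    IsDeflation conf p' := by
  obtain ⟨P₀, f₀, p₀, sq₀, hp₀⟩ := h.pullback f hp
  let e : P ≅ P₀ := sq.isLimit.conePointUniqueUpToIso sq₀.isLimit
  have he : e.hom ≫ p₀ = p' :=
    sq.isLimit.conePointUniqueUpToIso_hom_comp sq₀.isLimit WalkingCospan.right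
  exact he ▸ h.deflation_iso e hp₀

lemma inflation_pushout (h : IsExactStructure conf) {X Y X' P : E} {i : X ⟶ Y} {f : X ⟶ X'}
    {f' : Y ⟶ P} {i' : X' ⟶ P} (sq : IsPushout i f f' i') (hi : IsInflation conf i) :
    IsInflation conf i' := by
  obtain ⟨Z, p, w', hc⟩ := hi
  obtain ⟨p', w'', _, h'⟩ := h.conf_pushout w' hc sq
  exact ⟨_, _, _, h'⟩

lemma deflation_desc [HasZeroObject E] [HasBinaryBiproducts E]
    (h : IsExactStructure conf) {A Y B : E} (g : A ⟶ B) {q : Y ⟶ B}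
    (hq : IsDeflation conf q) : IsDeflation conf (biprod.desc g q) := by
  obtain ⟨Z, hZ⟩ := HasZeroObject.zero (C := E)
  -- `A ⊞ Y ⟶ A ⊞ B`
  have h1 : IsDeflation conf (biprod.map (𝟙 A) q) := by
    refine h.deflation_pullback (f := biprod.snd) (f' := biprod.snd) (p := q) ?_ hq
    refine IsPullback.of_isLimit' ⟨by simp⟩ (PullbackCone.IsLimit.mk _
      (fun s => biprod.lift (s.snd ≫ biprod.fst) s.fst) ?_ ?_ ?_)
    · intro s; simp
    · intro s
      ext
      · simp
      · simp [s.condition]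
    · intro s m h₁ h₂
      ext
      · simp [← h₂]
      · simp [h₁]
  have h2 : IsDeflation conf (biprod.snd : A ⊞ B ⟶ B) := by
    refine h.deflation_pullback (f := (0 : B ⟶ Z)) (f' := biprod.fst) (p := (0 : A ⟶ Z)) ?_
      (h.deflation_to_zero A hZ)
    refine IsPullback.of_isLimit' ⟨by simp⟩ (PullbackCone.IsLimit.mk _
      (fun s => biprod.lift s.fst s.snd) (by simp) (by simp) ?_)
    intro s m h₁ h₂
    ext
    · simp [h₁]
    · simp [h₂]
  let e : A ⊞ B ≅ A ⊞ B :=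
    { hom := biprod.lift biprod.fst (biprod.desc g (𝟙 _))
      inv := biprod.lift biprod.fst (biprod.desc (-g) (𝟙 _)) }
  have h3 := h.deflation_comp h1 (h.deflation_iso e h2)
  convert h3 using 1
  ext <;> simp [e]

lemma inflation_map_id [HasBinaryBiproducts E] (h : IsExactStructure conf) {A X : E} (Y : E) {m : A ⟶ X}
    (hm : IsInflation conf m) : IsInflation conf (biprod.map m (𝟙 Y)) := by
  refine h.inflation_pushout (f := biprod.inl) (f' := biprod.inl) (i := m) ?_ hm
  refine IsPushout.of_isColimit' ⟨by simp⟩ (PushoutCocone.IsColimit.mk _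
      (fun s => biprod.desc s.inl (biprod.inr ≫ s.inr)) ?_ ?_ ?_)
  · intro s; simp
  · intro s
    ext
    · simp [s.condition]
    · simp
  · intro s m h₁ h₂
    ext
    · simp [h₁]
    · simp [← h₂]

/-- The key diagram chase for mapping cones. -/
lemma inflation_lift [HasZeroObject E] [HasBinaryBiproducts E]
    (h : IsExactStructure conf) {A B P Y B' : E} {b : B ⟶ P} {p : P ⟶ A}
    {bp : b ≫ p = 0} (hP : conf (ShortComplex.mk b p bp)) {n : B ⟶ Y} {q : Y ⟶ B'}
    {nq : n ≫ q = 0} (hY : conf (ShortComplex.mk n q nq)) {y : P ⟶ Y} {g : A ⟶ B'}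
    (h₁ : b ≫ y = n) (h₂ : p ≫ g = y ≫ q) : IsInflation conf (biprod.lift (-p) y) := by
  obtain ⟨⟨hb⟩, ⟨hp⟩⟩ := h.pair hP
  obtain ⟨⟨hn⟩, ⟨hq⟩⟩ := h.pair hY
  have mb : Mono b := Fork.IsLimit.mono hb
  have mn : Mono n := Fork.IsLimit.mono hn
  have hw : biprod.lift (-p) y ≫ biprod.desc g q = 0 := by simp [h₂]
  have hmono : Mono (biprod.lift (-p) y) := by
    refine Preadditive.mono_of_cancel_zero _ (fun {T} k hk => ?_)
    have k1 : k ≫ p = 0 := by simpa using congr_arg (fun t => t ≫ biprod.fst) hk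
    have k2 : k ≫ y = 0 := by simpa using congr_arg (fun t => t ≫ biprod.snd) hk
    obtain ⟨r, hr⟩ := KernelFork.IsLimit.lift' hb k k1
    dsimp at hr
    have : r ≫ n = 0 := by rw [← h₁, ← Category.assoc, hr, k2]
    rw [← hr, (cancel_mono n).1 (this.trans zero_comp.symm), zero_comp]
  have key : ∀ {T : E} (t : T ⟶ A ⊞ Y) (_ : t ≫ biprod.desc g q = 0),
      ∃ l : T ⟶ P, l ≫ biprod.lift (-p) y = t := by
    intro T t ht
    obtain ⟨T', l, π, sq, hπ⟩ := h.pullback (t ≫ biprod.fst) (p := p) ⟨_, _, _, hP⟩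
    have ht' : (t ≫ biprod.fst) ≫ g + (t ≫ biprod.snd) ≫ q = 0 := by
      rw [← ht, biprod.desc_eq]; simp
    have h3 : (π ≫ t ≫ biprod.snd + l ≫ y) ≫ q = 0 := by
      have := congr_arg (fun z => π ≫ z) ht'
      simp only [Preadditive.comp_add, comp_zero] at this
      rw [Preadditive.add_comp, Category.assoc, Category.assoc l, ← h₂, ← Category.assoc l p g,
        sq.w, add_comm]
      simpa using this
    obtain ⟨r, hr⟩ := KernelFork.IsLimit.lift' hn _ h3
    dsimp at hr
    have h4 : (r ≫ b - l) ≫ biprod.lift (-p) y = π ≫ t := by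
      ext
      · simp [bp, sq.w]
      · simp [h₁, hr]
    obtain ⟨N, k, kπ, hk⟩ := hπ
    obtain ⟨_, ⟨hπ'⟩⟩ := h.pair hk
    have : Epi π := Cofork.IsColimit.epi hπ'
    have h5 : k ≫ (r ≫ b - l) = 0 := by
      rw [← cancel_mono (biprod.lift (-p) y), Category.assoc, h4, ← Category.assoc, kπ]
      simp
    obtain ⟨l', hl'⟩ := CokernelCofork.IsColimit.desc' hπ' _ h5
    dsimp at hl'
    refine ⟨l', ?_⟩
    rw [← cancel_epi π, ← Category.assoc, hl', h4]
  refine ⟨B', biprod.desc g q, hw, h.conf_of_kernel hw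
    (h.deflation_desc g ⟨_, _, _, hY⟩) ?_⟩
  exact KernelFork.IsLimit.ofι _ _ (fun t ht => (key t ht).choose)
    (fun t ht => (key t ht).choose_spec)
    (fun t ht m hm => by rw [← cancel_mono (biprod.lift (-p) y), hm, (key t ht).choose_spec])

/-- The conflations which appear in a mapping cone. -/
lemma conf_cone [HasZeroObject E] [HasBinaryBiproducts E]
    (h : IsExactStructure conf) {A' B B' P P' Y X C : E}
    {b : B ⟶ P} {p : P ⟶ A'} {bp : b ≫ p = 0} (hP : conf (ShortComplex.mk b p bp))
    {n : B ⟶ Y} {q : Y ⟶ B'} {nq : n ≫ q = 0} (hY : conf (ShortComplex.mk n q nq))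
    {y : P ⟶ Y} {g : A' ⟶ B'} (h₁ : b ≫ y = n) (h₂ : p ≫ g = y ≫ q)
    {m : A' ⟶ X} (hm : IsInflation conf m) {x' : X ⟶ P'} {b' : B' ⟶ P'}
    (sq : IsPushout m g x' b') (e : C ≅ X ⊞ Y)
    (v : P ⟶ C) (u : C ⟶ P')
    (hv : v = biprod.lift (-(p ≫ m)) y ≫ e.inv) (hu : u = e.hom ≫ biprod.desc x' (q ≫ b')) :
    ∃ w' : v ≫ u = 0, conf (ShortComplex.mk v u w') := by
  have i1 := h.inflation_lift hP hY h₁ h₂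
  have hv' : v = (biprod.lift (-p) y ≫ biprod.map m (𝟙 Y)) ≫ e.symm.hom := by
    rw [hv, Iso.symm_hom]
    congr 1
    ext <;> simp
  have hinfl : IsInflation conf v := by
    rw [hv']
    exact h.inflation_iso e.symm (h.inflation_comp i1 (h.inflation_map_id Y hm))
  have w' : v ≫ u = 0 := by
    rw [hv, hu, Category.assoc, Iso.inv_hom_id_assoc, biprod.lift_desc, ← Category.assoc y, ← h₂]
    simp [sq.w]
  refine ⟨w', ?_⟩
  obtain ⟨⟨hb⟩, ⟨hp⟩⟩ := h.pair hP
  obtain ⟨⟨hn⟩, ⟨hq⟩⟩ := h.pair hY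
  have ep : Epi p := Cofork.IsColimit.epi hp
  have eq : Epi q := Cofork.IsColimit.epi hq
  have hepi : Epi u := by
    refine Preadditive.epi_of_cancel_zero _ (fun {T} k hk => ?_)
    rw [hu, Category.assoc] at hk
    have hk' := (cancel_epi e.hom).1 (hk.trans comp_zero.symm)
    have k1 : x' ≫ k = 0 := by simpa using congr_arg (fun t => biprod.inl ≫ t) hk'
    have k2 : q ≫ b' ≫ k = 0 := by simpa using congr_arg (fun t => biprod.inr ≫ t) hk'
    apply sq.hom_ext
    · simp [k1]
    · rw [← cancel_epi q, k2]; simp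
  have key : ∀ {T : E} (t : C ⟶ T) (_ : v ≫ t = 0), ∃ l : P' ⟶ T, u ≫ l = t := by
    intro T t ht
    set t₁ := biprod.inl ≫ e.inv ≫ t with ht₁
    set t₂ := biprod.inr ≫ e.inv ≫ t with ht₂
    have ht' : e.inv ≫ t = biprod.desc t₁ t₂ := by ext <;> simp [ht₁, ht₂]
    have h3 : y ≫ t₂ = p ≫ m ≫ t₁ := by
      rw [hv, Category.assoc, ht', biprod.lift_desc] at ht
      have := eq_neg_of_add_eq_zero_right ht
      simpa using this
    have h4 : n ≫ t₂ = 0 := by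
      rw [← h₁, Category.assoc, h3, ← Category.assoc, bp, zero_comp]
    obtain ⟨s, hs⟩ := CokernelCofork.IsColimit.desc' hq _ h4
    dsimp at hs
    have h5 : m ≫ t₁ = g ≫ s := by
      rw [← cancel_epi p, ← h3, ← hs, ← Category.assoc p, h₂, Category.assoc]
    refine ⟨sq.desc t₁ s h5, ?_⟩
    rw [hu, ← cancel_epi e.inv, ht']
    ext <;> simp [hs]
  refine h.conf_of_cokernel _ hinfl ?_
  exact CokernelCofork.IsColimit.ofπ _ _ (fun t ht => (key t ht).choose)
    (fun t ht => (key t ht).choose_spec)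
    (fun t ht m hm => by rw [← cancel_epi u, hm, (key t ht).choose_spec])

end IsExactStructure

end ExactStructures

section Derived

variable {E : Type w} [Category.{w} E] [Preadditive E]

/-- A complex is acyclic if each differential `X n ⟶ X (n + 1)` factors as a deflation followed
by an inflation `X n ⟶ D n ⟶ X (n + 1)` such that each `D n ⟶ X (n + 1) ⟶ D (n + 1)` is
a conflation. -/
def IsAcyclic (conf : ObjectProperty (ShortComplex E)) (X : CochainComplex E ℤ) : Prop :=
  ∃ (D : ℤ → E) (e : ∀ n, X.X n ⟶ D n) (m : ∀ i j, i + 1 = j → (D i ⟶ X.X j)),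
    (∀ i j (hij : i + 1 = j), e i ≫ m i j hij = X.d i j) ∧
    ∀ i j (hij : i + 1 = j), ∃ zero : m i j hij ≫ e j = 0,
      conf (ShortComplex.mk (m i j hij) (e j) zero)

/-- The objects of the homotopy category which are acyclic complexes. -/
def acyclicComplexes (conf : ObjectProperty (ShortComplex E)) :
    ObjectProperty (HomotopyCategory E (ComplexShape.up ℤ)) :=
  fun X => IsAcyclic conf X.as

variable {conf : ObjectProperty (ShortComplex E)}

lemma isAcyclic_zero [HasZeroObject E] (h : IsExactStructure conf) {X : CochainComplex E ℤ}
    (hX : ∀ n, IsZero (X.X n)) : IsAcyclic conf X := by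
  refine ⟨fun n => X.X n, fun n => 0, fun i j hij => 0, fun i j hij => (hX i).eq_of_src _ _, ?_⟩
  exact fun i j hij => ⟨by simp, h.conf_zero (hX _) (hX _) (hX _)⟩

lemma IsAcyclic.shift (h : IsExactStructure conf) {X : CochainComplex E ℤ}
    (hX : IsAcyclic conf X) (a : ℤ) : IsAcyclic conf (X⟦a⟧) := by
  obtain ⟨D, e, m, hd, hc⟩ := hX
  have key : ∀ {A B C : E} {i : A ⟶ B} {p : B ⟶ C} {z : i ≫ p = 0},
      conf (ShortComplex.mk i p z) →
      ∃ z' : (a.negOnePow • i) ≫ p = 0, conf (ShortComplex.mk (a.negOnePow • i) p z') := by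
    intro A B C i p z hi
    have z' : (a.negOnePow • i) ≫ p = 0 := by rw [Linear.units_smul_comp, z, smul_zero]
    have hu : a.negOnePow • a.negOnePow • 𝟙 A = 𝟙 A := by
      rw [smul_smul, Int.units_mul_self, one_smul]
    let u : A ≅ A :=
      { hom := a.negOnePow • 𝟙 A
        inv := a.negOnePow • 𝟙 A
        hom_inv_id := by rw [Linear.units_smul_comp, Category.id_comp, hu]
        inv_hom_id := by rw [Linear.units_smul_comp, Category.id_comp, hu] }
    have ee : ShortComplex.mk i p z ≅ ShortComplex.mk (a.negOnePow • i) p z' :=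
      ShortComplex.isoMk u (Iso.refl _) (Iso.refl _) (by
        change (a.negOnePow • 𝟙 A) ≫ (a.negOnePow • i) = i ≫ 𝟙 B
        rw [Linear.units_smul_comp, Category.id_comp, smul_smul, Int.units_mul_self, one_smul,
          Category.comp_id]) (by simp)
    exact ⟨z', h.of_iso ee hi⟩
  refine ⟨fun n => D (n + a), fun n => e (n + a),
    fun i j hij => a.negOnePow • m (i + a) (j + a) (by omega), ?_, ?_⟩
  · intro i j hij
    change e (i + a) ≫ (a.negOnePow • m (i + a) (j + a) (by omega)) =
      a.negOnePow • X.d (i + a) (j + a)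
    rw [Linear.comp_units_smul, hd]
  · intro i j hij
    obtain ⟨z, hz⟩ := hc (i + a) (j + a) (by omega)
    exact key hz

lemma IsAcyclic.mappingCone [HasZeroObject E] [HasBinaryBiproducts E] (h : IsExactStructure conf)
    {X Y : CochainComplex E ℤ} (f : X ⟶ Y) (hX : IsAcyclic conf X) (hY : IsAcyclic conf Y) :
    IsAcyclic conf (CochainComplex.mappingCone f) := by
  obtain ⟨A, e, m, hd, hc⟩ := hX
  obtain ⟨B, q, n, hd', hc'⟩ := hY
  -- the induced maps on cycles
  have hg : ∀ i, ∃ g : A i ⟶ B i, e i ≫ g = f.f i ≫ q i ∧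
      ∀ j hij, g ≫ n i j hij = m i j hij ≫ f.f j := by
    intro i
    obtain ⟨z, hz⟩ := hc (i - 1) i (by omega)
    obtain ⟨z', hz'⟩ := hc' i (i + 1) rfl
    obtain ⟨_, ⟨he⟩⟩ := h.pair hz
    obtain ⟨⟨hn⟩, _⟩ := h.pair hz'
    have me : Epi (e i) := Cofork.IsColimit.epi he
    have mn : Mono (n i (i + 1) rfl) := Fork.IsLimit.mono hn
    have : m (i - 1) i (by omega) ≫ f.f i ≫ q i = 0 := by
      obtain ⟨z₁, hz₁⟩ := hc (i - 1 - 1) (i - 1) (by omega)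
      obtain ⟨_, ⟨he₁⟩⟩ := h.pair hz₁
      have me₁ : Epi (e (i - 1)) := Cofork.IsColimit.epi he₁
      rw [← cancel_epi (e (i - 1)), ← cancel_mono (n i (i + 1) rfl)]
      simp only [Category.assoc, hd', comp_zero, zero_comp]
      rw [f.comm, ← Category.assoc, ← Category.assoc, hd]
      simp
    obtain ⟨g, hg⟩ := CokernelCofork.IsColimit.desc' he _ this
    dsimp at hg
    refine ⟨g, hg, fun j hij => ?_⟩
    rw [← cancel_epi (e i), ← Category.assoc, hg, Category.assoc, hd', f.comm, ← Category.assoc, hd]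
  choose g hg₁ hg₂ using hg
  have hinf : ∀ i j hij, IsInflation conf (m i j hij) := fun i j hij => ⟨_, _, _, (hc i j hij).2⟩
  choose P x b sq _ using fun i => h.pushout (g i) (hinf i (i + 1) rfl)
  choose p bp xp hP using fun i => h.conf_pushout _ (hc i (i + 1) rfl).2 (sq i)
  -- the map from the cone to its cycles
  let u : ∀ i, (CochainComplex.mappingCone f).X i ⟶ P i := fun i =>
    (CochainComplex.mappingCone.fst f).1.v i (i + 1) rfl ≫ x i +
      (CochainComplex.mappingCone.snd f).v i i (add_zero i) ≫ q i ≫ b i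
  have hv : ∀ i j, i + 1 = j → ∃ v : P i ⟶ (CochainComplex.mappingCone f).X j,
      u i ≫ v = (CochainComplex.mappingCone f).d i j ∧
      ∃ zero : v ≫ u j = 0, conf (ShortComplex.mk v (u j) zero) := by
    rintro i j rfl
    let y : P i ⟶ Y.X (i + 1) := (sq i).desc (f.f (i + 1)) (n i (i + 1) rfl) (hg₂ i _ rfl).symm
    have hy₁ : x i ≫ y = f.f (i + 1) := by simp [y]
    have hy₂ : b i ≫ y = n i (i + 1) rfl := by simp [y]
    have hy₃ : p i ≫ g (i + 1) = y ≫ q (i + 1) := by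
      obtain ⟨z, hz⟩ := hc' i (i + 1) rfl
      apply (sq i).hom_ext
      · rw [← Category.assoc, xp, hg₁, ← Category.assoc, hy₁]
      · rw [← Category.assoc, bp, zero_comp, ← Category.assoc, hy₂, z]
    let ε : (CochainComplex.mappingCone f).X (i + 1) ≅ X.X (i + 1 + 1) ⊞ Y.X (i + 1) :=
      { hom := biprod.lift ((CochainComplex.mappingCone.fst f).1.v (i + 1) (i + 1 + 1) rfl)
          ((CochainComplex.mappingCone.snd f).v (i + 1) (i + 1) (add_zero _))
        inv := biprod.desc ((CochainComplex.mappingCone.inl f).v (i + 1 + 1) (i + 1) (by omega))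
          ((CochainComplex.mappingCone.inr f).f (i + 1))
        hom_inv_id := by
          rw [biprod.lift_desc]
          exact CochainComplex.mappingCone.id_X f (i + 1) (i + 1 + 1) rfl
        inv_hom_id := by ext <;> simp }
    let v : P i ⟶ (CochainComplex.mappingCone f).X (i + 1) :=
      biprod.lift (-(p i ≫ m (i + 1) (i + 1 + 1) rfl)) y ≫ ε.inv
    refine ⟨v, ?_, ?_⟩
    · have hv : v = -(p i ≫ m (i + 1) (i + 1 + 1) rfl) ≫
          (CochainComplex.mappingCone.inl f).v (i + 1 + 1) (i + 1) (by omega) +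
          y ≫ (CochainComplex.mappingCone.inr f).f (i + 1) := by
        simp [v, ε, biprod.lift_desc]
      rw [CochainComplex.mappingCone.ext_from_iff f (i + 1) i rfl,
        CochainComplex.mappingCone.inl_v_d f (i + 1) i (i + 1 + 1) (by omega) (by omega)]
      constructor
      · simp only [u, hv]
        simp [reassoc_of% hy₁, reassoc_of% xp, reassoc_of% hd]
        abel
      · simp only [u, hv]
        simp [reassoc_of% hy₂, reassoc_of% bp, reassoc_of% hd']
    · refine h.conf_cone (hP i) (hc' i (i + 1) rfl).2 hy₂ hy₃ (hinf _ _ _) (sq (i + 1)) ε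
        v (u (i + 1)) rfl ?_
      simp only [ε, biprod.lift_desc, u]
  choose v hv₁ hv₂ using hv
  exact ⟨P, u, v, hv₁, hv₂⟩

variable [HasZeroObject E] [HasBinaryBiproducts E]

lemma isTriangulated_acyclicComplexes (h : IsExactStructure conf) :
    (acyclicComplexes conf).IsTriangulated := by
  have : (acyclicComplexes conf).IsTriangulatedClosed₃ := by
    refine ⟨fun T hT h₁ h₂ => ?_⟩
    let K := T.obj₁.as
    let L := T.obj₂.as
    obtain ⟨f, hf⟩ := (HomotopyCategory.quotient E (ComplexShape.up ℤ)).map_surjective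
      (X := K) (Y := L) T.mor₁
    have hT' := HomotopyCategory.mappingCone_triangleh_distinguished f
    let e := Pretriangulated.isoTriangleOfIso₁₂ _ _ hT hT' (Iso.refl _) (Iso.refl _) (by
      refine (Category.comp_id (X := T.obj₁) (Y := T.obj₂) T.mor₁).trans ?_
      exact hf.symm.trans (Category.id_comp _).symm)
    exact ⟨_, IsAcyclic.mappingCone h f h₁ h₂, ⟨Pretriangulated.Triangle.π₃.mapIso e⟩⟩
  have : (acyclicComplexes conf).IsStableUnderShift ℤ := by
    refine ⟨fun a => ⟨fun X hX => ?_⟩⟩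
    change IsAcyclic conf (((HomotopyCategory.quotient E (ComplexShape.up ℤ)).obj X.as)⟦a⟧).as
    rw [HomotopyCategory.shift_quotient_obj]
    exact IsAcyclic.shift h hX a
  have : (acyclicComplexes conf).ContainsZero := by
    obtain ⟨Z, hZ⟩ := HasZeroObject.zero (C := CochainComplex E ℤ)
    refine ⟨(HomotopyCategory.quotient E (ComplexShape.up ℤ)).obj Z,
      Functor.map_isZero _ hZ, isAcyclic_zero h fun n => ?_⟩
    exact Functor.map_isZero (HomologicalComplex.eval E (ComplexShape.up ℤ) n) hZ
  have : (acyclicComplexes conf).IsTriangulatedClosed₂ :=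
    ObjectProperty.IsTriangulatedClosed₂.of_isTriangulatedClosed₃
  constructor

end Derived



section Heart

open Pretriangulated

variable {C : Type w} [Category.{w} C] [Preadditive C] [HasZeroObject C] [HasShift C ℤ]
  [∀ n : ℤ, (shiftFunctor C n).Additive] [Pretriangulated C]

lemma heart_hom_eq_zero (t : TStructure C) ⦃X Y : t.heart.FullSubcategory⦄ ⦃n : ℤ⦄
    (f : t.heart.ι.obj X ⟶ (t.heart.ι.obj Y)⟦n⟧) (hn : n < 0) : f = 0 := by
  obtain ⟨hX, -⟩ := (t.mem_heart_iff _).1 X.property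
  obtain ⟨-, hY⟩ := (t.mem_heart_iff _).1 Y.property
  have hY' : t.IsGE ((t.heart.ι.obj Y)⟦n⟧) (-n) := t.isGE_shift Y.obj 0 n (-n) (by omega)
  exact t.zero_of_isLE_of_isGE f 0 (-n) (by omega) hX hY'

lemma heart_admissible (t : TStructure C) :
    AbelianSubcategory.admissibleMorphism t.heart.ι = ⊤ := by
  refine top_le_iff.1 ?_
  intro X₁ X₂ f₁ _ X₃ f₂ f₃ hT
  obtain ⟨h₁, h₁'⟩ := (t.mem_heart_iff _).1 X₁.property
  obtain ⟨h₂, h₂'⟩ := (t.mem_heart_iff _).1 X₂.property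
  have hT' := rot_of_distTriang _ hT
  have h₁s : t.IsLE (X₁.obj⟦(1 : ℤ)⟧) (-1) := t.isLE_shift _ 0 1 (-1) (by omega)
  have h₁s' : t.IsGE (X₁.obj⟦(1 : ℤ)⟧) (-1) := t.isGE_shift _ 0 1 (-1) (by omega)
  have h₃ : t.IsLE X₃ 0 := t.isLE₂ _ hT' 0 h₂ (t.isLE_of_le (X₁.obj⟦(1 : ℤ)⟧) (-1) 0 (by omega))
  have h₃' : t.IsGE X₃ (-1) := t.isGE₂ _ hT' (-1) (t.isGE_of_ge X₂.obj (-1) 0 (by omega)) h₁s'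
  obtain ⟨L, R, hL, hR, a, b, c, hLR⟩ := t.exists_triangle X₃ (-1) 0 (by omega)
  have hL : t.IsLE L (-1) := ⟨hL⟩
  have hR : t.IsGE R 0 := ⟨hR⟩
  have hR' : t.IsLE R 0 := by
    have : t.IsLE (L⟦(1 : ℤ)⟧) (-2) := t.isLE_shift _ (-1) 1 (-2) (by omega)
    exact t.isLE₂ _ (rot_of_distTriang _ hLR) 0 h₃ (t.isLE_of_le (L⟦(1 : ℤ)⟧) (-2) 0 (by omega))
  have hL' : t.IsGE L (-1) := by
    have : t.IsGE (R⟦(-1 : ℤ)⟧) 1 := t.isGE_shift _ 0 (-1) 1 (by omega)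
    exact t.isGE₂ _ (inv_rot_of_distTriang _ hLR) (-1) (t.isGE_of_ge (R⟦(-1 : ℤ)⟧) (-1) 1 (by omega)) h₃'
  have hK : t.heart (L⟦(-1 : ℤ)⟧) := (t.mem_heart_iff _).2
    ⟨t.isLE_shift L (-1) (-1) 0 (by omega), t.isGE_shift L (-1) (-1) 0 (by omega)⟩
  have hQ : t.heart R := (t.mem_heart_iff _).2 ⟨hR', hR⟩
  let e : (L⟦(-1 : ℤ)⟧)⟦(1 : ℤ)⟧ ≅ L := (shiftEquiv C (1 : ℤ)).counitIso.app L
  refine ⟨⟨_, hK⟩, ⟨_, hQ⟩, e.hom ≫ a, b, c ≫ e.inv⟦(1 : ℤ)⟧', ?_⟩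
  refine isomorphic_distinguished _ hLR _
    (Triangle.isoMk _ _ e (Iso.refl _) (Iso.refl _) ?_ ?_ ?_)
  · exact Category.comp_id _
  · exact (Category.comp_id _).trans (Category.id_comp _).symm
  · change (c ≫ e.inv⟦(1 : ℤ)⟧') ≫ e.hom⟦(1 : ℤ)⟧' = 𝟙 _ ≫ c
    rw [Category.assoc, ← Functor.map_comp, e.inv_hom_id, CategoryTheory.Functor.map_id, Category.comp_id,
      Category.id_comp]

lemma heart_hasFiniteProducts (t : TStructure C) : HasFiniteProducts t.heart.FullSubcategory := by
  have : t.heart.ContainsZero := by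
    obtain ⟨Z, hZ⟩ := HasZeroObject.zero (C := C)
    refine ⟨Z, hZ, (t.mem_heart_iff _).2 ⟨?_, ?_⟩⟩
    · exact (t.isLE_iff_orthogonal 0 1 rfl Z).2 fun _ _ _ => hZ.eq_of_src _ _
    · exact (t.isGE_iff_orthogonal (-1) 0 rfl Z).2 fun _ _ _ => hZ.eq_of_tgt _ _
  have : t.heart.IsClosedUnderBinaryProducts := by
    refine ⟨?_⟩
    rintro X ⟨p⟩
    let A := p.diag.obj ⟨WalkingPair.left⟩
    let B := p.diag.obj ⟨WalkingPair.right⟩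
    have hA : t.heart A := p.prop_diag_obj _
    have hB : t.heart B := p.prop_diag_obj _
    rw [t.mem_heart_iff] at hA hB
    have h := binaryBiproductTriangle_distinguished A B
    have hAB : t.heart (A ⊞ B) := (t.mem_heart_iff _).2
      ⟨t.isLE₂ _ h 0 hA.1 hB.1, t.isGE₂ _ h 0 hA.2 hB.2⟩
    have l := (IsLimit.postcomposeHomEquiv (diagramIsoPair p.diag) p.cone).symm p.isLimit
    exact t.heart.prop_of_iso
      ((BinaryBiproduct.isLimit A B).conePointUniqueUpToIso l) hAB
  have := ObjectProperty.IsClosedUnderFiniteProducts.mk' (P := t.heart)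
  infer_instance

/-- The heart of a t-structure is an abelian category. -/
noncomputable instance heartAbelian [IsTriangulated C] (t : TStructure C) :
    Abelian t.heart.FullSubcategory :=
  have := heart_hasFiniteProducts t
  AbelianSubcategory.abelian t.heart.ι (heart_hom_eq_zero t) (heart_admissible t)

end Heart

section NQuasiAbelianCategories

variable {E : Type w} [Category.{w} E] [Preadditive E]

/-- `i : K ⟶ A` is a `D(E, Ex)`-kernel of `f : A ⟶ B`: it is killed by `f` and any morphism `j`
killed by `f` lifts to `K` after composition with a deflation. -/
def IsDKernel (conf : ObjectProperty (ShortComplex E)) {K A B : E} (i : K ⟶ A) (f : A ⟶ B) :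
    Prop :=
  i ≫ f = 0 ∧ ∀ ⦃X : E⦄ (j : X ⟶ A), j ≫ f = 0 →
    ∃ (N : E) (π : N ⟶ X) (k : N ⟶ K), IsDeflation conf π ∧ π ≫ j = k ≫ i

/-- `p : B ⟶ Q` is a `D(E, Ex)`-cokernel of `f : A ⟶ B`: it kills `f` and any morphism `j`
killing `f` extends to `Q` after composition with an inflation. -/
def IsDCokernel (conf : ObjectProperty (ShortComplex E)) {A B Q : E} (f : A ⟶ B) (p : B ⟶ Q) :
    Prop :=
  f ≫ p = 0 ∧ ∀ ⦃X : E⦄ (j : B ⟶ X), f ≫ j = 0 →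
    ∃ (N : E) (π : X ⟶ N) (k : Q ⟶ N), IsInflation conf π ∧ j ≫ π = p ≫ k

/-- Every morphism has a `D(E, Ex)`-kernel. -/
def HasDKernels (conf : ObjectProperty (ShortComplex E)) : Prop :=
  ∀ ⦃A B : E⦄ (f : A ⟶ B), ∃ (K : E) (i : K ⟶ A), IsDKernel conf i f

/-- Every morphism has a `D(E, Ex)`-cokernel. -/
def HasDCokernels (conf : ObjectProperty (ShortComplex E)) : Prop :=
  ∀ ⦃A B : E⦄ (f : A ⟶ B), ∃ (Q : E) (p : B ⟶ Q), IsDCokernel conf f p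

/-- In any sequence of `m + 1` composable morphisms, each of which (except the last one) is
a `D(E, Ex)`-kernel of the next one, the first morphism has a kernel. -/
def HasKernelsAfter (conf : ObjectProperty (ShortComplex E)) (m : ℕ) : Prop :=
  ∀ S : ComposableArrows E (m + 1),
    (∀ (j : ℕ) (hj : j + 2 ≤ m + 1),
      IsDKernel conf (S.map' j (j + 1)) (S.map' (j + 1) (j + 2))) →
    HasKernel (S.map' 0 1)

/-- In any sequence of `m + 1` composable morphisms, each of which (except the first one) is
a `D(E, Ex)`-cokernel of the previous one, the last morphism has a cokernel. -/
def HasCokernelsAfter (conf : ObjectProperty (ShortComplex E)) (m : ℕ) : Prop :=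
  ∀ S : ComposableArrows E (m + 1),
    (∀ (j : ℕ) (hj : j + 2 ≤ m + 1),
      IsDCokernel conf (S.map' j (j + 1)) (S.map' (j + 1) (j + 2))) →
    HasCokernel (S.map' m (m + 1))

variable (E) in
/-- The category `E` is `1`-quasi-abelian (i.e. quasi-abelian): it has kernels and cokernels,
push-outs of kernels are kernels and pull-backs of cokernels are cokernels. -/
def IsQuasiAbelian : Prop :=
  HasKernels E ∧ HasCokernels E ∧
    (∀ ⦃X Y X' Y' : E⦄ (i : X ⟶ Y) (f : X ⟶ X') (f' : Y ⟶ Y') (i' : X' ⟶ Y'),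
      IsPushout i f f' i' → Nonempty (NormalMono i) → Nonempty (NormalMono i')) ∧
    (∀ ⦃Y Z Y' Z' : E⦄ (f' : Y' ⟶ Y) (p' : Y' ⟶ Z') (p : Y ⟶ Z) (f : Z' ⟶ Z),
      IsPullback f' p' p f → Nonempty (NormalEpi p) → Nonempty (NormalEpi p'))

/-- The exact category `(E, conf)` is `n`-quasi-abelian. The `0`-quasi-abelian categories are the
abelian categories and the `1`-quasi-abelian categories are the quasi-abelian categories, both
with all the kernel-cokernel pairs as conflations. -/
def IsNQuasiAbelian (conf : ObjectProperty (ShortComplex E)) : ℕ → Prop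
  | 0 => Nonempty (Abelian E) ∧ ∀ S, IsKernelCokernelPair S → conf S
  | 1 => IsQuasiAbelian E ∧ ∀ S, IsKernelCokernelPair S → conf S
  | m + 2 => HasDKernels conf ∧ HasDCokernels conf ∧
      (HasKernelsAfter conf m ∨ HasCokernelsAfter conf m)

end NQuasiAbelianCategories

section TorsionClasses

variable {A : Type w} [Category.{w} A] [Abelian A]

/-- The conflations of a full subcategory of an abelian category: the sequences in the subcategory
which are short exact in the abelian category. -/
def inducedConflations (P : ObjectProperty A) : ObjectProperty (ShortComplex P.FullSubcategory) :=
  fun S => (S.map P.ι).ShortExact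

/-- The full subcategory `P` of the abelian category `A` is an `n`-tilting torsion class. In the
last condition, `S` is an exact sequence `0 ⟶ A' ⟶ X_n ⟶ ⋯ ⟶ X_1 ⟶ B ⟶ 0`. -/
structure IsNTiltingTorsionClass (n : ℕ) (P : ObjectProperty A) : Prop where
  cogenerates : ∀ X : A, ∃ (Y : A) (i : X ⟶ Y), P Y ∧ Mono i
  extensions : P.IsClosedUnderExtensions
  hasDKernels : HasDKernels (inducedConflations P)
  last : ∀ S : ComposableArrows A (n + 1), S.Exact → Mono (S.map' 0 1) →
    Epi (S.map' n (n + 1)) → (∀ (i : ℕ) (hi : i < n), P (S.obj' (i + 1))) → P (S.obj' (n + 1))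

/-- The full subcategory `P` of the abelian category `A` is an `n`-cotilting torsion-free class.
In the last condition, `S` is an exact sequence `0 ⟶ A' ⟶ Y_1 ⟶ ⋯ ⟶ Y_n ⟶ B ⟶ 0`. -/
structure IsNCotiltingTorsionFreeClass (n : ℕ) (P : ObjectProperty A) : Prop where
  generates : ∀ X : A, ∃ (Y : A) (p : Y ⟶ X), P Y ∧ Epi p
  extensions : P.IsClosedUnderExtensions
  hasDCokernels : HasDCokernels (inducedConflations P)
  first : ∀ S : ComposableArrows A (n + 1), S.Exact → Mono (S.map' 0 1) →
    Epi (S.map' n (n + 1)) → (∀ (i : ℕ) (hi : i < n), P (S.obj' (i + 1))) → P (S.obj' 0)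

end TorsionClasses

section TiltingPairs

variable {C : Type w} [Category.{w} C] [Preadditive C] [HasZeroObject C] [HasShift C ℤ]
  [∀ n : ℤ, (shiftFunctor C n).Additive] [Pretriangulated C] [IsTriangulated C]

/-- The triangulated category `C` is the derived category of the heart of `t`: the inclusion of the
heart extends to a triangulated equivalence from the derived category of the heart, which
identifies the standard t-structure with `t`. -/
def IsDerivedCategoryOfHeart (t : TStructure C) : Prop :=
  letI := HasDerivedCategory.standard t.heart.FullSubcategory
  ∃ (F : DerivedCategory t.heart.FullSubcategory ⥤ C) (_ : F.CommShift ℤ),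
    F.IsTriangulated ∧ F.IsEquivalence ∧
    (∀ X, DerivedCategory.TStructure.t.le 0 X ↔ t.le 0 (F.obj X)) ∧
    (∀ X, DerivedCategory.TStructure.t.ge 0 X ↔ t.ge 0 (F.obj X)) ∧
    Nonempty (DerivedCategory.singleFunctor t.heart.FullSubcategory 0 ⋙ F ≅ t.heart.ι)

/-- The pair of t-structures `(D, T)` on `C` is `n`-tilting. -/
structure IsNTilting (n : ℕ) (D T : TStructure C) : Prop where
  le_le : D.le (-(n : ℤ)) ≤ T.le 0
  le_le' : T.le 0 ≤ D.le 0
  derived : IsDerivedCategoryOfHeart D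
  cogenerates : ∀ X : D.heart.FullSubcategory, ∃ (Y : D.heart.FullSubcategory) (i : X ⟶ Y),
    (D.heart ⊓ T.heart) Y.obj ∧ Mono i

end TiltingPairs

section Classes

/-- An exact category: a projectively complete (i.e. idempotent complete) additive category with
a Quillen exact structure. -/
structure ExactCat : Type (w + 1) where
  E : Type w
  [category : Category.{w} E]
  [preadditive : Preadditive E]
  [hasZeroObject : HasZeroObject E]
  [hasBinaryBiproducts : HasBinaryBiproducts E]
  [idempotentComplete : IsIdempotentComplete E]
  conf : ObjectProperty (ShortComplex E)
  exact : IsExactStructure conf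

/-- A triangulated category with a pair of t-structures. -/
structure TPair : Type (w + 1) where
  C : Type w
  [category : Category.{w} C]
  [preadditive : Preadditive C]
  [hasZeroObject : HasZeroObject C]
  [hasShift : HasShift C ℤ]
  [additive : ∀ n : ℤ, (shiftFunctor C n).Additive]
  [pretriangulated : Pretriangulated C]
  [isTriangulated : IsTriangulated C]
  D : TStructure C
  T : TStructure C

/-- An abelian category with a strictly full subcategory. -/
structure AbSub : Type (w + 1) where
  A : Type w
  [category : Category.{w} A]
  [abelian : Abelian A]
  P : ObjectProperty A
  [isClosedUnderIsomorphisms : P.IsClosedUnderIsomorphisms]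

attribute [instance] ExactCat.category ExactCat.preadditive ExactCat.hasZeroObject
  ExactCat.hasBinaryBiproducts ExactCat.idempotentComplete
  TPair.category TPair.preadditive TPair.hasZeroObject TPair.hasShift TPair.additive
  TPair.pretriangulated TPair.isTriangulated
  AbSub.category AbSub.abelian AbSub.isClosedUnderIsomorphisms

/-- Exact equivalences: additive equivalences which preserve and reflect conflations. -/
def ExactCat.IsEquivalent (X Y : ExactCat.{w}) : Prop :=
  ∃ (F : X.E ⥤ Y.E) (_ : F.Additive), F.IsEquivalence ∧
    ∀ S : ShortComplex X.E, X.conf S ↔ Y.conf (S.map F)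

/-- Triangulated equivalences which identify the pairs of t-structures (a t-structure is determined
by its aisle). -/
def TPair.IsEquivalent (X Y : TPair.{w}) : Prop :=
  ∃ (F : X.C ⥤ Y.C) (_ : F.CommShift ℤ), F.IsTriangulated ∧ F.IsEquivalence ∧
    (∀ Z, X.D.le 0 Z ↔ Y.D.le 0 (F.obj Z)) ∧ (∀ Z, X.T.le 0 Z ↔ Y.T.le 0 (F.obj Z))

/-- Equivalences of abelian categories which identify the subcategories. -/
def AbSub.IsEquivalent (X Y : AbSub.{w}) : Prop :=
  ∃ F : X.A ⥤ Y.A, F.IsEquivalence ∧ ∀ Z, X.P Z ↔ Y.P (F.obj Z)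

/-- Equivalence of exact categories is an equivalence relation. -/
def ExactCat.setoid : Setoid ExactCat.{w} where
  r := ExactCat.IsEquivalent
  iseqv :=
    { refl := fun X => ⟨𝟭 _, inferInstance, inferInstance, fun _ => Iff.rfl⟩
      symm := by
        rintro X Y ⟨F, hF, _, h⟩
        have : F.asEquivalence.functor.Additive := hF
        have : F.inv.Additive := F.asEquivalence.inverse_additive
        refine ⟨F.inv, inferInstance, inferInstance, fun S => ?_⟩
        rw [h]
        have e : (S.map F.inv).map F ≅ S := S.mapNatIso F.asEquivalence.counitIso
        exact ⟨Y.exact.of_iso e.symm, Y.exact.of_iso e⟩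
      trans := by
        rintro X Y Z ⟨F, _, _, h⟩ ⟨G, _, _, h'⟩
        exact ⟨F ⋙ G, inferInstance, inferInstance, fun S => (h S).trans (h' _)⟩ }

/-- Equivalence of triangulated categories with pairs of t-structures is an equivalence
relation. -/
def TPair.setoid : Setoid TPair.{w} where
  r := TPair.IsEquivalent
  iseqv :=
    { refl := fun X => ⟨𝟭 _, inferInstance, inferInstance, inferInstance,
        fun _ => Iff.rfl, fun _ => Iff.rfl⟩
      symm := by
        rintro X Y ⟨F, hF, hF', _, h, h'⟩
        let _ : F.asEquivalence.functor.CommShift ℤ := hF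
        let _ : F.asEquivalence.inverse.CommShift ℤ := F.asEquivalence.commShiftInverse ℤ
        have : F.asEquivalence.CommShift ℤ := F.asEquivalence.commShift_of_functor ℤ
        have : F.asEquivalence.functor.IsTriangulated := hF'
        have : F.asEquivalence.IsTriangulated :=
          Equivalence.IsTriangulated.mk' _ hF'
        have : F.asEquivalence.inverse.IsTriangulated := inferInstance
        refine ⟨F.asEquivalence.inverse, inferInstance, inferInstance, inferInstance,
          fun S => ?_, fun S => ?_⟩
        · rw [h]
          exact (Y.D.le 0).prop_iff_of_iso (F.asEquivalence.counitIso.symm.app S)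
        · rw [h']
          exact (Y.T.le 0).prop_iff_of_iso (F.asEquivalence.counitIso.symm.app S)
      trans := by
        rintro X Y Z ⟨F, _, _, _, h, h'⟩ ⟨G, _, _, _, k, k'⟩
        exact ⟨F ⋙ G, inferInstance, inferInstance, inferInstance,
          fun S => (h S).trans (k _), fun S => (h' S).trans (k' _)⟩ }

/-- Equivalence of abelian categories with a strictly full subcategory is an equivalence
relation. -/
def AbSub.setoid : Setoid AbSub.{w} where
  r := AbSub.IsEquivalent
  iseqv :=
    { refl := fun X => ⟨𝟭 _, inferInstance, fun _ => Iff.rfl⟩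
      symm := by
        rintro X Y ⟨F, _, h⟩
        refine ⟨F.inv, inferInstance, fun S => ?_⟩
        rw [h]
        exact Y.P.prop_iff_of_iso (F.asEquivalence.counitIso.symm.app S)
      trans := by
        rintro X Y Z ⟨F, _, h⟩ ⟨G, _, k⟩
        exact ⟨F ⋙ G, inferInstance, fun S => (h S).trans (k _)⟩ }

/-- The class of `n`-quasi-abelian categories, up to exact equivalence. -/
def NQuasiAbelianClass (n : ℕ) : Type (w + 1) :=
  Quotient (ExactCat.setoid.{w}.comap
    (Subtype.val : {X : ExactCat.{w} // IsNQuasiAbelian X.conf n} → ExactCat.{w}))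

/-- The class of `n`-tilting pairs of t-structures, up to equivalence. -/
def NTiltingPairClass (n : ℕ) : Type (w + 1) :=
  Quotient (TPair.setoid.{w}.comap
    (Subtype.val : {X : TPair.{w} // IsNTilting n X.D X.T} → TPair.{w}))

/-- The class of `n`-tilting torsion classes, up to equivalence. -/
def NTiltingTorsionClass (n : ℕ) : Type (w + 1) :=
  Quotient (AbSub.setoid.{w}.comap
    (Subtype.val : {X : AbSub.{w} // IsNTiltingTorsionClass n X.P} → AbSub.{w}))

/-- The class of `n`-cotilting torsion-free classes, up to equivalence. -/
def NCotiltingTorsionFreeClass (n : ℕ) : Type (w + 1) :=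
  Quotient (AbSub.setoid.{w}.comap
    (Subtype.val : {X : AbSub.{w} // IsNCotiltingTorsionFreeClass n X.P} → AbSub.{w}))

/-- The class of an `n`-quasi-abelian category. -/
def NQuasiAbelianClass.mk {n : ℕ} (X : ExactCat.{w}) (h : IsNQuasiAbelian X.conf n) :
    NQuasiAbelianClass.{w} n :=
  Quotient.mk _ ⟨X, h⟩

/-- The class of an `n`-tilting pair of t-structures. -/
def NTiltingPairClass.mk {n : ℕ} (X : TPair.{w}) (h : IsNTilting n X.D X.T) :
    NTiltingPairClass.{w} n :=
  Quotient.mk _ ⟨X, h⟩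

/-- The class of an `n`-tilting torsion class. -/
def NTiltingTorsionClass.mk {n : ℕ} (X : AbSub.{w}) (h : IsNTiltingTorsionClass n X.P) :
    NTiltingTorsionClass.{w} n :=
  Quotient.mk _ ⟨X, h⟩

/-- The class of an `n`-cotilting torsion-free class. -/
def NCotiltingTorsionFreeClass.mk {n : ℕ} (X : AbSub.{w})
    (h : IsNCotiltingTorsionFreeClass n X.P) : NCotiltingTorsionFreeClass.{w} n :=
  Quotient.mk _ ⟨X, h⟩

end Classes

section Correspondence

namespace ExactCat

variable (X : ExactCat.{w})

instance : (acyclicComplexes X.conf).IsTriangulated := isTriangulated_acyclicComplexes X.exact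

/-- The derived category `D(E, Ex) = K(E) / N_Ex`. -/
abbrev Derived : Type w := (acyclicComplexes X.conf).trW.Localization

/-- The quotient functor from complexes to `D(E, Ex)`. -/
noncomputable def Q : CochainComplex X.E ℤ ⥤ X.Derived :=
  HomotopyCategory.quotient X.E (ComplexShape.up ℤ) ⋙ (acyclicComplexes X.conf).trW.Q

/-- The functor `E ⥤ D(E, Ex)` which sends an object to the complex concentrated in degree `0`. -/
noncomputable def toDerived : X.E ⥤ X.Derived := CochainComplex.singleFunctor X.E 0 ⋙ X.Q

/-- `RD^{≥ m}`: the objects of `D(E, Ex)` isomorphic to complexes which vanish in degrees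
`< m`. -/
def rightGE (m : ℤ) : ObjectProperty X.Derived :=
  fun Y => ∃ K : CochainComplex X.E ℤ, K.IsStrictlyGE m ∧ Nonempty (Y ≅ X.Q.obj K)

/-- `LD^{≤ m}`: the objects of `D(E, Ex)` isomorphic to complexes which vanish in degrees
`> m`. -/
def leftLE (m : ℤ) : ObjectProperty X.Derived :=
  fun Y => ∃ K : CochainComplex X.E ℤ, K.IsStrictlyLE m ∧ Nonempty (Y ≅ X.Q.obj K)

/-- The triangulated category `D(E, Ex)` with a pair of t-structures. -/
noncomputable def derivedPair (R L : TStructure X.Derived) : TPair.{w} where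
  C := X.Derived
  D := R
  T := L

/-- The (essential image of the) category `E` in the heart of a t-structure on `D(E, Ex)`. -/
noncomputable def inHeart (t : TStructure X.Derived) : AbSub.{w} where
  A := t.heart.FullSubcategory
  P := X.toDerived.essImage.inverseImage t.heart.ι

/-- The exact category `X` is the intersection of the hearts of the pair of t-structures `Y`, its
conflations being the sequences which are part of a distinguished triangle. -/
def IsIntersectionOfHearts (Y : TPair.{w}) : Prop :=
  ∃ (J : X.E ⥤ Y.C) (_ : J.Additive), J.Full ∧ J.Faithful ∧
    J.essImage = Y.D.heart ⊓ Y.T.heart ∧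
    ∀ S : ShortComplex X.E, X.conf S ↔
      ∃ δ : J.obj S.X₃ ⟶ (J.obj S.X₁)⟦(1 : ℤ)⟧,
        Pretriangulated.Triangle.mk (J.map S.f) (J.map S.g) δ ∈
          Pretriangulated.distinguishedTriangles

/-- The exact category `X` is the full subcategory `Y.P` of the abelian category `Y.A`, its
conflations being the sequences which are short exact in `Y.A`. -/
def IsSubcategory (Y : AbSub.{w}) : Prop :=
  ∃ (J : X.E ⥤ Y.A) (_ : J.Additive), J.Full ∧ J.Faithful ∧ J.essImage = Y.P ∧
    ∀ S : ShortComplex X.E, X.conf S ↔ (S.map J).ShortExact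

end ExactCat

/-- The abelian category `X.A` is the heart of the t-structure `Y.D`, and the subcategory `X.P` is
its intersection with the heart of `Y.T`. -/
def AbSub.IsFirstHeart (X : AbSub.{w}) (Y : TPair.{w}) : Prop :=
  ∃ (J : X.A ⥤ Y.C) (_ : J.Additive), J.Full ∧ J.Faithful ∧ J.essImage = Y.D.heart ∧
    ∀ Z, X.P Z ↔ Y.T.heart (J.obj Z)

/-- The abelian category `X.A` is the heart of the t-structure `Y.T`, and the subcategory `X.P` is
its intersection with the heart of `Y.D`. -/
def AbSub.IsSecondHeart (X : AbSub.{w}) (Y : TPair.{w}) : Prop :=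
  ∃ (J : X.A ⥤ Y.C) (_ : J.Additive), J.Full ∧ J.Faithful ∧ J.essImage = Y.T.heart ∧
    ∀ Z, X.P Z ↔ Y.D.heart (J.obj Z)

end Correspondence

end NQuasiAbelian

/-! The exact category `E` is the hub: each of the other three structures yields an exact category
and is determined by it up to equivalence. Two comparisons carry the proof.

From `E` to `D(E)`. An acyclic complex is effaceable: a morphism from one of its terms that kills
the boundaries extends, after an inflation, along the differential. Hence a chain map from an
acyclic complex to a complex vanishing below degree `m` dies after a quasi-isomorphism of its target
to a complex of the same kind (`exists_homotopy_of_effAt`), so morphisms to such complexes are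
fractions of such complexes. This gives full faithfulness of `E ⥤ D(E)` and the orthogonality of
complexes in degrees `≤ l` and `≥ m` for `l < m`. Iterated `D`-cokernels also produce effaceable
complexes and thereby the truncation triangles of the right t-structure; `D`-kernels give the left
one (`rightT`, `leftT`). Conversely, these t-structures force `D`-cokernels and `D`-kernels to exist
(`ExactCat.hasDCokernels`, `ExactCat.hasDKernels`). For `n ≥ 2` the axiom on kernels or cokernels
says that the towers of `D`-kernels or `D`-cokernels stop, and this bounds one aisle by the other
(`IsNQuasiAbelian.le_le`). Idempotent completeness identifies the zero objects of `D(E)` with the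
acyclic complexes and the intersection of the hearts with `E` (`isAcyclic_of_isZero`,
`essImage_iff`), and conflations are the sequences that extend to triangles (`conf_iff`).

From an abelian category `A` to `D(E)`. Suppose that `E` cogenerates `A` and contains all `n`-fold
cosyzygies. The cycles of an exact unbounded complex over `E` are `n`-fold cosyzygies, so exactness
in `A` is acyclicity in `E`; and `n` rounds of embedding into objects of `E` replace any complex
over `A` by a quasi-isomorphic one over `E`. Therefore `D(E)` is `D(A)`, and the standard coaisle
consists of complexes over `E` that vanish in low degrees (`IsCoresolving.exists_equivalence`). So
`A` is recovered as the right heart. This applies to tilting torsion classes, to the first heart of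
a tilting pair (`heart_closed`), and, in opposite categories, to cotilting torsion-free classes. The
second t-structure of a tilting pair is recovered from the intersection of the hearts
(`le_eq_leftLE`).

Existence and uniqueness on both sides of each correspondence are turned into bijections by
`exists_quotient_equiv`. -/

set_option linter.unusedSectionVars false

namespace NQuasiAbelian

/-! ### Recursive sequences indexed by the integers -/

section Sequences

/-- Recursive construction of a sequence indexed by the integers, starting at `m`. -/
lemma exists_int_sequence {S : ℤ → Type*} (R : ∀ i j, i + 1 = j → S i → S j → Prop) (m : ℤ)
    (base : ∀ k, k ≤ m → S k)
    (hbase : ∀ i j (hij : i + 1 = j) (hj : j ≤ m),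
      R i j hij (base i (by omega)) (base j hj))
    (step : ∀ i j (hij : i + 1 = j), m ≤ i → ∀ s : S i, ∃ s' : S j, R i j hij s s') :
    ∃ s : ∀ k, S k, (∀ k (hk : k ≤ m), s k = base k hk) ∧
      ∀ i j (hij : i + 1 = j), R i j hij (s i) (s j) := by
  classical
  choose next hnext using step
  let g : ∀ j : ℕ, S (m + j) := fun j =>
    Nat.rec (motive := fun j => S (m + (j : ℤ))) (base _ (by simp))
      (fun j s => next (m + (j : ℤ)) (m + ((j + 1 : ℕ) : ℤ)) (by push_cast; ring) (by omega) s) j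
  have hg : ∀ j : ℕ, R (m + (j : ℤ)) (m + ((j + 1 : ℕ) : ℤ)) (by push_cast; ring) (g j)
      (g (j + 1)) := fun j => hnext _ _ _ _ _
  have hg₀ : ∀ k (hk : k = m), HEq (g 0) (base k hk.le) := by
    rintro k rfl
    have aux : ∀ l (hl : l = k), HEq (base l hl.le) (base k le_rfl) := by
      rintro _ rfl; rfl
    exact aux _ (by simp)
  -- Above `m` the value has to be transported, since `k` and `m + (k - m).toNat` are equal only
  -- propositionally.
  let s : ∀ k, S k := fun k =>
    if hk : k ≤ m then base k hk
    else cast (by rw [Int.toNat_of_nonneg (by omega)]; congr 1; omega) (g (k - m).toNat)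
  have hs₁ : ∀ k (hk : k ≤ m), s k = base k hk := fun k hk => dif_pos hk
  have hs₂ : ∀ j : ℕ, s (m + j) = g j := by
    intro j
    by_cases hj : j = 0
    · subst hj
      rw [hs₁ _ (by simp)]
      exact (eq_of_heq (hg₀ (m + ((0 : ℕ) : ℤ)) (by simp))).symm
    · dsimp only [s]
      rw [dif_neg (by omega)]
      have aux : ∀ (l : ℕ) (hl : l = j) (h : S (m + l) = S (m + j)), cast h (g l) = g j := by
        rintro _ rfl _; rfl
      exact aux _ (by omega) _
  refine ⟨s, hs₁, fun i j hij => ?_⟩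
  by_cases hj : j ≤ m
  · rw [hs₁ j hj, hs₁ i (by omega)]
    exact hbase _ _ _ _
  · obtain ⟨l, rfl⟩ : ∃ l : ℕ, i = m + l := ⟨(i - m).toNat, by omega⟩
    obtain rfl : j = m + ((l + 1 : ℕ) : ℤ) := by push_cast; omega
    rw [hs₂, hs₂]
    exact hg l

/-- Recursive construction of a sequence indexed by the integers, in decreasing order. -/
lemma exists_int_sequence' {S : ℤ → Type*} (R : ∀ i j, i + 1 = j → S i → S j → Prop) (m : ℤ)
    (base : ∀ k, m ≤ k → S k)
    (hbase : ∀ i j (hij : i + 1 = j) (hi : m ≤ i),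
      R i j hij (base i hi) (base j (by omega)))
    (step : ∀ i j (hij : i + 1 = j), j ≤ m → ∀ s : S j, ∃ s' : S i, R i j hij s' s) :
    ∃ s : ∀ k, S k, (∀ k (hk : m ≤ k), s k = base k hk) ∧
      ∀ i j (hij : i + 1 = j), R i j hij (s i) (s j) := by
  -- Reflect the index by `k ↦ -k`; the result is transported back along `- -k = k`.
  obtain ⟨s, hs, hs'⟩ := exists_int_sequence (S := fun k => S (-k))
    (fun i j hij s s' => R (-j) (-i) (by omega) s' s) (-m) (fun k hk => base (-k) (by omega))
    (fun i j hij hj => hbase _ _ _ _) (fun i j hij hi s => step _ _ (by omega) (by omega) s)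
  have aux : ∀ k l (h : k = l) (x : ∀ k, S k), cast (by rw [h]) (x k) = x l := by
    rintro _ _ rfl _; rfl
  let t : ∀ k, S k := fun k => cast (by rw [neg_neg]) (s (-k))
  have ht : ∀ k, t (-k) = s k := by
    intro k
    have : ∀ l (h : l = k) (h' : S (-l) = S (-k)), cast h' (s l) = s k := by
      rintro _ rfl _; rfl
    exact this _ (by simp) _
  have key : ∀ k, ∃ l, k = -l := fun k => ⟨-k, by simp⟩
  refine ⟨t, fun k hk => ?_, fun i j hij => ?_⟩
  · obtain ⟨l, rfl⟩ := key k
    rw [ht, hs _ (by omega)]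
  · obtain ⟨l, rfl⟩ := key i
    obtain ⟨l', rfl⟩ := key j
    rw [ht, ht]
    exact hs' _ _ (by omega)

end Sequences

/-! ### Conflations attached to pushouts and pullbacks -/

section ExactStructures

variable {E : Type w} [Category.{w} E] [Preadditive E] [HasZeroObject E] [HasBinaryBiproducts E]
  {conf : ObjectProperty (ShortComplex E)}

namespace IsExactStructure

lemma deflation_id (h : IsExactStructure conf) (A : E) : IsDeflation conf (𝟙 A) := by
  obtain ⟨Z, hZ⟩ := HasZeroObject.zero (C := E)
  refine h.deflation_pullback (f := (0 : A ⟶ Z)) (f' := (0 : A ⟶ Z)) (p := 𝟙 Z) ?_ (h.id_zero hZ)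
  exact IsPullback.of_vert_isIso ⟨by simp⟩

lemma inflation_of_iso (h : IsExactStructure conf) {A B : E} (e : A ≅ B) :
    IsInflation conf e.hom := by
  simpa using h.inflation_iso e (h.inflation_id A)

lemma deflation_of_iso (h : IsExactStructure conf) {A B : E} (e : A ≅ B) :
    IsDeflation conf e.hom := by
  simpa using h.deflation_iso e (h.deflation_id B)

lemma mono_of_inflation (h : IsExactStructure conf) {X Y : E} {i : X ⟶ Y}
    (hi : IsInflation conf i) : Mono i := by
  obtain ⟨X, i, w', hc⟩ := hi
  obtain ⟨⟨hp'⟩, _⟩ := h.pair hc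
  exact Fork.IsLimit.mono hp'

lemma inflation_from_zero (h : IsExactStructure conf) {Z : E} (hZ : IsZero Z) (A : E) :
    IsInflation conf (0 : Z ⟶ A) := by
  refine ⟨A, 𝟙 A, by simp, h.conf_of_kernel _ (h.deflation_id A) ?_⟩
  exact KernelFork.IsLimit.ofι _ _ (fun _ _ => 0)
    (fun t ht => by simpa using ht.symm) (fun _ _ _ _ => hZ.eq_of_tgt _ _)

lemma inflation_inl (h : IsExactStructure conf) (A B : E) :
    IsInflation conf (biprod.inl : A ⟶ A ⊞ B) := by
  obtain ⟨Z, hZ⟩ := HasZeroObject.zero (C := E)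
  refine h.inflation_pushout (i := (0 : Z ⟶ B)) (f := (0 : Z ⟶ A)) (f' := biprod.inr) ?_
    (h.inflation_from_zero hZ B)
  refine IsPushout.of_isColimit' ⟨by simp⟩ (PushoutCocone.IsColimit.mk _
      (fun s => biprod.desc s.inr s.inl) (by simp) (by simp) ?_)
  intro s m h₁ h₂
  ext
  · simp [h₂]
  · simp [h₁]

/-- The conflation `P ⟶ N ⊕ Z ⟶ P'` attached to the pushout of an inflation `P ⟶ N` along
`P ⟶ Z`, for a given biproduct `C` of `Z` and `N`. -/
lemma conf_of_isPushout (h : IsExactStructure conf) {P N Z P' C : E} {π : P ⟶ N} {b : P ⟶ Z}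
    {a : N ⟶ P'} {i : Z ⟶ P'} (sq : IsPushout π b a i) (hπ : IsInflation conf π)
    {l : Z ⟶ C} {r : N ⟶ C} {p : C ⟶ Z} {q : C ⟶ N} (lp : l ≫ p = 𝟙 Z) (lq : l ≫ q = 0)
    (rp : r ≫ p = 0) (rq : r ≫ q = 𝟙 N) (tot : p ≫ l + q ≫ r = 𝟙 C) :
    ∃ zero : (π ≫ r - b ≫ l) ≫ (p ≫ i + q ≫ a) = 0,
      conf (ShortComplex.mk (π ≫ r - b ≫ l) (p ≫ i + q ≫ a) zero) := by
  have zero : (π ≫ r - b ≫ l) ≫ (p ≫ i + q ≫ a) = 0 := by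
    simp [reassoc_of% lp, reassoc_of% lq, reassoc_of% rp, reassoc_of% rq, sq.w]
  refine ⟨zero, h.conf_of_cokernel _ ?_ ?_⟩
  · let e : P ⊞ Z ≅ P ⊞ Z :=
      { hom := biprod.desc (biprod.lift (𝟙 _) (-b)) biprod.inr
        inv := biprod.desc (biprod.lift (𝟙 _) b) biprod.inr }
    let e' : N ⊞ Z ≅ C :=
      { hom := biprod.desc r l
        inv := biprod.lift q p
        hom_inv_id := by ext <;> simp [lp, lq, rp, rq]
        inv_hom_id := by simp [biprod.lift_desc, ← tot, add_comm] }
    -- The map with components `π` and `-b` is the inclusion of `P`, sheared by `e`, followed by `π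
    -- ⊞ 𝟙`.
    have := h.inflation_iso e' (h.inflation_comp
      (h.inflation_iso e (h.inflation_inl P Z)) (h.inflation_map_id Z hπ))
    convert this using 1
    have : biprod.lift (𝟙 P) (-b) = biprod.inl - b ≫ biprod.inr := by ext <;> simp
    simp [e, e', this, sub_eq_add_neg]
  · have hw : ∀ {T : E} (t : C ⟶ T) (_ : (π ≫ r - b ≫ l) ≫ t = 0),
        π ≫ r ≫ t = b ≫ l ≫ t := by
      intro T t ht
      simpa [sub_eq_zero] using ht
    refine CokernelCofork.IsColimit.ofπ _ _
      (fun t ht => sq.desc (r ≫ t) (l ≫ t) (hw t ht)) ?_ ?_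
    · intro T t ht
      rw [Preadditive.add_comp, Category.assoc, Category.assoc, sq.inl_desc, sq.inr_desc,
        ← Category.assoc, ← Category.assoc, ← Preadditive.add_comp, tot, Category.id_comp]
    · intro T t ht m hm
      apply sq.hom_ext
      · rw [sq.inl_desc, ← hm]; simp [reassoc_of% rp, reassoc_of% rq]
      · rw [sq.inr_desc, ← hm]; simp [reassoc_of% lp, reassoc_of% lq]

/-- The conflation `P' ⟶ N ⊕ Z ⟶ P` attached to the pullback of a deflation `N ⟶ P` along
`Z ⟶ P`, for a given biproduct `C` of `N` and `Z`. -/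
lemma conf_of_isPullback (h : IsExactStructure conf) {P N Z P' C : E} {π : N ⟶ P} {b : Z ⟶ P}
    {a : P' ⟶ N} {i : P' ⟶ Z} (sq : IsPullback a i π b) (hπ : IsDeflation conf π)
    {l : N ⟶ C} {r : Z ⟶ C} {p : C ⟶ N} {q : C ⟶ Z} (lp : l ≫ p = 𝟙 N) (lq : l ≫ q = 0)
    (rp : r ≫ p = 0) (rq : r ≫ q = 𝟙 Z) (tot : p ≫ l + q ≫ r = 𝟙 C) :
    ∃ zero : (i ≫ r - a ≫ l) ≫ (p ≫ π + q ≫ b) = 0,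
      conf (ShortComplex.mk (i ≫ r - a ≫ l) (p ≫ π + q ≫ b) zero) := by
  have zero : (i ≫ r - a ≫ l) ≫ (p ≫ π + q ≫ b) = 0 := by
    simp [reassoc_of% lp, reassoc_of% lq, reassoc_of% rp, reassoc_of% rq, sq.w]
  refine ⟨zero, h.conf_of_kernel _ ?_ ?_⟩
  · let e' : C ≅ Z ⊞ N :=
      { hom := biprod.lift q p
        inv := biprod.desc r l
        hom_inv_id := by simp [biprod.lift_desc, ← tot, add_comm]
        inv_hom_id := by ext <;> simp [lp, lq, rp, rq] }
    have := h.deflation_iso e' (h.deflation_desc b hπ)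
    convert this using 1
    simp [e', biprod.lift_desc, add_comm]
  · have hw : ∀ {T : E} (t : T ⟶ C) (_ : t ≫ (p ≫ π + q ≫ b) = 0),
        (-(t ≫ p)) ≫ π = (t ≫ q) ≫ b := by
      intro T t ht
      rw [Preadditive.neg_comp, neg_eq_iff_add_eq_zero, ← ht]
      simp
    refine KernelFork.IsLimit.ofι _ _
      (fun t ht => sq.lift (-(t ≫ p)) (t ≫ q) (hw t ht)) ?_ ?_
    · intro T t ht
      rw [Preadditive.comp_sub, ← Category.assoc, ← Category.assoc, sq.lift_fst, sq.lift_snd,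
        Preadditive.neg_comp, sub_neg_eq_add, Category.assoc, Category.assoc, add_comm,
        ← Preadditive.comp_add, tot, Category.comp_id]
    · intro T t ht m hm
      apply sq.hom_ext
      · rw [sq.lift_fst, ← hm]; simp [lp, rp]
      · rw [sq.lift_snd, ← hm]; simp [lq, rq]

end IsExactStructure

end ExactStructures

/-! ### Effaceable complexes and null homotopies -/

section Orthogonality

variable {E : Type w} [Category.{w} E] [Preadditive E] {conf : ObjectProperty (ShortComplex E)}

/-- `L` is effaceable at `k`: each morphism from `L.X k` which vanishes on boundaries becomes, after
composition with an inflation, the restriction of a morphism from `L.X (k + 1)`. -/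
def EffAt (conf : ObjectProperty (ShortComplex E)) (L : CochainComplex E ℤ) (k : ℤ) : Prop :=
  ∀ ⦃X : E⦄ (r : L.X k ⟶ X), (∀ i, L.d i k ≫ r = 0) → ∃ (N : E) (π : X ⟶ N)
    (s : L.X (k + 1) ⟶ N), IsInflation conf π ∧ r ≫ π = L.d k (k + 1) ≫ s

/-- `L` is coeffaceable at `k`. -/
def CoeffAt (conf : ObjectProperty (ShortComplex E)) (L : CochainComplex E ℤ) (k : ℤ) : Prop :=
  ∀ ⦃X : E⦄ (r : X ⟶ L.X k), (∀ j, r ≫ L.d k j = 0) → ∃ (N : E) (π : N ⟶ X)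
    (s : N ⟶ L.X (k - 1)), IsDeflation conf π ∧ π ≫ r = s ≫ L.d (k - 1) k

/-- A map that kills the boundaries factors through `e k : L.X k ⟶ D k`; the extension to `L.X (k +
1)` is the pushout of the inflation `D k ⟶ L.X (k + 1)` along this factor. -/
lemma IsAcyclic.effAt [HasZeroObject E] [HasBinaryBiproducts E] (h : IsExactStructure conf) {L : CochainComplex E ℤ}
    (hL : IsAcyclic conf L) (k : ℤ) : EffAt conf L k := by
  obtain ⟨D, e, m, hd, hc⟩ := hL
  intro X r hr
  obtain ⟨z, hz⟩ := hc (k - 1) k (by omega)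
  obtain ⟨z₁, hz₁⟩ := hc (k - 1 - 1) (k - 1) (by omega)
  obtain ⟨_, ⟨h₁⟩⟩ := h.pair hz
  have : Epi (e (k - 1)) := h.epi_of_deflation ⟨_, _, _, hz₁⟩
  obtain ⟨t, ht⟩ := CokernelCofork.IsColimit.desc' h₁ r (by
    rw [← cancel_epi (e (k - 1)), ← Category.assoc, hd, hr, comp_zero])
  dsimp at ht
  obtain ⟨N, s, π, sq, hπ⟩ := h.pushout t ⟨_, _, _, (hc k (k + 1) rfl).2⟩
  exact ⟨N, π, s, hπ, by rw [← ht, Category.assoc, ← sq.w, ← hd k (k + 1) rfl, Category.assoc]⟩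

/-- Dual argument, with the pullback of the deflation `L.X (k - 1) ⟶ D (k - 1)`. -/
lemma IsAcyclic.coeffAt [HasZeroObject E] [HasBinaryBiproducts E] (h : IsExactStructure conf) {L : CochainComplex E ℤ}
    (hL : IsAcyclic conf L) (k : ℤ) : CoeffAt conf L k := by
  obtain ⟨D, e, m, hd, hc⟩ := hL
  intro X r hr
  obtain ⟨z, hz⟩ := hc (k - 1) k (by omega)
  obtain ⟨z₁, hz₁⟩ := hc (k - 1 - 1) (k - 1) (by omega)
  obtain ⟨z₂, hz₂⟩ := hc k (k + 1) rfl
  obtain ⟨⟨h₁⟩, _⟩ := h.pair hz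
  have : Mono (m k (k + 1) rfl) := h.mono_of_inflation ⟨_, _, _, hz₂⟩
  obtain ⟨t, ht⟩ := KernelFork.IsLimit.lift' h₁ r (by
    rw [← cancel_mono (m k (k + 1) rfl), Category.assoc, hd, hr, zero_comp])
  dsimp at ht
  obtain ⟨N, s, π, sq, hπ⟩ := h.pullback t ⟨_, _, _, hz₁⟩
  exact ⟨N, π, s, hπ, by
    rw [← ht, ← Category.assoc, ← sq.w, ← hd (k - 1) k (by omega), Category.assoc]⟩

variable [HasZeroObject E]

variable [HasBinaryBiproducts E]

lemma effAt_of_isZero (h : IsExactStructure conf) {L : CochainComplex E ℤ} {k : ℤ}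
    (hL : IsZero (L.X k)) : EffAt conf L k :=
  fun X _ _ => ⟨X, 𝟙 X, 0, h.inflation_id X, hL.eq_of_src _ _⟩

open CochainComplex in
/-- The mapping cone of a morphism `u : Z ⟶ K` is acyclic if `K` is obtained from `Z` by successive
pushouts of inflations `P k ⟶ K.X k`. -/
lemma isAcyclic_mappingCone_of_isPushout (h : IsExactStructure conf) {Z K : CochainComplex E ℤ}
    (u : Z ⟶ K) {P : ℤ → E} {ι : ∀ k, Z.X k ⟶ P k} {b : ∀ k, P k ⟶ Z.X (k + 1)}
    {π : ∀ k, P k ⟶ K.X k} {a : ∀ k, K.X k ⟶ P (k + 1)}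
    (hι : ∀ k, ι k ≫ b k = Z.d k (k + 1)) (hab : ∀ k, a k ≫ b (k + 1) = 0)
    (hK : ∀ k, K.d k (k + 1) = a k ≫ π (k + 1)) (hu : ∀ k, u.f k = ι k ≫ π k)
    (sq : ∀ k, IsPushout (π k) (b k) (a k) (ι (k + 1))) (hπ : ∀ k, IsInflation conf (π k)) :
    IsAcyclic conf (mappingCone u) := by
  -- In degree `i` the cone `Z.X (i + 1) ⊞ K.X i` maps onto `P (i + 1)`, and the conflations
  -- required for acyclicity are those attached to the pushout squares.
  have H : ∀ i j, i + 1 = j → ∃ m : P (i + 1) ⟶ (mappingCone u).X j,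
      ((mappingCone.fst u).1.v i (i + 1) rfl ≫ ι (i + 1) +
        (mappingCone.snd u).v i i (add_zero i) ≫ a i) ≫ m = (mappingCone u).d i j ∧
      ∃ zero : m ≫ ((mappingCone.fst u).1.v j (j + 1) rfl ≫ ι (j + 1) +
        (mappingCone.snd u).v j j (add_zero j) ≫ a j) = 0, conf (ShortComplex.mk m _ zero) := by
    rintro i _ rfl
    refine ⟨π (i + 1) ≫ (mappingCone.inr u).f (i + 1) -
      b (i + 1) ≫ (mappingCone.inl u).v (i + 1 + 1) (i + 1) (by omega), ?_, ?_⟩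
    · rw [mappingCone.ext_from_iff u (i + 1) i rfl,
        mappingCone.inl_v_d u (i + 1) i (i + 1 + 1) (by omega) (by omega)]
      simp [hu, hK, ← hι, reassoc_of% hab]
    · exact h.conf_of_isPushout (sq (i + 1)) (hπ (i + 1)) (by simp) (by simp) (by simp)
        (by simp) (mappingCone.id_X u (i + 1) (i + 1 + 1) rfl)
  choose m hm hc using H
  exact ⟨_, _, m, hm, hc⟩

open CochainComplex in
/-- The mapping cone of a morphism `u : K ⟶ Z` is acyclic if `K` is obtained from `Z` by successive
pullbacks of deflations `K.X k ⟶ P k`. -/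
lemma isAcyclic_mappingCone_of_isPullback (h : IsExactStructure conf) {Z K : CochainComplex E ℤ}
    (u : K ⟶ Z) {P : ℤ → E} {ι : ∀ k, P k ⟶ Z.X k} {b : ∀ i j, i + 1 = j → (Z.X i ⟶ P j)}
    {π : ∀ k, K.X k ⟶ P k} {a : ∀ i j, i + 1 = j → (P i ⟶ K.X j)}
    (hι : ∀ i j hij, b i j hij ≫ ι j = Z.d i j)
    (hab : ∀ i j k hij hjk, b i j hij ≫ a j k hjk = 0)
    (hK : ∀ i j hij, K.d i j = π i ≫ a i j hij) (hu : ∀ k, u.f k = π k ≫ ι k)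
    (sq : ∀ i j hij, IsPullback (a i j hij) (ι i) (π j) (b i j hij))
    (hπ : ∀ k, IsDeflation conf (π k)) :
    IsAcyclic conf (mappingCone u) := by
  have H : ∀ i j (hij : i + 1 = j), ∃ m : P (i + 1) ⟶ (mappingCone u).X j,
      ((mappingCone.fst u).1.v i (i + 1) rfl ≫ π (i + 1) +
        (mappingCone.snd u).v i i (add_zero i) ≫ b i (i + 1) rfl) ≫ m = (mappingCone u).d i j ∧
      ∃ zero : m ≫ ((mappingCone.fst u).1.v j (j + 1) rfl ≫ π (j + 1) +
        (mappingCone.snd u).v j j (add_zero j) ≫ b j (j + 1) rfl) = 0,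
        conf (ShortComplex.mk m _ zero) := by
    rintro i _ rfl
    refine ⟨ι (i + 1) ≫ (mappingCone.inr u).f (i + 1) -
      a (i + 1) _ rfl ≫ (mappingCone.inl u).v (i + 1 + 1) (i + 1) (by omega), ?_, ?_⟩
    · rw [mappingCone.ext_from_iff u (i + 1) i rfl,
        mappingCone.inl_v_d u (i + 1) i (i + 1 + 1) (by omega) (by omega)]
      simp [hu, hK (i + 1) _ rfl, ← hι i _ rfl, reassoc_of% hab]
    · exact h.conf_of_isPullback (sq (i + 1) _ rfl) (hπ (i + 1 + 1)) (by simp) (by simp) (by simp)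
        (by simp) (mappingCone.id_X u (i + 1) (i + 1 + 1) rfl)
  choose m hm hc using H
  exact ⟨_, _, m, hm, hc⟩

/-- A construction of null homotopies. -/
lemma exists_homotopy_zero {L N : CochainComplex E ℤ} (f : L ⟶ N)
    (s : ∀ k, L.X (k + 1) ⟶ N.X k)
    (hs : ∀ k, f.f (k + 1) = L.d (k + 1) (k + 1 + 1) ≫ s (k + 1) + s k ≫ N.d k (k + 1)) :
    Nonempty (Homotopy f 0) := by
  refine ⟨{ hom := fun i j => if hij : j + 1 = i then eqToHom (by rw [hij]) ≫ s j else 0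
            zero := fun i j hij => dif_neg hij
            comm := fun i => ?_ }⟩
  obtain ⟨k, rfl⟩ : ∃ k, i = k + 1 := ⟨i - 1, by simp⟩
  rw [dNext_eq _ (i' := k + 1 + 1) (by simp), prevD_eq _ (j' := k) (by simp), hs]
  simp

open CochainComplex in
/-- A chain map from an effaceable complex to a complex vanishing in degrees `< m` becomes null
homotopic after composition with a quasi-isomorphism to a complex vanishing in degrees `< m`. -/
lemma exists_homotopy_of_effAt (h : IsExactStructure conf) {L Z : CochainComplex E ℤ} (g : L ⟶ Z)
    (m : ℤ) [Z.IsStrictlyGE m] (hL : ∀ k, m ≤ k → EffAt conf L k) :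
    ∃ (N : CochainComplex E ℤ) (u : Z ⟶ N), N.IsStrictlyGE m ∧
      IsAcyclic conf (mappingCone u) ∧ Nonempty (Homotopy (g ≫ u) 0) := by
  -- The state in degree `k`: a factorization `ι ≫ b` of the differential of `Z` through `P`, and
  -- the obstruction `r : L.X k ⟶ P` to continuing the null homotopy. One step effaces `r` by an
  -- inflation `π : P ⟶ N`, with `t` as the new component of the homotopy, and pushes `π` out along
  -- `b`; the next obstruction is `g ≫ ι' - t ≫ a`. The objects `N` become the terms of the new
  -- complex.
  let S : ℤ → Type w := fun k => Σ P : E, {x : (Z.X k ⟶ P) × (P ⟶ Z.X (k + 1)) × (L.X k ⟶ P) //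
    x.1 ≫ x.2.1 = Z.d k (k + 1) ∧ (∀ j, x.2.1 ≫ Z.d (k + 1) j = 0) ∧ (∀ i, L.d i k ≫ x.2.2 = 0) ∧
    x.2.2 ≫ x.2.1 = L.d k (k + 1) ≫ g.f (k + 1) ∧ (k < m → IsZero P)}
  obtain ⟨O, hO⟩ := HasZeroObject.zero (C := E)
  have hZ : ∀ k, k < m → IsZero (Z.X k) := fun k hk => Z.isZero_of_isStrictlyGE m k
  let R : ∀ i j, i + 1 = j → S i → S j → Prop := fun i j hij s s' =>
    ∃ (N : E) (π : s.1 ⟶ N) (t : L.X j ⟶ N) (a : N ⟶ s'.1), IsInflation conf π ∧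
      s.2.1.2.2 ≫ π = L.d i j ≫ t ∧
      IsPushout π (s.2.1.2.1 ≫ eqToHom (by rw [hij])) a s'.2.1.1 ∧ a ≫ s'.2.1.2.1 = 0 ∧
      s'.2.1.2.2 = g.f j ≫ s'.2.1.1 - t ≫ a ∧ (i < m → IsZero N)
  have step : ∀ i j (hij : i + 1 = j) (s : S i), ∃ s' : S j, R i j hij s s' := by
    rintro i _ rfl ⟨P, ⟨⟨ι, b, r⟩, h₁, h₂, h₃, h₄, h₅⟩⟩
    dsimp at h₁ h₂ h₃ h₄ h₅
    have : ∃ (N : E) (π : P ⟶ N) (s : L.X (i + 1) ⟶ N), IsInflation conf π ∧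
        r ≫ π = L.d i (i + 1) ≫ s ∧ (i < m → IsZero N) := by
      -- Below degree `m` the object `P` is zero, and the identity keeps `N` zero.
      rcases lt_or_ge i m with hi' | hi'
      · exact ⟨P, 𝟙 P, 0, h.inflation_id P, (h₅ hi').eq_of_tgt _ _, h₅⟩
      · obtain ⟨N, π, s, h₁, h₂⟩ := hL i hi' r h₃
        exact ⟨N, π, s, h₁, h₂, fun _ => by omega⟩
    obtain ⟨N, π, s, hπ, hs, hN⟩ := this
    obtain ⟨P', a, ι', sq, _⟩ := h.pushout b hπ
    refine ⟨⟨P', ⟨⟨ι', sq.desc 0 (Z.d _ _) (by simp [h₂]), g.f _ ≫ ι' - s ≫ a⟩, ?_, ?_, ?_, ?_,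
      ?_⟩⟩, N, π, s, a, hπ, hs, by simpa using sq, by simp, rfl, hN⟩
    · simp
    · intro j; apply sq.hom_ext <;> simp
    · intro j
      dsimp
      by_cases hj : j + 1 = i + 1
      · obtain rfl : j = i := by omega
        rw [Preadditive.comp_sub, ← reassoc_of% h₄, ← reassoc_of% hs, sq.w, sub_self]
      · rw [L.shape _ _ hj, zero_comp]
    · simp
    · intro hi
      have h1 : IsZero (Z.X (i + 1)) := hZ _ hi
      have h2 := hN (by omega)
      rw [IsZero.iff_id_eq_zero]
      apply sq.hom_ext
      · exact h2.eq_of_src _ _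
      · exact h1.eq_of_src _ _
  obtain ⟨s, -, hs⟩ := exists_int_sequence R (m - 1)
    (fun k hk => ⟨O, ⟨⟨0, 0, 0⟩, (hZ k (by omega)).eq_of_src _ _, by simp, by simp, by
      rw [← g.comm, (hZ k (by omega)).eq_of_src (Z.d k (k + 1)) 0]; simp, fun _ => hO⟩⟩)
    (fun i j hij hj => ⟨O, 0, 0, 0, by
      convert h.inflation_id O; exact hO.eq_of_src _ _, hO.eq_of_tgt _ _, by
        subst hij
        refine IsPushout.of_isColimit' ⟨hO.eq_of_src _ _⟩ (PushoutCocone.IsColimit.mk _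
          (fun _ => 0) ?_ ?_ ?_)
        · exact fun _ => hO.eq_of_src _ _
        · exact fun _ => (hZ _ (by omega)).eq_of_src _ _
        · exact fun _ _ _ _ => hO.eq_of_src _ _, hO.eq_of_src _ _, hO.eq_of_tgt _ _, fun _ => hO⟩)
    (fun i j hij hi s => step i j hij s)
  choose N π t a hπ ht sq hab hr hN using fun i => hs i (i + 1) rfl
  simp only [eqToHom_refl, Category.comp_id] at sq
  have hι := fun k => (s k).2.2.1
  have hb := fun k => (s k).2.2.2.1
  have hd : ∀ k, (a k ≫ π (k + 1)) ≫ a (k + 1) ≫ π (k + 1 + 1) = 0 := by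
    intro k
    rw [Category.assoc, reassoc_of% (sq (k + 1)).w, reassoc_of% (hab k), zero_comp]
  let K : CochainComplex E ℤ := CochainComplex.of N (fun k => a k ≫ π (k + 1)) hd
  have hK : ∀ k, K.d k (k + 1) = a k ≫ π (k + 1) := fun k => CochainComplex.of_d N (fun k => a k ≫ π (k + 1)) k
  let u : Z ⟶ K :=
    { f := fun k => (s k).2.1.1 ≫ π k
      comm' := by
        rintro i _ rfl
        have := (sq i).w
        rw [hK, Category.assoc, reassoc_of% (sq i).w, reassoc_of% (hι i)] }
  refine ⟨K, u, ?_, isAcyclic_mappingCone_of_isPushout h u hι hab hK (fun _ => rfl) sq hπ,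
    exists_homotopy_zero _ t fun k => ?_⟩
  · rw [CochainComplex.isStrictlyGE_iff]
    exact fun i hi => hN i hi
  · have h₁ := ht (k + 1)
    rw [hr, Preadditive.sub_comp, sub_eq_iff_eq_add, Category.assoc, Category.assoc] at h₁
    rw [hK]
    exact h₁

open CochainComplex in
/-- A chain map to a coeffaceable complex from a complex vanishing in degrees `> m` becomes null
homotopic after composition with a quasi-isomorphism from a complex vanishing in degrees `> m`. -/
lemma exists_homotopy_of_coeffAt (h : IsExactStructure conf) {L Z : CochainComplex E ℤ} (g : Z ⟶ L)
    (m : ℤ) [Z.IsStrictlyLE m] (hL : ∀ k, k ≤ m → CoeffAt conf L k) :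
    ∃ (N : CochainComplex E ℤ) (u : N ⟶ Z), N.IsStrictlyLE m ∧
      IsAcyclic conf (mappingCone u) ∧ Nonempty (Homotopy (u ≫ g) 0) := by
  -- The dual state. The second map is given for every `i` with `i + 1 = k`, which avoids transports
  -- along `k - 1 + 1 = k`.
  let S : ℤ → Type w := fun k => Σ P : E,
    {x : (P ⟶ Z.X k) × (∀ i, i + 1 = k → (Z.X i ⟶ P)) × (P ⟶ L.X k) //
    (∀ i hi, x.2.1 i hi ≫ x.1 = Z.d i k) ∧ (∀ i hi j, Z.d j i ≫ x.2.1 i hi = 0) ∧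
    (∀ j, x.2.2 ≫ L.d k j = 0) ∧
    (∀ i hi, x.2.1 i hi ≫ x.2.2 = g.f i ≫ L.d i k) ∧ (m < k → IsZero P)}
  obtain ⟨O, hO⟩ := HasZeroObject.zero (C := E)
  have hZ : ∀ k, m < k → IsZero (Z.X k) := fun k hk => Z.isZero_of_isStrictlyLE m k
  let R : ∀ i j, i + 1 = j → S i → S j → Prop := fun i j hij s' s =>
    ∃ (N : E) (π : N ⟶ s.1) (t : N ⟶ L.X i) (a : s'.1 ⟶ N), IsDeflation conf π ∧
      π ≫ s.2.1.2.2 = t ≫ L.d i j ∧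
      IsPullback a s'.2.1.1 π (s.2.1.2.1 i hij) ∧ (∀ k hk, s'.2.1.2.1 k hk ≫ a = 0) ∧
      s'.2.1.2.2 = s'.2.1.1 ≫ g.f i - a ≫ t ∧ (m < j → IsZero N)
  have step : ∀ i j (hij : i + 1 = j) (s : S j), ∃ s' : S i, R i j hij s' s := by
    rintro i j hij ⟨P, ⟨⟨ι, b, r⟩, h₁, h₂, h₃, h₄, h₅⟩⟩
    dsimp at h₁ h₂ h₃ h₄ h₅
    obtain rfl : i = j - 1 := by omega
    have : ∃ (N : E) (π : N ⟶ P) (s : N ⟶ L.X (j - 1)), IsDeflation conf π ∧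
        π ≫ r = s ≫ L.d (j - 1) j ∧ (m < j → IsZero N) := by
      rcases lt_or_ge m j with hi' | hi'
      · exact ⟨P, 𝟙 P, 0, h.deflation_id P, (h₅ hi').eq_of_src _ _, h₅⟩
      · obtain ⟨N, π, s, h₁, h₂⟩ := hL j hi' r h₃
        exact ⟨N, π, s, h₁, h₂, fun _ => by omega⟩
    obtain ⟨N, π, s, hπ, hs, hN⟩ := this
    obtain ⟨P', a, ι', sq, _⟩ := h.pullback (b _ hij) hπ
    refine ⟨⟨P', ⟨⟨ι', fun i hi => sq.lift 0 (Z.d _ _) (by simp [h₂]), ι' ≫ g.f _ - a ≫ s⟩, ?_, ?_,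
      ?_, ?_, ?_⟩⟩, N, π, s, a, hπ, hs, sq, by simp, rfl, hN⟩
    · simp
    · intro i hi j; apply sq.hom_ext <;> simp
    · intro k
      dsimp
      by_cases hj : j - 1 + 1 = k
      · obtain rfl : k = j := by omega
        rw [Preadditive.sub_comp, Category.assoc, ← h₄ _ hij, Category.assoc, ← hs,
          ← Category.assoc, ← Category.assoc, sq.w, sub_self]
      · rw [L.shape _ _ hj, comp_zero]
    · simp
    · intro hi
      have h1 : IsZero (Z.X (j - 1)) := hZ _ hi
      have h2 := hN (by omega)
      rw [IsZero.iff_id_eq_zero]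
      apply sq.hom_ext
      · exact h2.eq_of_tgt _ _
      · exact h1.eq_of_tgt _ _
  obtain ⟨s, -, hs⟩ := exists_int_sequence' R (m + 1)
    (fun k hk => ⟨O, ⟨⟨0, fun _ _ => 0, 0⟩, fun _ _ => (hZ k (by omega)).eq_of_tgt _ _, by simp,
      by simp, fun i hi => by
        rw [g.comm, (hZ k (by omega)).eq_of_tgt (Z.d i k) 0]; simp, fun _ => hO⟩⟩)
    (fun i j hij hj => ⟨O, 0, 0, 0, by
      convert h.deflation_id O; exact hO.eq_of_src _ _, hO.eq_of_src _ _, by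
        refine IsPullback.of_isLimit' ⟨hO.eq_of_src _ _⟩ (PullbackCone.IsLimit.mk _
          (fun _ => 0) ?_ ?_ ?_)
        · exact fun _ => hO.eq_of_tgt _ _
        · exact fun _ => (hZ _ (by omega)).eq_of_tgt _ _
        · exact fun _ _ _ _ => hO.eq_of_tgt _ _, fun _ _ => hO.eq_of_tgt _ _,
            hO.eq_of_src _ _, fun _ => hO⟩)
    (fun i j hij hi s => step i j hij s)
  -- The object `N` belongs to degree `j`, while the step data depend on `i` as well; fixing `i = j
  -- - 1` first makes `N` and `π` depend on `j` alone.
  have hs' : ∀ j, ∃ (N : E) (π : N ⟶ (s j).1), IsDeflation conf π ∧ (m < j → IsZero N) ∧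
      ∀ i (hij : i + 1 = j), ∃ (a : (s i).1 ⟶ N) (t : N ⟶ L.X i),
        π ≫ (s j).2.1.2.2 = t ≫ L.d i j ∧
        IsPullback a (s i).2.1.1 π ((s j).2.1.2.1 i hij) ∧ (∀ k hk, (s i).2.1.2.1 k hk ≫ a = 0) ∧
        (s i).2.1.2.2 = (s i).2.1.1 ≫ g.f i - a ≫ t := by
    intro j
    obtain ⟨N, π, t, a, h₁, h₂, h₃, h₄, h₅, h₆⟩ := hs (j - 1) j (by omega)
    refine ⟨N, π, h₁, h₆, fun i hij => ?_⟩
    obtain rfl : i = j - 1 := by omega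
    exact ⟨a, t, h₂, h₃, h₄, h₅⟩
  choose N π hπ hN a' t' ht' sq' hab' hr' using hs'
  let a := fun i => a' (i + 1) i rfl
  let t := fun i => t' (i + 1) i rfl
  have hι := fun k => (s k).2.2.1
  have hab : ∀ k, (s (k + 1)).2.1.2.1 k rfl ≫ a (k + 1) = 0 := fun k => hab' _ _ _ _ _
  have sq : ∀ i, IsPullback (a i) (s i).2.1.1 (π (i + 1)) ((s (i + 1)).2.1.2.1 i rfl) :=
    fun i => sq' _ _ _
  have hd : ∀ k, (π k ≫ a k) ≫ π (k + 1) ≫ a (k + 1) = 0 := by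
    intro k
    rw [Category.assoc, reassoc_of% (sq k).w, hab, comp_zero, comp_zero]
  let K : CochainComplex E ℤ := CochainComplex.of N (fun k => π k ≫ a k) hd
  have hK : ∀ k, K.d k (k + 1) = π k ≫ a k := fun k => CochainComplex.of_d N (fun k => π k ≫ a k) k
  let u : K ⟶ Z :=
    { f := fun k => π k ≫ (s k).2.1.1
      comm' := by
        rintro i _ rfl
        rw [hK, Category.assoc, Category.assoc, reassoc_of% (sq i).w, hι] }
  refine ⟨K, u, ?_, isAcyclic_mappingCone_of_isPullback h u (b := fun i j hij => (s j).2.1.2.1 i hij)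
    (π := π) (a := fun i j hij => a' j i hij) (fun _ _ _ => hι _ _ _)
    (fun i j k hij hjk => hab' _ _ _ _ _) ?_ (fun _ => rfl) (fun _ _ _ => sq' _ _ _) hπ,
    exists_homotopy_zero _ t fun k => ?_⟩
  · rw [CochainComplex.isStrictlyLE_iff]
    exact fun i hi => hN i hi
  · rintro i _ rfl
    exact hK i
  · have h₁ : π (k + 1) ≫ (s (k + 1)).2.1.2.2 = t k ≫ L.d k (k + 1) := ht' _ _ _
    have h₂ : (s (k + 1)).2.1.2.2 = _ - a (k + 1) ≫ t (k + 1) := hr' _ _ _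
    rw [h₂, Preadditive.comp_sub, sub_eq_iff_eq_add] at h₁
    change (π (k + 1) ≫ (s (k + 1)).2.1.1) ≫ g.f (k + 1) = _
    rw [hK, Category.assoc, Category.assoc, h₁]
    exact add_comm _ _

end Orthogonality

end NQuasiAbelian

/-! ### Fractions and orthogonality in the derived category -/

namespace NQuasiAbelian

namespace ExactCat

variable (X : ExactCat.{w})

/-- The quotient functor from the homotopy category to the derived category. -/
noncomputable abbrev qh : HomotopyCategory X.E (ComplexShape.up ℤ) ⥤ X.Derived :=
  (acyclicComplexes X.conf).trW.Q

/-- The functor from complexes to the homotopy category. -/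
noncomputable abbrev ho : CochainComplex X.E ℤ ⥤ HomotopyCategory X.E (ComplexShape.up ℤ) :=
  HomotopyCategory.quotient X.E (ComplexShape.up ℤ)

noncomputable instance : X.Q.CommShift ℤ :=
  inferInstanceAs ((X.ho ⋙ X.qh).CommShift ℤ)

instance : X.Q.Additive := inferInstanceAs ((X.ho ⋙ X.qh).Additive)

instance : X.toDerived.Additive :=
  inferInstanceAs ((CochainComplex.singleFunctor X.E 0 ⋙ X.Q).Additive)

variable {X}

lemma trW_ho_map {K L : CochainComplex X.E ℤ} (u : K ⟶ L)
    (hu : IsAcyclic X.conf (CochainComplex.mappingCone u)) :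
    (acyclicComplexes X.conf).trW (X.ho.map u) :=
  (ObjectProperty.trW_iff _ _).2
    ⟨_, _, _, HomotopyCategory.mappingCone_triangleh_distinguished u, hu⟩

lemma isIso_Q_map {K L : CochainComplex X.E ℤ} (u : K ⟶ L)
    (hu : IsAcyclic X.conf (CochainComplex.mappingCone u)) : IsIso (X.Q.map u) :=
  Localization.inverts X.qh (acyclicComplexes X.conf).trW _ (trW_ho_map u hu)

lemma Q_map_eq_of_homotopy {K L : CochainComplex X.E ℤ} {f g : K ⟶ L} (h : Homotopy f g) :
    X.Q.map f = X.Q.map g :=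
  congr_arg X.qh.map (HomotopyCategory.eq_of_homotopy _ _ h)

/-- The fibre `W` of `s` is acyclic, hence effaceable. A `u : Z ⟶ N` that annihilates `W ⟶ Z` up to
homotopy factors through `s`. So denominators whose targets vanish below `m` are cofinal. -/
lemma exists_of_trW {Z : CochainComplex X.E ℤ} (m : ℤ) [Z.IsStrictlyGE m]
    {Y : HomotopyCategory X.E (ComplexShape.up ℤ)} (s : X.ho.obj Z ⟶ Y)
    (hs : (acyclicComplexes X.conf).trW s) :
    ∃ (N : CochainComplex X.E ℤ) (u : Z ⟶ N) (t : Y ⟶ X.ho.obj N), N.IsStrictlyGE m ∧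
      IsAcyclic X.conf (CochainComplex.mappingCone u) ∧ s ≫ t = X.ho.map u := by
  obtain ⟨W, a, b, hT, hW⟩ := ((acyclicComplexes X.conf).trW_iff' _).1 hs
  obtain ⟨g, rfl⟩ := X.ho.map_surjective (X := W.as) a
  obtain ⟨N, u, hN, hu, ⟨H⟩⟩ := exists_homotopy_of_effAt X.exact g m
    (fun k _ => IsAcyclic.effAt X.exact hW k)
  have h0 : X.ho.map g ≫ X.ho.map u = 0 := by
    rw [← Functor.map_comp, HomotopyCategory.eq_of_homotopy _ _ H, Functor.map_zero]
  obtain ⟨t, ht⟩ := Pretriangulated.Triangle.yoneda_exact₂ _ hT _ h0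
  exact ⟨N, u, t, hN, hu, ht.symm⟩

/-- Dual argument, with the cone of `s`, which is coeffaceable. -/
lemma exists_of_trW' {Z : CochainComplex X.E ℤ} (m : ℤ) [Z.IsStrictlyLE m]
    {Y : HomotopyCategory X.E (ComplexShape.up ℤ)} (s : Y ⟶ X.ho.obj Z)
    (hs : (acyclicComplexes X.conf).trW s) :
    ∃ (N : CochainComplex X.E ℤ) (u : N ⟶ Z) (t : X.ho.obj N ⟶ Y), N.IsStrictlyLE m ∧
      IsAcyclic X.conf (CochainComplex.mappingCone u) ∧ t ≫ s = X.ho.map u := by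
  obtain ⟨W, a, b, hT, hW⟩ := ((acyclicComplexes X.conf).trW_iff _).1 hs
  obtain ⟨g, rfl⟩ := X.ho.map_surjective (Y := W.as) a
  obtain ⟨N, u, hN, hu, ⟨H⟩⟩ := exists_homotopy_of_coeffAt X.exact g m
    (fun k _ => IsAcyclic.coeffAt X.exact hW k)
  have h0 : X.ho.map u ≫ X.ho.map g = 0 := by
    rw [← Functor.map_comp, HomotopyCategory.eq_of_homotopy _ _ H, Functor.map_zero]
  obtain ⟨t, ht⟩ := Pretriangulated.Triangle.coyoneda_exact₂ _ hT _ h0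
  exact ⟨N, u, t, hN, hu, ht.symm⟩

/-- Morphisms in the derived category to a complex vanishing in degrees `< m` are left fractions
of such complexes. -/
lemma exists_left_fraction {K Z : CochainComplex X.E ℤ} (m : ℤ) [Z.IsStrictlyGE m]
    (α : X.Q.obj K ⟶ X.Q.obj Z) :
    ∃ (N : CochainComplex X.E ℤ) (f : K ⟶ N) (u : Z ⟶ N), N.IsStrictlyGE m ∧
      IsAcyclic X.conf (CochainComplex.mappingCone u) ∧ α ≫ X.Q.map u = X.Q.map f := by
  obtain ⟨φ, hφ⟩ := Localization.exists_leftFraction X.qh (acyclicComplexes X.conf).trW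
    (X := X.ho.obj K) (Y := X.ho.obj Z) α
  obtain ⟨N, u, t, hN, hu, ht⟩ := exists_of_trW m φ.s φ.hs
  obtain ⟨f, hf⟩ := X.ho.map_surjective (φ.f ≫ t)
  refine ⟨N, f, u, hN, hu, ?_⟩
  let α' : X.qh.obj (X.ho.obj K) ⟶ X.qh.obj (X.ho.obj Z) := α
  change α' ≫ X.qh.map (X.ho.map u) = X.qh.map (X.ho.map f)
  rw [hf, ← ht, show α' = _ from hφ, Functor.map_comp, Functor.map_comp,
    MorphismProperty.LeftFraction.map_comp_map_s_assoc]

lemma exists_right_fraction {Z K : CochainComplex X.E ℤ} (m : ℤ) [Z.IsStrictlyLE m]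
    (α : X.Q.obj Z ⟶ X.Q.obj K) :
    ∃ (N : CochainComplex X.E ℤ) (f : N ⟶ K) (u : N ⟶ Z), N.IsStrictlyLE m ∧
      IsAcyclic X.conf (CochainComplex.mappingCone u) ∧ X.Q.map u ≫ α = X.Q.map f := by
  obtain ⟨φ, hφ⟩ := Localization.exists_rightFraction X.qh (acyclicComplexes X.conf).trW
    (X := X.ho.obj Z) (Y := X.ho.obj K) α
  obtain ⟨N, u, t, hN, hu, ht⟩ := exists_of_trW' m φ.s φ.hs
  obtain ⟨f, hf⟩ := X.ho.map_surjective (t ≫ φ.f)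
  refine ⟨N, f, u, hN, hu, ?_⟩
  let α' : X.qh.obj (X.ho.obj Z) ⟶ X.qh.obj (X.ho.obj K) := α
  change X.qh.map (X.ho.map u) ≫ α' = X.qh.map (X.ho.map f)
  rw [hf, ← ht, show α' = _ from hφ, Functor.map_comp, Functor.map_comp, Category.assoc,
    MorphismProperty.RightFraction.map_s_comp_map]

lemma exists_of_Q_map_eq {K Z : CochainComplex X.E ℤ} (m : ℤ) [Z.IsStrictlyGE m]
    (f g : K ⟶ Z) (hfg : X.Q.map f = X.Q.map g) :
    ∃ (N : CochainComplex X.E ℤ) (u : Z ⟶ N), N.IsStrictlyGE m ∧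
      IsAcyclic X.conf (CochainComplex.mappingCone u) ∧ Nonempty (Homotopy (f ≫ u) (g ≫ u)) := by
  obtain ⟨Y, s, hs, h⟩ := (MorphismProperty.map_eq_iff_postcomp X.qh
    (acyclicComplexes X.conf).trW (X.ho.map f) (X.ho.map g)).1 hfg
  obtain ⟨N, u, t, hN, hu, ht⟩ := exists_of_trW m s hs
  refine ⟨N, u, hN, hu, ⟨HomotopyCategory.homotopyOfEq _ _ ?_⟩⟩
  rw [Functor.map_comp, Functor.map_comp, ← ht, reassoc_of% h]

/-- There are no nonzero morphisms from complexes vanishing in degrees `≥ m` to complexes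
vanishing in degrees `< m`. -/
lemma Q_hom_eq_zero {K Z : CochainComplex X.E ℤ} {l m : ℤ} (hlm : l < m) [K.IsStrictlyLE l]
    [Z.IsStrictlyGE m] (α : X.Q.obj K ⟶ X.Q.obj Z) : α = 0 := by
  obtain ⟨N, f, u, hN, hu, h⟩ := exists_left_fraction m α
  have hf : f = 0 := by
    ext i
    by_cases hi : l < i
    · exact (K.isZero_of_isStrictlyLE l i hi).eq_of_src _ _
    · exact (N.isZero_of_isStrictlyGE m i (by omega)).eq_of_tgt _ _
  have := isIso_Q_map u hu
  rw [← cancel_mono (X.Q.map u), h, hf, Functor.map_zero, zero_comp]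

/-- Effaceable complexes are orthogonal to complexes vanishing in degrees `< m`. -/
lemma Q_hom_eq_zero_of_effAt {K Z : CochainComplex X.E ℤ} {m : ℤ}
    (hK : ∀ k, m ≤ k → EffAt X.conf K k)
    [Z.IsStrictlyGE m] (α : X.Q.obj K ⟶ X.Q.obj Z) : α = 0 := by
  obtain ⟨N, f, u, hN, hu, h⟩ := exists_left_fraction m α
  obtain ⟨N', u', hN', hu', ⟨H⟩⟩ := exists_homotopy_of_effAt X.exact f m hK
  have := isIso_Q_map u hu
  have := isIso_Q_map u' hu'
  rw [← cancel_mono (X.Q.map u), h, ← cancel_mono (X.Q.map u'), ← Functor.map_comp,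
    Q_map_eq_of_homotopy H]
  simp

lemma Q_hom_eq_zero_of_coeffAt {K Z : CochainComplex X.E ℤ} {m : ℤ}
    (hK : ∀ k, k ≤ m → CoeffAt X.conf K k)
    [Z.IsStrictlyLE m] (α : X.Q.obj Z ⟶ X.Q.obj K) : α = 0 := by
  obtain ⟨N, f, u, hN, hu, h⟩ := exists_right_fraction m α
  obtain ⟨N', u', hN', hu', ⟨H⟩⟩ := exists_homotopy_of_coeffAt X.exact f m hK
  have := isIso_Q_map u hu
  have := isIso_Q_map u' hu'
  rw [← cancel_epi (X.Q.map u), h, ← cancel_epi (X.Q.map u'), ← Functor.map_comp,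
    Q_map_eq_of_homotopy H]
  simp

end ExactCat

end NQuasiAbelian

/-! ### Stupid truncations and towers of `D`-cokernels and `D`-kernels -/

namespace NQuasiAbelian

section Complexes

variable {E : Type w} [Category.{w} E] [Preadditive E] {conf : ObjectProperty (ShortComplex E)}
  [HasZeroObject E]

/-- The stupid truncations of a complex. -/
lemma exists_stupid_truncations (K : CochainComplex E ℤ) (m : ℤ) :
    ∃ S : ShortComplex (CochainComplex E ℤ), S.X₂ = K ∧ S.X₁.IsStrictlyGE m ∧
      S.X₃.IsStrictlyLE (m - 1) ∧ (∀ i, m ≤ i → IsIso (S.f.f i)) ∧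
      (∀ i, i < m → IsIso (S.g.f i)) := by
  -- Each term is split as a sum of `A` and `B`, one of which is zero. Choosing these splittings
  -- degree by degree keeps the case distinction out of the definitions of the two complexes.
  have hA : ∀ i, ∃ (A B : E) (ι : A ⟶ K.X i) (r : K.X i ⟶ A) (p : K.X i ⟶ B) (s : B ⟶ K.X i),
      ι ≫ r = 𝟙 A ∧ s ≫ p = 𝟙 B ∧ ι ≫ p = 0 ∧ r ≫ ι + p ≫ s = 𝟙 _ ∧
      (i < m → IsZero A ∧ IsIso p) ∧ (m ≤ i → IsZero B ∧ IsIso ι) := by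
    intro i
    obtain ⟨Z, hZ⟩ := HasZeroObject.zero (C := E)
    by_cases hi : i < m
    · exact ⟨Z, K.X i, 0, 0, 𝟙 _, 𝟙 _, hZ.eq_of_src _ _, by simp, by simp, by simp,
        fun _ => ⟨hZ, inferInstance⟩, fun _ => by omega⟩
    · exact ⟨K.X i, Z, 𝟙 _, 𝟙 _, 0, 0, by simp, hZ.eq_of_src _ _, by simp, by simp,
        fun _ => by omega, fun _ => ⟨hZ, inferInstance⟩⟩
  choose A B ι r p s h₁ h₂ h₃ h₄ h₅ h₆ using hA
  have h₀ : ∀ i j, ι i ≫ K.d i j ≫ p j = 0 := by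
    intro i j
    by_cases hij : i + 1 = j
    · by_cases hi : i < m
      · exact (h₅ i hi).1.eq_of_src _ _
      · exact (h₆ j (by omega)).1.eq_of_tgt _ _
    · rw [K.shape _ _ hij]; simp
  have hr : ∀ i j, ι i ≫ K.d i j ≫ r j ≫ ι j = ι i ≫ K.d i j := by
    intro i j
    have := congr_arg (fun t => ι i ≫ K.d i j ≫ t) (h₄ j)
    simpa [reassoc_of% (h₀ i j)] using this
  have hp : ∀ i j, p i ≫ s i ≫ K.d i j ≫ p j = K.d i j ≫ p j := by
    intro i j
    have := congr_arg (fun t => t ≫ K.d i j ≫ p j) (h₄ i)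
    simpa [h₀ i j] using this
  let K₁ : CochainComplex E ℤ :=
    { X := A
      d := fun i j => ι i ≫ K.d i j ≫ r j
      shape := fun i j hij => by rw [K.shape _ _ hij]; simp
      d_comp_d' := fun i j k _ _ => by
        simp only [Category.assoc]
        rw [reassoc_of% (hr i j)]
        simp }
  let K₃ : CochainComplex E ℤ :=
    { X := B
      d := fun i j => s i ≫ K.d i j ≫ p j
      shape := fun i j hij => by rw [K.shape _ _ hij]; simp
      d_comp_d' := fun i j k _ _ => by
        simp only [Category.assoc]
        rw [hp j k]
        simp }
  let f : K₁ ⟶ K := { f := ι, comm' := fun i j _ => by simp [K₁, hr] }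
  let g : K ⟶ K₃ := { f := p, comm' := fun i j _ => by simp [K₃, hp] }
  refine ⟨ShortComplex.mk f g (by ext i; exact h₃ i), rfl, ?_, ?_, fun i hi => (h₆ i hi).2,
    fun i hi => (h₅ i hi).2⟩
  · exact (CochainComplex.isStrictlyGE_iff _ _).2 fun i hi => (h₅ i hi).1
  · exact (CochainComplex.isStrictlyLE_iff _ _).2 fun i hi => (h₆ i (by omega)).1

variable [HasBinaryBiproducts E]

/-- Extension of a complex `V` vanishing in degrees `> m` by iterated `D`-cokernels. -/
lemma exists_cokernel_tower (h : IsExactStructure conf) (hD : HasDCokernels conf)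
    (V : CochainComplex E ℤ) (m : ℤ) [V.IsStrictlyLE m] :
    ∃ (T : CochainComplex E ℤ) (ρ : T ⟶ V), (∀ i, i ≤ m → IsIso (ρ.f i)) ∧
      ∀ i j k, i + 1 = j → j + 1 = k → m ≤ j → IsDCokernel conf (T.d i j) (T.d j k) ∧
        (HasCokernel (T.d i j) → Epi (T.d j k)) := by
  -- A genuine cokernel is taken whenever one exists. The next differential is then an epimorphism,
  -- which is what later makes the tower stop.
  have hD' : ∀ ⦃A B : E⦄ (f : A ⟶ B), ∃ (Q : E) (p : B ⟶ Q), IsDCokernel conf f p ∧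
      (HasCokernel f → Epi p) := by
    intro A B f
    by_cases hf : HasCokernel f
    · refine ⟨_, cokernel.π f, ⟨by simp, fun X j hj => ⟨X, 𝟙 X, cokernel.desc f j hj,
        h.inflation_id X, by simp⟩⟩, fun _ => inferInstance⟩
    · obtain ⟨Q, p, hp⟩ := hD f
      exact ⟨Q, p, hp, fun h => (hf h).elim⟩
  -- The predicate records which maps out of `Y` kill the incoming differential. It replaces that
  -- differential without naming its source, so that the given complex and the tower above it are
  -- treated alike.
  let S : ℤ → Type w := fun k => Σ Y : E,
    {x : (∀ Z : E, (Y ⟶ Z) → Prop) × (Y ⟶ V.X k) //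
      ∃ (W : E) (f : W ⟶ Y), ∀ Z g, x.1 Z g ↔ f ≫ g = 0}
  let R : ∀ i j, i + 1 = j → S i → S j → Prop := fun i j hij s s' =>
    ∃ d : s.1 ⟶ s'.1, (∀ Z g, s'.2.1.1 Z g ↔ d ≫ g = 0) ∧ s.2.1.1 _ d ∧
      d ≫ s'.2.1.2 = s.2.1.2 ≫ V.d i j ∧
      (m ≤ i → (∀ Z g, s.2.1.1 Z g → ∃ (N : E) (π : Z ⟶ N) (k : s'.1 ⟶ N),
        IsInflation conf π ∧ g ≫ π = d ≫ k) ∧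
        ∀ (W : E) (f : W ⟶ s.1), (∀ Z g, s.2.1.1 Z g ↔ f ≫ g = 0) → HasCokernel f → Epi d)
  have step : ∀ i j (hij : i + 1 = j), m ≤ i → ∀ s : S i, ∃ s' : S j, R i j hij s s' := by
    rintro i j hij hi ⟨Y, ⟨⟨K, v⟩, W, f, hf⟩⟩
    dsimp at hf
    obtain ⟨Q, d, ⟨h₁, h₂⟩, h₃⟩ := hD' f
    refine ⟨⟨Q, ⟨⟨fun Z g => d ≫ g = 0, 0⟩, Y, d, fun _ _ => Iff.rfl⟩⟩, d, fun _ _ => Iff.rfl,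
      (hf _ _).2 h₁, (V.isZero_of_isStrictlyLE m j (by omega)).eq_of_tgt _ _, fun _ => ⟨fun Z g hg =>
        h₂ g ((hf _ _).1 hg), fun W' f' hf' hc => h₃ ?_⟩⟩
    dsimp at hf'
    refine ⟨⟨⟨CokernelCofork.ofπ (cokernel.π f') ((hf _ _).1 ((hf' _ _).2 (by simp))), ?_⟩⟩⟩
    exact CokernelCofork.IsColimit.ofπ _ _
      (fun t ht => cokernel.desc f' t ((hf' _ _).1 ((hf _ _).2 ht))) (by simp)
      (fun t ht l hl => by rw [← cancel_epi (cokernel.π f'), hl, cokernel.π_desc])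
  obtain ⟨s, hs₀, hs⟩ := exists_int_sequence R m
    (fun k hk => ⟨V.X k, ⟨⟨fun Z g => ∀ i, V.d i k ≫ g = 0, 𝟙 _⟩, V.X (k - 1), V.d (k - 1) k,
      fun Z g => ⟨fun h => h _, fun h i => by
        by_cases hi : i + 1 = k
        · obtain rfl : i = k - 1 := by omega
          exact h
        · rw [V.shape _ _ hi, zero_comp]⟩⟩⟩)
    (fun i j hij hj => ⟨V.d i j, fun Z g => ⟨fun h => h _, fun h k => by
        by_cases hk : k + 1 = j
        · obtain rfl : i = k := by omega
          exact h
        · rw [V.shape _ _ hk, zero_comp]⟩, fun k => by simp, by simp, fun _ => by omega⟩)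
    step
  choose d hd₁ hd₂ hd₃ hd₄ using fun i => hs i (i + 1) rfl
  let T : CochainComplex E ℤ := CochainComplex.of (fun k => (s k).1) d
    (fun k => (hd₁ k _ _).1 (hd₂ (k + 1)))
  have hT : ∀ k, T.d k (k + 1) = d k := fun k => CochainComplex.of_d (fun k => (s k).1) d k
  let ρ : T ⟶ V :=
    { f := fun k => (s k).2.1.2
      comm' := by
        rintro i _ rfl
        rw [hT]
        exact (hd₃ i).symm }
  refine ⟨T, ρ, fun i hi => ?_, ?_⟩
  · change IsIso (s i).2.1.2
    rw [hs₀ i hi]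
    dsimp
    infer_instance
  · rintro i _ _ rfl rfl hi
    rw [hT, hT]
    exact ⟨⟨(hd₁ _ _ _).1 (hd₂ _), fun Z g hg => (hd₄ (i + 1) hi).1 Z g ((hd₁ _ _ _).2 hg)⟩,
      (hd₄ (i + 1) hi).2 _ _ (hd₁ i)⟩

/-- Extension of a complex `V` vanishing in degrees `< m` by iterated `D`-kernels. -/
lemma exists_kernel_tower (h : IsExactStructure conf) (hD : HasDKernels conf)
    (V : CochainComplex E ℤ) (m : ℤ) [V.IsStrictlyGE m] :
    ∃ (T : CochainComplex E ℤ) (ρ : V ⟶ T), (∀ i, m ≤ i → IsIso (ρ.f i)) ∧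
      ∀ i j k, i + 1 = j → j + 1 = k → j ≤ m → IsDKernel conf (T.d i j) (T.d j k) ∧
        (HasKernel (T.d j k) → Mono (T.d i j)) := by
  have hD' : ∀ ⦃A B : E⦄ (f : A ⟶ B), ∃ (K : E) (i : K ⟶ A), IsDKernel conf i f ∧
      (HasKernel f → Mono i) := by
    intro A B f
    by_cases hf : HasKernel f
    · refine ⟨_, kernel.ι f, ⟨by simp, fun X j hj => ⟨X, 𝟙 X, kernel.lift f j hj,
        h.deflation_id X, by simp⟩⟩, fun _ => inferInstance⟩
    · obtain ⟨Q, p, hp⟩ := hD f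
      exact ⟨Q, p, hp, fun h => (hf h).elim⟩
  let S : ℤ → Type w := fun k => Σ Y : E,
    {x : (∀ Z : E, (Z ⟶ Y) → Prop) × (V.X k ⟶ Y) //
      ∃ (W : E) (f : Y ⟶ W), ∀ Z g, x.1 Z g ↔ g ≫ f = 0}
  let R : ∀ i j, i + 1 = j → S i → S j → Prop := fun i j hij s' s =>
    ∃ d : s'.1 ⟶ s.1, (∀ Z g, s'.2.1.1 Z g ↔ g ≫ d = 0) ∧ s.2.1.1 _ d ∧
      s'.2.1.2 ≫ d = V.d i j ≫ s.2.1.2 ∧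
      (j ≤ m → (∀ Z g, s.2.1.1 Z g → ∃ (N : E) (π : N ⟶ Z) (k : N ⟶ s'.1),
        IsDeflation conf π ∧ π ≫ g = k ≫ d) ∧
        ∀ (W : E) (f : s.1 ⟶ W), (∀ Z g, s.2.1.1 Z g ↔ g ≫ f = 0) → HasKernel f → Mono d)
  have step : ∀ i j (hij : i + 1 = j), j ≤ m → ∀ s : S j, ∃ s' : S i, R i j hij s' s := by
    rintro i j hij hi ⟨Y, ⟨⟨K, v⟩, W, f, hf⟩⟩
    dsimp at hf
    obtain ⟨Q, d, ⟨h₁, h₂⟩, h₃⟩ := hD' f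
    refine ⟨⟨Q, ⟨⟨fun Z g => g ≫ d = 0, 0⟩, Y, d, fun _ _ => Iff.rfl⟩⟩, d, fun _ _ => Iff.rfl,
      (hf _ _).2 h₁, (V.isZero_of_isStrictlyGE m i (by omega)).eq_of_src _ _, fun _ => ⟨fun Z g hg =>
        h₂ g ((hf _ _).1 hg), fun W' f' hf' hc => h₃ ?_⟩⟩
    dsimp at hf'
    refine ⟨⟨⟨KernelFork.ofι (kernel.ι f') ((hf _ _).1 ((hf' _ _).2 (by simp))), ?_⟩⟩⟩
    exact KernelFork.IsLimit.ofι _ _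
      (fun t ht => kernel.lift f' t ((hf' _ _).1 ((hf _ _).2 ht))) (by simp)
      (fun t ht l hl => by rw [← cancel_mono (kernel.ι f'), hl, kernel.lift_ι])
  obtain ⟨s, hs₀, hs⟩ := exists_int_sequence' R m
    (fun k hk => ⟨V.X k, ⟨⟨fun Z g => ∀ j, g ≫ V.d k j = 0, 𝟙 _⟩, V.X (k + 1), V.d k (k + 1),
      fun Z g => ⟨fun h => h _, fun h i => by
        by_cases hi : k + 1 = i
        · subst hi
          exact h
        · rw [V.shape _ _ hi, comp_zero]⟩⟩⟩)
    (fun i j hij hj => ⟨V.d i j, fun Z g => ⟨fun h => h _, fun h k => by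
        by_cases hk : i + 1 = k
        · obtain rfl : j = k := by omega
          exact h
        · rw [V.shape _ _ hk, comp_zero]⟩, fun k => by simp, by simp, fun _ => by omega⟩)
    step
  choose d hd₁ hd₂ hd₃ hd₄ using fun i => hs i (i + 1) rfl
  let T : CochainComplex E ℤ := CochainComplex.of (fun k => (s k).1) d
    (fun k => (hd₁ (k + 1) _ _).1 (hd₂ k))
  have hT : ∀ k, T.d k (k + 1) = d k := fun k => CochainComplex.of_d (fun k => (s k).1) d k
  let ρ : V ⟶ T :=
    { f := fun k => (s k).2.1.2
      comm' := by
        rintro i _ rfl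
        rw [hT]
        exact hd₃ i }
  refine ⟨T, ρ, fun i hi => ?_, ?_⟩
  · change IsIso (s i).2.1.2
    rw [hs₀ i hi]
    dsimp
    infer_instance
  · rintro i _ _ rfl rfl hi
    rw [hT, hT]
    exact ⟨⟨(hd₁ _ _ _).1 (hd₂ _), fun Z g hg => (hd₄ i hi).1 Z g ((hd₁ _ _ _).2 hg)⟩,
      (hd₄ i hi).2 _ _ (hd₁ (i + 1))⟩

lemma effAt_of_isDCokernel {T : CochainComplex E ℤ} {j : ℤ}
    (hT : IsDCokernel conf (T.d (j - 1) j) (T.d j (j + 1))) : EffAt conf T j :=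
  fun _ r hr => hT.2 r (hr _)

lemma coeffAt_of_isDKernel {T : CochainComplex E ℤ} {j : ℤ}
    (hT : IsDKernel conf (T.d (j - 1) j) (T.d j (j + 1))) : CoeffAt conf T j :=
  fun _ r hr => hT.2 r (hr _)

end Complexes

/-! ### t-structures defined by a coaisle or by an aisle -/

section TStructures

open Pretriangulated

variable {C : Type w} [Category.{w} C] [Preadditive C] [HasZeroObject C] [HasShift C ℤ]
  [∀ n : ℤ, (shiftFunctor C n).Additive] [Pretriangulated C]

/-- The t-structure with a given coaisle. -/
def tStructureOfGE (G : ℤ → ObjectProperty C) (hG : Antitone G)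
    (hiso : ∀ n, (G n).IsClosedUnderIsomorphisms)
    (hshift : ∀ (n a n' : ℤ), a + n' = n → ∀ X : C, G n X → G n' (X⟦a⟧))
    (hex : ∀ A : C, ∃ (X Y : C) (_ : ∀ (Z : C) (f : X ⟶ Z), G 1 Z → f = 0) (_ : G 1 Y)
      (f : X ⟶ A) (g : A ⟶ Y) (h : Y ⟶ X⟦(1 : ℤ)⟧), Triangle.mk f g h ∈ distTriang C) :
    TStructure C where
  le n := fun X => ∀ (Z : C) (f : X ⟶ Z), G (n + 1) Z → f = 0
  ge := G
  le_isClosedUnderIsomorphisms n := ⟨fun e hX Z f hZ => by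
    rw [← cancel_epi e.hom, hX _ (e.hom ≫ f) hZ, comp_zero]⟩
  le_shift n a n' h X hX Z f hZ := by
    let e : X ≅ X⟦a⟧⟦-a⟧ := (shiftEquiv C a).unitIso.app X
    have := hX _ (e.hom ≫ f⟦-a⟧') (hshift (n' + 1) (-a) (n + 1) (by omega) _ hZ)
    have h0 : f⟦-a⟧' = 0 := by rw [← cancel_epi e.hom, this, comp_zero]
    exact (shiftFunctor C (-a)).map_injective (by rw [h0, Functor.map_zero])
  ge_shift n a n' h X hX := hshift n a n' h X hX
  zero' X Y f hX hY := hX _ f (by simpa using hY)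
  le_zero_le X hX Z f hZ := hX Z f (hG (by omega) _ hZ)
  ge_one_le := hG (by omega)
  exists_triangle_zero_one A := by simpa using hex A

/-- The t-structure with a given aisle. -/
def tStructureOfLE (G : ℤ → ObjectProperty C) (hG : Monotone G)
    (hiso : ∀ n, (G n).IsClosedUnderIsomorphisms)
    (hshift : ∀ (n a n' : ℤ), a + n' = n → ∀ X : C, G n X → G n' (X⟦a⟧))
    (hex : ∀ A : C, ∃ (X Y : C) (_ : G 0 X) (_ : ∀ (Z : C) (f : Z ⟶ Y), G 0 Z → f = 0)
      (f : X ⟶ A) (g : A ⟶ Y) (h : Y ⟶ X⟦(1 : ℤ)⟧), Triangle.mk f g h ∈ distTriang C) :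
    TStructure C where
  le := G
  ge n := fun X => ∀ (Z : C) (f : Z ⟶ X), G (n - 1) Z → f = 0
  ge_isClosedUnderIsomorphisms n := ⟨fun e hX Z f hZ => by
    rw [← cancel_mono e.inv, hX _ (f ≫ e.inv) hZ, zero_comp]⟩
  ge_shift n a n' h X hX Z f hZ := by
    let e : X ≅ X⟦a⟧⟦-a⟧ := (shiftEquiv C a).unitIso.app X
    have := hX _ (f⟦-a⟧' ≫ e.inv) (hshift (n' - 1) (-a) (n - 1) (by omega) _ hZ)
    have h0 : f⟦-a⟧' = 0 := by rw [← cancel_mono e.inv, this, zero_comp]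
    exact (shiftFunctor C (-a)).map_injective (by rw [h0, Functor.map_zero])
  le_shift n a n' h X hX := hshift n a n' h X hX
  zero' X Y f hX hY := hY _ f (by simpa using hX)
  le_zero_le := hG (by omega)
  ge_one_le X hX Z f hZ := hX Z f (hG (by omega) _ hZ)
  exists_triangle_zero_one A := by simpa using hex A

end TStructures

end NQuasiAbelian

/-! ### The right and left t-structures on the derived category -/

namespace NQuasiAbelian

open Pretriangulated

lemma distinguished_of_iso₂ {C : Type w} [Category.{w} C] [Preadditive C] [HasZeroObject C]
    [HasShift C ℤ] [∀ n : ℤ, (shiftFunctor C n).Additive] [Pretriangulated C] (T : Triangle C)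
    (hT : T ∈ distTriang C) {A : C} (e : T.obj₂ ≅ A) :
    Triangle.mk (T.mor₁ ≫ e.hom) (e.inv ≫ T.mor₂) T.mor₃ ∈ distTriang C :=
  isomorphic_distinguished _ hT _ (Triangle.isoMk _ _ (Iso.refl _) e.symm (Iso.refl _)
    (by change (T.mor₁ ≫ e.hom) ≫ e.inv = 𝟙 T.obj₁ ≫ T.mor₁; simp)
    (by change (e.inv ≫ T.mor₂) ≫ 𝟙 T.obj₃ = e.inv ≫ T.mor₂; simp)
    (by change T.mor₃ ≫ (𝟙 T.obj₁)⟦(1 : ℤ)⟧' = 𝟙 T.obj₃ ≫ T.mor₃; simp))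

namespace ExactCat

variable {X : ExactCat.{w}}

lemma distinguished_of_splitting (S : ShortComplex (CochainComplex X.E ℤ))
    (σ : ∀ n, (S.map (HomologicalComplex.eval X.E (ComplexShape.up ℤ) n)).Splitting) :
    ∃ δ : X.Q.obj S.X₃ ⟶ (X.Q.obj S.X₁)⟦(1 : ℤ)⟧,
      Triangle.mk (X.Q.map S.f) (X.Q.map S.g) δ ∈ distTriang X.Derived :=
  ⟨_, X.qh.map_distinguished _
    ((HomotopyCategory.distinguished_iff_iso_trianglehOfDegreewiseSplit _).2
      ⟨S, σ, ⟨Iso.refl _⟩⟩)⟩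

lemma mappingCone_distinguished {K L : CochainComplex X.E ℤ} (u : K ⟶ L) :
    ∃ δ : X.Q.obj (CochainComplex.mappingCone u) ⟶ (X.Q.obj K)⟦(1 : ℤ)⟧,
      Triangle.mk (X.Q.map u) (X.Q.map (CochainComplex.mappingCone.inr u)) δ ∈
        distTriang X.Derived :=
  ⟨_, X.qh.map_distinguished _ (HomotopyCategory.mappingCone_triangleh_distinguished u)⟩

lemma Q_obj_surjective (Y : X.Derived) : ∃ K : CochainComplex X.E ℤ, Nonempty (X.Q.obj K ≅ Y) :=
  ⟨(X.qh.objPreimage Y).as, ⟨X.qh.objObjPreimageIso Y⟩⟩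

instance (m : ℤ) : (X.rightGE m).IsClosedUnderIsomorphisms :=
  ⟨fun e ⟨K, hK, ⟨e'⟩⟩ => ⟨K, hK, ⟨e.symm ≪≫ e'⟩⟩⟩

instance (m : ℤ) : (X.leftLE m).IsClosedUnderIsomorphisms :=
  ⟨fun e ⟨K, hK, ⟨e'⟩⟩ => ⟨K, hK, ⟨e.symm ≪≫ e'⟩⟩⟩

lemma rightGE_Q (m : ℤ) (K : CochainComplex X.E ℤ) [hK : K.IsStrictlyGE m] :
    X.rightGE m (X.Q.obj K) := ⟨K, hK, ⟨Iso.refl _⟩⟩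

lemma leftLE_Q (m : ℤ) (K : CochainComplex X.E ℤ) [hK : K.IsStrictlyLE m] :
    X.leftLE m (X.Q.obj K) := ⟨K, hK, ⟨Iso.refl _⟩⟩

variable (X) in
lemma rightGE_antitone : Antitone X.rightGE := by
  rintro a b hab Y ⟨K, hK, e⟩
  exact ⟨K, K.isStrictlyGE_of_ge a b hab, e⟩

variable (X) in
lemma leftLE_monotone : Monotone X.leftLE := by
  rintro a b hab Y ⟨K, hK, e⟩
  exact ⟨K, K.isStrictlyLE_of_le a b hab, e⟩

variable (X) in
lemma rightGE_shift (n a n' : ℤ) (h : a + n' = n) (Y : X.Derived) (hY : X.rightGE n Y) :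
    X.rightGE n' (Y⟦a⟧) := by
  obtain ⟨K, hK, ⟨e⟩⟩ := hY
  exact ⟨K⟦a⟧, K.isStrictlyGE_shift n a n' h,
    ⟨(shiftFunctor _ a).mapIso e ≪≫ (X.Q.commShiftIso a).symm.app K⟩⟩

variable (X) in
lemma leftLE_shift (n a n' : ℤ) (h : a + n' = n) (Y : X.Derived) (hY : X.leftLE n Y) :
    X.leftLE n' (Y⟦a⟧) := by
  obtain ⟨K, hK, ⟨e⟩⟩ := hY
  exact ⟨K⟦a⟧, K.isStrictlyLE_shift n a n' h,
    ⟨(shiftFunctor _ a).mapIso e ≪≫ (X.Q.commShiftIso a).symm.app K⟩⟩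

lemma hom_eq_zero_of_leftLE_of_rightGE {l m : ℤ} (hlm : l < m) {A B : X.Derived}
    (hA : X.leftLE l A) (hB : X.rightGE m B) (f : A ⟶ B) : f = 0 := by
  obtain ⟨K, hK, ⟨e⟩⟩ := hA
  obtain ⟨L, hL, ⟨e'⟩⟩ := hB
  rw [← cancel_epi e.inv, ← cancel_mono e'.hom, Category.assoc,
    Q_hom_eq_zero hlm (e.inv ≫ f ≫ e'.hom)]
  simp

/-- The third vertex of a triangle whose other vertices belong to `RD^{≥ m + 1}` and `RD^{≥ m}`. -/
lemma rightGE_obj₃ (m : ℤ) (T : Triangle X.Derived) (hT : T ∈ distTriang _)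
    (h₁ : X.rightGE (m + 1) T.obj₁) (h₂ : X.rightGE m T.obj₂) : X.rightGE m T.obj₃ := by
  obtain ⟨K, hK, ⟨e⟩⟩ := h₁
  obtain ⟨L, hL, ⟨e'⟩⟩ := h₂
  -- After `L` is replaced by a quasi-isomorphic `N` vanishing below `m`, the first morphism is a
  -- chain map `f`, and the third vertex is its cone, with terms built from `K.X (k + 1)` and `N.X
  -- k`.
  obtain ⟨N, f, u, hN, hu, h⟩ := exists_left_fraction m (e.inv ≫ T.mor₁ ≫ e'.hom)
  have := isIso_Q_map u hu
  obtain ⟨δ, hδ⟩ := mappingCone_distinguished f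
  let e'' : T.obj₂ ≅ X.Q.obj N := e' ≪≫ asIso (X.Q.map u)
  let i := isoTriangleOfIso₁₂ _ _ hT hδ e e'' (by
    change T.mor₁ ≫ e'.hom ≫ X.Q.map u = e.hom ≫ X.Q.map f
    simp [← h])
  refine ⟨CochainComplex.mappingCone f, ?_, ⟨Triangle.π₃.mapIso i⟩⟩
  rw [CochainComplex.isStrictlyGE_iff]
  intro k hk
  rw [CochainComplex.mappingCone.isZero_X_iff]
  exact ⟨K.isZero_of_isStrictlyGE (m + 1) _, N.isZero_of_isStrictlyGE m _⟩

lemma leftLE_obj₃ (m : ℤ) (T : Triangle X.Derived) (hT : T ∈ distTriang _)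
    (h₁ : X.leftLE (m + 1) T.obj₁) (h₂ : X.leftLE m T.obj₂) : X.leftLE m T.obj₃ := by
  obtain ⟨K, hK, ⟨e⟩⟩ := h₁
  obtain ⟨L, hL, ⟨e'⟩⟩ := h₂
  obtain ⟨N, f, u, hN, hu, h⟩ := exists_right_fraction (m + 1) (e.inv ≫ T.mor₁ ≫ e'.hom)
  have := isIso_Q_map u hu
  obtain ⟨δ, hδ⟩ := mappingCone_distinguished f
  let e'' : T.obj₁ ≅ X.Q.obj N := e ≪≫ (asIso (X.Q.map u)).symm
  let i := isoTriangleOfIso₁₂ _ _ hT hδ e'' e' (by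
    change T.mor₁ ≫ e'.hom = (e.hom ≫ inv (X.Q.map u)) ≫ X.Q.map f
    simp [← h])
  refine ⟨CochainComplex.mappingCone f, ?_, ⟨Triangle.π₃.mapIso i⟩⟩
  rw [CochainComplex.isStrictlyLE_iff]
  intro k hk
  rw [CochainComplex.mappingCone.isZero_X_iff]
  exact ⟨N.isZero_of_isStrictlyLE (m + 1) _, L.isZero_of_isStrictlyLE m _⟩

lemma rightGE_ext₂ (m : ℤ) (T : Triangle X.Derived) (hT : T ∈ distTriang _)
    (h₁ : X.rightGE m T.obj₁) (h₃ : X.rightGE m T.obj₃) : X.rightGE m T.obj₂ :=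
  rightGE_obj₃ m _ (inv_rot_of_distTriang _ hT) (X.rightGE_shift m (-1) (m + 1) (by omega) _ h₃) h₁

lemma leftLE_ext₂ (m : ℤ) (T : Triangle X.Derived) (hT : T ∈ distTriang _)
    (h₁ : X.leftLE m T.obj₁) (h₃ : X.leftLE m T.obj₃) : X.leftLE m T.obj₂ :=
  leftLE_obj₃ m _ (inv_rot_of_distTriang _ hT) (X.leftLE_shift m (-1) (m + 1) (by omega) _ h₃) h₁

/-- In every degree one of the two outer terms is zero, so the sequence splits degreewise. -/
lemma exists_distinguished_of_isIso (S : ShortComplex (CochainComplex X.E ℤ)) (m : ℤ)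
    (h₁ : ∀ i, i < m → IsZero (S.X₁.X i) ∧ IsIso (S.g.f i))
    (h₂ : ∀ i, m ≤ i → IsZero (S.X₃.X i) ∧ IsIso (S.f.f i)) :
    ∃ δ : X.Q.obj S.X₃ ⟶ (X.Q.obj S.X₁)⟦(1 : ℤ)⟧,
      Triangle.mk (X.Q.map S.f) (X.Q.map S.g) δ ∈ distTriang X.Derived := by
  have : ∀ n, Nonempty (S.map (HomologicalComplex.eval X.E (ComplexShape.up ℤ) n)).Splitting := by
    intro n
    by_cases hn : n < m
    · obtain ⟨h0, h1⟩ := h₁ n hn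
      let t : S.X₃.X n ⟶ S.X₂.X n := inv (S.g.f n)
      exact ⟨{ r := (0 : S.X₂.X n ⟶ S.X₁.X n)
               s := t
               f_r := h0.eq_of_src _ _
               s_g := IsIso.inv_hom_id (S.g.f n)
               id := by
                change (0 : S.X₂.X n ⟶ S.X₁.X n) ≫ S.f.f n + S.g.f n ≫ t = 𝟙 _
                simp [t] }⟩
    · obtain ⟨h0, h1⟩ := h₂ n (by omega)
      let t : S.X₂.X n ⟶ S.X₁.X n := inv (S.f.f n)
      exact ⟨{ r := t
               s := (0 : S.X₃.X n ⟶ S.X₂.X n)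
               f_r := IsIso.hom_inv_id (S.f.f n)
               s_g := h0.eq_of_src _ _
               id := by
                change t ≫ S.f.f n + S.g.f n ≫ (0 : S.X₃.X n ⟶ S.X₂.X n) = 𝟙 _
                simp [t] }⟩
  exact distinguished_of_splitting S (fun n => (this n).some)

/-- The fiber of a morphism of complexes `T ⟶ V` which is an isomorphism in degrees `≤ m`, with `V`
vanishing in degrees `> m`. -/
lemma exists_triangle_of_isIso_le {T V : CochainComplex X.E ℤ} (ρ : T ⟶ V) (m : ℤ)
    [V.IsStrictlyLE m] (hρ : ∀ i, i ≤ m → IsIso (ρ.f i)) :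
    ∃ (S : CochainComplex X.E ℤ) (_ : S.IsStrictlyGE (m + 1)) (f : S ⟶ T)
      (δ : X.Q.obj V ⟶ (X.Q.obj S)⟦(1 : ℤ)⟧),
      Triangle.mk (X.Q.map f) (X.Q.map ρ) δ ∈ distTriang X.Derived := by
  -- The fibre is the stupid truncation of `T` in degrees `> m`.
  obtain ⟨S, rfl, h₁, h₃, hf, hg⟩ := exists_stupid_truncations T (m + 1)
  have w' : S.f ≫ ρ = 0 := by
    ext i
    by_cases hi : i ≤ m
    · exact (S.X₁.isZero_of_isStrictlyGE (m + 1) i).eq_of_src _ _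
    · exact (V.isZero_of_isStrictlyLE m i).eq_of_tgt _ _
  obtain ⟨δ, hδ⟩ := exists_distinguished_of_isIso (ShortComplex.mk S.f ρ w') (m + 1)
    (fun i hi => ⟨S.X₁.isZero_of_isStrictlyGE (m + 1) i, hρ i (by omega)⟩)
    (fun i hi => ⟨V.isZero_of_isStrictlyLE m i, hf i hi⟩)
  exact ⟨S.X₁, h₁, S.f, δ, hδ⟩

/-- The cofiber of a morphism of complexes `V ⟶ T` which is an isomorphism in degrees `≥ m`, with
`V` vanishing in degrees `< m`. -/
lemma exists_triangle_of_isIso_ge {T V : CochainComplex X.E ℤ} (ρ : V ⟶ T) (m : ℤ)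
    [V.IsStrictlyGE m] (hρ : ∀ i, m ≤ i → IsIso (ρ.f i)) :
    ∃ (S : CochainComplex X.E ℤ) (_ : S.IsStrictlyLE (m - 1)) (f : T ⟶ S)
      (δ : X.Q.obj S ⟶ (X.Q.obj V)⟦(1 : ℤ)⟧),
      Triangle.mk (X.Q.map ρ) (X.Q.map f) δ ∈ distTriang X.Derived := by
  obtain ⟨S, rfl, h₁, h₃, hf, hg⟩ := exists_stupid_truncations T m
  have w' : ρ ≫ S.g = 0 := by
    ext i
    by_cases hi : i < m
    · exact (V.isZero_of_isStrictlyGE m i).eq_of_src _ _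
    · exact (S.X₃.isZero_of_isStrictlyLE (m - 1) i).eq_of_tgt _ _
  obtain ⟨δ, hδ⟩ := exists_distinguished_of_isIso (ShortComplex.mk ρ S.g w') m
    (fun i hi => ⟨V.isZero_of_isStrictlyGE m i, hg i hi⟩)
    (fun i hi => ⟨S.X₃.isZero_of_isStrictlyLE (m - 1) i, hρ i hi⟩)
  exact ⟨S.X₃, h₃, S.g, δ, hδ⟩

lemma exists_stupid_triangle (K : CochainComplex X.E ℤ) (m : ℤ) :
    ∃ (A B : CochainComplex X.E ℤ) (_ : A.IsStrictlyGE m) (_ : B.IsStrictlyLE (m - 1))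
      (f : A ⟶ K) (g : K ⟶ B) (δ : X.Q.obj B ⟶ (X.Q.obj A)⟦(1 : ℤ)⟧),
      Triangle.mk (X.Q.map f) (X.Q.map g) δ ∈ distTriang X.Derived ∧
      (∀ i, m ≤ i → IsIso (f.f i)) ∧ (∀ i, i < m → IsIso (g.f i)) := by
  obtain ⟨S, rfl, h₁, h₃, hf, hg⟩ := exists_stupid_truncations K m
  obtain ⟨δ, hδ⟩ := exists_distinguished_of_isIso S m
    (fun i hi => ⟨S.X₁.isZero_of_isStrictlyGE m i, hg i hi⟩)
    (fun i hi => ⟨S.X₃.isZero_of_isStrictlyLE (m - 1) i, hf i hi⟩)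
  exact ⟨S.X₁, S.X₃, h₁, h₃, S.f, S.g, δ, hδ, hf, hg⟩

/-- The truncation triangles of the right t-structure. -/
lemma exists_right_truncation (hD : HasDCokernels X.conf) (A : X.Derived) (m : ℤ) :
    ∃ (T : CochainComplex X.E ℤ) (Y : X.Derived) (_ : ∀ j, m ≤ j → IsDCokernel X.conf
        (T.d (j - 1) j) (T.d j (j + 1)) ∧ (HasCokernel (T.d (j - 1) j) → Epi (T.d j (j + 1))))
      (_ : X.rightGE m Y) (f : X.Q.obj T ⟶ A) (g : A ⟶ Y) (h : Y ⟶ (X.Q.obj T)⟦(1 : ℤ)⟧),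
      Triangle.mk f g h ∈ distTriang X.Derived := by
  obtain ⟨K, ⟨e⟩⟩ := Q_obj_surjective A
  obtain ⟨S, V, hS, hV, f₁, g₁, δ₁, h₁, -, hg₁⟩ := exists_stupid_triangle K (m + 1)
  have : V.IsStrictlyLE m := by simpa using hV
  -- `T` extends the part `V` of `K` in degrees `≤ m` by iterated `D`-cokernels. It is therefore
  -- effaceable from degree `m` on and has no nonzero morphism to `RD^{≥ m}`.
  obtain ⟨T, ρ, hρ, hT⟩ := exists_cokernel_tower X.exact hD V m
  obtain ⟨S', hS', f₂, δ₂, h₂⟩ := exists_triangle_of_isIso_le ρ m hρ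
  have hT' : ∀ k, m ≤ k → EffAt X.conf T k := fun k hk =>
    effAt_of_isDCokernel (hT (k - 1) k (k + 1) (by omega) rfl hk).1
  -- The shift of `S` by `1` lies in `RD^{≥ m}`, so `ρ` lifts to a morphism `t` from `T` to `K`.
  have h0 : X.Q.map ρ ≫ δ₁ = 0 := by
    have hZ := X.rightGE_shift (m + 1) 1 m (by omega) _ (rightGE_Q (m + 1) S)
    obtain ⟨Z, hZ, ⟨e'⟩⟩ := hZ
    rw [← cancel_mono e'.hom, Q_hom_eq_zero_of_effAt hT' ((X.Q.map ρ ≫ δ₁) ≫ e'.hom), zero_comp]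
  obtain ⟨t, ht⟩ : ∃ t : X.Q.obj T ⟶ X.Q.obj K, X.Q.map ρ = t ≫ X.Q.map g₁ :=
    Triangle.coyoneda_exact₃ _ h₁ (X.Q.map ρ) h0
  obtain ⟨F, a, b, hF⟩ : ∃ (F : X.Derived) (a : F ⟶ X.Q.obj T) (b : X.Q.obj K ⟶ F⟦(1 : ℤ)⟧),
      Triangle.mk a t b ∈ distTriang X.Derived := distinguished_cocone_triangle₁ t
  -- The octahedron on the factorization of `ρ` through `t` relates the three fibres; it exhibits
  -- the cone of `t` as the cone of a morphism from `S'` to `S`, hence as an object of `RD^{≥ m}`.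
  let o := Triangulated.someOctahedron' ht.symm hF h₁ h₂
  have hF' : X.rightGE m (F⟦(1 : ℤ)⟧) := rightGE_obj₃ m _ (rot_of_distTriang _ o.mem)
    (rightGE_Q (m + 1) S') (X.rightGE_antitone (by omega) _ (rightGE_Q (m + 1) S))
  exact ⟨T, F⟦(1 : ℤ)⟧, fun j hj => hT (j - 1) j (j + 1) (by omega) rfl hj, hF', _, _, _,
    distinguished_of_iso₂ _ (rot_of_distTriang _ hF) e⟩

/-- The truncation triangles of the left t-structure. -/
lemma exists_left_truncation (hD : HasDKernels X.conf) (A : X.Derived) (m : ℤ) :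
    ∃ (T : CochainComplex X.E ℤ) (Y : X.Derived) (_ : ∀ j, j ≤ m → IsDKernel X.conf
        (T.d (j - 1) j) (T.d j (j + 1)) ∧ (HasKernel (T.d j (j + 1)) → Mono (T.d (j - 1) j)))
      (_ : X.leftLE m Y) (f : Y ⟶ A) (g : A ⟶ X.Q.obj T) (h : X.Q.obj T ⟶ Y⟦(1 : ℤ)⟧),
      Triangle.mk f g h ∈ distTriang X.Derived := by
  obtain ⟨K, ⟨e⟩⟩ := Q_obj_surjective A
  obtain ⟨V, S, hV, hS, f₁, g₁, δ₁, h₁, hf₁, -⟩ := exists_stupid_triangle K m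
  obtain ⟨T, ρ, hρ, hT⟩ := exists_kernel_tower X.exact hD V m
  obtain ⟨S', hS', f₂, δ₂, h₂⟩ := exists_triangle_of_isIso_ge ρ m hρ
  have hT' : ∀ k, k ≤ m → CoeffAt X.conf T k := fun k hk =>
    coeffAt_of_isDKernel (hT (k - 1) k (k + 1) (by omega) rfl hk).1
  have h0 : ∀ (φ : (X.Q.obj S)⟦(-1 : ℤ)⟧ ⟶ X.Q.obj T), φ = 0 := by
    intro φ
    have hZ := X.leftLE_shift (m - 1) (-1) m (by omega) _ (leftLE_Q (m - 1) S)
    obtain ⟨Z, hZ, ⟨e'⟩⟩ := hZ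
    rw [← cancel_epi e'.inv, Q_hom_eq_zero_of_coeffAt hT' (e'.inv ≫ φ), comp_zero]
  obtain ⟨t, ht⟩ : ∃ t : X.Q.obj K ⟶ X.Q.obj T, X.Q.map ρ = X.Q.map f₁ ≫ t :=
    Triangle.yoneda_exact₂ _ (inv_rot_of_distTriang _ h₁) (X.Q.map ρ) (h0 _)
  obtain ⟨F, a, b, hF⟩ : ∃ (F : X.Derived) (a : X.Q.obj T ⟶ F) (b : F ⟶ (X.Q.obj K)⟦(1 : ℤ)⟧),
      Triangle.mk t a b ∈ distTriang X.Derived := distinguished_cocone_triangle t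
  let o := Triangulated.someOctahedron ht.symm h₁ hF h₂
  have hF' : X.leftLE (m - 1) F := leftLE_obj₃ (m - 1) _ o.mem
    (X.leftLE_monotone (by omega) _ (leftLE_Q (m - 1) S)) (leftLE_Q (m - 1) S')
  exact ⟨T, F⟦(-1 : ℤ)⟧, fun j hj => hT (j - 1) j (j + 1) (by omega) rfl hj,
    X.leftLE_shift (m - 1) (-1) m (by omega) _ hF', _, _, _,
    distinguished_of_iso₂ _ (inv_rot_of_distTriang _ hF) e⟩

lemma eq_zero_of_effAt {T : CochainComplex X.E ℤ} {m : ℤ} (hT : ∀ k, m ≤ k → EffAt X.conf T k)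
    {Z : X.Derived} (hZ : X.rightGE m Z) (f : X.Q.obj T ⟶ Z) : f = 0 := by
  obtain ⟨K, hK, ⟨e⟩⟩ := hZ
  rw [← cancel_mono e.hom, Q_hom_eq_zero_of_effAt hT (f ≫ e.hom), zero_comp]

lemma eq_zero_of_coeffAt {T : CochainComplex X.E ℤ} {m : ℤ} (hT : ∀ k, k ≤ m → CoeffAt X.conf T k)
    {Z : X.Derived} (hZ : X.leftLE m Z) (f : Z ⟶ X.Q.obj T) : f = 0 := by
  obtain ⟨K, hK, ⟨e⟩⟩ := hZ
  rw [← cancel_epi e.inv, Q_hom_eq_zero_of_coeffAt hT (e.inv ≫ f), comp_zero]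

/-- The right t-structure on the derived category of an exact category. -/
noncomputable def rightT (hD : HasDCokernels X.conf) : TStructure X.Derived :=
  tStructureOfGE X.rightGE X.rightGE_antitone (fun _ => inferInstance) X.rightGE_shift (by
    intro A
    obtain ⟨T, Y, hT, hY, f, g, h, H⟩ := exists_right_truncation hD A 1
    exact ⟨_, Y, fun Z φ hZ => eq_zero_of_effAt
      (fun k hk => effAt_of_isDCokernel (hT k hk).1) hZ φ, hY, f, g, h, H⟩)

/-- The left t-structure on the derived category of an exact category. -/
noncomputable def leftT (hD : HasDKernels X.conf) : TStructure X.Derived :=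
  tStructureOfLE X.leftLE X.leftLE_monotone (fun _ => inferInstance) X.leftLE_shift (by
    intro A
    obtain ⟨T, Y, hT, hY, f, g, h, H⟩ := exists_left_truncation hD A 0
    exact ⟨Y, _, hY, fun Z φ hZ => eq_zero_of_coeffAt
      (fun k hk => coeffAt_of_isDKernel (hT k hk).1) hZ φ, f, g, h, H⟩)

end ExactCat

end NQuasiAbelian

/-! ### Retracts of conflations and of acyclic complexes -/

namespace NQuasiAbelian

section ExactStructures

variable {E : Type w} [Category.{w} E] [Preadditive E] [HasZeroObject E] [HasBinaryBiproducts E]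
  {conf : ObjectProperty (ShortComplex E)}

namespace IsExactStructure

/-- The pullback of a conflation. -/
lemma conf_pullback (h : IsExactStructure conf) {X Y Z Z' P : E} {i : X ⟶ Y} {p : Y ⟶ Z}
    (w' : i ≫ p = 0) (hc : conf (ShortComplex.mk i p w')) {f : Z' ⟶ Z} {f' : P ⟶ Y}
    {p' : P ⟶ Z'} (sq : IsPullback f' p' p f) :
    ∃ (i' : X ⟶ P) (w'' : i' ≫ p' = 0), i' ≫ f' = i ∧ conf (ShortComplex.mk i' p' w'') := by
  obtain ⟨⟨hi⟩, _⟩ := h.pair hc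
  have : Mono i := Fork.IsLimit.mono hi
  have hp' := h.deflation_pullback sq ⟨_, _, _, hc⟩
  refine ⟨sq.lift i 0 (by simp [w']), by simp, by simp, h.conf_of_kernel _ hp' ?_⟩
  have key : ∀ {T : E} (t : T ⟶ P) (_ : t ≫ p' = 0), (t ≫ f') ≫ p = 0 := by
    intro T t ht
    rw [Category.assoc, sq.w, ← Category.assoc, ht, zero_comp]
  refine KernelFork.IsLimit.ofι _ _
    (fun t ht => hi.lift (KernelFork.ofι (t ≫ f') (key t ht))) ?_ ?_
  · intro T t ht
    apply sq.hom_ext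
    · simpa using hi.fac (KernelFork.ofι (t ≫ f') (key t ht)) .zero
    · simp [ht]
  · intro T t ht m hm
    rw [← cancel_mono i]
    have h1 := hi.fac (KernelFork.ofι (t ≫ f') (key t ht)) .zero
    dsimp at h1
    rw [h1, ← hm]
    simp

/-- A retract of a conflation is a conflation. -/
lemma conf_of_retract (h : IsExactStructure conf) {S S' : ShortComplex E} (i : S ⟶ S') (r : S' ⟶ S)
    (hir : i ≫ r = 𝟙 S) (hS' : conf S') : conf S := by
  have h₁ : i.τ₁ ≫ r.τ₁ = 𝟙 _ := by rw [← ShortComplex.comp_τ₁, hir]; rfl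
  have h₂ : i.τ₂ ≫ r.τ₂ = 𝟙 _ := by rw [← ShortComplex.comp_τ₂, hir]; rfl
  have h₃ : i.τ₃ ≫ r.τ₃ = 𝟙 _ := by rw [← ShortComplex.comp_τ₃, hir]; rfl
  obtain ⟨⟨hf'⟩, ⟨hg'⟩⟩ := h.pair hS'
  -- `S.g` is a cokernel of `S.f`
  have hg : ∀ {T : E} (t : S.X₂ ⟶ T), S.f ≫ t = 0 → ∃ l : S.X₃ ⟶ T, S.g ≫ l = t := by
    intro T t ht
    obtain ⟨l, hl⟩ := CokernelCofork.IsColimit.desc' hg' (r.τ₂ ≫ t) (by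
      rw [← r.comm₁₂_assoc, ht, comp_zero])
    dsimp at hl
    exact ⟨i.τ₃ ≫ l, by rw [← i.comm₂₃_assoc, hl, reassoc_of% h₂]⟩
  -- Pushing `S'` out along `r.τ₁` and pulling the result back along `i.τ₃` gives a conflation with
  -- the outer terms of `S`. Its middle term `R` is compared with `S.X₂` by `u` and `v`.
  obtain ⟨P, a, f', sq, hf''⟩ := h.pushout r.τ₁ ⟨_, _, _, hS'⟩
  obtain ⟨q, z, hq, hP⟩ := h.conf_pushout S'.zero hS' sq
  obtain ⟨R, b, g', sq', -⟩ := h.pullback i.τ₃ ⟨_, _, _, hP⟩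
  obtain ⟨f'', z', hf₂, hR⟩ := h.conf_pullback z hP sq'
  let u : S.X₂ ⟶ R := sq'.lift (i.τ₂ ≫ a) S.g (by simp [hq, i.comm₂₃])
  let v : R ⟶ S.X₂ := b ≫ sq.desc r.τ₂ S.f r.comm₁₂.symm
  have hu₁ : S.f ≫ u = f'' := by
    apply sq'.hom_ext
    · simp only [u, Category.assoc, sq'.lift_fst, hf₂]
      rw [← i.comm₁₂_assoc, sq.w, reassoc_of% h₁]
    · simp [u, z']
  have hu₂ : u ≫ g' = S.g := by simp [u]
  have hv₁ : f'' ≫ v = S.f := by simp [v, reassoc_of% hf₂]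
  have hv₂ : v ≫ S.g = g' := by
    have : sq.desc r.τ₂ S.f r.comm₁₂.symm ≫ S.g = q ≫ r.τ₃ := by
      apply sq.hom_ext
      · simp [reassoc_of% hq, r.comm₂₃]
      · simp [reassoc_of% z]
    rw [Category.assoc, this, reassoc_of% sq'.w, h₃, Category.comp_id]
  obtain ⟨_, ⟨hgR⟩⟩ := h.pair hR
  -- An endomorphism `c` of the middle term that is the identity on both ends satisfies `(𝟙 _ - c) ≫
  -- (𝟙 _ - c) = 0`, because `𝟙 _ - c` factors through `g` and its composite with `g` vanishes. The
  -- inverse of `c` is therefore `𝟙 _ + 𝟙 _ - c`.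
  have key : ∀ {A B C : E} {f : A ⟶ B} {g : B ⟶ C} (_ : f ≫ g = 0)
      (_ : ∀ (t : B ⟶ B), f ≫ t = 0 → ∃ l, g ≫ l = t) (c : B ⟶ B)
      (_ : f ≫ c = f) (_ : c ≫ g = g), IsIso c := by
    intro A B C f g hfg hl c hc hc'
    obtain ⟨l, hl⟩ := hl (𝟙 _ - c) (by simp [hc])
    have : (𝟙 _ - c) ≫ (𝟙 _ - c) = 0 := by
      calc (𝟙 _ - c) ≫ (𝟙 _ - c) = (𝟙 _ - c) ≫ g ≫ l := by rw [hl]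
        _ = 0 := by
          rw [← Category.assoc, Preadditive.sub_comp, hc', Category.id_comp, sub_self, zero_comp]
    have h2 : c ≫ c = c + c - 𝟙 _ := by
      simp only [Preadditive.comp_sub, Preadditive.sub_comp, Category.id_comp,
        Category.comp_id] at this
      rw [← sub_eq_zero, ← this]
      abel
    exact ⟨𝟙 _ + 𝟙 _ - c, by simp [h2], by simp [h2]⟩
  have i₁ : IsIso (u ≫ v) := key S.zero (fun t ht => hg t ht) (u ≫ v)
    (by rw [reassoc_of% hu₁, hv₁]) (by rw [Category.assoc, hv₂, hu₂])
  have i₂ : IsIso (v ≫ u) := key z' (fun t ht => ⟨_, (CokernelCofork.IsColimit.desc' hgR t ht).2⟩)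
    (v ≫ u) (by rw [reassoc_of% hv₁, hu₁]) (by rw [Category.assoc, hu₂, hv₂])
  have : IsIso v := by
    have : IsSplitEpi v := ⟨⟨⟨inv (u ≫ v) ≫ u, by simp⟩⟩⟩
    have : Mono v := mono_of_mono v u
    exact isIso_of_mono_of_isSplitEpi v
  let e : R ≅ S.X₂ := asIso v
  have ee : ShortComplex.mk f'' g' z' ≅ S := by
    refine ShortComplex.isoMk (Iso.refl _) e (Iso.refl _) ?_ ?_
    on_goal 1 => change 𝟙 _ ≫ S.f = f'' ≫ v
    on_goal 2 => change v ≫ S.g = g' ≫ 𝟙 _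
    · rw [hv₁, Category.id_comp]
    · rw [hv₂, Category.comp_id]
  exact h.of_iso ee hR

lemma conf_biprod (h : IsExactStructure conf) {S S' : ShortComplex E} (hS : conf S)
    (hS' : conf S') :
    ∃ z : biprod.map S.f S'.f ≫ biprod.map S.g S'.g = 0,
      conf (ShortComplex.mk (biprod.map S.f S'.f) (biprod.map S.g S'.g) z) := by
  have z : biprod.map S.f S'.f ≫ biprod.map S.g S'.g = 0 := by ext <;> simp
  obtain ⟨_, ⟨hg⟩⟩ := h.pair hS
  obtain ⟨_, ⟨hg'⟩⟩ := h.pair hS'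
  have e₁ : Epi S.g := Cofork.IsColimit.epi hg
  have e₂ : Epi S'.g := Cofork.IsColimit.epi hg'
  refine ⟨z, h.conf_of_cokernel _ ?_ ?_⟩
  · have h₁ := h.inflation_map_id S'.X₁ ⟨_, _, _, hS⟩
    have h₂ := h.inflation_map_id S.X₂ ⟨_, _, _, hS'⟩
    have h₃ := h.inflation_comp (h.inflation_iso (biprod.braiding _ _) h₁)
      (h.inflation_iso (biprod.braiding _ _) h₂)
    convert h₃ using 1
    ext <;> simp
  · have ex : ∀ {T : E} (t : S.X₂ ⊞ S'.X₂ ⟶ T) (_ : biprod.map S.f S'.f ≫ t = 0),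
        ∃ l, biprod.map S.g S'.g ≫ l = t := by
      intro T t ht
      obtain ⟨l, hl⟩ := CokernelCofork.IsColimit.desc' hg (biprod.inl ≫ t) (by
        simpa using congr_arg (fun s => biprod.inl ≫ s) ht)
      obtain ⟨l', hl'⟩ := CokernelCofork.IsColimit.desc' hg' (biprod.inr ≫ t) (by
        simpa using congr_arg (fun s => biprod.inr ≫ s) ht)
      dsimp at hl hl'
      exact ⟨biprod.desc l l', by ext <;> simp [hl, hl']⟩
    exact CokernelCofork.IsColimit.ofπ _ _ (fun t ht => (ex t ht).choose)
      (fun t ht => (ex t ht).choose_spec)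
      (fun t ht m hm => by rw [← cancel_epi (biprod.map S.g S'.g), hm, (ex t ht).choose_spec])

end IsExactStructure

end ExactStructures

section Acyclic

variable {E : Type w} [Category.{w} E] [Preadditive E] [HasZeroObject E] [HasBinaryBiproducts E]
  {conf : ObjectProperty (ShortComplex E)}

/-- The pushout criterion with identities for all `ι` and `π`. -/
lemma isAcyclic_mappingCone_id (h : IsExactStructure conf) (K : CochainComplex E ℤ) :
    IsAcyclic conf (CochainComplex.mappingCone (𝟙 K)) :=
  isAcyclic_mappingCone_of_isPushout h (𝟙 K) (P := K.X) (ι := fun _ => 𝟙 _) (b := fun _ => K.d _ _)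
    (π := fun _ => 𝟙 _) (a := fun _ => K.d _ _) (by simp) (by simp) (by simp) (by simp)
    (fun k => IsPushout.of_horiz_isIso ⟨by simp⟩) (fun _ => h.inflation_id _)

/-- A retract of an acyclic complex is acyclic. -/
lemma IsAcyclic.of_retract [IsIdempotentComplete E] (h : IsExactStructure conf)
    {K A : CochainComplex E ℤ} (s : K ⟶ A) (r : A ⟶ K) (hsr : s ≫ r = 𝟙 K)
    (hA : IsAcyclic conf A) : IsAcyclic conf K := by
  obtain ⟨D, e, m, hd, hc⟩ := hA
  have hsr' : ∀ n, s.f n ≫ r.f n = 𝟙 _ := fun n => by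
    rw [← HomologicalComplex.comp_f, hsr]; rfl
  have he : ∀ n, Epi (e n) := fun n =>
    h.epi_of_deflation ⟨_, _, _, (hc (n - 1) n (by omega)).2⟩
  have hm : ∀ i j hij, Mono (m i j hij) := fun i j hij =>
    h.mono_of_inflation ⟨_, _, _, (hc i j hij).2⟩
  -- The idempotent `r ≫ s` of `A` descends to idempotents of the objects `D n`. These split, and
  -- the sequences for `K` become retracts of the conflations of `A`.
  have hp : ∀ n, ∃ p : D n ⟶ D n, e n ≫ p = r.f n ≫ s.f n ≫ e n := by
    intro n
    obtain ⟨z, hz⟩ := hc (n - 1) n (by omega)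
    obtain ⟨_, ⟨hg⟩⟩ := h.pair hz
    obtain ⟨l, hl⟩ := CokernelCofork.IsColimit.desc' hg (r.f n ≫ s.f n ≫ e n) (by
      have := he (n - 1)
      dsimp
      rw [← cancel_epi (e (n - 1)), reassoc_of% (hd (n - 1) n), ← r.comm_assoc,
        ← s.comm_assoc, ← hd (n - 1) n (by omega), Category.assoc, z]
      simp)
    exact ⟨l, hl⟩
  choose p hp using hp
  have hp' : ∀ i j hij, p i ≫ m i j hij = m i j hij ≫ r.f j ≫ s.f j := by
    intro i j hij
    have := he i
    rw [← cancel_epi (e i), reassoc_of% (hp i), hd, reassoc_of% (hd i j hij), ← r.comm_assoc,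
      ← s.comm]
  have hpp : ∀ n, p n ≫ p n = p n := by
    intro n
    have := he n
    rw [← cancel_epi (e n), reassoc_of% (hp n), hp, reassoc_of% (hsr' n)]
  choose F i q hiq hqi using fun n => IsIdempotentComplete.idempotents_split (D n) (p n) (hpp n)
  refine ⟨F, fun n => s.f n ≫ e n ≫ q n, fun a b hab => i a ≫ m a b hab ≫ r.f b, ?_, ?_⟩
  · intro a b hab
    simp only [Category.assoc]
    rw [reassoc_of% (hqi a), reassoc_of% (hp' a b hab), hsr', Category.comp_id,
      reassoc_of% (hd a b hab), s.comm_assoc, hsr', Category.comp_id]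
  · intro a b hab
    obtain ⟨z, hz⟩ := hc a b hab
    have key : m a b hab ≫ r.f b ≫ s.f b ≫ e b = 0 := by
      rw [← reassoc_of% (hp' a b hab), z, comp_zero]
    have z' : (i a ≫ m a b hab ≫ r.f b) ≫ s.f b ≫ e b ≫ q b = 0 := by
      simp only [Category.assoc]
      rw [reassoc_of% key, zero_comp, comp_zero]
    refine ⟨z', h.conf_of_retract (S' := ShortComplex.mk (m a b hab) (e b) z)
      { τ₁ := i a, τ₂ := s.f b, τ₃ := i b, comm₁₂ := ?_, comm₂₃ := ?_ }
      { τ₁ := q a, τ₂ := r.f b, τ₃ := q b, comm₁₂ := ?_, comm₂₃ := ?_ } ?_ hz⟩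
    · change i a ≫ m a b hab = (i a ≫ m a b hab ≫ r.f b) ≫ s.f b
      rw [Category.assoc, Category.assoc, ← hp', ← hqi, Category.assoc, reassoc_of% (hiq a)]
    · change s.f b ≫ e b = (s.f b ≫ e b ≫ q b) ≫ i b
      rw [Category.assoc, Category.assoc, hqi, hp, reassoc_of% (hsr' b)]
    · change q a ≫ (i a ≫ m a b hab ≫ r.f b) = m a b hab ≫ r.f b
      rw [reassoc_of% (hqi a), reassoc_of% (hp' a b hab), hsr', Category.comp_id]
    · change r.f b ≫ s.f b ≫ e b ≫ q b = e b ≫ q b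
      rw [← reassoc_of% (hp b), ← hqi, Category.assoc, hiq, Category.comp_id]
    · ext
      · exact hiq a
      · exact hsr' b
      · exact hiq b

/-- A complex which is a retract of a sum of two acyclic complexes is acyclic. -/
lemma IsAcyclic.of_retract_add [IsIdempotentComplete E] (h : IsExactStructure conf)
    {K A B : CochainComplex E ℤ} (s : K ⟶ A) (r : A ⟶ K) (s' : K ⟶ B) (r' : B ⟶ K)
    (hsr : s ≫ r + s' ≫ r' = 𝟙 K) (hA : IsAcyclic conf A) (hB : IsAcyclic conf B) :
    IsAcyclic conf K := by
  let M : CochainComplex E ℤ :=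
    { X := fun n => A.X n ⊞ B.X n
      d := fun i j => biprod.map (A.d i j) (B.d i j)
      shape := fun i j hij => by ext <;> simp [A.shape _ _ hij, B.shape _ _ hij]
      d_comp_d' := fun i j k _ _ => by ext <;> simp }
  refine IsAcyclic.of_retract h (A := M)
    { f := fun n => biprod.lift (s.f n) (s'.f n)
      comm' := fun i j _ => by ext <;> simp [M] }
    { f := fun n => biprod.desc (r.f n) (r'.f n)
      comm' := fun i j _ => by ext <;> simp [M] } ?_ ?_
  · ext n
    have := congr_arg (fun t => t.f n) hsr
    simpa using this
  · obtain ⟨D, e, m, hd, hc⟩ := hA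
    obtain ⟨D', e', m', hd', hc'⟩ := hB
    refine ⟨fun n => D n ⊞ D' n, fun n => biprod.map (e n) (e' n),
      fun i j hij => biprod.map (m i j hij) (m' i j hij), fun i j hij => ?_, fun i j hij => ?_⟩
    · ext <;> simp [M, reassoc_of% (hd i j hij), reassoc_of% (hd' i j hij)]
    · exact h.conf_biprod (hc i j hij).2 (hc' i j hij).2

open CochainComplex HomComplex in
/-- A homotopy retract of an acyclic complex is acyclic. -/
lemma IsAcyclic.of_homotopy [IsIdempotentComplete E] (h : IsExactStructure conf)
    {K A : CochainComplex E ℤ} (s : K ⟶ A) (r : A ⟶ K) (H : Homotopy (s ≫ r) (𝟙 K))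
    (hA : IsAcyclic conf A) : IsAcyclic conf K := by
  -- Being null homotopic, `𝟙 K - s ≫ r` factors through the cone of `𝟙 K`, so `K` is an honest
  -- retract of the sum of `A` and this acyclic cone.
  have H' : Homotopy (𝟙 K - s ≫ r) 0 := (Homotopy.equivSubZero H.symm)
  obtain ⟨z, hz⟩ := Cochain.equivHomotopy _ _ H'
  refine IsAcyclic.of_retract_add h s r (mappingCone.inr (𝟙 K))
    (mappingCone.desc (𝟙 K) z (𝟙 K - s ≫ r) ?_) ?_ hA (isAcyclic_mappingCone_id h K)
  · rw [Category.id_comp, hz]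
    simp
  · simp

end Acyclic

namespace ExactCat

variable {X : ExactCat.{w}}

/-- If the identity of `K` dies in the quotient, it factors up to homotopy through an acyclic
complex. The closure of acyclic complexes under homotopy retracts, which rests on idempotent
completeness, does the rest. -/
lemma isAcyclic_of_isZero {K : CochainComplex X.E ℤ} (hK : IsZero (X.Q.obj K)) :
    IsAcyclic X.conf K := by
  have h0 : X.qh.map (𝟙 (X.ho.obj K)) = X.qh.map 0 := hK.eq_of_src _ _
  obtain ⟨Y, s, hs, h⟩ := (MorphismProperty.map_eq_iff_postcomp X.qh
    (acyclicComplexes X.conf).trW _ _).1 h0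
  obtain ⟨W, a, b, hT, hW⟩ := ((acyclicComplexes X.conf).trW_iff' _).1 hs
  obtain ⟨c, hc⟩ : ∃ c : X.ho.obj K ⟶ W, 𝟙 _ = c ≫ a :=
    Pretriangulated.Triangle.coyoneda_exact₂ _ hT _ (h.trans zero_comp)
  obtain ⟨c', rfl⟩ := X.ho.map_surjective (Y := W.as) c
  obtain ⟨a', rfl⟩ := X.ho.map_surjective (X := W.as) a
  refine IsAcyclic.of_homotopy X.exact c' a' (HomotopyCategory.homotopyOfEq _ _ ?_) hW
  rw [Functor.map_comp, CategoryTheory.Functor.map_id]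
  exact hc.symm

lemma isAcyclic_mappingCone {K L : CochainComplex X.E ℤ} (f : K ⟶ L) [IsIso (X.Q.map f)] :
    IsAcyclic X.conf (CochainComplex.mappingCone f) := by
  obtain ⟨δ, hδ⟩ := mappingCone_distinguished f
  exact isAcyclic_of_isZero
    ((Pretriangulated.Triangle.isZero₃_iff_isIso₁ _ hδ).2 (by assumption))

end ExactCat

end NQuasiAbelian

/-! ### The embedding of `E` into its derived category -/

namespace NQuasiAbelian

open Pretriangulated CochainComplex

section

variable {E : Type w} [Category.{w} E] [Preadditive E] [HasZeroObject E] [HasBinaryBiproducts E]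
  {conf : ObjectProperty (ShortComplex E)}

/-- A quasi-isomorphism from a complex vanishing in positive degrees to a complex vanishing in
negative degrees factors in degree `0` as a deflation followed by an inflation. -/
lemma exists_factorization (h : IsExactStructure conf) {K N : CochainComplex E ℤ} (f : K ⟶ N)
    [K.IsStrictlyLE 0] [N.IsStrictlyGE 0] (hf : IsAcyclic conf (mappingCone f)) :
    ∃ (D : E) (p : K.X 0 ⟶ D) (i : D ⟶ N.X 0), IsDeflation conf p ∧ IsInflation conf i ∧
      p ≫ i = f.f 0 ∧ (∀ j, K.d j 0 ≫ p = 0) ∧ (∀ j, i ≫ N.d 0 j = 0) ∧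
      (∀ ⦃T : E⦄ (t : T ⟶ N.X 0), t ≫ N.d 0 1 = 0 → ∃ l, l ≫ i = t) ∧
      (∀ ⦃T : E⦄ (t : K.X 0 ⟶ T), K.d (-1) 0 ≫ t = 0 → ∃ l, p ≫ l = t) := by
  obtain ⟨D, e, m, hd, hc⟩ := hf
  have hK : IsZero (K.X 1) := K.isZero_of_isStrictlyLE 0 1
  have hN : IsZero (N.X (-1)) := N.isZero_of_isStrictlyGE 0 (-1)
  obtain ⟨z₁, c₁⟩ := hc (-2) (-1) (by omega)
  obtain ⟨z₂, c₂⟩ := hc (-1) 0 (by omega)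
  obtain ⟨z₃, c₃⟩ := hc 0 1 (by omega)
  obtain ⟨z₄, c₄⟩ := hc (-3) (-2) (by omega)
  have m₃ : Mono (m 0 1 (by omega)) := h.mono_of_inflation ⟨_, _, _, c₃⟩
  have e₁ : Epi (e (-2)) := h.epi_of_deflation ⟨_, _, _, c₄⟩
  obtain ⟨⟨hm⟩, _⟩ := h.pair c₂
  obtain ⟨_, ⟨he⟩⟩ := h.pair c₁
  -- As `N.X (-1)` and `K.X 1` vanish, the cone is `K.X 0` in degree `-1` and `N.X 0` in degree `0`,
  -- with `f.f 0` as the differential between them. The factorization sought is the one through `D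
  -- (-1)`.
  let ε : K.X 0 ≅ (mappingCone f).X (-1) :=
    { hom := (mappingCone.inl f).v 0 (-1) (by omega)
      inv := (mappingCone.fst f).1.v (-1) 0 (by omega)
      hom_inv_id := by simp
      inv_hom_id := by
        rw [mappingCone.ext_from_iff f 0 (-1) (by omega)]
        exact ⟨by simp, hN.eq_of_src _ _⟩ }
  let ε' : (mappingCone f).X 0 ≅ N.X 0 :=
    { hom := (mappingCone.snd f).v 0 0 (add_zero 0)
      inv := (mappingCone.inr f).f 0
      inv_hom_id := by simp
      hom_inv_id := by
        rw [mappingCone.ext_from_iff f 1 0 (by omega)]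
        exact ⟨hK.eq_of_src _ _, by simp⟩ }
  have hpi : (ε.hom ≫ e (-1)) ≫ m (-1) 0 (by omega) ≫ ε'.hom = f.f 0 := by
    simp only [Category.assoc, reassoc_of% (hd (-1) 0 (by omega)), ε, ε']
    rw [mappingCone.inl_v_d_assoc f 0 (-1) 1 (by omega) (by omega)]
    simp
  have hmd : m (-1) 0 (by omega) ≫ (mappingCone f).d 0 1 = 0 := by
    rw [← hd 0 1 (by omega), reassoc_of% z₂, zero_comp]
  have hi : ∀ j, (m (-1) 0 (by omega) ≫ ε'.hom) ≫ N.d 0 j = 0 := by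
    intro j
    by_cases hj : 0 + 1 = j
    · obtain rfl : j = 1 := by omega
      have h₁ : (mappingCone.snd f).v 0 0 (add_zero 0) ≫ N.d 0 1 =
          (mappingCone f).d 0 1 ≫ (mappingCone.snd f).v 1 1 (add_zero 1) := by
        rw [mappingCone.d_snd_v f 0 1 (by omega),
          hK.eq_of_tgt ((mappingCone.fst f).1.v 0 1 (by omega)) 0]
        simp
      rw [Category.assoc, h₁, reassoc_of% hmd, zero_comp]
    · rw [N.shape _ _ hj, comp_zero]
  have hp : ∀ j, K.d j 0 ≫ (ε.hom ≫ e (-1)) = 0 := by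
    intro j
    by_cases hj : j + 1 = 0
    · obtain rfl : j = -1 := by omega
      have h₁ : K.d (-1) 0 ≫ ε.hom = - (mappingCone.inl f).v (-1) (-2) (by omega) ≫
          (mappingCone f).d (-2) (-1) := by
        rw [mappingCone.inl_v_d f (-1) (-2) 0 (by omega) (by omega),
          hN.eq_of_tgt (f.f (-1)) 0]
        simp [ε]
      rw [reassoc_of% h₁, Preadditive.neg_comp, ← hd (-2) (-1) (by omega), Category.assoc,
        Category.assoc, z₁]
      simp
    · rw [K.shape _ _ hj, zero_comp]
  refine ⟨D (-1), ε.hom ≫ e (-1), m (-1) 0 (by omega) ≫ ε'.hom, h.deflation_iso _ ⟨_, _, _, c₁⟩,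
    h.inflation_iso _ ⟨_, _, _, c₂⟩, hpi, hp, hi, fun T t ht => ?_, fun T t ht => ?_⟩
  · obtain ⟨l, hl⟩ := KernelFork.IsLimit.lift' hm (t ≫ ε'.inv) (by
      dsimp
      rw [← cancel_mono (m 0 1 (zero_add 1)), Category.assoc, Category.assoc, hd]
      simp [ε', reassoc_of% ht])
    dsimp at hl
    exact ⟨l, by rw [reassoc_of% hl]; simp⟩
  · obtain ⟨l, hl⟩ := CokernelCofork.IsColimit.desc' he (ε.inv ≫ t) (by
      dsimp
      rw [← cancel_epi (e (-2)), reassoc_of% (hd (-2) (-1) (by omega))]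
      simp only [ε]
      rw [mappingCone.d_fst_v_assoc f (-2) (-1) 0 (by omega) (by omega)]
      simp [ht])
    dsimp at hl
    exact ⟨l, by rw [Category.assoc, hl]; simp⟩

/-- The cone of a conflation in degree `0` is effaceable. -/
lemma effAt_of_conf (h : IsExactStructure conf) {A B C : CochainComplex E ℤ} (φ : A ⟶ B) (ψ : B ⟶ C)
    [A.IsStrictlyLE 0] [A.IsStrictlyGE 0] [B.IsStrictlyLE 0] [B.IsStrictlyGE 0]
    [C.IsStrictlyLE 0] [C.IsStrictlyGE 0] (w' : φ ≫ ψ = 0) (zero : φ.f 0 ≫ ψ.f 0 = 0)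
    (hc : conf (ShortComplex.mk (φ.f 0) (ψ.f 0) zero)) (k : ℤ) :
    EffAt conf (mappingCone (mappingCone.desc φ 0 ψ (by simp [w']))) k := by
  set q := mappingCone.desc φ 0 ψ (by simp [w']) with hq
  have hA : ∀ i, i ≠ 0 → IsZero (A.X i) := fun i hi => by
    rcases lt_or_gt_of_ne hi with hi | hi
    · exact A.isZero_of_isStrictlyGE 0 i
    · exact A.isZero_of_isStrictlyLE 0 i
  have hB : ∀ i, i ≠ 0 → IsZero (B.X i) := fun i hi => by
    rcases lt_or_gt_of_ne hi with hi | hi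
    · exact B.isZero_of_isStrictlyGE 0 i
    · exact B.isZero_of_isStrictlyLE 0 i
  have hC : ∀ i, i ≠ 0 → IsZero (C.X i) := fun i hi => by
    rcases lt_or_gt_of_ne hi with hi | hi
    · exact C.isZero_of_isStrictlyGE 0 i
    · exact C.isZero_of_isStrictlyLE 0 i
  obtain ⟨_, ⟨hg⟩⟩ := h.pair hc
  have epi : Epi (ψ.f 0) := Cofork.IsColimit.epi hg
  -- the differentials
  have d₂ : (mappingCone.inl φ).v 0 (-1) (by omega) ≫ (mappingCone.inl q).v (-1) (-2) (by omega) ≫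
      (mappingCone q).d (-2) (-1) =
      -φ.f 0 ≫ (mappingCone.inr φ).f 0 ≫ (mappingCone.inl q).v 0 (-1) (by omega) := by
    rw [mappingCone.inl_v_d q (-1) (-2) 0 (by omega) (by omega), Preadditive.comp_sub,
      mappingCone.inl_v_d_assoc φ 0 (-1) 1 (by omega) (by omega),
      (hA 1 (by omega)).eq_of_tgt (A.d 0 1) 0]
    simp [hq]
  have d₁ : (mappingCone.inr φ).f 0 ≫ (mappingCone.inl q).v 0 (-1) (by omega) ≫
      (mappingCone q).d (-1) 0 = ψ.f 0 ≫ (mappingCone.inr q).f 0 := by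
    rw [mappingCone.inl_v_d q 0 (-1) 1 (by omega) (by omega), Preadditive.comp_sub,
      mappingCone.inr_f_d_assoc, (hB 1 (by omega)).eq_of_tgt (B.d 0 1) 0]
    simp [hq]
  -- The cone has the terms of `A`, `B`, `C` in degrees `-2`, `-1`, `0`. Effacement uses in degree
  -- `0` that `ψ.f 0` is an epimorphism, in degree `-1` that it is a cokernel, and in degree `-2`
  -- the pushout of the inflation `φ.f 0`.
  intro Y r hr
  by_cases h₀ : k = 0
  · subst h₀
    refine ⟨Y, 𝟙 Y, 0, h.inflation_id Y, ?_⟩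
    rw [Category.comp_id, comp_zero, mappingCone.ext_from_iff q 1 0 (by omega),
      mappingCone.ext_from_iff φ 2 1 (by omega)]
    refine ⟨⟨(hA 2 (by omega)).eq_of_src _ _, (hB 1 (by omega)).eq_of_src _ _⟩, ?_⟩
    rw [← cancel_epi (ψ.f 0), ← reassoc_of% d₁, hr]
    simp
  by_cases h₁ : k = -1
  · subst h₁
    obtain ⟨t, ht⟩ := CokernelCofork.IsColimit.desc' hg ((mappingCone.inr φ).f 0 ≫
      (mappingCone.inl q).v 0 (-1) (by omega) ≫ r) (by
        have := congr_arg (fun s => s ≫ r) d₂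
        simp only [Category.assoc, hr, Preadditive.neg_comp, comp_zero] at this
        dsimp
        rw [← neg_eq_zero, ← this])
    dsimp at ht
    refine ⟨Y, 𝟙 Y, (mappingCone.snd q).v 0 0 (add_zero 0) ≫ t, h.inflation_id Y, ?_⟩
    rw [Category.comp_id, mappingCone.ext_from_iff q 0 (-1) (by omega),
      mappingCone.ext_from_iff φ 1 0 (by omega)]
    refine ⟨⟨(hA 1 (by omega)).eq_of_src _ _, ?_⟩, (hC (-1) (by omega)).eq_of_src _ _⟩
    change _ = (mappingCone.inr φ).f 0 ≫ (mappingCone.inl q).v 0 (-1) (by omega) ≫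
      (mappingCone q).d (-1) 0 ≫ _
    rw [reassoc_of% d₁, ← ht]
    simp
  by_cases h₂ : k = -2
  · subst h₂
    obtain ⟨N, s, π, sq, hπ⟩ := h.pushout ((mappingCone.inl φ).v 0 (-1) (by omega) ≫
      (mappingCone.inl q).v (-1) (-2) (by omega) ≫ r) ⟨_, _, _, hc⟩
    refine ⟨N, π, -((mappingCone.fst q).1.v (-1) 0 (by omega) ≫
      (mappingCone.snd φ).v 0 0 (add_zero 0) ≫ s), hπ, ?_⟩
    rw [mappingCone.ext_from_iff q (-1) (-2) (by omega),
      mappingCone.ext_from_iff φ 0 (-1) (by omega)]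
    refine ⟨⟨?_, (hB (-1) (by omega)).eq_of_src _ _⟩, (hC (-2) (by omega)).eq_of_src _ _⟩
    change _ = (mappingCone.inl φ).v 0 (-1) (by omega) ≫
      (mappingCone.inl q).v (-1) (-2) (by omega) ≫ (mappingCone q).d (-2) (-1) ≫ _
    rw [reassoc_of% d₂]
    have := sq.w
    simp only [Category.assoc] at this
    simp [← this]
  · exact effAt_of_isZero h (by
      rw [mappingCone.isZero_X_iff, mappingCone.isZero_X_iff]
      exact ⟨⟨hA _ (by omega), hB _ (by omega)⟩, hC _ h₀⟩) r hr

end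

namespace ExactCat

variable {X : ExactCat.{w}}

/-- The identity of `K` is itself a morphism from an effaceable complex to one that vanishes below
`m`. -/
lemma isZero_of_effAt {K : CochainComplex X.E ℤ} (m : ℤ) [K.IsStrictlyGE m]
    (hK : ∀ k, EffAt X.conf K k) : IsZero (X.Q.obj K) := by
  rw [IsZero.iff_id_eq_zero]
  exact Q_hom_eq_zero_of_effAt (m := m) (fun k _ => hK k) _

lemma single_map_f_zero {A B : X.E} (g : A ⟶ B) :
    ((CochainComplex.singleFunctor X.E 0).map g).f 0 =
      (HomologicalComplex.singleObjXSelf (ComplexShape.up ℤ) 0 A).hom ≫ g ≫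
        (HomologicalComplex.singleObjXSelf (ComplexShape.up ℤ) 0 B).inv :=
  HomologicalComplex.single_map_f_self ..

/-- Let `u : B' ⟶ N` be the denominator of a fraction. The vanishing of `B'` in degree `-1` makes
the deflation `p` invertible, so `B` is identified with the kernel of `N.d 0 1`, and the numerator
factors through this kernel. -/
instance : X.toDerived.Full where
  map_surjective {A B} α := by
    let A' := (CochainComplex.singleFunctor X.E 0).obj A
    let B' := (CochainComplex.singleFunctor X.E 0).obj B
    obtain ⟨N, f, u, hN, hu, h⟩ := exists_left_fraction (X := X) (K := A') (Z := B') 0 α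
    obtain ⟨D, p, i, hp, hi, hpi, -, -, h₁, h₂⟩ := exists_factorization X.exact u hu
    obtain ⟨l, hl⟩ := h₁ (f.f 0) (by
      rw [f.comm, (A'.isZero_of_isStrictlyLE 0 1).eq_of_tgt (A'.d 0 1) 0, zero_comp])
    obtain ⟨l', hl'⟩ := h₂ (𝟙 _) (by
      rw [(B'.isZero_of_isStrictlyGE 0 (-1)).eq_of_src (B'.d (-1) 0) 0, zero_comp])
    have := X.exact.epi_of_deflation hp
    have hl'' : l' ≫ p = 𝟙 _ := by rw [← cancel_epi p, reassoc_of% hl', Category.comp_id]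
    let eA : A'.X 0 ≅ A := HomologicalComplex.singleObjXSelf _ 0 A
    let eB : B'.X 0 ≅ B := HomologicalComplex.singleObjXSelf _ 0 B
    refine ⟨eA.inv ≫ l ≫ l' ≫ eB.hom, ?_⟩
    have := isIso_Q_map u hu
    have key : (CochainComplex.singleFunctor X.E 0).map (eA.inv ≫ l ≫ l' ≫ eB.hom) ≫ u = f := by
      refine HomologicalComplex.from_single_hom_ext ?_
      rw [HomologicalComplex.comp_f, single_map_f_zero, ← hpi, ← hl]
      change (eA.hom ≫ (eA.inv ≫ l ≫ l' ≫ eB.hom) ≫ eB.inv) ≫ p ≫ i = _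
      simp [reassoc_of% hl'']
    let α' : X.Q.obj A' ⟶ X.Q.obj B' := α
    change X.Q.map _ = α'
    rw [← cancel_mono (X.Q.map u), ← Functor.map_comp, key]
    exact h.symm

/-- The map becomes null homotopic after some `u : B' ⟶ N`. There is no room for a homotopy in
degree `0`, and `u.f 0` is a monomorphism. -/
lemma toDerived_map_eq_zero {A B : X.E} (g : A ⟶ B) (hg : X.toDerived.map g = 0) : g = 0 := by
  let A' := (CochainComplex.singleFunctor X.E 0).obj A
  let B' := (CochainComplex.singleFunctor X.E 0).obj B
  let g' : A' ⟶ B' := (CochainComplex.singleFunctor X.E 0).map g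
  have hg' : X.Q.map g' = X.Q.map 0 := hg.trans (X.Q.map_zero _ _).symm
  obtain ⟨N, u, hN, hu, ⟨H⟩⟩ := exists_of_Q_map_eq 0 g' 0 hg'
  obtain ⟨D, p, i, -, hi, hpi, -, -, -, h₂⟩ := exists_factorization X.exact u hu
  obtain ⟨l', hl'⟩ := h₂ (𝟙 _) (by
    rw [(B'.isZero_of_isStrictlyGE 0 (-1)).eq_of_src (B'.d (-1) 0) 0, zero_comp])
  have := X.exact.mono_of_inflation hi
  have h₀ : g'.f 0 ≫ u.f 0 = 0 := by
    have := H.comm 0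
    rw [dNext_eq H.hom (show (ComplexShape.up ℤ).Rel 0 1 by simp),
      prevD_eq H.hom (show (ComplexShape.up ℤ).Rel (-1) 0 by simp),
      (A'.isZero_of_isStrictlyLE 0 1).eq_of_tgt (A'.d 0 1) 0,
      (N.isZero_of_isStrictlyGE 0 (-1)).eq_of_src (N.d (-1) 0) 0] at this
    simpa using this
  have h₁ : g'.f 0 = 0 := by
    rw [← hpi, ← Category.assoc] at h₀
    rw [← Category.comp_id (g'.f 0), ← hl', ← Category.assoc, (cancel_mono i).1
      (h₀.trans zero_comp.symm), zero_comp]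
  let eA : A'.X 0 ≅ A := HomologicalComplex.singleObjXSelf _ 0 A
  let eB : B'.X 0 ≅ B := HomologicalComplex.singleObjXSelf _ 0 B
  have h₂ : eA.hom ≫ g ≫ eB.inv = 0 := (single_map_f_zero g).symm.trans h₁
  simpa using congr_arg (fun t => eA.inv ≫ t ≫ eB.hom) h₂

instance : X.toDerived.Faithful where
  map_injective {A B f g} h := by
    rw [← sub_eq_zero]
    exact toDerived_map_eq_zero _ (by rw [Functor.map_sub, h, sub_self])

end ExactCat

end NQuasiAbelian

/-! ### Coresolving subcategories of abelian categories and resolutions -/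

namespace NQuasiAbelian

open Pretriangulated CochainComplex

section

universe v₁ v₂ v₃ v₄ u₁ u₂ u₃ u₄

variable {B : Type u₁} {C : Type u₂} {D₁ : Type u₃} {D₂ : Type u₄} [Category.{v₁} B]
  [Category.{v₂} C] [Category.{v₃} D₁] [Category.{v₄} D₂]

/-- A criterion for a functor between localized categories to be an equivalence. -/
lemma isEquivalence_of_resolutions (F : B ⥤ C) [F.Full] [F.Faithful] (L₁ : B ⥤ D₁)
    (L₂ : C ⥤ D₂) (W₁ : MorphismProperty B) (W₂ : MorphismProperty C) [L₁.IsLocalization W₁]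
    [L₂.IsLocalization W₂] [W₁.HasLeftCalculusOfFractions] [W₂.HasLeftCalculusOfFractions]
    (hW : ∀ ⦃X Y : B⦄ (f : X ⟶ Y), W₁ f ↔ W₂ (F.map f))
    (hF : ∀ Z : C, ∃ (X : B) (s : Z ⟶ F.obj X), W₂ s)
    (G : D₁ ⥤ D₂) (e : F ⋙ L₂ ≅ L₁ ⋙ G) : G.IsEquivalence := by
  have e_nat : ∀ {X Y : B} (f : X ⟶ Y),
      G.map (L₁.map f) = e.inv.app X ≫ L₂.map (F.map f) ≫ e.hom.app Y := by
    intro X Y f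
    have := e.hom.naturality f
    dsimp at this
    rw [this, ← NatTrans.comp_app_assoc, e.inv_hom_id]
    simp
  have : L₁.EssSurj := Localization.essSurj L₁ W₁
  have : L₂.EssSurj := Localization.essSurj L₂ W₂
  have faithful : G.Faithful := by
    refine ⟨fun {X Y} f g hfg => ?_⟩
    obtain ⟨X₀, ⟨eX⟩⟩ : ∃ X₀, Nonempty (L₁.obj X₀ ≅ X) := ⟨_, ⟨L₁.objObjPreimageIso X⟩⟩
    obtain ⟨Y₀, ⟨eY⟩⟩ : ∃ Y₀, Nonempty (L₁.obj Y₀ ≅ Y) := ⟨_, ⟨L₁.objObjPreimageIso Y⟩⟩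
    obtain ⟨φ, h₁, h₂⟩ := Localization.exists_leftFraction₂ L₁ W₁ (eX.hom ≫ f ≫ eY.inv)
      (eX.hom ≫ g ≫ eY.inv)
    have i₁ := Localization.inverts L₁ W₁ φ.s φ.hs
    have key : L₂.map (F.map φ.f) = L₂.map (F.map φ.f') := by
      have : G.map (L₁.map φ.f) = G.map (L₁.map φ.f') := by
        rw [← φ.fst.map_comp_map_s L₁ (Localization.inverts _ _),
          ← φ.snd.map_comp_map_s L₁ (Localization.inverts _ _), ← h₁, ← h₂]
        simp [hfg]
      rw [e_nat, e_nat, cancel_epi] at this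
      exact (cancel_mono _).1 this
    rw [MorphismProperty.map_eq_iff_postcomp L₂ W₂] at key
    obtain ⟨Z, s, hs, hs'⟩ := key
    -- The equalizing morphism ends outside the image of `F`; a further morphism of `W₂` brings its
    -- target back into the image.
    obtain ⟨T, t, ht⟩ := hF Z
    obtain ⟨r, hr⟩ := F.map_surjective (s ≫ t)
    have hr' : W₁ r := by rw [hW, hr]; exact W₂.comp_mem _ _ hs ht
    have key : φ.f ≫ r = φ.f' ≫ r := F.map_injective (by simp [hr, reassoc_of% hs'])
    have i₂ := Localization.inverts L₁ W₁ r hr'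
    have : eX.hom ≫ f ≫ eY.inv = eX.hom ≫ g ≫ eY.inv := by
      rw [← cancel_mono (L₁.map φ.s), h₁, h₂]
      rw [φ.fst.map_comp_map_s L₁ (Localization.inverts _ _)]
      refine Eq.trans ?_ (φ.snd.map_comp_map_s L₁ (Localization.inverts _ _)).symm
      change L₁.map φ.f = L₁.map φ.f'
      rw [← cancel_mono (L₁.map r), ← L₁.map_comp, ← L₁.map_comp, key]
    simpa using this
  have full : G.Full := by
    refine G.full_of_comp_essSurj L₁ (fun X Y α => ?_)
    obtain ⟨φ, hφ⟩ := Localization.exists_leftFraction L₂ W₂ (e.hom.app X ≫ α ≫ e.inv.app Y)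
    obtain ⟨T, t, ht⟩ := hF φ.Y'
    obtain ⟨f, hf⟩ := F.map_surjective (φ.f ≫ t)
    obtain ⟨r, hr⟩ := F.map_surjective (φ.s ≫ t)
    have hr' : W₁ r := by rw [hW, hr]; exact W₂.comp_mem _ _ φ.hs ht
    have i₁ := Localization.inverts L₁ W₁ r hr'
    refine ⟨L₁.map f ≫ inv (L₁.map r), ?_⟩
    rw [G.map_comp, Functor.map_inv, IsIso.comp_inv_eq, e_nat, e_nat, hf, hr]
    have h₁ := φ.map_comp_map_s L₂ (Localization.inverts _ _)
    rw [← hφ] at h₁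
    have h₂ := congr_arg (fun s => e.inv.app X ≫ s ≫ L₂.map t ≫ e.hom.app T) h₁
    simp only [Category.assoc] at h₂
    rw [← NatTrans.comp_app_assoc, e.inv_hom_id] at h₂
    simp at h₂
    simp [h₂]
  have essSurj : G.EssSurj := by
    refine ⟨fun Y => ?_⟩
    obtain ⟨T, t, ht⟩ := hF (L₂.objPreimage Y)
    have i₁ := Localization.inverts L₂ W₂ t ht
    exact ⟨L₁.obj T, ⟨(e.app T).symm ≪≫ (asIso (L₂.map t)).symm ≪≫ L₂.objObjPreimageIso Y⟩⟩
  exact { }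

end

section

variable {A : Type w} [Category.{w} A] [Abelian A]

/-- `Z` is an iterated (`n`-fold) cosyzygy of `X` with respect to `P`: there is an exact sequence
`0 ⟶ X ⟶ P_n ⟶ ⋯ ⟶ P_1 ⟶ Z ⟶ 0` with `P_1, …, P_n` in `P`. -/
inductive IsCosyzygy (P : ObjectProperty A) : ℕ → A → A → Prop
  | zero {X Y : A} (e : X ≅ Y) : IsCosyzygy P 0 X Y
  | succ {k : ℕ} {X I Y Z : A} (i : X ⟶ I) (p : I ⟶ Y) (w' : i ≫ p = 0)
      (h : (ShortComplex.mk i p w').ShortExact) (hI : P I) (hY : IsCosyzygy P k Y Z) :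
      IsCosyzygy P (k + 1) X Z

lemma IsCosyzygy.snoc {P : ObjectProperty A} {k : ℕ} {X I Y Z : A} (h : IsCosyzygy P k X Y)
    (i : Y ⟶ I) (p : I ⟶ Z) (w' : i ≫ p = 0) (hS : (ShortComplex.mk i p w').ShortExact)
    (hI : P I) : IsCosyzygy P (k + 1) X Z := by
  induction h with
  | zero e =>
    refine .succ (e.hom ≫ i) p (by simp [w']) ?_ hI (.zero (Iso.refl _))
    have ee : ShortComplex.mk i p w' ≅ ShortComplex.mk (e.hom ≫ i) p (by simp [w']) :=
      ShortComplex.isoMk e.symm (Iso.refl _) (Iso.refl _) (by simp) (by simp)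
    exact ShortComplex.shortExact_of_iso ee hS
  | succ j q w'' h hI' _ ih => exact .succ j q w'' h hI' (ih i w' hS)

lemma IsCosyzygy.trans_one {P : ObjectProperty A} {k : ℕ} {X Y Z : A} (h : IsCosyzygy P k X Y)
    (h' : IsCosyzygy P 1 Y Z) : IsCosyzygy P (k + 1) X Z := by
  cases h' with
  | succ i p w' hS hI hY =>
    cases hY with
    | zero e =>
      have ee : ShortComplex.mk i p w' ≅ ShortComplex.mk i (p ≫ e.hom) (by simp [reassoc_of% w']) :=
        ShortComplex.isoMk (Iso.refl _) (Iso.refl _) e (by simp) (by simp)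
      exact h.snoc _ _ _ (ShortComplex.shortExact_of_iso ee hS) hI

end

/-- The exact category `X` is a full subcategory of the abelian category `A` (with the induced
exact structure) which cogenerates `A` and contains its `n`-fold cosyzygies. -/
structure IsCoresolving (X : ExactCat.{w}) {A : Type w} [Category.{w} A] [Abelian A]
    (J : X.E ⥤ A) (n : ℕ) : Prop where
  full : J.Full
  faithful : J.Faithful
  additive : J.Additive
  conf_iff : ∀ S : ShortComplex X.E, X.conf S ↔ (S.map J).ShortExact
  cogenerates : ∀ Z : A, ∃ (Y : X.E) (i : Z ⟶ J.obj Y), Mono i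
  closed : ∀ Y Z : A, IsCosyzygy J.essImage n Y Z → J.essImage Z

namespace IsCoresolving

variable {X : ExactCat.{w}} {A : Type w} [Category.{w} A] [Abelian A] {J : X.E ⥤ A} {n : ℕ}

lemma essImage_biprod [J.Additive] {Y Z : A} (hY : J.essImage Y) (hZ : J.essImage Z) :
    J.essImage (Y ⊞ Z) := by
  obtain ⟨Y', ⟨e⟩⟩ := hY
  obtain ⟨Z', ⟨e'⟩⟩ := hZ
  have := preservesBinaryBiproducts_of_preservesBiproducts J
  exact ⟨Y' ⊞ Z', ⟨J.mapBiprod Y' Z' ≪≫ biprod.mapIso e e'⟩⟩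

lemma ses_cycles (K : CochainComplex A ℤ) (hK : ∀ i, K.ExactAt i) (i j : ℤ) (hij : i + 1 = j) :
    ∃ (w' : K.iCycles i ≫ K.toCycles i j = 0),
      (ShortComplex.mk (K.iCycles i) (K.toCycles i j) w').ShortExact := by
  have hw : K.iCycles i ≫ K.toCycles i j = 0 := by
    rw [← cancel_mono (K.iCycles j)]
    simp
  refine ⟨hw, ?_⟩
  have h₁ : Epi (K.toCycles i j) := by
    have : Epi (K.sc j).toCycles := (hK j).epi_toCycles
    obtain rfl : i = (ComplexShape.up ℤ).prev j := by simp; omega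
    exact this
  refine ShortComplex.ShortExact.mk' ?_ (inferInstanceAs (Mono (K.iCycles i))) h₁
  refine ShortComplex.exact_of_f_is_kernel _ (KernelFork.IsLimit.ofι _ _
    (fun {T} t ht => K.liftCycles t j (by simp; omega) ?_) ?_ ?_)
  · rw [← K.toCycles_i, reassoc_of% ht, zero_comp]
  · intro T t ht
    simp
  · intro T t ht s hs
    rw [← cancel_mono (K.iCycles i), hs]
    simp

/-- The short exact sequences of cycles are spliced. In an unbounded exact complex all cycles are
thus cosyzygies of any prescribed length, and closure under `n`-fold cosyzygies suffices to control
them. -/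
lemma isCosyzygy_of_exact {P : ObjectProperty A} (K : CochainComplex A ℤ)
    (hK : ∀ i, K.ExactAt i) (hP : ∀ i, P (K.X i)) (m : ℕ) (k : ℤ) :
    IsCosyzygy P m (K.cycles (k - m)) (K.cycles k) := by
  induction m generalizing k with
  | zero => exact .zero (eqToIso (by simp))
  | succ m ih =>
    obtain ⟨w', h⟩ := ses_cycles K hK (k - 1) k (by omega)
    refine .snoc ?_ _ _ w' h (hP _)
    convert ih (k - 1) using 2
    push_cast
    ring

lemma exactAt_of_isAcyclic (hJ : IsCoresolving X J n) [J.Additive] {K : CochainComplex X.E ℤ}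
    (hK : IsAcyclic X.conf K) (i : ℤ) :
    ((J.mapHomologicalComplex (ComplexShape.up ℤ)).obj K).ExactAt i := by
  obtain ⟨D, e, m, hd, hc⟩ := hK
  rw [HomologicalComplex.exactAt_iff' _ (i - 1) i (i + 1) (by simp) (by simp)]
  obtain ⟨z₁, c₁⟩ := hc (i - 1) i (by omega)
  obtain ⟨z₂, c₂⟩ := hc i (i + 1) (by omega)
  obtain ⟨z₀, c₀⟩ := hc (i - 1 - 1) (i - 1) (by omega)
  rw [hJ.conf_iff] at c₀ c₁ c₂
  have h₁ : Epi (J.map (e (i - 1))) := c₀.epi_g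
  have h₂ : Mono (J.map (m i (i + 1) rfl)) := c₂.mono_f
  let S := (((J.mapHomologicalComplex (ComplexShape.up ℤ)).obj K).sc' (i - 1) i (i + 1))
  let S₁ : ShortComplex A := ShortComplex.mk (J.map (m (i - 1) i (by omega))) (J.map (K.d i (i + 1)))
    (by rw [← hd i (i + 1) rfl, ← J.map_comp, reassoc_of% z₁, zero_comp, J.map_zero])
  let φ : S ⟶ S₁ :=
    { τ₁ := J.map (e (i - 1))
      τ₂ := 𝟙 _
      τ₃ := 𝟙 _
      comm₁₂ := by
        change J.map _ ≫ J.map _ = J.map _ ≫ 𝟙 _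
        rw [← J.map_comp, hd]
        simp
      comm₂₃ := by
        change 𝟙 _ ≫ J.map _ = J.map _ ≫ 𝟙 _
        simp }
  let ψ : (ShortComplex.mk (m (i - 1) i (by omega)) (e i) z₁).map J ⟶ S₁ :=
    { τ₁ := 𝟙 _
      τ₂ := 𝟙 _
      τ₃ := J.map (m i (i + 1) rfl)
      comm₁₂ := by
        change 𝟙 _ ≫ J.map _ = J.map _ ≫ 𝟙 _
        simp
      comm₂₃ := by
        change 𝟙 _ ≫ J.map _ = J.map _ ≫ J.map _
        rw [← J.map_comp, hd]
        simp }
  have : Epi φ.τ₁ := h₁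
  have : IsIso φ.τ₂ := inferInstanceAs (IsIso (𝟙 _))
  have : Mono φ.τ₃ := inferInstanceAs (Mono (𝟙 _))
  have : Epi ψ.τ₁ := inferInstanceAs (Epi (𝟙 _))
  have : IsIso ψ.τ₂ := inferInstanceAs (IsIso (𝟙 _))
  have : Mono ψ.τ₃ := h₂
  exact (ShortComplex.exact_iff_of_epi_of_isIso_of_mono φ).2
    ((ShortComplex.exact_iff_of_epi_of_isIso_of_mono ψ).1 c₁.exact)

/-- The cycles of the image complex are `n`-fold cosyzygies of other cycles, so they come from
`X.E`, and the short exact sequences that they form are conflations. -/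
lemma isAcyclic_of_exactAt (hJ : IsCoresolving X J n) [J.Additive] {K : CochainComplex X.E ℤ}
    (hK : ∀ i, ((J.mapHomologicalComplex (ComplexShape.up ℤ)).obj K).ExactAt i) :
    IsAcyclic X.conf K := by
  have := hJ.full
  have := hJ.faithful
  obtain ⟨Z, ι, t, hti, hses, hZ⟩ : ∃ (Z : ℤ → A) (ι : ∀ i, Z i ⟶ J.obj (K.X i))
      (t : ∀ i j, i + 1 = j → (J.obj (K.X i) ⟶ Z j)),
      (∀ i j hij, t i j hij ≫ ι j = J.map (K.d i j)) ∧
      (∀ i j hij, ∃ w', (ShortComplex.mk (ι i) (t i j hij) w').ShortExact) ∧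
      ∀ k, J.essImage (Z k) := by
    let K' := (J.mapHomologicalComplex (ComplexShape.up ℤ)).obj K
    exact ⟨fun i => K'.cycles i, fun i => K'.iCycles i, fun i j _ => K'.toCycles i j, fun i j _ => K'.toCycles_i i j,
      ses_cycles K' hK, fun k => hJ.closed _ _
        (isCosyzygy_of_exact K' hK (fun i => J.obj_mem_essImage _) n k)⟩
  choose D ε using fun i => hZ (i + 1)
  replace ε := fun i => (ε i).some
  choose e he using fun i => J.map_surjective (t i (i + 1) rfl ≫ (ε i).inv)
  choose m hm using fun i => J.map_surjective ((ε i).hom ≫ ι (i + 1))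
  refine ⟨D, e, fun i j hij => m i ≫ (K.XIsoOfEq hij).hom, ?_, ?_⟩
  · rintro i j rfl
    apply J.map_injective
    rw [J.map_comp, J.map_comp, he, hm]
    simp [hti]
  · rintro i j rfl
    obtain ⟨w', h⟩ := hses (i + 1) (i + 1 + 1) rfl
    have zero : (m i ≫ (K.XIsoOfEq rfl).hom) ≫ e (i + 1) = 0 := by
      apply J.map_injective
      rw [J.map_comp, J.map_comp, he, hm]
      simp [reassoc_of% w']
    refine ⟨zero, ?_⟩
    rw [hJ.conf_iff]
    have ee : ShortComplex.mk (ι (i + 1)) (t (i + 1) (i + 1 + 1) rfl) w' ≅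
        (ShortComplex.mk (m i ≫ (K.XIsoOfEq rfl).hom) (e (i + 1)) zero).map J :=
      ShortComplex.isoMk (ε i).symm (Iso.refl _) (ε (i + 1)).symm
        (by
          change (ε i).inv ≫ J.map _ = ι (i + 1) ≫ 𝟙 _
          rw [J.map_comp, hm]
          simp)
        (by
          change 𝟙 _ ≫ J.map _ = t _ _ _ ≫ _
          rw [he]
          exact Category.id_comp _)
    exact ShortComplex.shortExact_of_iso ee h

/-- Every complex embeds, up to a shift, in a contractible one with terms in `J`; its quotient is
homotopy equivalent to a complex quasi-isomorphic to the given one. -/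
lemma exists_step (hJ : IsCoresolving X J n) [J.Additive] (M : CochainComplex A ℤ) :
    ∃ (N : CochainComplex A ℤ) (s : (HomotopyCategory.quotient A (ComplexShape.up ℤ)).obj M ⟶
        (HomotopyCategory.quotient A (ComplexShape.up ℤ)).obj N),
      HomotopyCategory.quasiIso A (ComplexShape.up ℤ) s ∧
      (∀ k : ℤ, IsCosyzygy J.essImage 1 (M.X (k - 1)) (N.X k)) ∧
      ∀ m : ℤ, M.IsStrictlyGE m → N.IsStrictlyGE m := by
  obtain ⟨O, hO⟩ := HasZeroObject.zero (C := X.E)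
  -- A zero object is embedded in a zero object, so that lower bounds of complexes are preserved.
  have hI : ∀ Z : A, ∃ (I : A) (i : Z ⟶ I), Mono i ∧ J.essImage I ∧ (IsZero Z → IsZero I) := by
    intro Z
    by_cases hZ : IsZero Z
    · exact ⟨Z, 𝟙 Z, inferInstance, ⟨O, ⟨(J.map_isZero hO).iso hZ⟩⟩, id⟩
    · obtain ⟨Y, i, hi⟩ := hJ.cogenerates Z
      exact ⟨_, i, hi, J.obj_mem_essImage Y, fun h => (hZ h).elim⟩
  choose I ι hι hP h₀ using hI
  let L := (CategoryTheory.shiftFunctor (CochainComplex A ℤ) (-1 : ℤ)).obj M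
  let Y : CochainComplex A ℤ :=
    { X := fun k => I (L.X k)
      d := fun _ _ => 0
      shape := fun _ _ _ => rfl
      d_comp_d' := fun _ _ _ _ _ => comp_zero }
  let β : HomComplex.Cochain L Y 0 := HomComplex.Cochain.ofHoms fun k => ι (L.X k)
  let α : HomComplex.Cocycle L Y 1 := HomComplex.Cocycle.mk (-(HomComplex.δ 0 1 β)) 2 (by omega)
    (by rw [HomComplex.δ_neg, HomComplex.δ_δ, neg_zero])
  -- The degreewise embedding `β` of `L`, the shift of `M` by `-1`, need not be a chain map to `Y`.
  -- With `-δ β` as second component it becomes a chain map to the contractible cone of `𝟙 Y`.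
  let i : L ⟶ mappingCone (𝟙 Y) := mappingCone.lift (𝟙 Y) α β (by simp [α])
  have hi : ∀ k, i.f k ≫ (mappingCone.snd (𝟙 Y)).v k k (add_zero k) = ι (L.X k) := fun k => by
    simp [i, β]
  have : ∀ k, Mono (i.f k) := fun k => by
    have : Mono (i.f k ≫ (mappingCone.snd (𝟙 Y)).v k k (add_zero k)) := by
      rw [hi]
      infer_instance
    exact mono_of_mono _ ((mappingCone.snd (𝟙 Y)).v k k (add_zero k))
  have : Mono i := HomologicalComplex.mono_of_mono_f _ inferInstance
  let S : ShortComplex (CochainComplex A ℤ) := ShortComplex.mk i (cokernel.π i) (by simp)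
  have hS : S.ShortExact :=
    { exact := ShortComplex.exact_of_g_is_cokernel _ (cokernelIsCokernel i)
      mono_f := inferInstance
      epi_g := inferInstance }
  have hS' : ∀ k, (S.map (HomologicalComplex.eval A (ComplexShape.up ℤ) k)).ShortExact :=
    fun k => hS.map_of_exact _
  have hL : ∀ k, L.X k = M.X (k - 1) := fun k => rfl
  let q := HomotopyCategory.quotient A (ComplexShape.up ℤ)
  have z : IsZero (q.obj (mappingCone (𝟙 Y))) :=
    (Triangle.isZero₃_iff_isIso₁ _
      (HomotopyCategory.mappingCone_triangleh_distinguished (𝟙 Y))).2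
      (inferInstanceAs (IsIso (q.map (𝟙 Y))))
  -- Since the cone of `𝟙 Y` is contractible, the cone of `i` is the shift of `L` by `1`, which is
  -- `M` up to homotopy. It is also quasi-isomorphic to the cokernel of `i`, whose terms are
  -- cosyzygies of the terms of `M`.
  have hτ : IsIso (mappingCone.triangleh i).mor₃ :=
    (Triangle.isZero₂_iff_isIso₃ _ (HomotopyCategory.mappingCone_triangleh_distinguished i)).1 z
  let τ : q.obj (mappingCone i) ⟶ (q.obj L)⟦(1 : ℤ)⟧ := (mappingCone.triangleh i).mor₃
  have : IsIso τ := hτ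
  let e : q.obj M ≅ (q.obj L)⟦(1 : ℤ)⟧ := (shiftNegShift (q.obj M) (1 : ℤ)).symm ≪≫
    (CategoryTheory.shiftFunctor _ (1 : ℤ)).mapIso ((q.commShiftIso (-1 : ℤ)).app M).symm
  refine ⟨cokernel i, e.hom ≫ inv τ ≫ q.map (mappingCone.descShortComplex S), ?_, ?_, ?_⟩
  · refine ((HomotopyCategory.quasiIso A _).cancel_left_of_respectsIso e.hom _).2
      (((HomotopyCategory.quasiIso A _).cancel_left_of_respectsIso (inv τ) _).2 ?_)
    rw [HomotopyCategory.quotient_map_mem_quasiIso_iff]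
    exact mappingCone.quasiIso_descShortComplex hS
  · intro k
    refine .succ (i.f k) ((cokernel.π i).f k) _ (hS' k) ?_ (.zero (Iso.refl _))
    have e' : (mappingCone (𝟙 Y)).X k ≅ Y.X (k + 1) ⊞ Y.X k :=
      HomologicalComplex.homotopyCofiber.XIsoBiprod (𝟙 Y) _ _ rfl
    exact (J.essImage.prop_iff_of_iso e').2 (essImage_biprod (hP _) (hP _))
  · intro m hm
    rw [isStrictlyGE_iff]
    intro k hk
    have := (hS' k).epi_g
    have hz : IsZero ((mappingCone (𝟙 Y)).X k) := by
      rw [mappingCone.isZero_X_iff]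
      exact ⟨h₀ _ (M.isZero_of_isStrictlyGE m (k + 1 + -1) (by omega)),
        h₀ _ (M.isZero_of_isStrictlyGE m (k + -1) (by omega))⟩
    exact IsZero.of_epi ((cokernel.π i).f k) hz

/-- For `j = n` every term of `N` is an `n`-fold cosyzygy and therefore comes from `X.E`. -/
lemma exists_steps (hJ : IsCoresolving X J n) [J.Additive] (M : CochainComplex A ℤ) (j : ℕ) :
    ∃ (N : CochainComplex A ℤ) (s : (HomotopyCategory.quotient A (ComplexShape.up ℤ)).obj M ⟶
        (HomotopyCategory.quotient A (ComplexShape.up ℤ)).obj N),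
      HomotopyCategory.quasiIso A (ComplexShape.up ℤ) s ∧
      (∀ k : ℤ, IsCosyzygy J.essImage j (M.X (k - j)) (N.X k)) ∧
      ∀ m : ℤ, M.IsStrictlyGE m → N.IsStrictlyGE m := by
  induction j with
  | zero =>
    exact ⟨M, 𝟙 _, MorphismProperty.id_mem _ _, fun k => .zero (eqToIso (by simp)), fun _ h => h⟩
  | succ j ih =>
    obtain ⟨N, s, hs, hN, hN'⟩ := ih
    obtain ⟨N', s', hs', hN₂, hN₂'⟩ := hJ.exists_step N
    refine ⟨N', s ≫ s', MorphismProperty.comp_mem _ _ _ hs hs', fun k => ?_,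
      fun m hm => hN₂' m (hN' m hm)⟩
    refine .trans_one ?_ (hN₂ k)
    convert hN (k - 1) using 2
    push_cast
    ring

/-- Every complex in `A` is quasi-isomorphic to a complex in `X.E`. -/
lemma exists_resolution (hJ : IsCoresolving X J n) [J.Additive] (M : CochainComplex A ℤ) :
    ∃ (K : CochainComplex X.E ℤ) (s : (HomotopyCategory.quotient A (ComplexShape.up ℤ)).obj M ⟶
        (HomotopyCategory.quotient A (ComplexShape.up ℤ)).obj
          ((J.mapHomologicalComplex (ComplexShape.up ℤ)).obj K)),
      HomotopyCategory.quasiIso A (ComplexShape.up ℤ) s ∧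
      ∀ m : ℤ, M.IsStrictlyGE m → K.IsStrictlyGE m := by
  have := hJ.full
  have := hJ.faithful
  obtain ⟨N, s, hs, hN, hN'⟩ := hJ.exists_steps M n
  choose K e using fun k => hJ.closed _ _ (hN k)
  replace e := fun k => (e k).some
  let K' : CochainComplex X.E ℤ :=
    { X := K
      d := fun i j => J.preimage ((e i).hom ≫ N.d i j ≫ (e j).inv)
      shape := fun i j h => J.map_injective (by simp [N.shape i j h])
      d_comp_d' := fun i j k _ _ => J.map_injective (by simp) }
  let ε : N ≅ (J.mapHomologicalComplex (ComplexShape.up ℤ)).obj K' :=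
    HomologicalComplex.Hom.isoOfComponents (fun k => (e k).symm) (fun i j _ => by
      change (e i).inv ≫ J.map (J.preimage _) = _
      rw [J.map_preimage, Iso.inv_hom_id_assoc]
      rfl)
  refine ⟨K', s ≫ (HomotopyCategory.quotient A (ComplexShape.up ℤ)).map ε.hom, ?_, fun m hm => ?_⟩
  · exact ((HomotopyCategory.quasiIso A _).cancel_right_of_respectsIso _ _).2 hs
  · have := hN' m hm
    rw [← CochainComplex.isStrictlyGE_mapHomologicalComplex_obj_iff K' J]
    exact CochainComplex.isStrictlyGE_of_iso ε m

end IsCoresolving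

end NQuasiAbelian

/-! ### Comparison of `D(E)` with the derived category of an abelian category -/

namespace NQuasiAbelian

open Pretriangulated CochainComplex

namespace IsCoresolving

variable {X : ExactCat.{w}} {A : Type w} [Category.{w} A] [Abelian A] {J : X.E ⥤ A} {n : ℕ}

lemma acyclicComplexes_eq (hJ : IsCoresolving X J n) [J.Additive] : acyclicComplexes X.conf =
    (HomotopyCategory.subcategoryAcyclic A).inverseImage
      (J.mapHomotopyCategory (ComplexShape.up ℤ)) := by
  ext ⟨K⟩
  refine Iff.trans ?_ (HomotopyCategory.quotient_obj_mem_subcategoryAcyclic_iff_exactAt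
    ((J.mapHomologicalComplex (ComplexShape.up ℤ)).obj K)).symm
  exact ⟨fun h => hJ.exactAt_of_isAcyclic h, fun h => hJ.isAcyclic_of_exactAt h⟩

lemma trW_iff (hJ : IsCoresolving X J n) [J.Additive]
    ⦃K L : HomotopyCategory X.E (ComplexShape.up ℤ)⦄ (f : K ⟶ L) :
    (acyclicComplexes X.conf).trW f ↔ (HomotopyCategory.subcategoryAcyclic A).trW
      ((J.mapHomotopyCategory (ComplexShape.up ℤ)).map f) := by
  rw [hJ.acyclicComplexes_eq]
  exact ObjectProperty.inverseImage_trW_iff ..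

/-- The derived category of `X` is equivalent to the derived category of an abelian category in
which `X` is coresolving. -/
theorem exists_equivalence (hJ : IsCoresolving X J n) [J.Additive] [HasDerivedCategory.{w} A] :
    ∃ (Φ : X.Derived ⥤ DerivedCategory A) (_ : Φ.CommShift ℤ), Φ.IsTriangulated ∧
      Φ.IsEquivalence ∧
      Nonempty (X.Q ⋙ Φ ≅ J.mapHomologicalComplex (ComplexShape.up ℤ) ⋙ DerivedCategory.Q) ∧
      Nonempty (X.toDerived ⋙ Φ ≅ J ⋙ DerivedCategory.singleFunctor A 0) ∧
      ∀ (m : ℤ) (Z : X.Derived), X.rightGE m Z ↔ DerivedCategory.TStructure.t.ge m (Φ.obj Z) := by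
  have := hJ.full
  have := hJ.faithful
  let F := J.mapHomotopyCategory (ComplexShape.up ℤ)
  let W := (acyclicComplexes X.conf).trW
  let F' : HomotopyCategory X.E (ComplexShape.up ℤ) ⥤ DerivedCategory A := F ⋙ DerivedCategory.Qh
  have hF' : W.IsInvertedBy F' := fun K L f hf =>
    Localization.inverts DerivedCategory.Qh (HomotopyCategory.subcategoryAcyclic A).trW _
      ((hJ.trW_iff f).1 hf)
  let Φ : X.Derived ⥤ DerivedCategory A := Localization.lift F' hF' W.Q
  let lifting : Localization.Lifting W.Q W F' Φ := inferInstance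
  let : Φ.CommShift ℤ := Functor.commShiftOfLocalization W.Q W ℤ F' Φ
  let e : W.Q ⋙ Φ ≅ F' := Localization.Lifting.iso W.Q W F' Φ
  have : NatTrans.CommShift e.hom ℤ := NatTrans.commShift_iso_hom_of_localization W.Q W ℤ F' Φ
  have : W.Q.mapArrow.EssSurj := Localization.essSurj_mapArrow _ W
  have tri : Φ.IsTriangulated := Functor.isTriangulated_of_precomp_iso e
  have eqv : Φ.IsEquivalence := by
    refine isEquivalence_of_resolutions F W.Q DerivedCategory.Qh W
      (HomotopyCategory.subcategoryAcyclic A).trW hJ.trW_iff (fun Z => ?_) Φ e.symm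
    obtain ⟨K, s, hs, -⟩ := hJ.exists_resolution Z.as
    rw [HomotopyCategory.quasiIso_eq_trW_subcategoryAcyclic] at hs
    exact ⟨_, s, hs⟩
  let e₁ : X.Q ⋙ Φ ≅ J.mapHomologicalComplex (ComplexShape.up ℤ) ⋙ DerivedCategory.Q :=
    Functor.isoWhiskerLeft (HomotopyCategory.quotient X.E (ComplexShape.up ℤ)) e ≪≫
      Functor.isoWhiskerLeft (J.mapHomologicalComplex (ComplexShape.up ℤ))
        (DerivedCategory.quotientCompQhIso A)
  let e₂ : X.toDerived ⋙ Φ ≅ J ⋙ DerivedCategory.singleFunctor A 0 :=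
    Functor.isoWhiskerLeft (CochainComplex.singleFunctor X.E 0) e₁ ≪≫
      Functor.isoWhiskerRight (HomologicalComplex.singleMapHomologicalComplex J
        (ComplexShape.up ℤ) 0) DerivedCategory.Q
  refine ⟨Φ, inferInstance, tri, eqv, ⟨e₁⟩, ⟨e₂⟩, fun m Z => ⟨?_, fun h => ?_⟩⟩
  · rintro ⟨K, hK, ⟨ε⟩⟩
    refine (DerivedCategory.TStructure.t.ge m).prop_of_iso (Φ.mapIso ε ≪≫ e₁.app K).symm ?_
    have : CochainComplex.IsStrictlyGE ((J.mapHomologicalComplex (ComplexShape.up ℤ)).obj K) m := by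
      rwa [CochainComplex.isStrictlyGE_mapHomologicalComplex_obj_iff]
    exact (DerivedCategory.isGE_Q_obj_iff _ _).2 inferInstance |>.ge
  -- The converse uses that the resolution of a complex vanishing below `m` can be chosen to vanish
  -- below `m`.
  · have : DerivedCategory.IsGE (Φ.obj Z) m := ⟨h⟩
    obtain ⟨M, hM, ⟨ε⟩⟩ := DerivedCategory.exists_iso_Q_obj_of_isGE (Φ.obj Z) m
    obtain ⟨K, s, hs, hK⟩ := hJ.exists_resolution M
    rw [HomotopyCategory.quasiIso_eq_trW_subcategoryAcyclic] at hs
    have := Localization.inverts DerivedCategory.Qh (HomotopyCategory.subcategoryAcyclic A).trW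
      s hs
    let ε' : DerivedCategory.Q.obj M ≅
        DerivedCategory.Q.obj ((J.mapHomologicalComplex (ComplexShape.up ℤ)).obj K) :=
      ((DerivedCategory.quotientCompQhIso A).app M).symm ≪≫ asIso (DerivedCategory.Qh.map s) ≪≫
        (DerivedCategory.quotientCompQhIso A).app _
    exact ⟨K, hK m hM, ⟨Φ.preimageIso (ε ≪≫ ε' ≪≫ (e₁.app K).symm)⟩⟩

end IsCoresolving

end NQuasiAbelian

/-! ### Intersection of the hearts, and conflations as triangles -/

namespace NQuasiAbelian

open Pretriangulated CochainComplex

section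

variable {C : Type w} [Category.{w} C] [Preadditive C] [HasZeroObject C] [HasShift C ℤ]
  [∀ n : ℤ, (CategoryTheory.shiftFunctor C n).Additive] [Pretriangulated C] {t t' : TStructure C}

lemma le_ext₂ (t : TStructure C) {n : ℤ} {T : Triangle C} (hT : T ∈ distTriang C)
    (h₁ : t.le n T.obj₁) (h₃ : t.le n T.obj₃) : t.le n T.obj₂ :=
  (t.isLE₂ T hT n ⟨h₁⟩ ⟨h₃⟩).le

lemma ge_ext₂ (t : TStructure C) {n : ℤ} {T : Triangle C} (hT : T ∈ distTriang C)
    (h₁ : t.ge n T.obj₁) (h₃ : t.ge n T.obj₃) : t.ge n T.obj₂ :=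
  (t.isGE₂ T hT n ⟨h₁⟩ ⟨h₃⟩).ge

lemma le_shift_iff (t : TStructure C) {n a n' : ℤ} (h : a + n' = n) (Z : C) :
    t.le n' (Z⟦a⟧) ↔ t.le n Z := by
  simpa only [t.le_iff_isLE] using t.isLE_shift_iff Z n a n' h

lemma ge_shift_iff (t : TStructure C) {n a n' : ℤ} (h : a + n' = n) (Z : C) :
    t.ge n' (Z⟦a⟧) ↔ t.ge n Z := by
  simpa only [t.ge_iff_isGE] using t.isGE_shift_iff Z n a n' h

lemma le_ext₃ (t : TStructure C) {n : ℤ} {T : Triangle C} (hT : T ∈ distTriang C)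
    (h₁ : t.le (n + 1) T.obj₁) (h₂ : t.le n T.obj₂) : t.le n T.obj₃ :=
  le_ext₂ t (rot_of_distTriang _ hT) h₂ ((le_shift_iff t (by omega) _).2 h₁)

lemma le_ext₁ (t : TStructure C) {n n' : ℤ} (hn : n + 1 = n') {T : Triangle C}
    (hT : T ∈ distTriang C) (h₂ : t.le n' T.obj₂) (h₃ : t.le n T.obj₃) : t.le n' T.obj₁ :=
  le_ext₂ t (inv_rot_of_distTriang _ hT) ((le_shift_iff t (by omega) _).2 h₃) h₂

lemma ge_ext₁ (t : TStructure C) {n n' : ℤ} (hn : n + 1 = n') {T : Triangle C}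
    (hT : T ∈ distTriang C) (h₂ : t.ge n' T.obj₂) (h₃ : t.ge n T.obj₃) : t.ge n' T.obj₁ :=
  ge_ext₂ t (inv_rot_of_distTriang _ hT) ((ge_shift_iff t (by omega) _).2 h₃) h₂

lemma le_le_shift {a b : ℤ} (h : t.le a ≤ t'.le b) (m : ℤ) : t.le (a + m) ≤ t'.le (b + m) :=
  fun Z hZ => (le_shift_iff t' (show m + b = b + m by omega) Z).1
    (h _ ((le_shift_iff t (show m + a = a + m by omega) Z).2 hZ))

lemma ge_le_of_le_le {a b : ℤ} (h : t.le a ≤ t'.le b) : t'.ge (b + 1) ≤ t.ge (a + 1) := by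
  intro Z hZ
  have : t.IsGE Z (a + 1) := by
    rw [t.isGE_iff_orthogonal a (a + 1) rfl]
    intro Y f hY
    exact t'.zero_of_isLE_of_isGE f b (b + 1) (by omega) ⟨h _ hY.le⟩ ⟨hZ⟩
  exact this.ge

lemma le_le_of_ge_le {a b : ℤ} (h : t'.ge (b + 1) ≤ t.ge (a + 1)) : t.le a ≤ t'.le b := by
  intro Z hZ
  have : t'.IsLE Z b := by
    rw [t'.isLE_iff_orthogonal b (b + 1) rfl]
    intro Y f hY
    exact t.zero_of_isLE_of_isGE f a (a + 1) (by omega) ⟨hZ⟩ ⟨h _ hY.ge⟩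
  exact this.le

lemma ge_le_of_le_zero_le (h : t'.le 0 ≤ t.le 0) (m : ℤ) : t.ge m ≤ t'.ge m := by
  have := ge_le_of_le_le (le_le_shift h (m - 1))
  simpa using this

end

namespace ExactCat

variable {X : ExactCat.{w}}

lemma leftLE_toDerived (A : X.E) : X.leftLE 0 (X.toDerived.obj A) :=
  leftLE_Q 0 ((CochainComplex.singleFunctor X.E 0).obj A)

lemma rightGE_toDerived (A : X.E) : X.rightGE 0 (X.toDerived.obj A) :=
  rightGE_Q 0 ((CochainComplex.singleFunctor X.E 0).obj A)

/-- An object is in the image of `X.E` if and only if it is isomorphic to a complex vanishing in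
positive degrees and to a complex vanishing in negative degrees. -/
lemma essImage_iff (Z : X.Derived) :
    X.toDerived.essImage Z ↔ X.leftLE 0 Z ∧ X.rightGE 0 Z := by
  refine ⟨fun ⟨A, ⟨e⟩⟩ => ⟨(X.leftLE 0).prop_of_iso e (leftLE_toDerived A),
    (X.rightGE 0).prop_of_iso e (rightGE_toDerived A)⟩, ?_⟩
  rintro ⟨⟨K, hK, ⟨e⟩⟩, ⟨L, hL, ⟨e'⟩⟩⟩
  obtain ⟨N, f, u, hN, hu, h⟩ := exists_left_fraction 0 (e.inv ≫ e'.hom)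
  have := isIso_Q_map u hu
  have hf : IsIso (X.Q.map f) := by rw [← h]; infer_instance
  obtain ⟨D, p, i, -, -, hpi, hp, hi, -, -⟩ :=
    exists_factorization X.exact f (isAcyclic_mappingCone f)
  let g₁ : K ⟶ (CochainComplex.singleFunctor X.E 0).obj D :=
    HomologicalComplex.mkHomToSingle p (fun i _ => hp i)
  let g₂ : (CochainComplex.singleFunctor X.E 0).obj D ⟶ N :=
    HomologicalComplex.mkHomFromSingle i (fun i _ => hi i)
  have hg : g₁ ≫ g₂ = f := by
    ext k
    rcases lt_trichotomy k 0 with hk | rfl | hk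
    · exact (N.isZero_of_isStrictlyGE 0 k hk).eq_of_tgt _ _
    · rw [HomologicalComplex.comp_f, ← hpi]
      change (HomologicalComplex.mkHomToSingle p _).f 0 ≫
        (HomologicalComplex.mkHomFromSingle i _).f 0 = _
      rw [HomologicalComplex.mkHomToSingle_f, HomologicalComplex.mkHomFromSingle_f]
      simp
    · exact (K.isZero_of_isStrictlyLE 0 k hk).eq_of_src _ _
  let s : X.Q.obj K ⟶ X.toDerived.obj D := X.Q.map g₁
  let r : X.toDerived.obj D ⟶ X.Q.obj K := X.Q.map g₂ ≫ inv (X.Q.map f)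
  have hsr : s ≫ r = 𝟙 _ := by
    change X.Q.map g₁ ≫ X.Q.map g₂ ≫ inv (X.Q.map f) = _
    rw [← Functor.map_comp_assoc, hg, IsIso.hom_inv_id]
  -- The isomorphism given by `f` factors through `D` in degree `0`, so the object is a retract of
  -- `D` in the derived category. Full faithfulness moves the idempotent to `E`, where it splits.
  obtain ⟨ε, hε⟩ := X.toDerived.map_surjective (r ≫ s)
  obtain ⟨Y, a, b, hab, hba⟩ := IsIdempotentComplete.idempotents_split D ε
    (X.toDerived.map_injective (by simp [hε, reassoc_of% hsr]))
  refine ⟨Y, ⟨?_ ≪≫ e.symm⟩⟩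
  exact
    { hom := X.toDerived.map a ≫ r
      inv := s ≫ X.toDerived.map b
      hom_inv_id := by
        have : X.toDerived.map (a ≫ b ≫ a ≫ b) = 𝟙 _ := by simp [hab]
        rw [Category.assoc, ← Category.assoc r, ← hε, ← hba, ← this]
        simp
      inv_hom_id := by
        rw [Category.assoc, ← Functor.map_comp_assoc, hba, hε]
        simp [hsr] }

/-- Let `T` be a t-structure such that `E` is the intersection of its heart with the "right
heart". Then its aisle is generated by the complexes vanishing in positive degrees. -/
lemma le_eq_leftLE (R T : TStructure X.Derived) (hR : ∀ m, R.ge m = X.rightGE m) (n : ℕ)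
    (h₁ : R.le (-(n : ℤ)) ≤ T.le 0) (h₂ : T.le 0 ≤ R.le 0)
    (hE : X.toDerived.essImage = R.heart ⊓ T.heart) : T.le 0 = X.leftLE 0 := by
  have hl : ∀ m, X.leftLE m ≤ R.le m := by
    intro m Z hZ
    have : R.IsLE Z m := by
      rw [R.isLE_iff_orthogonal m (m + 1) rfl]
      intro Y f hY
      have := hY.ge
      rw [hR] at this
      exact hom_eq_zero_of_leftLE_of_rightGE (by omega) hZ this f
    exact this.le
  have hg := ge_le_of_le_zero_le h₂
  have hE' : ∀ Z, X.toDerived.essImage Z → T.le 0 Z := fun Z hZ => by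
    rw [hE] at hZ
    exact hZ.2.1
  -- Descending induction from `n`, where `h₁` applies. In the step the stupid truncation splits off
  -- the term in degree `-k`, a shift of an object of `E`, and leaves a complex vanishing in degrees
  -- `≥ -k`.
  have key : ∀ k : ℕ, k ≤ n → X.leftLE (-(k : ℤ)) ≤ T.le 0 := by
    intro k hk
    induction hk using Nat.decreasingInduction with
    | self => exact fun Z hZ => h₁ _ (hl _ _ hZ)
    | of_succ k hk ih =>
      rintro Z ⟨K, hK, ⟨e⟩⟩
      obtain ⟨A, B, hA, hB, f, g, δ, h, hf, -⟩ := exists_stupid_triangle K (-(k : ℤ))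
      refine (T.le 0).prop_of_iso e.symm (le_ext₂ T h ?_ (ih _ ?_))
      · have hA' : A.IsStrictlyLE (-(k : ℤ)) := by
          rw [isStrictlyLE_iff]
          intro i hi
          have := hf i (by omega)
          exact (K.isZero_of_isStrictlyLE _ i hi).of_iso (asIso (f.f i))
        have : T.le 0 ((X.Q.obj A)⟦(-k : ℤ)⟧) := hE' _ ((essImage_iff _).2
          ⟨X.leftLE_shift _ _ _ (by omega) _ (leftLE_Q (-(k : ℤ)) A),
            X.rightGE_shift _ _ _ (by omega) _ (rightGE_Q (-(k : ℤ)) A)⟩)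
        exact T.le_monotone (show -(k : ℤ) ≤ 0 by omega) _
          ((le_shift_iff T (show (-k : ℤ) + 0 = -k by omega) _).1 this)
      · have : -(k : ℤ) - 1 = -((k + 1 : ℕ) : ℤ) := by push_cast; ring
        rw [← this]
        exact leftLE_Q _ B
  have key₀ : X.leftLE 0 ≤ T.le 0 := by simpa using key 0 (by omega)
  refine le_antisymm (fun Z hZ => ?_) key₀
  -- Conversely, let `K` represent an object of `T.le 0`. The part `A` of `K` in degrees `≥ 0` lies
  -- in both hearts, hence in `E`, and `Z` is an extension of `B`, which lives in negative degrees,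
  -- by `A`.
  obtain ⟨K, ⟨e⟩⟩ := Q_obj_surjective Z
  obtain ⟨A, B, hA, hB, f, g, δ, h, -, -⟩ := exists_stupid_triangle K 0
  have hB' : T.le (-1) (X.Q.obj B) := by
    have := key₀ _ (X.leftLE_shift (0 - 1) (-1) 0 (by omega) _ (leftLE_Q (0 - 1) B))
    exact (le_shift_iff T (by omega) _).1 this
  have hA₁ : T.le 0 (X.Q.obj A) := le_ext₁ T (by omega) h ((T.le 0).prop_of_iso e.symm hZ) hB'
  have hA₂ : R.ge 0 (X.Q.obj A) := by
    rw [hR]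
    exact rightGE_Q 0 A
  have hA₃ : X.toDerived.essImage (X.Q.obj A) := by
    rw [hE]
    exact ⟨⟨h₂ _ hA₁, hA₂⟩, hA₁, hg _ _ hA₂⟩
  exact (X.leftLE 0).prop_of_iso e (leftLE_ext₂ 0 _ h ((essImage_iff _).1 hA₃).1
    (X.leftLE_monotone (show (0 - 1 : ℤ) ≤ 0 by omega) _ (leftLE_Q (0 - 1) B)))

/-- A sequence in `X.E` is a conflation if and only if it extends to a distinguished triangle. -/
lemma conf_iff (S : ShortComplex X.E) : X.conf S ↔
    ∃ δ : X.toDerived.obj S.X₃ ⟶ (X.toDerived.obj S.X₁)⟦(1 : ℤ)⟧,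
      Triangle.mk (X.toDerived.map S.f) (X.toDerived.map S.g) δ ∈ distTriang X.Derived := by
  have key : ∀ S : ShortComplex X.E, X.conf S →
      ∃ δ : X.toDerived.obj S.X₃ ⟶ (X.toDerived.obj S.X₁)⟦(1 : ℤ)⟧,
        Triangle.mk (X.toDerived.map S.f) (X.toDerived.map S.g) δ ∈ distTriang X.Derived := by
    intro S hS
    let φ := (CochainComplex.singleFunctor X.E 0).map S.f
    let ψ := (CochainComplex.singleFunctor X.E 0).map S.g
    have w' : φ ≫ ψ = 0 := by
      rw [← Functor.map_comp, S.zero, Functor.map_zero]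
    let q := mappingCone.desc φ 0 ψ (by simp [w'])
    have zero : φ.f 0 ≫ ψ.f 0 = 0 := by rw [← HomologicalComplex.comp_f, w']; rfl
    have hc : X.conf (ShortComplex.mk (φ.f 0) (ψ.f 0) zero) :=
      X.exact.of_iso (S.mapNatIso (HomologicalComplex.singleCompEvalIsoSelf X.E
        (ComplexShape.up ℤ) 0)).symm hS
    have : (mappingCone φ).IsStrictlyGE (-1) := isStrictlyGE_mappingCone φ 0 0 (-1)
    have : (mappingCone q).IsStrictlyGE (-2) := isStrictlyGE_mappingCone q (-1) 0 (-2)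
    have hz : IsZero (X.Q.obj (mappingCone q)) :=
      isZero_of_effAt (-2) (effAt_of_conf X.exact φ ψ w' zero hc)
    have := isIso_Q_map q (isAcyclic_of_isZero hz)
    obtain ⟨δ, hδ⟩ := mappingCone_distinguished φ
    have hq : X.Q.map (mappingCone.inr φ) ≫ X.Q.map q = X.Q.map ψ := by
      rw [← Functor.map_comp]
      simp [q]
    let e := asIso (X.Q.map q)
    refine ⟨e.inv ≫ δ, isomorphic_distinguished _ hδ _ (Triangle.isoMk _ _ (Iso.refl _)
      (Iso.refl _) e.symm ?_ ?_ ?_)⟩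
    · exact (Category.comp_id _).trans (Category.id_comp _).symm
    · change X.Q.map ψ ≫ e.inv = 𝟙 _ ≫ X.Q.map (mappingCone.inr φ)
      rw [← hq]
      simp [e]
    · change (e.inv ≫ δ) ≫ (CategoryTheory.shiftFunctor _ (1 : ℤ)).map (𝟙 _) = e.inv ≫ δ
      simp
  refine ⟨key S, fun ⟨δ, hδ⟩ => ?_⟩
  let A := (CochainComplex.singleFunctor X.E 0).obj S.X₁
  let B := (CochainComplex.singleFunctor X.E 0).obj S.X₂
  let C := (CochainComplex.singleFunctor X.E 0).obj S.X₃
  let φ : A ⟶ B := (CochainComplex.singleFunctor X.E 0).map S.f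
  let ψ : B ⟶ C := (CochainComplex.singleFunctor X.E 0).map S.g
  have w' : φ ≫ ψ = 0 := by rw [← Functor.map_comp, S.zero, Functor.map_zero]
  let q := mappingCone.desc φ 0 ψ (by simp [w'])
  obtain ⟨δ', hδ'⟩ := mappingCone_distinguished φ
  have hq : X.Q.map (mappingCone.inr φ) ≫ X.Q.map q = X.Q.map ψ := by
    rw [← Functor.map_comp]
    simp [q]
  -- `q` is an isomorphism in the derived category
  let e := Pretriangulated.isoTriangleOfIso₁₂ _ _ hδ' hδ (Iso.refl _) (Iso.refl _)
    ((Category.comp_id _).trans (Category.id_comp _).symm)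
  let e₃ : X.Q.obj (mappingCone φ) ≅ X.Q.obj C := Triangle.π₃.mapIso e
  have he₃ : X.Q.map (mappingCone.inr φ) ≫ e₃.hom = X.Q.map ψ := by
    refine e.hom.comm₂.trans ?_
    change 𝟙 _ ≫ _ = _
    exact Category.id_comp _
  -- Two fillings of the same square agree, as there is no nonzero morphism from the shift of `A` by
  -- `1` to `C`.
  have h₀ : e₃.hom = X.Q.map q := by
    rw [← sub_eq_zero]
    obtain ⟨k, hk⟩ : ∃ k : (X.Q.obj A)⟦(1 : ℤ)⟧ ⟶ X.Q.obj C,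
        e₃.hom - X.Q.map q = δ' ≫ k := Triangle.yoneda_exact₃ _ hδ' _ (by
      change X.Q.map (mappingCone.inr φ) ≫ (e₃.hom - X.Q.map q) = 0
      rw [Preadditive.comp_sub, he₃, hq, sub_self])
    have hk' : k = 0 := hom_eq_zero_of_leftLE_of_rightGE (show (-1 : ℤ) < 0 by omega)
      (X.leftLE_shift 0 1 (-1) (by omega) _ (leftLE_toDerived _)) (rightGE_toDerived _) k
    rw [hk, hk', comp_zero]
  have : IsIso (X.Q.map q) := by rw [← h₀]; infer_instance
  have hA₁ : IsZero (A.X 1) := A.isZero_of_isStrictlyLE 0 1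
  have hC₁ : IsZero (C.X 1) := C.isZero_of_isStrictlyLE 0 1
  have : (mappingCone φ).IsStrictlyLE 0 := by
    rw [isStrictlyLE_iff]
    intro i hi
    rw [mappingCone.isZero_X_iff]
    exact ⟨A.isZero_of_isStrictlyLE 0 _ (by omega), B.isZero_of_isStrictlyLE 0 _ (by omega)⟩
  obtain ⟨D, p, i, hp, hi, hpi, -, -, hi', -⟩ :=
    exists_factorization X.exact q (isAcyclic_mappingCone q)
  have := X.exact.mono_of_inflation hi
  -- `C` has no term in degree `1`, so the inflation `i` is invertible and `q.f 0` is a deflation;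
  -- up to isomorphisms it is `S.g`.
  obtain ⟨l, hl⟩ := hi' (𝟙 _) (by rw [hC₁.eq_of_tgt (C.d 0 1) 0, comp_zero])
  have hil : i ≫ l = 𝟙 _ := by rw [← cancel_mono i, Category.assoc, hl]; simp
  let eB : B.X 0 ≅ S.X₂ := HomologicalComplex.singleObjXSelf _ 0 S.X₂
  let eC : C.X 0 ≅ S.X₃ := HomologicalComplex.singleObjXSelf _ 0 S.X₃
  let ε₃ : D ≅ C.X 0 := ⟨i, l, hil, hl⟩
  let ε₂ : B.X 0 ≅ (mappingCone φ).X 0 :=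
    { hom := (mappingCone.inr φ).f 0
      inv := (mappingCone.snd φ).v 0 0 (add_zero 0)
      hom_inv_id := by simp
      inv_hom_id := by
        rw [mappingCone.ext_from_iff φ 1 0 (by omega)]
        exact ⟨hA₁.eq_of_src _ _, by simp⟩ }
  have hg : (eB.symm ≪≫ ε₂).hom ≫ p ≫ (ε₃ ≪≫ eC).hom = S.g := by
    have h₁ : ψ.f 0 = eB.hom ≫ S.g ≫ eC.inv := single_map_f_zero S.g
    have h₂ : ε₂.hom ≫ q.f 0 = ψ.f 0 := by simp [ε₂, q]
    have h₃ : p ≫ ε₃.hom = q.f 0 := hpi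
    simp [reassoc_of% h₃, reassoc_of% h₂, h₁]
  have hg' : IsDeflation X.conf S.g := by
    rw [← hg]
    exact X.exact.deflation_iso _ (X.exact.deflation_comp hp (X.exact.deflation_of_iso _))
  have hS : ∀ {T : X.E} (s : T ⟶ S.X₁), s ≫ S.f = 0 → s = 0 := by
    intro T s hs
    apply X.toDerived.map_injective
    obtain ⟨k, hk⟩ : ∃ k : X.toDerived.obj T ⟶ (X.toDerived.obj S.X₃)⟦(-1 : ℤ)⟧,
        X.toDerived.map s = k ≫ (Triangle.mk (X.toDerived.map S.f) (X.toDerived.map S.g)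
          δ).invRotate.mor₁ :=
      Triangle.coyoneda_exact₂ _ (inv_rot_of_distTriang _ hδ) _ (by
        change X.toDerived.map s ≫ X.toDerived.map S.f = 0
        rw [← Functor.map_comp, hs, Functor.map_zero])
    have hk' : k = 0 := hom_eq_zero_of_leftLE_of_rightGE (show (0 : ℤ) < 1 by omega)
      (leftLE_toDerived _) (X.rightGE_shift 0 (-1) 1 (by omega) _ (rightGE_toDerived _)) k
    rw [hk, hk', Functor.map_zero]
    exact zero_comp
  have hS' : ∀ {T : X.E} (t : T ⟶ S.X₂), t ≫ S.g = 0 → ∃ s, s ≫ S.f = t := by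
    intro T t ht
    obtain ⟨k, hk⟩ : ∃ k : X.toDerived.obj T ⟶ X.toDerived.obj S.X₁,
        X.toDerived.map t = k ≫ X.toDerived.map S.f :=
      Triangle.coyoneda_exact₂ _ hδ _ (by
        change X.toDerived.map t ≫ X.toDerived.map S.g = 0
        rw [← Functor.map_comp, ht, Functor.map_zero])
    obtain ⟨s, rfl⟩ := X.toDerived.map_surjective k
    exact ⟨s, X.toDerived.map_injective (by rw [hk, Functor.map_comp])⟩
  refine X.exact.conf_of_kernel S.zero hg' (KernelFork.IsLimit.ofι _ _
    (fun t ht => (hS' t ht).choose) (fun t ht => (hS' t ht).choose_spec)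
    (fun t ht m hm => ?_))
  rw [← sub_eq_zero]
  apply hS
  rw [Preadditive.sub_comp, hm, (hS' t ht).choose_spec, sub_self]

end ExactCat

end NQuasiAbelian

/-! ### `D`-cokernels and `D`-kernels from t-structures -/

namespace NQuasiAbelian

open Pretriangulated CochainComplex

namespace ExactCat

variable {X : ExactCat.{w}}

/-- In degree `0` the two terms of the homotopy formula pass through `K.X 1` and `N.X (-1)`, which
vanish. -/
lemma f_zero_eq_of_homotopy {E : Type w} [Category.{w} E] [Preadditive E]
    {K N : CochainComplex E ℤ} [K.IsStrictlyLE 0] [N.IsStrictlyGE 0]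
    {f g : K ⟶ N} (H : Homotopy f g) : f.f 0 = g.f 0 := by
  have := H.comm 0
  rw [dNext_eq H.hom (show (ComplexShape.up ℤ).Rel 0 1 by simp),
    prevD_eq H.hom (show (ComplexShape.up ℤ).Rel (-1) 0 by simp),
    (K.isZero_of_isStrictlyLE 0 1).eq_of_tgt (K.d 0 1) 0,
    (N.isZero_of_isStrictlyGE 0 (-1)).eq_of_src (N.d (-1) 0) 0] at this
  simpa using this

/-- The deflation in `exists_factorization` is invertible, as `K` has no term in degree `-1`. -/
lemma inflation_f_zero {K N : CochainComplex X.E ℤ} (v : K ⟶ N) [K.IsStrictlyLE 0]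
    [K.IsStrictlyGE 0] [N.IsStrictlyGE 0] [IsIso (X.Q.map v)] : IsInflation X.conf (v.f 0) := by
  obtain ⟨D, p, i, hp, hi, hpi, -, -, -, h₂⟩ :=
    exists_factorization X.exact v (isAcyclic_mappingCone v)
  obtain ⟨l, hl⟩ := h₂ (𝟙 _) (by
    rw [(K.isZero_of_isStrictlyGE 0 (-1)).eq_of_src (K.d (-1) 0) 0, zero_comp])
  have := X.exact.epi_of_deflation hp
  have hl' : l ≫ p = 𝟙 _ := by rw [← cancel_epi p, reassoc_of% hl, Category.comp_id]
  let e : K.X 0 ≅ D := ⟨p, l, hl, hl'⟩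
  rw [← hpi]
  exact X.exact.inflation_comp (X.exact.inflation_of_iso e) hi

lemma deflation_f_zero {K N : CochainComplex X.E ℤ} (v : K ⟶ N) [K.IsStrictlyLE 0]
    [N.IsStrictlyGE 0] [N.IsStrictlyLE 0] [IsIso (X.Q.map v)] : IsDeflation X.conf (v.f 0) := by
  obtain ⟨D, p, i, hp, hi, hpi, -, -, h₁, -⟩ :=
    exists_factorization X.exact v (isAcyclic_mappingCone v)
  obtain ⟨l, hl⟩ := h₁ (𝟙 _) (by
    rw [(N.isZero_of_isStrictlyLE 0 1).eq_of_tgt (N.d 0 1) 0, comp_zero])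
  have := X.exact.mono_of_inflation hi
  have hl' : i ≫ l = 𝟙 _ := by rw [← cancel_mono i, Category.assoc, hl, Category.comp_id, Category.id_comp]
  let e : D ≅ N.X 0 := ⟨i, l, hl', hl⟩
  rw [← hpi]
  exact X.exact.deflation_comp hp (X.exact.deflation_of_iso e)

/-- The `D`-cokernel is the degree `0` term of a complex in degrees `≥ 0` that represents the
truncation of the cone of `f`. A map `j` with `f ≫ j = 0` extends to the cone, vanishes on the part
of the cone in `t.le (-1)` by orthogonality, and so factors through the truncation. The fractions
that realize this by chain maps provide the inflation `π`. -/
lemma exists_isDCokernel_f_zero (t : TStructure X.Derived) (ht : t.ge 0 = X.rightGE 0)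
    {A B : CochainComplex X.E ℤ} [A.IsStrictlyLE 0] [B.IsStrictlyLE 0] [B.IsStrictlyGE 0]
    (f : A ⟶ B) :
    ∃ (N : X.E) (p : B.X 0 ⟶ N), f.f 0 ≫ p = 0 ∧ ∀ (M : CochainComplex X.E ℤ) [M.IsStrictlyLE 0]
      [M.IsStrictlyGE 0] (j : B ⟶ M), f ≫ j = 0 → ∃ (N' : X.E) (π : M.X 0 ⟶ N') (k : N ⟶ N'),
        IsInflation X.conf π ∧ j.f 0 ≫ π = p ≫ k := by
  obtain ⟨δ, hδ⟩ := mappingCone_distinguished f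
  have ht1 : X.rightGE 0 = t.ge 0 := ht.symm
  obtain ⟨V, W, hV, hW, a, b, c, H⟩ := t.exists_triangle (X.Q.obj (mappingCone f)) (-1) 0 (by simp)
  rw [ht] at hW
  obtain ⟨N₀, hN₀, ⟨e⟩⟩ := hW
  obtain ⟨N₁, b', u, hN₁, hu, hb'⟩ := exists_left_fraction (K := B) (Z := N₀) 0
    (X.Q.map (mappingCone.inr f) ≫ b ≫ e.hom)
  have := isIso_Q_map u hu
  have hz : X.Q.map (f ≫ b') = X.Q.map 0 := by
    have h₁ : X.Q.map f ≫ X.Q.map (mappingCone.inr f) = 0 := comp_distTriang_mor_zero₁₂ _ hδ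
    rw [Functor.map_comp, ← hb', Functor.map_zero]
    simp only [← Category.assoc, h₁, zero_comp]
  obtain ⟨N₂, u', hN₂, hu', ⟨H₂⟩⟩ := exists_of_Q_map_eq 0 (f ≫ b') 0 hz
  have := isIso_Q_map u' hu'
  refine ⟨N₂.X 0, (b' ≫ u').f 0, by simpa using f_zero_eq_of_homotopy H₂, ?_⟩
  intro M _ _ j hj
  obtain ⟨l, hl⟩ : ∃ l : X.Q.obj (mappingCone f) ⟶ X.Q.obj M,
      X.Q.map j = X.Q.map (mappingCone.inr f) ≫ l :=
    Triangle.yoneda_exact₂ _ hδ (X.Q.map j) (by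
      change X.Q.map f ≫ X.Q.map j = 0
      rw [← Functor.map_comp, hj, Functor.map_zero])
  have hal : a ≫ l = 0 := by
    have h₁ : t.IsLE V (-1) := ⟨hV⟩
    have h₂ : t.IsGE (X.Q.obj M) 0 := ⟨ht ▸ rightGE_Q 0 M⟩
    exact t.zero _ (-1) 0 (by simp)
  obtain ⟨l', hl'⟩ : ∃ l' : W ⟶ X.Q.obj M, l = b ≫ l' :=
    Triangle.yoneda_exact₂ _ H l hal
  obtain ⟨M₁, k, v, hM₁, hv, hk⟩ := exists_left_fraction (K := N₂) (Z := M) 0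
    (inv (X.Q.map u') ≫ inv (X.Q.map u) ≫ e.inv ≫ l')
  have := isIso_Q_map v hv
  have hkv : X.Q.map (b' ≫ u' ≫ k) = X.Q.map (j ≫ v) := by
    simp only [Functor.map_comp, ← hk, ← hb', hl, hl']
    simp
  obtain ⟨M₂, v', hM₂, hv', ⟨H₃⟩⟩ := exists_of_Q_map_eq 0 _ _ hkv
  have := isIso_Q_map v' hv'
  have : IsIso (X.Q.map (v ≫ v')) := by rw [Functor.map_comp]; infer_instance
  refine ⟨M₂.X 0, (v ≫ v').f 0, (k ≫ v').f 0, inflation_f_zero _, ?_⟩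
  simpa using (f_zero_eq_of_homotopy H₃).symm

lemma f_zero_eq_of_Q_map_eq {K N : CochainComplex X.E ℤ} [K.IsStrictlyLE 0] [N.IsStrictlyLE 0]
    [N.IsStrictlyGE 0] {f g : K ⟶ N} (h : X.Q.map f = X.Q.map g) : f.f 0 = g.f 0 := by
  obtain ⟨M, w, hM, hw, ⟨H⟩⟩ := exists_of_Q_map_eq 0 f g h
  have := isIso_Q_map w hw
  have := X.exact.mono_of_inflation (inflation_f_zero w)
  rw [← cancel_mono (w.f 0)]
  simpa using f_zero_eq_of_homotopy H

/-- Dually, the `D`-kernel is the degree `0` term of a complex in degrees `≤ 0` that represents the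
truncation of the fibre of `f`. -/
lemma exists_isDKernel_f_zero (t : TStructure X.Derived) (ht : t.le 0 = X.leftLE 0)
    {A B : CochainComplex X.E ℤ} [A.IsStrictlyLE 0] [A.IsStrictlyGE 0] [B.IsStrictlyLE 0]
    [B.IsStrictlyGE 0] (f : A ⟶ B) :
    ∃ (N : X.E) (p : N ⟶ A.X 0), p ≫ f.f 0 = 0 ∧ ∀ (M : CochainComplex X.E ℤ) [M.IsStrictlyLE 0]
      [M.IsStrictlyGE 0] (j : M ⟶ A), j ≫ f = 0 → ∃ (N' : X.E) (π : N' ⟶ M.X 0) (k : N' ⟶ N),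
        IsDeflation X.conf π ∧ π ≫ j.f 0 = k ≫ p := by
  obtain ⟨δ, hδ⟩ := mappingCone_distinguished f
  obtain ⟨C, i, δ', hi⟩ : ∃ (C : X.Derived) (i : C ⟶ X.Q.obj A) (δ' : X.Q.obj B ⟶ C⟦(1 : ℤ)⟧),
      Triangle.mk i (X.Q.map f) δ' ∈ distTriang X.Derived :=
    ⟨_, _, _, inv_rot_of_distTriang _ hδ⟩
  obtain ⟨V, W, hV, hW, a, b, c, H⟩ := t.exists_triangle C 0 1 (by simp)
  rw [ht] at hV
  obtain ⟨N₀, hN₀, ⟨e⟩⟩ := hV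
  obtain ⟨N₁, b', u, hN₁, hu, hb'⟩ := exists_right_fraction (K := A) (Z := N₀) 0
    (e.inv ≫ a ≫ i)
  have := isIso_Q_map u hu
  have hz : X.Q.map (b' ≫ f) = X.Q.map 0 := by
    have h₁ : i ≫ X.Q.map f = 0 := comp_distTriang_mor_zero₁₂ _ hi
    rw [Functor.map_comp, ← hb', Functor.map_zero]
    simp only [Category.assoc, h₁, comp_zero]
  refine ⟨N₁.X 0, b'.f 0, by simpa using f_zero_eq_of_Q_map_eq hz, ?_⟩
  intro M _ _ j hj
  obtain ⟨l, hl⟩ : ∃ l : X.Q.obj M ⟶ C, X.Q.map j = l ≫ i :=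
    Triangle.coyoneda_exact₂ _ hi (X.Q.map j) (by
      change X.Q.map j ≫ X.Q.map f = 0
      rw [← Functor.map_comp, hj, Functor.map_zero])
  have hal : l ≫ b = 0 := by
    have h₁ : t.IsGE W 1 := ⟨hW⟩
    have h₂ : t.IsLE (X.Q.obj M) 0 := ⟨ht ▸ leftLE_Q 0 M⟩
    exact t.zero _ 0 1 (by simp)
  obtain ⟨l', hl'⟩ : ∃ l' : X.Q.obj M ⟶ V, l = l' ≫ a :=
    Triangle.coyoneda_exact₂ _ H l hal
  obtain ⟨M₁, k, v, hM₁, hv, hk⟩ := exists_right_fraction (K := N₁) (Z := M) 0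
    (l' ≫ e.hom ≫ inv (X.Q.map u))
  have := isIso_Q_map v hv
  have hkv : X.Q.map (k ≫ b') = X.Q.map (v ≫ j) := by
    have h₁ : X.Q.map b' = X.Q.map u ≫ e.inv ≫ a ≫ i := hb'.symm
    simp only [Functor.map_comp, ← hk, h₁, hl, hl']
    simp
  exact ⟨M₁.X 0, v.f 0, k.f 0, deflation_f_zero _, by simpa using (f_zero_eq_of_Q_map_eq hkv).symm⟩

/-- Converse to the construction of `rightT`. The preceding results speak of degree `0` terms, which
are moved to the objects of `X.E` by the isomorphisms `e`. -/
lemma hasDCokernels (t : TStructure X.Derived) (ht : t.ge 0 = X.rightGE 0) :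
    HasDCokernels X.conf := by
  intro A B f
  let F := CochainComplex.singleFunctor X.E 0
  obtain ⟨N, p, hp, h⟩ := exists_isDCokernel_f_zero t ht (A := F.obj A) (B := F.obj B) (F.map f)
  let e (A : X.E) : (F.obj A).X 0 ≅ A := HomologicalComplex.singleObjXSelf _ 0 A
  have hf : ∀ {A B : X.E} (f : A ⟶ B), (F.map f).f 0 = (e A).hom ≫ f ≫ (e B).inv :=
    fun f => single_map_f_zero f
  refine ⟨N, (e B).inv ≫ p, ?_, fun M j hj => ?_⟩
  · rw [hf] at hp
    rw [← cancel_epi (e A).hom, comp_zero, ← hp]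
    simp
  · obtain ⟨N', π, k, hπ, hk⟩ := h (F.obj M) (F.map j) (by
      rw [← Functor.map_comp, hj, Functor.map_zero])
    refine ⟨N', (e M).inv ≫ π, k, X.exact.inflation_comp (X.exact.inflation_of_iso (e M).symm) hπ,
      ?_⟩
    rw [hf] at hk
    rw [Category.assoc, ← hk]
    simp

lemma hasDKernels (t : TStructure X.Derived) (ht : t.le 0 = X.leftLE 0) :
    HasDKernels X.conf := by
  intro A B f
  let F := CochainComplex.singleFunctor X.E 0
  obtain ⟨N, p, hp, h⟩ := exists_isDKernel_f_zero t ht (A := F.obj A) (B := F.obj B) (F.map f)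
  let e (A : X.E) : (F.obj A).X 0 ≅ A := HomologicalComplex.singleObjXSelf _ 0 A
  have hf : ∀ {A B : X.E} (f : A ⟶ B), (F.map f).f 0 = (e A).hom ≫ f ≫ (e B).inv :=
    fun f => single_map_f_zero f
  refine ⟨N, p ≫ (e A).hom, ?_, fun M j hj => ?_⟩
  · rw [hf] at hp
    rw [← cancel_mono (e B).inv, zero_comp, ← hp]
    simp
  · obtain ⟨N', π, k, hπ, hk⟩ := h (F.obj M) (F.map j) (by
      rw [← Functor.map_comp, hj, Functor.map_zero])
    refine ⟨N', π ≫ (e M).hom, k, X.exact.deflation_comp hπ (X.exact.deflation_of_iso (e M)), ?_⟩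
    rw [hf] at hk
    rw [← Category.assoc k, ← hk]
    simp

end ExactCat

end NQuasiAbelian

/-! ### Complexes that begin with an inflation -/

namespace NQuasiAbelian

open Pretriangulated CochainComplex

section

variable {E : Type w} [Category.{w} E] [Preadditive E] [HasZeroObject E] [HasBinaryBiproducts E]
  {conf : ObjectProperty (ShortComplex E)}

/-- A variant of `effAt_of_conf` in which the inflation is the differential of a complex living in
degrees `-1` and `0`. -/
lemma effAt_of_conf_d (h : IsExactStructure conf) {W V : CochainComplex E ℤ} (q : W ⟶ V)
    [W.IsStrictlyLE 0] [W.IsStrictlyGE (-1)] [V.IsStrictlyLE 0] [V.IsStrictlyGE 0]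
    (zero : W.d (-1) 0 ≫ q.f 0 = 0) (hc : conf (ShortComplex.mk (W.d (-1) 0) (q.f 0) zero)) (k : ℤ) :
    EffAt conf (mappingCone q) k := by
  have hW : ∀ i, i ≠ 0 → i ≠ -1 → IsZero (W.X i) := fun i hi hi' => by
    rcases lt_or_gt_of_ne hi with hi | hi
    · exact W.isZero_of_isStrictlyGE (-1) i
    · exact W.isZero_of_isStrictlyLE 0 i
  have hV : ∀ i, i ≠ 0 → IsZero (V.X i) := fun i hi => by
    rcases lt_or_gt_of_ne hi with hi | hi
    · exact V.isZero_of_isStrictlyGE 0 i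
    · exact V.isZero_of_isStrictlyLE 0 i
  obtain ⟨_, ⟨hg⟩⟩ := h.pair hc
  have epi : Epi (q.f 0) := Cofork.IsColimit.epi hg
  have d₂ : (mappingCone.inl q).v (-1) (-2) (by omega) ≫ (mappingCone q).d (-2) (-1) =
      -(W.d (-1) 0 ≫ (mappingCone.inl q).v 0 (-1) (by omega)) := by
    rw [mappingCone.inl_v_d q (-1) (-2) 0 (by omega) (by omega),
      (hV (-1) (by omega)).eq_of_tgt (q.f (-1)) 0]
    simp
  have d₁ : (mappingCone.inl q).v 0 (-1) (by omega) ≫ (mappingCone q).d (-1) 0 =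
      q.f 0 ≫ (mappingCone.inr q).f 0 := by
    rw [mappingCone.inl_v_d q 0 (-1) 1 (by omega) (by omega),
      (hW 1 (by omega) (by omega)).eq_of_tgt (W.d 0 1) 0]
    simp
  intro Y r hr
  by_cases h₀ : k = 0
  · subst h₀
    refine ⟨Y, 𝟙 Y, 0, h.inflation_id Y, ?_⟩
    rw [Category.comp_id, comp_zero, mappingCone.ext_from_iff q 1 0 (by omega)]
    refine ⟨(hW 1 (by omega) (by omega)).eq_of_src _ _, ?_⟩
    rw [← cancel_epi (q.f 0), ← reassoc_of% d₁, hr]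
    simp
  by_cases h₁ : k = -1
  · subst h₁
    obtain ⟨t, ht⟩ := CokernelCofork.IsColimit.desc' hg
      ((mappingCone.inl q).v 0 (-1) (by omega) ≫ r) (by
        have := congr_arg (fun s => s ≫ r) d₂
        simp only [Category.assoc, hr, Preadditive.neg_comp, comp_zero] at this
        dsimp
        rw [← neg_eq_zero, ← this])
    dsimp at ht
    refine ⟨Y, 𝟙 Y, (mappingCone.snd q).v 0 0 (add_zero 0) ≫ t, h.inflation_id Y, ?_⟩
    rw [Category.comp_id, mappingCone.ext_from_iff q 0 (-1) (by omega)]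
    refine ⟨?_, (hV (-1) (by omega)).eq_of_src _ _⟩
    change _ = (mappingCone.inl q).v 0 (-1) (by omega) ≫ (mappingCone q).d (-1) 0 ≫ _
    rw [reassoc_of% d₁, ← ht]
    simp
  by_cases h₂ : k = -2
  · subst h₂
    obtain ⟨N, s, π, sq, hπ⟩ := h.pushout
      ((mappingCone.inl q).v (-1) (-2) (by omega) ≫ r) ⟨_, _, _, hc⟩
    refine ⟨N, π, -((mappingCone.fst q).1.v (-1) 0 (by omega) ≫ s), hπ, ?_⟩
    rw [mappingCone.ext_from_iff q (-1) (-2) (by omega)]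
    refine ⟨?_, (hV (-2) (by omega)).eq_of_src _ _⟩
    change _ = (mappingCone.inl q).v (-1) (-2) (by omega) ≫ (mappingCone q).d (-2) (-1) ≫ _
    rw [reassoc_of% d₂]
    have := sq.w
    simp only [Category.assoc] at this
    simp [← this]
  · exact effAt_of_isZero h (by
      rw [mappingCone.isZero_X_iff]
      exact ⟨hW _ (by omega) (by omega), hV _ h₀⟩) r hr

end

namespace ExactCat

variable {X : ExactCat.{w}}

/-- The part of `K` in degrees `-1` and `0` is quasi-isomorphic to the cokernel of the inflation,
placed in degree `0`. The rest lives in degrees `≥ 1`. -/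
lemma rightGE_zero_of_inflation (K : CochainComplex X.E ℤ) [K.IsStrictlyGE (-1)]
    (hK : IsInflation X.conf (K.d (-1) 0)) : X.rightGE 0 (X.Q.obj K) := by
  obtain ⟨A, W, hA, hW, f, g, δ, H, hf, hg⟩ := exists_stupid_triangle K 1
  have : W.IsStrictlyLE 0 := by simpa using hW
  have hW' : W.IsStrictlyGE (-1) := by
    rw [isStrictlyGE_iff]
    intro i hi
    have := hg i (by omega)
    exact (K.isZero_of_isStrictlyGE (-1) i).of_iso (asIso (g.f i)).symm
  have h₁ := hg (-1) (by omega)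
  have h₂ := hg 0 (by omega)
  have hWi : IsInflation X.conf (W.d (-1) 0) := by
    have : W.d (-1) 0 = (asIso (g.f (-1))).inv ≫ K.d (-1) 0 ≫ (asIso (g.f 0)).hom := by simp
    rw [this]
    exact X.exact.inflation_comp (X.exact.inflation_of_iso (asIso (g.f (-1))).symm)
      (X.exact.inflation_iso _ hK)
  obtain ⟨Z, p, zero, hc⟩ := hWi
  let V := (CochainComplex.singleFunctor X.E 0).obj Z
  let e : V.X 0 ≅ Z := HomologicalComplex.singleObjXSelf (ComplexShape.up ℤ) 0 Z
  let q : W ⟶ V := HomologicalComplex.mkHomToSingle p (by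
    intro i hi
    obtain rfl : i = -1 := by simp at hi; omega
    exact zero)
  have hq : q.f 0 = p ≫ e.inv := HomologicalComplex.mkHomToSingle_f _ _
  have hc' : conf X (ShortComplex.mk (W.d (-1) 0) (q.f 0) (by simp [hq, reassoc_of% zero])) := by
    have ee : ShortComplex.mk (W.d (-1) 0) p zero ≅
        ShortComplex.mk (W.d (-1) 0) (q.f 0) (by simp [hq, reassoc_of% zero]) :=
      ShortComplex.isoMk (Iso.refl _) (Iso.refl _) e.symm (by simp) (by simp [hq])
    exact X.exact.of_iso ee hc
  have hiso : IsIso (X.Q.map q) := by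
    obtain ⟨δ', H'⟩ := mappingCone_distinguished q
    have : (mappingCone q).IsStrictlyGE (-2) := isStrictlyGE_mappingCone q (-1) 0 (-2)
    exact (Triangle.isZero₃_iff_isIso₁ _ H').1
      (isZero_of_effAt (-2) (effAt_of_conf_d X.exact q _ hc'))
  refine rightGE_ext₂ 0 _ H (X.rightGE_antitone (by omega) _ (rightGE_Q 1 A)) ?_
  exact (X.rightGE 0).prop_of_iso (asIso (X.Q.map q)).symm (rightGE_Q 0 V)

end ExactCat

end NQuasiAbelian

/-! ### Kernel axioms and the inclusions of aisles -/

namespace NQuasiAbelian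

open Pretriangulated CochainComplex

section

variable {E : Type w} [Category.{w} E] [Preadditive E] {conf : ObjectProperty (ShortComplex E)}

lemma hasKernel_of_mono [HasZeroObject E] {A B : E} (f : A ⟶ B) [Mono f] : HasKernel f := by
  obtain ⟨Z, hZ⟩ := HasZeroObject.zero (C := E)
  exact ⟨⟨_, KernelFork.IsLimit.ofι (0 : Z ⟶ A) zero_comp (fun _ _ => 0)
    (fun t ht => by rw [zero_comp, ← cancel_mono f, ht, zero_comp])
    (fun _ _ _ _ => hZ.eq_of_tgt _ _)⟩⟩

lemma hasCokernel_of_epi [HasZeroObject E] {A B : E} (f : A ⟶ B) [Epi f] : HasCokernel f := by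
  obtain ⟨Z, hZ⟩ := HasZeroObject.zero (C := E)
  exact ⟨⟨_, CokernelCofork.IsColimit.ofπ (0 : B ⟶ Z) comp_zero (fun _ _ => 0)
    (fun t ht => by rw [comp_zero, ← cancel_epi f, ht, comp_zero])
    (fun _ _ _ _ => hZ.eq_of_src _ _)⟩⟩

/-- The lift `k` is defined only on the source of a deflation, but it descends because `i` is a
monomorphism. -/
lemma IsDKernel.isLimit_of_mono [HasZeroObject E] [HasBinaryBiproducts E] (h : IsExactStructure conf) {K A B : E} {i : K ⟶ A} {f : A ⟶ B}
    (hi : IsDKernel conf i f) [Mono i] : Nonempty (IsLimit (KernelFork.ofι i hi.1)) := by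
  have key : ∀ {T : E} (t : T ⟶ A), t ≫ f = 0 → ∃ l : T ⟶ K, l ≫ i = t := by
    intro T t ht
    obtain ⟨N, π, k, ⟨M, κ, z, hc⟩, hk⟩ := hi.2 t ht
    obtain ⟨_, ⟨hπ⟩⟩ := h.pair hc
    obtain ⟨l, hl⟩ := CokernelCofork.IsColimit.desc' hπ k (by
      rw [← cancel_mono i, Category.assoc, ← hk, ← Category.assoc]
      simp [z])
    dsimp at hl
    have := h.epi_of_deflation ⟨M, κ, z, hc⟩
    exact ⟨l, by rw [← cancel_epi π, hk, ← Category.assoc, hl]⟩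
  exact ⟨KernelFork.IsLimit.ofι _ _ (fun t ht => (key t ht).choose)
    (fun t ht => (key t ht).choose_spec)
    (fun t ht m hm => by rw [← cancel_mono i, hm, (key t ht).choose_spec])⟩

variable [HasZeroObject E] [HasBinaryBiproducts E]

lemma isDKernel_kernel (h : IsExactStructure conf) {A B : E} (f : A ⟶ B) [HasKernel f] :
    IsDKernel conf (kernel.ι f) f :=
  ⟨kernel.condition f, fun X j hj => ⟨X, 𝟙 X, kernel.lift f j hj, h.deflation_id X, by simp⟩⟩

lemma isDCokernel_cokernel (h : IsExactStructure conf) {A B : E} (f : A ⟶ B) [HasCokernel f] :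
    IsDCokernel conf f (cokernel.π f) :=
  ⟨cokernel.condition f, fun X j hj => ⟨X, 𝟙 X, cokernel.desc f j hj, h.inflation_id X, by simp⟩⟩

/-- A kernel is the kernel of its own cokernel, hence part of a kernel-cokernel pair. -/
lemma inflation_of_isLimit [HasCokernels E] (hc : ∀ S, IsKernelCokernelPair S → conf S)
    {K A B : E} {i : K ⟶ A} {f : A ⟶ B} {w' : i ≫ f = 0} (hi : IsLimit (KernelFork.ofι i w')) :
    IsInflation conf i := by
  have : Mono i := Fork.IsLimit.mono hi
  have hf : cokernel.π i ≫ cokernel.desc i f w' = f := cokernel.π_desc _ _ _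
  refine ⟨cokernel i, cokernel.π i, cokernel.condition i, hc _ ⟨⟨?_⟩, ⟨cokernelIsCokernel i⟩⟩⟩
  have key : ∀ {T : E} (t : T ⟶ A), t ≫ cokernel.π i = 0 → ∃ l : T ⟶ K, l ≫ i = t :=
    fun {T} t ht => by
      obtain ⟨l, hl⟩ := KernelFork.IsLimit.lift' hi t (by rw [← hf, reassoc_of% ht, zero_comp])
      exact ⟨l, hl⟩
  exact KernelFork.IsLimit.ofι _ _ (fun t ht => (key t ht).choose)
    (fun t ht => (key t ht).choose_spec)
    (fun t ht m hm => by rw [← cancel_mono i, hm, (key t ht).choose_spec])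

/-- The axiom is applied to the `m + 1` differentials between the degrees `a` and `a + m + 1`. -/
lemma HasKernelsAfter.hasKernel_d {m : ℕ} (h : HasKernelsAfter conf m) (T : CochainComplex E ℤ)
    (a b : ℤ) (hb : a + 1 = b)
    (hT : ∀ i j k, i + 1 = j → j + 1 = k → j ≤ a + m → IsDKernel conf (T.d i j) (T.d j k)) :
    HasKernel (T.d a b) := by
  subst hb
  let S : ComposableArrows E (m + 1) := ComposableArrows.mkOfObjOfMapSucc
    (fun i : Fin (m + 1 + 1) => T.X (a + i.1)) (fun i => T.d (a + i.castSucc.1) (a + i.succ.1))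
  have hS : ∀ (j : ℕ) (hj : j < m + 1), S.map' j (j + 1) = T.d (a + j) (a + (j + 1 : ℕ)) :=
    fun j hj => ComposableArrows.mkOfObjOfMapSucc_map_succ _ _ j hj
  have := h S (fun j hj => by
    rw [hS j (by omega), hS (j + 1) (by omega)]
    exact hT _ _ _ (by push_cast; ring) (by push_cast; ring) (by push_cast; omega))
  rw [hS 0 (by omega)] at this
  have key : ∀ a' b', a' = a → b' = a + 1 → HasKernel (T.d a' b') → HasKernel (T.d a (a + 1)) := by
    rintro _ _ rfl rfl h
    exact h
  exact key _ _ (by simp) (by simp) this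

lemma HasCokernelsAfter.hasCokernel_d {m : ℕ} (h : HasCokernelsAfter conf m)
    (T : CochainComplex E ℤ) (a b : ℤ) (hb : a + 1 = b)
    (hT : ∀ i j k, i + 1 = j → j + 1 = k → a ≤ i + m → IsDCokernel conf (T.d i j) (T.d j k)) :
    HasCokernel (T.d a b) := by
  subst hb
  let S : ComposableArrows E (m + 1) := ComposableArrows.mkOfObjOfMapSucc
    (fun i : Fin (m + 1 + 1) => T.X (a - m + i.1))
    (fun i => T.d (a - m + i.castSucc.1) (a - m + i.succ.1))
  have hS : ∀ (j : ℕ) (hj : j < m + 1), S.map' j (j + 1) = T.d (a - m + j) (a - m + (j + 1 : ℕ)) :=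
    fun j hj => ComposableArrows.mkOfObjOfMapSucc_map_succ _ _ j hj
  have := h S (fun j hj => by
    rw [hS j (by omega), hS (j + 1) (by omega)]
    exact hT _ _ _ (by push_cast; ring) (by push_cast; ring) (by omega))
  rw [hS m (by omega)] at this
  have key : ∀ a' b', a' = a → b' = a + 1 → HasCokernel (T.d a' b') →
      HasCokernel (T.d a (a + 1)) := by
    rintro _ _ rfl rfl h
    exact h
  exact key _ _ (by simp) (by push_cast; ring) this

/-- The differential before one with a kernel is a monomorphism by `hT`, and a monomorphism has a
kernel, so the property propagates to all lower degrees. Two consecutive monomorphisms with zero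
composite start at a zero object. -/
lemma isStrictlyGE_of_kernel_tower (T : CochainComplex E ℤ) (k : ℤ) (hk : HasKernel (T.d k (k + 1)))
    (hT : ∀ i j l, i + 1 = j → j + 1 = l → j ≤ k → HasKernel (T.d j l) → Mono (T.d i j)) :
    T.IsStrictlyGE (k - 1) ∧ Mono (T.d (k - 1) k) := by
  have key : ∀ r : ℕ, ∀ i j, i + 1 = j → j + r = k → Mono (T.d i j) := by
    intro r
    induction r with
    | zero =>
      intro i j hij hj
      obtain rfl : j = k := by simpa using hj
      exact hT i j _ hij rfl le_rfl hk
    | succ r hr =>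
      intro i j hij hj
      have := hr j (j + 1) rfl (by push_cast at hj; omega)
      exact hT i j (j + 1) hij rfl (by omega) (hasKernel_of_mono _)
  refine ⟨?_, key 0 _ _ (by omega) (by simp)⟩
  rw [isStrictlyGE_iff]
  intro i hi
  obtain ⟨r, hr⟩ := Int.le.dest (show i + 2 ≤ k by omega)
  have h₁ := key r (i + 1) (i + 1 + 1) rfl (by omega)
  have h₂ := key (r + 1) i (i + 1) rfl (by push_cast; omega)
  have h₃ : T.d i (i + 1) = 0 := by
    rw [← cancel_mono (T.d (i + 1) (i + 1 + 1))]
    simp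
  rw [IsZero.iff_id_eq_zero, ← cancel_mono (T.d i (i + 1)), h₃]
  simp

lemma isStrictlyLE_of_cokernel_tower (T : CochainComplex E ℤ) (k : ℤ)
    (hk : HasCokernel (T.d (k - 1) k))
    (hT : ∀ i j l, i + 1 = j → j + 1 = l → k ≤ j → HasCokernel (T.d i j) → Epi (T.d j l)) :
    T.IsStrictlyLE (k + 1) := by
  have key : ∀ r : ℕ, ∀ i j, i + 1 = j → k + r = i → Epi (T.d i j) := by
    intro r
    induction r with
    | zero =>
      intro i j hij hj
      obtain rfl : i = k := by simpa using hj.symm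
      exact hT _ i j (by omega) hij le_rfl hk
    | succ r hr =>
      intro i j hij hj
      have := hr (i - 1) i (by omega) (by push_cast at hj; omega)
      exact hT (i - 1) i j (by omega) hij (by omega) (hasCokernel_of_epi _)
  rw [isStrictlyLE_iff]
  intro i hi
  obtain ⟨r, hr⟩ := Int.le.dest (show k + 2 ≤ i by omega)
  have h₁ := key r (i - 1 - 1) (i - 1) (by omega) (by omega)
  have h₂ := key (r + 1) (i - 1) i (by omega) (by push_cast; omega)
  have h₃ : T.d (i - 1) i = 0 := by
    rw [← cancel_epi (T.d (i - 1 - 1) (i - 1))]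
    simp
  rw [IsZero.iff_id_eq_zero, ← cancel_epi (T.d (i - 1) i), h₃]
  simp

end

namespace ExactCat

variable {X : ExactCat.{w}}

/-- In the truncation triangle of `W` the tower `T` lies in `L.ge 1` by coeffaceability. The
remaining vertex then lies in `L.ge 1` and in the aisle `L.le 0`, so it vanishes. -/
lemma exists_iso_of_ge_one (hD : HasDKernels X.conf) (L : TStructure X.Derived)
    (hL : L.le 0 = X.leftLE 0) {W : X.Derived} (hW : L.ge 1 W) :
    ∃ (T : CochainComplex X.E ℤ) (_ : ∀ i j l, i + 1 = j → j + 1 = l → j ≤ 0 →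
        IsDKernel X.conf (T.d i j) (T.d j l) ∧ (HasKernel (T.d j l) → Mono (T.d i j))),
      Nonempty (W ≅ X.Q.obj T) := by
  obtain ⟨T, Y, hT, hY, f, g, h, H⟩ := exists_left_truncation hD W 0
  refine ⟨T, ?_, ?_⟩
  · rintro i j _ hij rfl hj
    obtain rfl : i = j - 1 := by omega
    exact hT j hj
  have h₁ : L.ge 1 (X.Q.obj T) := by
    have : L.IsGE (X.Q.obj T) 1 := by
      rw [L.isGE_iff_orthogonal 0 1 rfl]
      intro Z φ hZ
      have hZ' : L.le 0 Z := hZ.le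
      exact eq_zero_of_coeffAt (fun k hk => coeffAt_of_isDKernel (hT k hk).1) (hL ▸ hZ') φ
    exact this.ge
  have h₂ : L.ge 1 Y := ge_ext₁ L (show (0 : ℤ) + 1 = 1 by rfl) H hW (L.ge_antitone (by omega) _ h₁)
  have h₃ : IsZero Y := by
    rw [IsZero.iff_id_eq_zero]
    have h₄ : L.IsLE Y 0 := ⟨hL ▸ hY⟩
    have h₅ : L.IsGE Y 1 := ⟨h₂⟩
    exact L.zero _ 0 1 (by simp)
  have : IsIso g := (Triangle.isZero₁_iff_isIso₂ _ H).1 h₃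
  exact ⟨asIso g⟩

lemma exists_iso_of_le (hD : HasDCokernels X.conf) (R : TStructure X.Derived)
    (m m' : ℤ) (hm : m + 1 = m') (hR : R.ge m' = X.rightGE m') {W : X.Derived} (hW : R.le m W) :
    ∃ (T : CochainComplex X.E ℤ) (_ : ∀ i j l, i + 1 = j → j + 1 = l → m' ≤ j →
        IsDCokernel X.conf (T.d i j) (T.d j l) ∧ (HasCokernel (T.d i j) → Epi (T.d j l))),
      Nonempty (W ≅ X.Q.obj T) := by
  obtain ⟨T, Y, hT, hY, f, g, h, H⟩ := exists_right_truncation hD W m'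
  refine ⟨T, ?_, ?_⟩
  · rintro i j _ hij rfl hj
    obtain rfl : i = j - 1 := by omega
    exact hT j hj
  have h₁ : R.le m (X.Q.obj T) := by
    have : R.IsLE (X.Q.obj T) m := by
      rw [R.isLE_iff_orthogonal m m' hm]
      intro Z φ hZ
      have hZ' : R.ge m' Z := hZ.ge
      exact eq_zero_of_effAt (fun k hk => effAt_of_isDCokernel (hT k hk).1) (hR ▸ hZ') φ
    exact this.le
  have h₂ : R.le m Y := le_ext₃ R H (R.le_monotone (by omega) _ h₁) hW
  have h₃ : IsZero Y := by
    rw [IsZero.iff_id_eq_zero]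
    have h₄ : R.IsGE Y m' := ⟨hR ▸ hY⟩
    have h₅ : R.IsLE Y m := ⟨h₂⟩
    exact R.zero _ m m' (by omega)
  have : IsIso f := (Triangle.isZero₃_iff_isIso₁ _ H).1 h₃
  exact ⟨(asIso f).symm⟩

lemma leftLE_le (R : TStructure X.Derived) (m : ℤ) (hR : R.ge (m + 1) = X.rightGE (m + 1)) :
    X.leftLE m ≤ R.le m := by
  intro Z hZ
  have : R.IsLE Z m := by
    rw [R.isLE_iff_orthogonal m (m + 1) rfl]
    intro Y f hY
    exact hom_eq_zero_of_leftLE_of_rightGE (show m < m + 1 by omega) hZ (hR ▸ hY.ge) f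
  exact this.le

/-- With kernels, the inclusion is proved for coaisles. An object of `L.ge 1` is a kernel tower
going down from degree `0`; the axiom gives the differential leaving degree `-m` a kernel, so the
tower starts in degree `-m - 1`, that is `-(m + 2) + 1`. With cokernels, an object of `R.le (-(m +
2))` is a cokernel tower, and the axiom for the differential entering degree `-1` makes it end in
degree `0`. -/
lemma le_neg_le (hK : HasDKernels X.conf) (hC : HasDCokernels X.conf) (R L : TStructure X.Derived)
    (hR : ∀ m, R.ge m = X.rightGE m) (hL : L.le 0 = X.leftLE 0) (m : ℕ)
    (h : HasKernelsAfter X.conf m ∨ HasCokernelsAfter X.conf m) :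
    R.le (-((m + 2 : ℕ) : ℤ)) ≤ L.le 0 := by
  rcases h with h | h
  · apply le_le_of_ge_le
    intro W hW
    obtain ⟨T, hT, ⟨e⟩⟩ := exists_iso_of_ge_one hK L hL hW
    have h₁ : HasKernel (T.d (-m) (-m + 1)) := h.hasKernel_d T _ _ rfl fun i j l hij hjl hj =>
      (hT i j l hij hjl (by omega)).1
    have := (isStrictlyGE_of_kernel_tower T (-m) h₁ (fun i j l hij hjl hj =>
      (hT i j l hij hjl (by omega)).2)).1
    rw [hR]
    refine (X.rightGE _).prop_of_iso e.symm ⟨T, ?_, ⟨Iso.refl _⟩⟩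
    convert this using 1
    push_cast; ring
  · intro W hW
    obtain ⟨T, hT, ⟨e⟩⟩ := exists_iso_of_le hC R _ _ rfl (hR _) hW
    have h₁ : HasCokernel (T.d (-1 - 1) (-1)) := h.hasCokernel_d T _ _ (by omega) fun i j l hij hjl hj =>
      (hT i j l hij hjl (by push_cast; omega)).1
    have := isStrictlyLE_of_cokernel_tower T (-1) h₁ (fun i j l hij hjl hj =>
      (hT i j l hij hjl (by push_cast; omega)).2)
    rw [hL]
    exact (X.leftLE _).prop_of_iso e.symm ⟨T, this, ⟨Iso.refl _⟩⟩

/-- The kernel tower starts in degree `-1`, one degree too low. But its first differential is a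
kernel, hence an inflation, and `rightGE_zero_of_inflation` gains the missing degree. -/
lemma le_neg_one_le [HasKernels X.E] [HasCokernels X.E]
    (hc : ∀ S, IsKernelCokernelPair S → X.conf S) (hK : HasDKernels X.conf)
    (R L : TStructure X.Derived)
    (hR : ∀ m, R.ge m = X.rightGE m) (hL : L.le 0 = X.leftLE 0) : R.le (-1) ≤ L.le 0 := by
  apply le_le_of_ge_le
  intro W hW
  obtain ⟨T, hT, ⟨e⟩⟩ := exists_iso_of_ge_one hK L hL hW
  obtain ⟨h₁, h₂⟩ := isStrictlyGE_of_kernel_tower T 0 inferInstance (fun i j l hij hjl hj =>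
    (hT i j l hij hjl hj).2)
  have h₃ : Mono (T.d (-1) 0) := h₂
  obtain ⟨hl⟩ := (hT (-1) 0 1 rfl rfl le_rfl).1.isLimit_of_mono X.exact
  change R.ge 0 W
  rw [hR]
  have : T.IsStrictlyGE (-1) := h₁
  exact (X.rightGE _).prop_of_iso e.symm
    (rightGE_zero_of_inflation T (inflation_of_isLimit hc hl))

end ExactCat

end NQuasiAbelian

/-! ### Transport of t-structures, and the abelian case -/

namespace NQuasiAbelian

open Pretriangulated CochainComplex

section

variable {C D : Type w} [Category.{w} C] [Preadditive C] [HasZeroObject C] [HasShift C ℤ]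
  [∀ n : ℤ, (CategoryTheory.shiftFunctor C n).Additive] [Pretriangulated C]
  [Category.{w} D] [Preadditive D] [HasZeroObject D] [HasShift D ℤ]
  [∀ n : ℤ, (CategoryTheory.shiftFunctor D n).Additive] [Pretriangulated D]

/-- The t-structure obtained from a t-structure by a triangulated equivalence. -/
def pullbackT (t : TStructure D) (F : C ⥤ D) [F.CommShift ℤ] [F.IsTriangulated] [F.IsEquivalence] :
    TStructure C where
  le n := (t.le n).inverseImage F
  ge n := (t.ge n).inverseImage F
  le_isClosedUnderIsomorphisms _ := inferInstance
  ge_isClosedUnderIsomorphisms _ := inferInstance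
  le_shift n a n' h Z hZ := by
    refine (t.le n').prop_of_iso ((F.commShiftIso a).symm.app Z) ?_
    exact (le_shift_iff t h _).2 hZ
  ge_shift n a n' h Z hZ := by
    refine (t.ge n').prop_of_iso ((F.commShiftIso a).symm.app Z) ?_
    exact (ge_shift_iff t h _).2 hZ
  zero' Z Z' f hZ hZ' := by
    apply F.map_injective
    have h₁ : t.IsLE (F.obj Z) 0 := ⟨hZ⟩
    have h₂ : t.IsGE (F.obj Z') 1 := ⟨hZ'⟩
    rw [F.map_zero, t.zero (F.map f) 0 1 (by simp)]
  le_zero_le Z hZ := t.le_zero_le _ hZ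
  ge_one_le Z hZ := t.ge_one_le _ hZ
  exists_triangle_zero_one A := by
    obtain ⟨V, W, hV, hW, a, b, c, H⟩ := t.exists_triangle_zero_one (F.obj A)
    let e := F.objObjPreimageIso V
    let a' : F.objPreimage V ⟶ A := F.preimage (e.hom ≫ a)
    obtain ⟨Z, b', c', H'⟩ := distinguished_cocone_triangle a'
    have H'' := F.map_distinguished _ H'
    let E := isoTriangleOfIso₁₂ _ _ H'' H e (Iso.refl _) (by
      change F.map a' ≫ 𝟙 _ = e.hom ≫ a
      rw [Category.comp_id, F.map_preimage])
    exact ⟨_, Z, (t.le 0).prop_of_iso e.symm hV,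
      (t.ge 1).prop_of_iso (Triangle.π₃.mapIso E).symm hW, a', b', c', H'⟩

lemma le_eq_of_ge_eq {t t' : TStructure C} (h : ∀ m, t.ge m = t'.ge m) (m : ℤ) :
    t.le m = t'.le m :=
  le_antisymm (le_le_of_ge_le (by rw [h])) (le_le_of_ge_le (by rw [h]))

lemma ge_eq_of_le_zero_eq {t t' : TStructure C} (h : t.le 0 = t'.le 0) (m : ℤ) :
    t.ge m = t'.ge m :=
  le_antisymm (ge_le_of_le_zero_le h.ge m) (ge_le_of_le_zero_le h.le m)

/-- A coaisle determines its aisle; this is applied to the t-structure pulled back along `F`. -/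
lemma le_iff_of_ge_iff {t : TStructure C} {t' : TStructure D} (F : C ⥤ D) [F.CommShift ℤ]
    [F.IsTriangulated] [F.IsEquivalence] (h : ∀ m Z, t.ge m Z ↔ t'.ge m (F.obj Z)) (m : ℤ) (Z : C) :
    t.le m Z ↔ t'.le m (F.obj Z) := by
  rw [le_eq_of_ge_eq (t := t) (t' := pullbackT t' F) (fun m => by ext Z; exact h m Z)]
  rfl

lemma ge_iff_of_le_zero_iff {t : TStructure C} {t' : TStructure D} (F : C ⥤ D) [F.CommShift ℤ]
    [F.IsTriangulated] [F.IsEquivalence] (h : ∀ Z, t.le 0 Z ↔ t'.le 0 (F.obj Z)) (m : ℤ) (Z : C) :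
    t.ge m Z ↔ t'.ge m (F.obj Z) := by
  rw [ge_eq_of_le_zero_eq (t := t) (t' := pullbackT t' F) (by ext Z; exact h Z)]
  rfl

lemma heart_iff_of_le_zero_iff {t : TStructure C} {t' : TStructure D} (F : C ⥤ D) [F.CommShift ℤ]
    [F.IsTriangulated] [F.IsEquivalence] (h : ∀ Z, t.le 0 Z ↔ t'.le 0 (F.obj Z)) (Z : C) :
    t.heart Z ↔ t'.heart (F.obj Z) :=
  and_congr (h Z) (ge_iff_of_le_zero_iff F h 0 Z)

end

section

variable {A : Type w} [Category.{w} A] [Abelian A]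

lemma isKernelCokernelPair_iff_shortExact (S : ShortComplex A) :
    IsKernelCokernelPair S ↔ S.ShortExact := by
  refine ⟨fun ⟨⟨h₁⟩, ⟨h₂⟩⟩ => ?_, fun h => ⟨⟨h.fIsKernel⟩, ⟨h.gIsCokernel⟩⟩⟩
  exact { exact := ShortComplex.exact_of_f_is_kernel _ h₁
          mono_f := Fork.IsLimit.mono h₁
          epi_g := Cofork.IsColimit.epi h₂ }

/-- An abelian category with an exact structure. -/
abbrev ExactCat.ofAbelian {conf : ObjectProperty (ShortComplex A)} (h : IsExactStructure conf)
    [IsIdempotentComplete A] : ExactCat.{w} where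
  E := A
  conf := conf
  exact := h

lemma isCoresolving_id {conf : ObjectProperty (ShortComplex A)} (h : IsExactStructure conf)
    [IsIdempotentComplete A] (hc : ∀ S, IsKernelCokernelPair S → conf S) :
    IsCoresolving (ExactCat.ofAbelian h) (𝟭 A) 0 where
  full := inferInstance
  faithful := inferInstance
  additive := inferInstance
  conf_iff S := by
    refine Iff.trans ?_ (isKernelCokernelPair_iff_shortExact S)
    exact ⟨fun hS => h.pair hS, fun hS => hc _ hS⟩
  cogenerates Z := ⟨Z, 𝟙 Z, inferInstanceAs (Mono (𝟙 Z))⟩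
  closed _ Z _ := ⟨Z, ⟨Iso.refl _⟩⟩

end

namespace ExactCat

/-- In the derived category of an abelian category an object of the standard aisle is represented by
a complex in degrees `≤ 0`, and `J` is an equivalence, so the terms can be taken in `X.E`. -/
lemma le_zero_le_of_isCoresolving {X : ExactCat.{w}} {A : Type w} [Category.{w} A] [Abelian A]
    {J : X.E ⥤ A} {n : ℕ} (hJ : IsCoresolving X J n) [J.IsEquivalence] (R L : TStructure X.Derived)
    (hR : ∀ m, R.ge m = X.rightGE m) (hL : L.le 0 = X.leftLE 0) : R.le 0 ≤ L.le 0 := by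
  intro V hV
  let _ : HasDerivedCategory.{w} A := HasDerivedCategory.standard A
  have := hJ.additive
  obtain ⟨Φ, _, _, _, ⟨e⟩, -, hΦ⟩ := hJ.exists_equivalence
  have h₁ := (le_iff_of_ge_iff (t := R) (t' := DerivedCategory.TStructure.t) Φ
    (fun m Z => by rw [hR]; exact hΦ m Z) 0 V).1 hV
  have : DerivedCategory.IsLE (Φ.obj V) 0 := ⟨h₁⟩
  obtain ⟨K, hK, ⟨ε⟩⟩ := DerivedCategory.exists_iso_Q_obj_of_isLE (Φ.obj V) 0
  have : J.asEquivalence.functor.Additive := hJ.additive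
  have : J.inv.Additive := J.asEquivalence.inverse_additive
  rw [hL]
  refine ⟨(J.inv.mapHomologicalComplex (ComplexShape.up ℤ)).obj K, ?_,
    ⟨Φ.preimageIso (ε ≪≫ ?_ ≪≫ (e.app _).symm)⟩⟩
  · rw [isStrictlyLE_iff] at hK ⊢
    exact fun i hi => J.inv.map_isZero (hK i hi)
  · exact DerivedCategory.Q.mapIso (HomologicalComplex.Hom.isoOfComponents
      (fun i => J.asEquivalence.counitIso.symm.app (K.X i))
      (fun i j _ => (J.asEquivalence.counitIso.inv.naturality (K.d i j)).symm))

lemma le_zero_le_of_abelian (X : ExactCat.{w}) (hA : Nonempty (Abelian X.E))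
    (hc : ∀ S, IsKernelCokernelPair S → X.conf S) (R L : TStructure X.Derived)
    (hR : ∀ m, R.ge m = X.rightGE m) (hL : L.le 0 = X.leftLE 0) : R.le 0 ≤ L.le 0 := by
  obtain ⟨E, conf, ex⟩ := X
  rename_i i₁ i₂ i₃ i₄ i₅
  change Nonempty (Abelian E) at hA
  obtain ⟨hA⟩ := hA
  -- With binary biproducts the preadditive structure is unique, so the given one is that of the
  -- abelian category.
  have : i₂ = hA.toPreadditive := Subsingleton.elim _ _
  subst this
  exact le_zero_le_of_isCoresolving (isCoresolving_id ex hc) R L hR hL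

end ExactCat

lemma hasKernels_of_abelian {E : Type w} [Category.{w} E] [Preadditive E] [HasBinaryBiproducts E]
    (hA : Nonempty (Abelian E)) : HasKernels E ∧ HasCokernels E := by
  rename_i i₁ i₂ i₃
  obtain ⟨hA⟩ := hA
  have : i₂ = hA.toPreadditive := Subsingleton.elim _ _
  subst this
  exact ⟨inferInstance, inferInstance⟩

namespace IsNQuasiAbelian

variable {X : ExactCat.{w}} {n : ℕ}

lemma hasDKernels (h : IsNQuasiAbelian X.conf n) : HasDKernels X.conf := by
  match n, h with
  | 0, h =>
    have := (hasKernels_of_abelian h.1).1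
    exact fun A B f => ⟨_, _, isDKernel_kernel X.exact f⟩
  | 1, h =>
    have := h.1.1
    exact fun A B f => ⟨_, _, isDKernel_kernel X.exact f⟩
  | m + 2, h => exact h.1

lemma hasDCokernels (h : IsNQuasiAbelian X.conf n) : HasDCokernels X.conf := by
  match n, h with
  | 0, h =>
    have := (hasKernels_of_abelian h.1).2
    exact fun A B f => ⟨_, _, isDCokernel_cokernel X.exact f⟩
  | 1, h =>
    have := h.1.2.1
    exact fun A B f => ⟨_, _, isDCokernel_cokernel X.exact f⟩
  | m + 2, h => exact h.2.1

lemma le_le (h : IsNQuasiAbelian X.conf n) {R L : TStructure X.Derived}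
    (hR : ∀ m, R.ge m = X.rightGE m) (hL : L.le 0 = X.leftLE 0) : R.le (-(n : ℤ)) ≤ L.le 0 := by
  match n, h with
  | 0, h => exact X.le_zero_le_of_abelian h.1 h.2 R L hR hL
  | 1, h =>
    have := h.1.1
    have := h.1.2.1
    exact ExactCat.le_neg_one_le h.2 (IsNQuasiAbelian.hasDKernels h) R L hR hL
  | m + 2, h => exact ExactCat.le_neg_le h.1 h.2.1 R L hR hL m h.2.2

end IsNQuasiAbelian

lemma ExactCat.le_zero_le (X : ExactCat.{w}) {R L : TStructure X.Derived}
    (hR : ∀ m, R.ge m = X.rightGE m) (hL : L.le 0 = X.leftLE 0) : L.le 0 ≤ R.le 0 := by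
  rw [hL]
  exact leftLE_le R 0 (hR _)

end NQuasiAbelian

/-! ### Closure properties of the intersection of two hearts -/

namespace NQuasiAbelian

open Pretriangulated CochainComplex

section

variable {C : Type w} [Category.{w} C] [Preadditive C] [HasZeroObject C] [HasShift C ℤ]
  [∀ n : ℤ, (CategoryTheory.shiftFunctor C n).Additive] [Pretriangulated C] [IsTriangulated C]

/-- The short exact sequences of the heart are the sequences which are part of a distinguished
triangle. -/
lemma heart_shortExact_iff (t : TStructure C) (S : ShortComplex t.heart.FullSubcategory) :
    S.ShortExact ↔ ∃ δ : S.X₃.obj ⟶ S.X₁.obj⟦(1 : ℤ)⟧,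
      Triangle.mk (t.heart.ι.map S.f) (t.heart.ι.map S.g) δ ∈ distTriang C := by
  have := heart_hasFiniteProducts t
  have hz := heart_hom_eq_zero t
  constructor
  · intro hS
    have := hS.epi_g
    obtain ⟨K, i, δ, H⟩ := AbelianSubcategory.exists_distinguished_triangle_of_epi
      hz (heart_admissible t) S.g
    have h₁ := AbelianSubcategory.isLimitKernelForkOfDistTriang hz i S.g δ H
    let e : S.X₁ ≅ K := hS.fIsKernel.conePointUniqueUpToIso h₁
    have he : e.hom ≫ i = S.f := hS.fIsKernel.conePointUniqueUpToIso_hom_comp h₁ .zero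
    refine ⟨δ ≫ (t.heart.ι.map e.inv)⟦(1 : ℤ)⟧', isomorphic_distinguished _ H _
      (Triangle.isoMk _ _ (t.heart.ι.mapIso e) (Iso.refl _) (Iso.refl _) ?_ ?_ ?_)⟩
    · refine (Category.comp_id _).trans ?_
      change t.heart.ι.map S.f = t.heart.ι.map e.hom ≫ t.heart.ι.map i
      rw [← he, Functor.map_comp]
    · exact (Category.comp_id _).trans (Category.id_comp _).symm
    · change (δ ≫ (t.heart.ι.map e.inv)⟦(1 : ℤ)⟧') ≫ (t.heart.ι.map e.hom)⟦(1 : ℤ)⟧' = 𝟙 _ ≫ δ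
      rw [Category.assoc, ← Functor.map_comp, ← Functor.map_comp, e.inv_hom_id,
        CategoryTheory.Functor.map_id, CategoryTheory.Functor.map_id, Category.comp_id,
        Category.id_comp]
  · rintro ⟨δ, H⟩
    exact (isKernelCokernelPair_iff_shortExact S).1
      ⟨⟨AbelianSubcategory.isLimitKernelForkOfDistTriang hz S.f S.g δ H⟩,
        ⟨AbelianSubcategory.isColimitCokernelCoforkOfDistTriang hz S.f S.g δ H⟩⟩

variable {D T : TStructure C}

/-- Short exact sequences of the heart of `D` are triangles, and passing to the quotient lowers the
bound with respect to `T` by one. -/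
lemma le_of_isCosyzygy {P : ObjectProperty D.heart.FullSubcategory} (hP : ∀ Z, P Z → T.le 0 Z.obj)
    {k : ℕ} {Y Z : D.heart.FullSubcategory} (h : IsCosyzygy P k Y Z) (hY : T.le k Y.obj) :
    T.le 0 Z.obj := by
  induction h with
  | zero e => exact (T.le 0).prop_of_iso (D.heart.ι.mapIso e) hY
  | @succ k Y I Y' Z i p w' hS hI _ ih =>
    obtain ⟨δ, H⟩ := (heart_shortExact_iff D _).1 hS
    exact ih (le_ext₃ T H (by simpa using hY) (T.le_monotone (by omega) _ (hP _ hI)))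

/-- The bound carries the extra parameter `j` because the induction removes the first short exact
sequence, while the given bound concerns the last object. -/
lemma ge_of_isCosyzygy {P : ObjectProperty T.heart.FullSubcategory} (hP : ∀ Z, P Z → D.ge 0 Z.obj)
    {k : ℕ} {Y Z : T.heart.FullSubcategory} (h : IsCosyzygy P k Y Z) (j : ℕ)
    (hZ : D.ge (-(k : ℤ) - j) Z.obj) : D.ge (-(j : ℤ)) Y.obj := by
  induction h generalizing j with
  | zero e => exact (D.ge _).prop_of_iso (T.heart.ι.mapIso e).symm (by simpa using hZ)
  | @succ k Y I Y' Z i p w' hS hI _ ih =>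
    obtain ⟨δ, H⟩ := (heart_shortExact_iff T _).1 hS
    have h₁ : D.ge (-((j + 1 : ℕ) : ℤ)) Y'.obj := ih (j + 1) (by
      have h₀ : -(k : ℤ) - ((j + 1 : ℕ) : ℤ) = -((k + 1 : ℕ) : ℤ) - j := by push_cast; ring
      rw [h₀]
      exact hZ)
    exact ge_ext₁ D (show -((j + 1 : ℕ) : ℤ) + 1 = -(j : ℤ) by push_cast; ring) H
      (D.ge_antitone (by omega) _ (hP _ hI)) h₁

/-- Shifting `h` gives `D.le 0 ≤ T.le n`, so `n` sequences bring any object of the heart of `D` into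
`T.le 0`. The condition on the coaisle of `T` holds on the whole heart of `D`. -/
lemma heart_closed {n : ℕ} (h : D.le (-(n : ℤ)) ≤ T.le 0) (h' : T.le 0 ≤ D.le 0)
    {P : ObjectProperty D.heart.FullSubcategory} (hP : ∀ Z, P Z ↔ T.heart Z.obj)
    {Y Z : D.heart.FullSubcategory} (hYZ : IsCosyzygy P n Y Z) : P Z := by
  rw [hP]
  refine ⟨le_of_isCosyzygy (fun Z hZ => ((hP Z).1 hZ).1) hYZ ?_,
    ge_le_of_le_zero_le h' 0 _ Z.property.2⟩
  have := le_le_shift h n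
  simp only [neg_add_cancel, zero_add] at this
  exact this _ Y.property.1

/-- The dual bound is `T.ge 0 ≤ D.ge (-n)`, and passing to kernels raises it by one each time. -/
lemma heart_closed' {n : ℕ} (h : D.le (-(n : ℤ)) ≤ T.le 0) (h' : T.le 0 ≤ D.le 0)
    {P : ObjectProperty T.heart.FullSubcategory} (hP : ∀ Z, P Z ↔ D.heart Z.obj)
    {Y Z : T.heart.FullSubcategory} (hYZ : IsCosyzygy P n Y Z) : P Y := by
  rw [hP]
  refine ⟨h' _ Y.property.1, ?_⟩
  have := ge_of_isCosyzygy (fun Z hZ => ((hP Z).1 hZ).2) hYZ 0 (by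
    have h₁ := ge_le_of_le_le (le_le_shift h (-1))
    simp only [zero_add, neg_add_cancel, neg_add_cancel_right] at h₁
    simpa using h₁ _ Z.property.2)
  simpa using this

lemma heart_isClosedUnderExtensions
    {P : ObjectProperty D.heart.FullSubcategory} (hP : ∀ Z, P Z ↔ T.heart Z.obj) :
    P.IsClosedUnderExtensions where
  prop_X₂_of_shortExact {S} hS h₁ h₃ := by
    rw [hP] at h₁ h₃ ⊢
    obtain ⟨δ, H⟩ := (heart_shortExact_iff D _).1 hS
    exact ⟨le_ext₂ T H h₁.1 h₃.1, ge_ext₂ T H h₁.2 h₃.2⟩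

end

/-! ### Cosyzygies and long exact sequences -/

section

variable {A : Type w} [Category.{w} A] [Abelian A] {P : ObjectProperty A}

lemma IsCosyzygy.of_iso {k : ℕ} {X Y Z : A} (h : IsCosyzygy P k X Y) (e : Y ≅ Z) :
    IsCosyzygy P k X Z := by
  induction h with
  | zero e' => exact .zero (e' ≪≫ e)
  | succ i p w' hS hI _ ih => exact .succ i p w' hS hI (ih e)

lemma shortExact_image {X Y Z : A} (f : X ⟶ Y) (g : Y ⟶ Z) (w' : f ≫ g = 0)
    (h : (ShortComplex.mk f g w').Exact) : ∃ (w'' : image.ι f ≫ factorThruImage g = 0),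
      (ShortComplex.mk (image.ι f) (factorThruImage g) w'').ShortExact := by
  have h₁ : f ≫ factorThruImage g = 0 := by
    rw [← cancel_mono (image.ι g)]
    simpa using w'
  have h₂ : image.ι f ≫ factorThruImage g = 0 := by
    rw [← cancel_epi (factorThruImage f)]
    simpa using h₁
  refine ⟨h₂, { exact := ?_, mono_f := inferInstanceAs (Mono (image.ι f)), epi_g := inferInstanceAs (Epi (factorThruImage g)) }⟩
  let φ : ShortComplex.mk f (factorThruImage g) h₁ ⟶ ShortComplex.mk f g w' :=
    { τ₁ := 𝟙 _, τ₂ := 𝟙 _, τ₃ := image.ι g }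
  let ψ : ShortComplex.mk f (factorThruImage g) h₁ ⟶ ShortComplex.mk (image.ι f) (factorThruImage g) h₂ :=
    { τ₁ := factorThruImage f, τ₂ := 𝟙 _, τ₃ := 𝟙 _ }
  have : Epi φ.τ₁ := inferInstanceAs (Epi (𝟙 X))
  have : IsIso φ.τ₂ := inferInstanceAs (IsIso (𝟙 Y))
  have : Mono φ.τ₃ := inferInstanceAs (Mono (image.ι g))
  have : Epi ψ.τ₁ := inferInstanceAs (Epi (factorThruImage f))
  have : IsIso ψ.τ₂ := inferInstanceAs (IsIso (𝟙 Y))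
  have : Mono ψ.τ₃ := inferInstanceAs (Mono (𝟙 (image g)))
  exact (ShortComplex.exact_iff_of_epi_of_isIso_of_mono ψ).1
    ((ShortComplex.exact_iff_of_epi_of_isIso_of_mono φ).2 h)

/-- An exact sequence exhibits its last object as a cosyzygy of the first one. -/
lemma isCosyzygy_of_composableArrows {n : ℕ} (S : ComposableArrows A (n + 1)) (hS : S.Exact)
    (hm : Mono (S.map' 0 1)) (he : Epi (S.map' n (n + 1)))
    (hP : ∀ (i : ℕ) (hi : i < n), P (S.obj' (i + 1))) :
    IsCosyzygy P n (S.obj' 0) (S.obj' (n + 1)) := by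
  let d (k : ℕ) (hk : k < n + 1) : S.obj' k ⟶ S.obj' (k + 1) := S.map' k (k + 1)
  have key : ∀ (k : ℕ) (hk : k < n + 1), IsCosyzygy P k (S.obj' 0) (image (d k hk)) := by
    intro k
    induction k with
    | zero =>
      intro hk
      have : Mono (d 0 hk) := hm
      have : Mono (factorThruImage (d 0 hk)) := mono_of_mono_fac (image.fac (d 0 hk))
      have : IsIso (factorThruImage (d 0 hk)) := isIso_of_mono_of_epi _
      exact .zero (asIso (factorThruImage (d 0 hk)))
    | succ k ih =>
      intro hk
      obtain ⟨w'', h⟩ := shortExact_image (d k (by omega)) (d (k + 1) hk)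
        (hS.toIsComplex.zero k) (hS.exact k)
      exact (ih (by omega)).snoc _ _ _ h (hP k (by omega))
  have hn : n < n + 1 := by omega
  have : Epi (d n hn) := he
  have : Epi (image.ι (d n hn)) := epi_of_epi_fac (image.fac (d n hn))
  have : IsIso (image.ι (d n hn)) := isIso_of_mono_of_epi _
  exact (key n hn).of_iso (asIso (image.ι (d n hn)))

/-- This splicing makes the axioms `last` and `first`, which speak of long exact sequences,
applicable to cosyzygies. -/
lemma IsCosyzygy.exists_composableArrows {n : ℕ} {Y Z : A} (h : IsCosyzygy P n Y Z) :
    ∃ (S : ComposableArrows A n) (f : Y ⟶ S.left), (S.precomp f).Exact ∧ Mono f ∧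
      Epi ((S.precomp f).map' n (n + 1)) ∧
      (∀ (i : ℕ) (hi : i < n), P ((S.precomp f).obj' (i + 1))) ∧
      (S.precomp f).obj' (n + 1) = Z := by
  induction h with
  | @zero Y Z e =>
    have h₁ : Mono e.hom := inferInstance
    have h₂ : Epi e.hom := inferInstance
    exact ⟨.mk₀ Z, e.hom, ComposableArrows.exact₁ _, h₁, h₂, fun i hi => by omega, rfl⟩
  | @succ k X I Y Z i p w' hS hI _ ih =>
    obtain ⟨S, f, h₁, h₂, h₃, h₄, h₅⟩ := ih
    have hp : Epi p := hS.epi_g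
    refine ⟨S.precomp (p ≫ f), i, ?_, hS.mono_f, ?_, ?_, h₅⟩
    · refine ComposableArrows.exact_of_δ₀ ?_ ?_
      · refine ComposableArrows.exact₂_mk _ (by change i ≫ p ≫ f = 0; simp [reassoc_of% w']) ?_
        let φ : ShortComplex.mk i p w' ⟶ ShortComplex.mk i (p ≫ f) (by simp [reassoc_of% w']) :=
          { τ₁ := 𝟙 _, τ₂ := 𝟙 _, τ₃ := f }
        have : Epi φ.τ₁ := inferInstanceAs (Epi (𝟙 X))
        have : IsIso φ.τ₂ := inferInstanceAs (IsIso (𝟙 I))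
        have : Mono φ.τ₃ := h₂
        exact (ShortComplex.exact_iff_of_epi_of_isIso_of_mono φ).1 hS.exact
      · change (S.precomp (p ≫ f)).Exact
        -- Replacing the first map `f` by `p ≫ f` preserves exactness, as `p` is an epimorphism.
        match k, S, f, h₁ with
        | 0, S, f, _ => exact ComposableArrows.exact₁ _
        | m + 1, S, f, h₁ =>
          obtain ⟨h₁, h₁'⟩ := (ComposableArrows.exact_iff_δ₀ _).1 h₁
          refine ComposableArrows.exact_of_δ₀ ?_ h₁'
          have h₆ : f ≫ S.map' 0 1 = 0 := h₁.toIsComplex.zero 0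
          have h₇ : (ShortComplex.mk f (S.map' 0 1) h₆).Exact := h₁.exact 0
          have h₈ : (p ≫ f) ≫ S.map' 0 1 = 0 := by rw [Category.assoc, h₆, comp_zero]
          refine ComposableArrows.exact₂_mk _ h₈ ?_
          let φ : ShortComplex.mk (p ≫ f) (S.map' 0 1) h₈ ⟶ ShortComplex.mk f (S.map' 0 1) h₆ :=
            { τ₁ := p, τ₂ := 𝟙 _, τ₃ := 𝟙 _
              comm₂₃ := (Category.id_comp _).trans (Category.comp_id _).symm }
          have : Epi φ.τ₁ := hp
          have : IsIso φ.τ₂ := inferInstanceAs (IsIso (𝟙 _))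
          have : Mono φ.τ₃ := inferInstanceAs (Mono (𝟙 _))
          exact (ShortComplex.exact_iff_of_epi_of_isIso_of_mono φ).2 h₇
    · match k, S, f, h₃ with
      | 0, S, f, h₃ =>
        have : Epi f := h₃
        exact inferInstanceAs (Epi (p ≫ f))
      | m + 1, S, f, h₃ => exact h₃
    · intro j hj
      match j with
      | 0 => exact hI
      | j + 1 => exact h₄ j (by omega)

lemma IsNTiltingTorsionClass.closed {n : ℕ} (hP : IsNTiltingTorsionClass n P) {Y Z : A}
    (h : IsCosyzygy P n Y Z) : P Z := by
  obtain ⟨S, f, h₁, h₂, h₃, h₄, rfl⟩ := h.exists_composableArrows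
  exact hP.last _ h₁ h₂ h₃ h₄

lemma IsNCotiltingTorsionFreeClass.closed {n : ℕ} (hP : IsNCotiltingTorsionFreeClass n P) {Y Z : A}
    (h : IsCosyzygy P n Y Z) : P Y := by
  obtain ⟨S, f, h₁, h₂, h₃, h₄, rfl⟩ := h.exists_composableArrows
  exact hP.first _ h₁ h₂ h₃ h₄

end

end NQuasiAbelian

/-! ### The exact structure of an extension closed subcategory -/

namespace NQuasiAbelian

section

variable {A : Type w} [Category.{w} A] [Abelian A]

lemma shortExact_pullback {X Y Z Z' : A} {i : X ⟶ Y} {p : Y ⟶ Z} {w' : i ≫ p = 0}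
    (h : (ShortComplex.mk i p w').ShortExact) (f : Z' ⟶ Z) :
    (ShortComplex.mk (pullback.lift i 0 (by simp [w'])) (pullback.snd p f)
      (pullback.lift_snd _ _ _)).ShortExact := by
  have : Epi p := h.epi_g
  have : Mono i := h.mono_f
  have hm : Mono (pullback.lift i (0 : X ⟶ Z') (by simp [w']) : X ⟶ pullback p f) :=
    mono_of_mono_fac (pullback.lift_fst _ _ _)
  refine { exact := ShortComplex.exact_of_f_is_kernel _ ?_, mono_f := hm,
           epi_g := inferInstanceAs (Epi (pullback.snd p f)) }
  refine KernelFork.IsLimit.ofι' _ _ (fun {T} t ht => ⟨h.exact.lift (t ≫ pullback.fst p f) ?_, ?_⟩)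
  · change (t ≫ pullback.fst p f) ≫ p = 0
    rw [Category.assoc, pullback.condition]
    dsimp at ht
    rw [reassoc_of% ht, zero_comp]
  · dsimp at ht ⊢
    apply pullback.hom_ext
    · exact (Category.assoc _ _ _).trans ((congr_arg (_ ≫ ·) (pullback.lift_fst _ _ _)).trans
        (h.exact.lift_f _ _))
    · exact (Category.assoc _ _ _).trans ((congr_arg (_ ≫ ·) (pullback.lift_snd _ _ _)).trans
        (comp_zero.trans ht.symm))

lemma shortExact_pushout {X Y Z X' : A} {i : X ⟶ Y} {p : Y ⟶ Z} {w' : i ≫ p = 0}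
    (h : (ShortComplex.mk i p w').ShortExact) (f : X ⟶ X') :
    (ShortComplex.mk (pushout.inr i f) (pushout.desc p 0 (by simp [w']))
      (pushout.inr_desc _ _ _)).ShortExact := by
  have : Epi p := h.epi_g
  have : Mono i := h.mono_f
  have hm : Epi (pushout.desc p (0 : X' ⟶ Z) (by simp [w']) : pushout i f ⟶ Z) :=
    epi_of_epi_fac (pushout.inl_desc _ _ _)
  refine { exact := ShortComplex.exact_of_g_is_cokernel _ ?_,
           mono_f := inferInstanceAs (Mono (pushout.inr i f)), epi_g := hm }
  refine CokernelCofork.IsColimit.ofπ' _ _ (fun {T} t ht =>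
    ⟨h.exact.desc (pushout.inl i f ≫ t) ?_, ?_⟩)
  · change i ≫ pushout.inl i f ≫ t = 0
    rw [← Category.assoc, pushout.condition, Category.assoc]
    dsimp at ht
    rw [ht, comp_zero]
  · dsimp at ht ⊢
    apply pushout.hom_ext
    · exact (Category.assoc _ _ _).symm.trans ((congr_arg (· ≫ _) (pushout.inl_desc _ _ _)).trans
        (h.exact.g_desc _ _))
    · exact (Category.assoc _ _ _).symm.trans ((congr_arg (· ≫ _) (pushout.inr_desc _ _ _)).trans
        (zero_comp.trans ht.symm))

variable {P : ObjectProperty A}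

lemma shortExact_hom {S : ShortComplex P.FullSubcategory} (hS : inducedConflations P S) :
    ∃ w', (ShortComplex.mk S.f.hom S.g.hom w').ShortExact :=
  ⟨(S.map P.ι).zero, hS⟩

lemma isDeflation_iff [P.IsClosedUnderIsomorphisms] {Y Z : P.FullSubcategory} (p : Y ⟶ Z) :
    IsDeflation (inducedConflations P) p ↔ Epi p.hom ∧ P (kernel p.hom) := by
  constructor
  · rintro ⟨X, i, z, hc⟩
    obtain ⟨w', h⟩ := shortExact_hom hc
    exact ⟨h.epi_g, P.prop_of_iso
      (h.fIsKernel.conePointUniqueUpToIso (limit.isLimit (parallelPair p.hom 0))) X.property⟩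
  · rintro ⟨h₁, h₂⟩
    refine ⟨⟨_, h₂⟩, ObjectProperty.homMk (kernel.ι p.hom), ?_, ?_⟩
    · ext
      exact kernel.condition p.hom
    · exact { exact := ShortComplex.exact_of_f_is_kernel _ (kernelIsKernel p.hom)
              mono_f := inferInstanceAs (Mono (kernel.ι p.hom))
              epi_g := h₁ }

lemma isInflation_iff [P.IsClosedUnderIsomorphisms] {X Y : P.FullSubcategory} (i : X ⟶ Y) :
    IsInflation (inducedConflations P) i ↔ Mono i.hom ∧ P (cokernel i.hom) := by
  constructor
  · rintro ⟨Z, p, z, hc⟩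
    obtain ⟨w', h⟩ := shortExact_hom hc
    exact ⟨h.mono_f, P.prop_of_iso
      (h.gIsCokernel.coconePointUniqueUpToIso (colimit.isColimit (parallelPair i.hom 0))) Z.property⟩
  · rintro ⟨h₁, h₂⟩
    refine ⟨⟨_, h₂⟩, ObjectProperty.homMk (cokernel.π i.hom), ?_, ?_⟩
    · ext
      exact cokernel.condition i.hom
    · exact { exact := ShortComplex.exact_of_g_is_cokernel _ (cokernelIsCokernel i.hom)
              mono_f := h₁
              epi_g := inferInstanceAs (Epi (cokernel.π i.hom)) }

lemma inducedConflations_pair {S : ShortComplex P.FullSubcategory} (hS : inducedConflations P S) :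
    IsKernelCokernelPair S := by
  obtain ⟨w', h⟩ := shortExact_hom hS
  have := h.mono_f
  have := h.epi_g
  constructor
  · refine ⟨KernelFork.IsLimit.ofι _ _ (fun t ht => ObjectProperty.homMk (h.exact.lift t.hom
      (congr_arg (·.hom) ht))) (fun t ht => ?_) (fun t ht m hm => ?_)⟩
    · ext
      exact h.exact.lift_f t.hom _
    · ext
      rw [← cancel_mono (ShortComplex.mk S.f.hom S.g.hom w').f]
      exact (congr_arg (·.hom) hm).trans (h.exact.lift_f t.hom _).symm
  · refine ⟨CokernelCofork.IsColimit.ofπ _ _ (fun t ht => ObjectProperty.homMk (h.exact.desc t.hom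
      (congr_arg (·.hom) ht))) (fun t ht => ?_) (fun t ht m hm => ?_)⟩
    · ext
      exact h.exact.g_desc t.hom _
    · ext
      rw [← cancel_epi (ShortComplex.mk S.f.hom S.g.hom w').g]
      exact (congr_arg (·.hom) hm).trans (h.exact.g_desc t.hom _).symm

/-- Closure under extensions puts the required pullbacks and pushouts into `P`: each is the middle
term of a short exact sequence with outer terms in `P`. -/
lemma isExactStructure_inducedConflations [P.IsClosedUnderIsomorphisms]
    [P.IsClosedUnderExtensions] (h₀ : ∀ Z, IsZero Z → P Z) :
    IsExactStructure (inducedConflations P) where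
  of_iso e hS := ShortComplex.shortExact_of_iso (P.ι.mapShortComplex.mapIso e) hS
  pair hS := inducedConflations_pair hS
  id_zero {Z} hZ := by
    rw [isDeflation_iff]
    exact ⟨inferInstanceAs (Epi (𝟙 Z.obj)), h₀ _ (isZero_kernel_of_mono (𝟙 Z.obj))⟩
  deflation_comp {X Y Z p q} hp hq := by
    obtain ⟨K, i, z, hp⟩ := hp
    obtain ⟨L, j, z', hq⟩ := hq
    obtain ⟨w₁, h₁⟩ := shortExact_hom hp
    obtain ⟨w₂, h₂⟩ := shortExact_hom hq
    have := h₁.epi_g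
    have := h₂.epi_g
    -- The kernel of `p ≫ q` is the pullback of `p` along `j`, an extension of `L` by `K`.
    have hP := P.prop_X₂_of_shortExact (shortExact_pullback h₁ j.hom) K.property L.property
    rw [isDeflation_iff]
    refine ⟨epi_comp p.hom q.hom, P.prop_of_iso ?_ hP⟩
    refine IsLimit.conePointUniqueUpToIso (?_ : IsLimit (KernelFork.ofι
      (pullback.fst p.hom j.hom) ?_)) (limit.isLimit (parallelPair (p ≫ q).hom 0))
    · change pullback.fst p.hom j.hom ≫ p.hom ≫ q.hom = 0
      rw [pullback.condition_assoc, w₂, comp_zero]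
    · have : Mono j.hom := h₂.mono_f
      refine KernelFork.IsLimit.ofι' _ _ (fun {T} t ht => ⟨pullback.lift t
        (h₂.exact.lift (t ≫ p.hom) ((Category.assoc _ _ _).trans ht)) ?_, ?_⟩)
      · exact (h₂.exact.lift_f _ _).symm
      · exact pullback.lift_fst _ _ _
  inflation_comp {X Y Z i j} hi hj := by
    obtain ⟨K, p, z, hi⟩ := hi
    obtain ⟨L, q, z', hj⟩ := hj
    obtain ⟨w₁, h₁⟩ := shortExact_hom hi
    obtain ⟨w₂, h₂⟩ := shortExact_hom hj
    have := h₁.mono_f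
    have := h₂.mono_f
    have hP := P.prop_X₂_of_shortExact (shortExact_pushout h₂ p.hom) K.property L.property
    rw [isInflation_iff]
    refine ⟨mono_comp i.hom j.hom, P.prop_of_iso ?_ hP⟩
    refine IsColimit.coconePointUniqueUpToIso (?_ : IsColimit (CokernelCofork.ofπ
      (pushout.inl j.hom p.hom) ?_)) (colimit.isColimit (parallelPair (i ≫ j).hom 0))
    · change (i.hom ≫ j.hom) ≫ pushout.inl j.hom p.hom = 0
      rw [Category.assoc, pushout.condition, reassoc_of% w₁, zero_comp]
    · have : Epi p.hom := h₁.epi_g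
      refine CokernelCofork.IsColimit.ofπ' _ _ (fun {T} t ht => ⟨pushout.desc t
        (h₁.exact.desc (j.hom ≫ t) ((Category.assoc _ _ _).symm.trans ht)) ?_, ?_⟩)
      · exact (h₁.exact.g_desc _ _).symm
      · exact pushout.inl_desc _ _ _
  pullback {Y Z Z' p} f hp := by
    obtain ⟨K, i, z, hp⟩ := hp
    obtain ⟨w₁, h₁⟩ := shortExact_hom hp
    have hP := P.prop_X₂_of_shortExact (shortExact_pullback h₁ f.hom) K.property Z'.property
    refine ⟨⟨_, hP⟩, ObjectProperty.homMk (pullback.fst p.hom f.hom),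
      ObjectProperty.homMk (pullback.snd p.hom f.hom), ?_, K,
      ObjectProperty.homMk (pullback.lift i.hom 0 (by rw [zero_comp]; exact w₁)), ?_, ?_⟩
    · exact IsPullback.of_map P.ι (by ext; exact pullback.condition) (IsPullback.of_hasPullback _ _)
    · ext
      exact pullback.lift_snd _ _ _
    · exact shortExact_pullback h₁ f.hom
  pushout {X Y X' i} f hi := by
    obtain ⟨K, p, z, hi⟩ := hi
    obtain ⟨w₁, h₁⟩ := shortExact_hom hi
    have hP := P.prop_X₂_of_shortExact (shortExact_pushout h₁ f.hom) X'.property K.property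
    refine ⟨⟨_, hP⟩, ObjectProperty.homMk (pushout.inl i.hom f.hom),
      ObjectProperty.homMk (pushout.inr i.hom f.hom), ?_, K,
      ObjectProperty.homMk (pushout.desc p.hom 0 (by rw [comp_zero]; exact w₁)), ?_, ?_⟩
    · exact IsPushout.of_map P.ι (by ext; exact pushout.condition) (IsPushout.of_hasPushout _ _)
    · ext
      exact pushout.inr_desc _ _ _
    · exact shortExact_pushout h₁ f.hom

lemma shortExact_inl_snd (B B' : A) :
    (ShortComplex.mk (biprod.inl : B ⟶ B ⊞ B') (biprod.snd : B ⊞ B' ⟶ B') biprod.inl_snd).ShortExact :=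
  (ShortComplex.Splitting.ofHasBinaryBiproduct B B').shortExact

/-- The split sequences with sub `B'` and quotient `B`, and with sub `B` and quotient `B'`,
alternate and exhibit `B` as a cosyzygy of every length. So `P` is closed under direct summands. -/
lemma prop_of_biprod [P.IsClosedUnderIsomorphisms] {n : ℕ}
    (hc : ∀ Y Z, IsCosyzygy P n Y Z → P Z) {B B' : A} (h : P (B ⊞ B')) : P B := by
  have key : ∀ k, (∃ Y, IsCosyzygy P k Y B) ∧ ∃ Y, IsCosyzygy P k Y B' := by
    intro k
    induction k with
    | zero => exact ⟨⟨_, .zero (Iso.refl _)⟩, ⟨_, .zero (Iso.refl _)⟩⟩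
    | succ k ih =>
      obtain ⟨⟨Y, hY⟩, ⟨Y', hY'⟩⟩ := ih
      exact ⟨⟨Y', hY'.snoc _ _ _ (shortExact_inl_snd B' B) (P.prop_of_iso (biprod.braiding B B') h)⟩,
        ⟨Y, hY.snoc _ _ _ (shortExact_inl_snd B B') h⟩⟩
  obtain ⟨⟨Y, hY⟩, -⟩ := key n
  exact hc _ _ hY

lemma hasBinaryBiproducts_fullSubcategory [P.IsClosedUnderExtensions] :
    HasBinaryBiproducts P.FullSubcategory where
  has_binary_biproduct Y Z := by
    let W : P.FullSubcategory := ⟨Y.obj ⊞ Z.obj, P.prop_biprod Y.property Z.property⟩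
    let b : BinaryBicone Y Z :=
      { pt := W
        fst := ObjectProperty.homMk biprod.fst
        snd := ObjectProperty.homMk biprod.snd
        inl := ObjectProperty.homMk biprod.inl
        inr := ObjectProperty.homMk biprod.inr
        inl_fst := by ext; exact biprod.inl_fst
        inl_snd := by ext; exact biprod.inl_snd
        inr_fst := by ext; exact biprod.inr_fst
        inr_snd := by ext; exact biprod.inr_snd }
    exact hasBinaryBiproduct_of_total b
      (ObjectProperty.hom_ext _ (biprod.total (X := Y.obj) (Y := Z.obj)))

/-- Splitting both `p` and `𝟙 _ - p` in `A` presents `Y` as `B ⊞ B'`, to which the closure under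
direct summands applies. -/
lemma isIdempotentComplete_fullSubcategory [P.IsClosedUnderIsomorphisms]
    (h : ∀ B B' : A, P (B ⊞ B') → P B) : IsIdempotentComplete P.FullSubcategory where
  idempotents_split Y p hp := by
    have := Idempotents.isIdempotentComplete_of_abelian A
    have hp' : p.hom ≫ p.hom = p.hom := congr_arg (·.hom) hp
    obtain ⟨B, i, e, h₁, h₂⟩ := IsIdempotentComplete.idempotents_split Y.obj p.hom hp'
    obtain ⟨B', i', e', h₁', h₂'⟩ := IsIdempotentComplete.idempotents_split Y.obj (𝟙 _ - p.hom) (by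
      simp [hp'])
    have h₃ : i ≫ e' = 0 := by
      have : Mono i' := mono_of_mono_fac h₁'
      have : Epi e := epi_of_epi_fac h₁
      rw [← cancel_mono i', ← cancel_epi e, Category.assoc, h₂', reassoc_of% h₂]
      simp [hp']
    have h₄ : i' ≫ e = 0 := by
      have : Mono i := mono_of_mono_fac h₁
      have : Epi e' := epi_of_epi_fac h₁'
      rw [← cancel_mono i, ← cancel_epi e', Category.assoc, h₂, reassoc_of% h₂']
      simp [hp']
    let ε : Y.obj ≅ B ⊞ B' :=
      { hom := biprod.lift e e'
        inv := biprod.desc i i'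
        hom_inv_id := by rw [biprod.lift_desc, h₂, h₂']; simp
        inv_hom_id := by ext <;> simp [h₁, h₁', h₃, h₄] }
    exact ⟨⟨B, h B B' (P.prop_of_iso ε Y.property)⟩, ObjectProperty.homMk i,
      ObjectProperty.homMk e, by ext; exact h₁, by ext; exact h₂⟩

end

end NQuasiAbelian

/-! ### Uniqueness and invariance of the correspondences -/

namespace NQuasiAbelian

open Pretriangulated

section

variable {A B C : Type w} [Category.{w} A] [Category.{w} B] [Category.{w} C]

/-- A functor whose values are in the essential image of a fully faithful functor `G` factors
through `G`. -/
lemma exists_comp_iso (F : A ⥤ C) (G : B ⥤ C) [G.Full] [G.Faithful]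
    (h : ∀ Z, G.essImage (F.obj Z)) : ∃ H : A ⥤ B, Nonempty (H ⋙ G ≅ F) := by
  have : G.toEssImage.IsEquivalence := inferInstance
  let F' : A ⥤ G.EssImageSubcategory := G.essImage.lift F h
  refine ⟨F' ⋙ G.toEssImage.inv, ⟨?_⟩⟩
  exact Functor.isoWhiskerRight (Functor.isoWhiskerLeft F' G.toEssImage.asEquivalence.counitIso)
    G.essImage.ι

lemma full_of_comp_iso {F : A ⥤ C} {G : B ⥤ C} {H : A ⥤ B} (e : H ⋙ G ≅ F) [F.Full]
    [G.Faithful] : H.Full := by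
  have : (H ⋙ G).Full := Functor.Full.of_iso e.symm
  exact Functor.Full.of_comp_faithful H G

lemma faithful_of_comp_iso {F : A ⥤ C} {G : B ⥤ C} {H : A ⥤ B} (e : H ⋙ G ≅ F) [F.Faithful] :
    H.Faithful := by
  have : (H ⋙ G).Faithful := Functor.Faithful.of_iso e.symm
  exact Functor.Faithful.of_comp H G

lemma essImage_of_comp_iso {F : A ⥤ C} {G : B ⥤ C} {H : A ⥤ B} (e : H ⋙ G ≅ F)
    [G.Full] [G.Faithful] (Z : B) : H.essImage Z ↔ F.essImage (G.obj Z) := by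
  constructor
  · rintro ⟨Y, ⟨e'⟩⟩
    exact ⟨Y, ⟨(e.app Y).symm ≪≫ G.mapIso e'⟩⟩
  · rintro ⟨Y, ⟨e'⟩⟩
    exact ⟨Y, ⟨G.preimageIso (e.app Y ≪≫ e')⟩⟩

lemma isEquivalence_of_comp_iso {F : A ⥤ C} {G : B ⥤ C} {H : A ⥤ B} (e : H ⋙ G ≅ F)
    [F.Full] [F.Faithful] [G.Full] [G.Faithful] (h : ∀ Z, F.essImage (G.obj Z)) :
    H.IsEquivalence where
  full := full_of_comp_iso e
  faithful := faithful_of_comp_iso e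
  essSurj := ⟨fun Z => (essImage_of_comp_iso e Z).2 (h Z)⟩

variable [Preadditive A] [Preadditive B] [Preadditive C]

lemma additive_of_iso {F G : A ⥤ C} (e : F ≅ G) [F.Additive] : G.Additive where
  map_add {X Y f g} := by
    rw [← cancel_epi (e.hom.app X), ← e.hom.naturality, Functor.map_add, Preadditive.add_comp,
      Preadditive.comp_add, e.hom.naturality, e.hom.naturality]

lemma additive_of_comp_iso {F : A ⥤ C} {G : B ⥤ C} {H : A ⥤ B} (e : H ⋙ G ≅ F) [F.Additive]
    [G.Additive] [G.Faithful] : H.Additive := by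
  have : (H ⋙ G).Additive := additive_of_iso e.symm
  exact ⟨fun {X Y f g} => G.map_injective
    (((H ⋙ G).map_add (f := f) (g := g)).trans (G.map_add (f := H.map f) (g := H.map g)).symm)⟩

end

namespace ExactCat

variable {X X' : ExactCat.{w}}

lemma shortExact_map_iff_of_iso {A : Type w} [Category.{w} A] [Abelian A] {F G : X.E ⥤ A}
    [F.PreservesZeroMorphisms] [G.PreservesZeroMorphisms] (e : F ≅ G) (S : ShortComplex X.E) :
    (S.map F).ShortExact ↔ (S.map G).ShortExact :=
  ⟨fun h => ShortComplex.shortExact_of_iso (S.mapNatIso e) h,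
    fun h => ShortComplex.shortExact_of_iso (S.mapNatIso e).symm h⟩

lemma distinguished_iff_of_iso {C D : Type w} [Category.{w} C] [Category.{w} D] [Preadditive D]
    [Preadditive C] [HasZeroObject D] [HasShift D ℤ]
    [∀ n : ℤ, (CategoryTheory.shiftFunctor D n).Additive] [Pretriangulated D]
    {F G : C ⥤ D} (e : F ≅ G) (S : ShortComplex C) :
    (∃ δ : F.obj S.X₃ ⟶ (F.obj S.X₁)⟦(1 : ℤ)⟧,
      Triangle.mk (F.map S.f) (F.map S.g) δ ∈ distTriang D) ↔
    (∃ δ : G.obj S.X₃ ⟶ (G.obj S.X₁)⟦(1 : ℤ)⟧,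
      Triangle.mk (G.map S.f) (G.map S.g) δ ∈ distTriang D) := by
  have key : ∀ {F G : C ⥤ D} (_ : F ≅ G), (∃ δ : F.obj S.X₃ ⟶ (F.obj S.X₁)⟦(1 : ℤ)⟧,
      Triangle.mk (F.map S.f) (F.map S.g) δ ∈ distTriang D) →
    (∃ δ : G.obj S.X₃ ⟶ (G.obj S.X₁)⟦(1 : ℤ)⟧,
      Triangle.mk (G.map S.f) (G.map S.g) δ ∈ distTriang D) := by
    rintro F G e ⟨δ, H⟩
    refine ⟨e.inv.app _ ≫ δ ≫ (e.hom.app _)⟦(1 : ℤ)⟧', isomorphic_distinguished _ H _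
      (Triangle.isoMk _ _ (e.symm.app _) (e.symm.app _) (e.symm.app _) ?_ ?_ ?_)⟩
    · exact e.inv.naturality S.f
    · exact e.inv.naturality S.g
    · change (e.inv.app _ ≫ δ ≫ (e.hom.app _)⟦(1 : ℤ)⟧') ≫ (e.inv.app _)⟦(1 : ℤ)⟧' =
        e.inv.app _ ≫ δ
      rw [Category.assoc, Category.assoc, ← Functor.map_comp, e.hom_inv_id_app]
      simp
  exact ⟨key e, key e.symm⟩

lemma IsSubcategory.unique {Z : AbSub.{w}} (h : X.IsSubcategory Z) (h' : X'.IsSubcategory Z) :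
    X.IsEquivalent X' := by
  obtain ⟨J, _, _, _, hJ, hc⟩ := h
  obtain ⟨J', _, _, _, hJ', hc'⟩ := h'
  obtain ⟨H, ⟨e⟩⟩ := exists_comp_iso J J' (fun W => by
    rw [hJ', ← hJ]
    exact J.obj_mem_essImage W)
  have := additive_of_comp_iso e
  refine ⟨H, this, isEquivalence_of_comp_iso e (fun W => by
    rw [hJ, ← hJ']
    exact J'.obj_mem_essImage W), fun S => ?_⟩
  rw [hc, hc']
  exact (shortExact_map_iff_of_iso e S).symm

lemma IsIntersectionOfHearts.unique {Y : TPair.{w}} (h : X.IsIntersectionOfHearts Y)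
    (h' : X'.IsIntersectionOfHearts Y) : X.IsEquivalent X' := by
  obtain ⟨J, _, _, _, hJ, hc⟩ := h
  obtain ⟨J', _, _, _, hJ', hc'⟩ := h'
  obtain ⟨H, ⟨e⟩⟩ := exists_comp_iso J J' (fun W => by
    rw [hJ', ← hJ]
    exact J.obj_mem_essImage W)
  have := additive_of_comp_iso e
  refine ⟨H, this, isEquivalence_of_comp_iso e (fun W => by
    rw [hJ, ← hJ']
    exact J'.obj_mem_essImage W), fun S => ?_⟩
  rw [hc, hc']
  exact (distinguished_iff_of_iso e S).symm

lemma essImage_comp_of_isEquivalence {A B C : Type w} [Category.{w} A] [Category.{w} B]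
    [Category.{w} C] (F : A ⥤ B) [F.IsEquivalence] (G : B ⥤ C) :
    (F ⋙ G).essImage = G.essImage := by
  ext Z
  exact ⟨fun ⟨Y, ⟨e⟩⟩ => ⟨F.obj Y, ⟨e⟩⟩,
    fun ⟨Y, ⟨e⟩⟩ => ⟨F.objPreimage Y, ⟨G.mapIso (F.objObjPreimageIso Y) ≪≫ e⟩⟩⟩

lemma IsEquivalent.isSubcategory (h : X.IsEquivalent X') {Z : AbSub.{w}}
    (h' : X'.IsSubcategory Z) : X.IsSubcategory Z := by
  obtain ⟨F, _, _, hF⟩ := h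
  obtain ⟨J, _, _, _, hJ, hc⟩ := h'
  exact ⟨F ⋙ J, inferInstance, inferInstance, inferInstance,
    (essImage_comp_of_isEquivalence F J).trans hJ, fun S => (hF S).trans (hc _)⟩

lemma IsEquivalent.isIntersectionOfHearts (h : X.IsEquivalent X') {Y : TPair.{w}}
    (h' : X'.IsIntersectionOfHearts Y) : X.IsIntersectionOfHearts Y := by
  obtain ⟨F, _, _, hF⟩ := h
  obtain ⟨J, _, _, _, hJ, hc⟩ := h'
  exact ⟨F ⋙ J, inferInstance, inferInstance, inferInstance,
    (essImage_comp_of_isEquivalence F J).trans hJ, fun S => (hF S).trans (hc _)⟩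

lemma shortExact_map_iff_of_isEquivalence {A B : Type w} [Category.{w} A] [Abelian A]
    [Category.{w} B] [Abelian B] (F : A ⥤ B) [F.IsEquivalence] [F.PreservesZeroMorphisms]
    (S : ShortComplex A) : S.ShortExact ↔ (S.map F).ShortExact := by
  refine ⟨fun h => h.map_of_exact F, fun h => ?_⟩
  exact { exact := (ShortComplex.exact_map_iff_of_faithful S F).1 h.exact
          mono_f := F.mono_of_mono_map h.mono_f
          epi_g := F.epi_of_epi_map h.epi_g }

lemma IsSubcategory.of_isEquivalent {Z Z' : AbSub.{w}} (h : X.IsSubcategory Z)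
    (hZ : Z.IsEquivalent Z') : X.IsSubcategory Z' := by
  obtain ⟨J, _, _, _, hJ, hc⟩ := h
  obtain ⟨F, _, hF⟩ := hZ
  -- An equivalence is automatically additive, because it preserves biproducts.
  have := preservesBinaryBiproducts_of_preservesBinaryProducts F
  have : F.Additive := Functor.additive_of_preservesBinaryBiproducts F
  refine ⟨J ⋙ F, inferInstance, inferInstance, inferInstance, ?_, fun S => (hc S).trans
    (shortExact_map_iff_of_isEquivalence F _)⟩
  ext W
  have h₁ : Z'.P W ↔ Z.P (F.objPreimage W) := by
    rw [hF]
    exact Z'.P.prop_iff_of_iso (F.objObjPreimageIso W).symm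
  rw [h₁, ← hJ]
  exact ⟨fun ⟨Y, ⟨e⟩⟩ => ⟨Y, ⟨F.preimageIso (e ≪≫ (F.objObjPreimageIso W).symm)⟩⟩,
    fun ⟨Y, ⟨e⟩⟩ => ⟨Y, ⟨F.mapIso e ≪≫ F.objObjPreimageIso W⟩⟩⟩

lemma IsIntersectionOfHearts.of_isEquivalent {Y Y' : TPair.{w}} (h : X.IsIntersectionOfHearts Y)
    (hY : Y.IsEquivalent Y') : X.IsIntersectionOfHearts Y' := by
  obtain ⟨J, _, _, _, hJ, hc⟩ := h
  obtain ⟨F, _, _, _, hD, hT⟩ := hY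
  refine ⟨J ⋙ F, inferInstance, inferInstance, inferInstance, ?_, fun S => ?_⟩
  · ext W
    have h₁ : (Y'.D.heart ⊓ Y'.T.heart) W ↔ (Y.D.heart ⊓ Y.T.heart) (F.objPreimage W) := by
      refine Iff.trans ((Y'.D.heart ⊓ Y'.T.heart).prop_iff_of_iso (F.objObjPreimageIso W).symm) ?_
      exact and_congr (heart_iff_of_le_zero_iff F hD _).symm (heart_iff_of_le_zero_iff F hT _).symm
    rw [h₁, ← hJ]
    exact ⟨fun ⟨Y, ⟨e⟩⟩ => ⟨Y, ⟨F.preimageIso (e ≪≫ (F.objObjPreimageIso W).symm)⟩⟩,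
      fun ⟨Y, ⟨e⟩⟩ => ⟨Y, ⟨F.mapIso e ≪≫ F.objObjPreimageIso W⟩⟩⟩
  · rw [hc]
    constructor
    · rintro ⟨δ, H⟩
      exact ⟨_, F.map_distinguished _ H⟩
    · rintro ⟨δ, H⟩
      obtain ⟨α, hα⟩ := F.map_surjective
        (δ ≫ (F.commShiftIso (1 : ℤ)).inv.app (J.obj S.X₁) : F.obj (J.obj S.X₃) ⟶ _)
      have hα' : F.map α ≫ (F.commShiftIso (1 : ℤ)).hom.app (J.obj S.X₁) = δ := by
        rw [hα, Category.assoc, Iso.inv_hom_id_app]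
        exact Category.comp_id _
      refine ⟨α, ?_⟩
      rw [← F.map_distinguished_iff]
      convert H using 1
      exact congr_arg (Triangle.mk (F.map (J.map S.f)) (F.map (J.map S.g))) hα'

end ExactCat

end NQuasiAbelian

/-! ### Subcategories closed under cosyzygies or syzygies are `n`-quasi-abelian -/

namespace NQuasiAbelian

section

variable {E : Type w} [Category.{w} E] [Preadditive E] {conf : ObjectProperty (ShortComplex E)}

lemma deflation_of_isColimit [HasKernels E] (hc : ∀ S, IsKernelCokernelPair S → conf S)
    {A B Q : E} {f : A ⟶ B} {p : B ⟶ Q} {w' : f ≫ p = 0}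
    (hp : IsColimit (CokernelCofork.ofπ p w')) : IsDeflation conf p := by
  have : Epi p := Cofork.IsColimit.epi hp
  have hf : kernel.lift p f w' ≫ kernel.ι p = f := kernel.lift_ι _ _ _
  refine ⟨kernel p, kernel.ι p, kernel.condition p, hc _ ⟨⟨kernelIsKernel p⟩, ⟨?_⟩⟩⟩
  have key : ∀ {T : E} (t : B ⟶ T), kernel.ι p ≫ t = 0 → ∃ l : Q ⟶ T, p ≫ l = t :=
    fun {T} t ht => by
      obtain ⟨l, hl⟩ := CokernelCofork.IsColimit.desc' hp t (by
        rw [← hf, Category.assoc, ht, comp_zero])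
      exact ⟨l, hl⟩
  exact CokernelCofork.IsColimit.ofπ _ _ (fun t ht => (key t ht).choose)
    (fun t ht => (key t ht).choose_spec)
    (fun t ht m hm => by rw [← cancel_epi p, hm, (key t ht).choose_spec])

lemma normalMono_of_inflation (h : IsExactStructure conf) {X Y : E} {i : X ⟶ Y}
    (hi : IsInflation conf i) : Nonempty (NormalMono i) := by
  obtain ⟨Z, p, z, hc⟩ := hi
  obtain ⟨⟨hi'⟩, _⟩ := h.pair hc
  exact ⟨⟨Z, p, z, hi'⟩⟩

lemma normalEpi_of_deflation (h : IsExactStructure conf) {Y Z : E} {p : Y ⟶ Z}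
    (hp : IsDeflation conf p) : Nonempty (NormalEpi p) := by
  obtain ⟨X, i, z, hc⟩ := hp
  obtain ⟨_, ⟨hp'⟩⟩ := h.pair hc
  exact ⟨⟨X, i, z, hp'⟩⟩

/-- Under these hypotheses all kernels are inflations and all cokernels are deflations, so the
stability conditions are those of the exact structure. -/
lemma isQuasiAbelian (h : IsExactStructure conf) (hc : ∀ S, IsKernelCokernelPair S → conf S)
    [HasKernels E] [HasCokernels E] [HasZeroObject E] [HasBinaryBiproducts E] : IsQuasiAbelian E :=
  ⟨inferInstance, inferInstance,
    fun _ _ _ _ _ _ _ _ sq ⟨hi⟩ => normalMono_of_inflation h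
      (h.inflation_pushout sq (inflation_of_isLimit hc hi.isLimit)),
    fun _ _ _ _ _ _ _ _ sq ⟨hp⟩ => normalEpi_of_deflation h
      (h.deflation_pullback sq (deflation_of_isColimit hc hp.isColimit))⟩

end

section

variable {A : Type w} [Category.{w} A] [Abelian A] {P : ObjectProperty A}

lemma hasKernel_of_prop {X Y : P.FullSubcategory} (f : X ⟶ Y) (h : P (kernel f.hom)) :
    HasKernel f := by
  let K : P.FullSubcategory := ⟨_, h⟩
  let i : K ⟶ X := ObjectProperty.homMk (kernel.ι f.hom)
  refine ⟨⟨_, KernelFork.IsLimit.ofι i (by ext; exact kernel.condition f.hom)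
    (fun t ht => ObjectProperty.homMk (kernel.lift f.hom t.hom (congr_arg (·.hom) ht)))
    (fun t ht => ?_) (fun t ht m hm => ?_)⟩⟩
  · ext
    exact kernel.lift_ι _ _ _
  · ext
    exact (congr_arg (·.hom) hm).trans (kernel.lift_ι f.hom t.hom _).symm

lemma hasCokernel_of_prop {X Y : P.FullSubcategory} (f : X ⟶ Y) (h : P (cokernel f.hom)) :
    HasCokernel f := by
  let K : P.FullSubcategory := ⟨_, h⟩
  let i : Y ⟶ K := ObjectProperty.homMk (cokernel.π f.hom)
  refine ⟨⟨_, CokernelCofork.IsColimit.ofπ i (by ext; exact cokernel.condition f.hom)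
    (fun t ht => ObjectProperty.homMk (cokernel.desc f.hom t.hom (congr_arg (·.hom) ht)))
    (fun t ht => ?_) (fun t ht m hm => ?_)⟩⟩
  · ext
    exact cokernel.π_desc _ _ _
  · ext
    exact (congr_arg (·.hom) hm).trans (cokernel.π_desc f.hom t.hom _).symm

lemma epi_hom_of_deflation [P.IsClosedUnderIsomorphisms] {X Y : P.FullSubcategory} {p : X ⟶ Y}
    (h : IsDeflation (inducedConflations P) p) : Epi p.hom :=
  ((isDeflation_iff p).1 h).1

lemma mono_hom_of_inflation [P.IsClosedUnderIsomorphisms] {X Y : P.FullSubcategory} {i : X ⟶ Y}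
    (h : IsInflation (inducedConflations P) i) : Mono i.hom :=
  ((isInflation_iff i).1 h).1

/-- The `D`-cokernel is tested on an embedding of `cokernel f.hom` into an object of `P`. This shows
that `kernel g.hom` has zero image in `cokernel f.hom`. -/
lemma exact_of_isDCokernel [P.IsClosedUnderIsomorphisms]
    (hP : ∀ X : A, ∃ (Y : A) (i : X ⟶ Y), P Y ∧ Mono i) {X Y Z : P.FullSubcategory} {f : X ⟶ Y}
    {g : Y ⟶ Z} (h : IsDCokernel (inducedConflations P) f g) :
    ∃ w' : f.hom ≫ g.hom = 0, (ShortComplex.mk f.hom g.hom w').Exact := by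
  refine ⟨congr_arg (·.hom) h.1, ?_⟩
  rw [ShortComplex.exact_iff_kernel_ι_comp_cokernel_π_zero]
  obtain ⟨W, i, hW, _⟩ := hP (cokernel f.hom)
  obtain ⟨N, π, k, hπ, hk⟩ := h.2 (X := ⟨W, hW⟩) (ObjectProperty.homMk (cokernel.π f.hom ≫ i))
    (by ext; exact cokernel.condition_assoc _ _ |>.trans zero_comp)
  have := mono_hom_of_inflation hπ
  have hk' : (cokernel.π f.hom ≫ i) ≫ π.hom = g.hom ≫ k.hom := congr_arg (·.hom) hk
  change kernel.ι g.hom ≫ cokernel.π f.hom = 0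
  rw [← cancel_mono i, ← cancel_mono π.hom, Category.assoc, Category.assoc, ← Category.assoc _ i,
    hk', kernel.condition_assoc]
  simp

lemma exact_of_isDKernel [P.IsClosedUnderIsomorphisms]
    (hP : ∀ X : A, ∃ (Y : A) (p : Y ⟶ X), P Y ∧ Epi p) {X Y Z : P.FullSubcategory} {f : X ⟶ Y}
    {g : Y ⟶ Z} (h : IsDKernel (inducedConflations P) f g) :
    ∃ w' : f.hom ≫ g.hom = 0, (ShortComplex.mk f.hom g.hom w').Exact := by
  refine ⟨congr_arg (·.hom) h.1, ?_⟩
  rw [ShortComplex.exact_iff_kernel_ι_comp_cokernel_π_zero]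
  obtain ⟨W, p, hW, _⟩ := hP (kernel g.hom)
  obtain ⟨N, π, k, hπ, hk⟩ := h.2 (X := ⟨W, hW⟩) (ObjectProperty.homMk (p ≫ kernel.ι g.hom))
    (by ext; change (p ≫ kernel.ι g.hom) ≫ g.hom = 0; simp)
  have := epi_hom_of_deflation hπ
  have hk' : π.hom ≫ p ≫ kernel.ι g.hom = k.hom ≫ f.hom := congr_arg (·.hom) hk
  change kernel.ι g.hom ≫ cokernel.π f.hom = 0
  rw [← cancel_epi p, ← cancel_epi π.hom, ← Category.assoc p, ← Category.assoc π.hom, hk',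
    Category.assoc, cokernel.condition]
  simp

/-- A sequence of morphisms of the subcategory which is exact in the abelian category. -/
lemma isCosyzygy_kernel_cokernel {m : ℕ} (S : ComposableArrows P.FullSubcategory (m + 1))
    (hS : ∀ (j : ℕ) (hj : j + 2 ≤ m + 1),
      ∃ w' : (S.map' j (j + 1)).hom ≫ (S.map' (j + 1) (j + 2)).hom = 0,
        (ShortComplex.mk _ _ w').Exact) :
    IsCosyzygy P (m + 2) (kernel (S.map' 0 1).hom) (cokernel (S.map' m (m + 1)).hom) := by
  let d (k : ℕ) (hk : k < m + 1) : (S.obj' k).obj ⟶ (S.obj' (k + 1)).obj := (S.map' k (k + 1)).hom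
  have h₀ : ∀ {X Y : A} (f : X ⟶ Y), ∃ w' : kernel.ι f ≫ factorThruImage f = 0,
      (ShortComplex.mk (kernel.ι f) (factorThruImage f) w').ShortExact := fun f => by
    have w' : kernel.ι f ≫ factorThruImage f = 0 := by
      rw [← cancel_mono (image.ι f)]
      simp
    refine ⟨w', { exact := ShortComplex.exact_of_f_is_kernel _ ?_,
                  mono_f := inferInstanceAs (Mono (kernel.ι f)),
                  epi_g := inferInstanceAs (Epi (factorThruImage f)) }⟩
    exact KernelFork.IsLimit.ofι _ _ (fun t ht => kernel.lift f t (by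
      rw [← image.fac f, reassoc_of% ht, zero_comp])) (fun t ht => kernel.lift_ι _ _ _)
      (fun t ht m hm => by rw [← cancel_mono (kernel.ι f), hm, kernel.lift_ι])
  have h₁ : ∀ {X Y : A} (f : X ⟶ Y), ∃ w' : image.ι f ≫ cokernel.π f = 0,
      (ShortComplex.mk (image.ι f) (cokernel.π f) w').ShortExact := fun f => by
    have w' : image.ι f ≫ cokernel.π f = 0 := by
      rw [← cancel_epi (factorThruImage f)]
      simp
    refine ⟨w', { exact := ShortComplex.exact_of_g_is_cokernel _ ?_,
                  mono_f := inferInstanceAs (Mono (image.ι f)),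
                  epi_g := inferInstanceAs (Epi (cokernel.π f)) }⟩
    exact CokernelCofork.IsColimit.ofπ _ _ (fun t ht => cokernel.desc f t (by
      rw [← image.fac f, Category.assoc, ht, comp_zero])) (fun t ht => cokernel.π_desc _ _ _)
      (fun t ht m hm => by rw [← cancel_epi (cokernel.π f), hm, cokernel.π_desc])
  have key : ∀ (k : ℕ) (hk : k < m + 1),
      IsCosyzygy P (k + 1) (kernel (d 0 (by omega))) (image (d k hk)) := by
    intro k
    induction k with
    | zero =>
      intro hk
      obtain ⟨w', h⟩ := h₀ (d 0 hk)
      exact .succ _ _ w' h (S.obj' 0).property (.zero (Iso.refl _))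
    | succ k ih =>
      intro hk
      obtain ⟨w', h⟩ := hS k (by omega)
      obtain ⟨w'', h⟩ := shortExact_image (d k (by omega)) (d (k + 1) hk) w' h
      exact (ih (by omega)).snoc _ _ _ h (S.obj' (k + 1)).property
  obtain ⟨w', h⟩ := h₁ (d m (by omega))
  exact (key m (by omega)).snoc _ _ _ h (S.obj' (m + 1)).property

lemma shortExact_kernel {X Y : A} (p : X ⟶ Y) [Epi p] :
    (ShortComplex.mk (kernel.ι p) p (kernel.condition p)).ShortExact where
  exact := ShortComplex.exact_of_f_is_kernel _ (kernelIsKernel p)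
  mono_f := inferInstanceAs (Mono (kernel.ι p))
  epi_g := inferInstanceAs (Epi p)

lemma shortExact_cokernel {X Y : A} (i : X ⟶ Y) [Mono i] :
    (ShortComplex.mk i (cokernel.π i) (cokernel.condition i)).ShortExact where
  exact := ShortComplex.exact_of_g_is_cokernel _ (cokernelIsCokernel i)
  mono_f := inferInstanceAs (Mono i)
  epi_g := inferInstanceAs (Epi (cokernel.π i))

lemma isNQuasiAbelian_zero (hP : ∀ Z, P Z) : IsNQuasiAbelian (inducedConflations P) 0 := by
  have : P.ι.EssSurj := ⟨fun Z => ⟨⟨Z, hP Z⟩, ⟨Iso.refl _⟩⟩⟩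
  have : P.ι.IsEquivalence := { }
  have : HasFiniteProducts P.FullSubcategory :=
    ⟨fun _ => Adjunction.hasLimitsOfShape_of_equivalence P.ι⟩
  refine ⟨⟨abelianOfEquivalence P.ι⟩, fun S ⟨⟨h₁⟩, ⟨h₂⟩⟩ => ?_⟩
  rw [inducedConflations, ← isKernelCokernelPair_iff_shortExact]
  exact ⟨⟨KernelFork.mapIsLimit _ h₁ P.ι⟩, ⟨CokernelCofork.mapIsColimit _ h₂ P.ι⟩⟩

/-- Closure under quotients keeps the image of a `D`-kernel in `P`. A lift that exists only after a
deflation descends by the diagonal filler of an epimorphism against a monomorphism. -/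
lemma isLimit_image_of_isDKernel [P.IsClosedUnderIsomorphisms]
    (hq : ∀ {Y Z : A} (p : Y ⟶ Z) [Epi p], P Y → P Z)
    {K X Y : P.FullSubcategory} {i : K ⟶ X} {f : X ⟶ Y}
    (h : IsDKernel (inducedConflations P) i f) :
    ∃ (I : P.FullSubcategory) (j : I ⟶ X) (z : j ≫ f = 0),
      Mono j.hom ∧ Nonempty (IsLimit (KernelFork.ofι j z)) := by
  let I : P.FullSubcategory := ⟨image i.hom, hq (factorThruImage i.hom) K.property⟩
  let j : I ⟶ X := ObjectProperty.homMk (image.ι i.hom)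
  have hj : Mono j.hom := inferInstanceAs (Mono (image.ι i.hom))
  have hj' : Mono j := P.ι.mono_of_mono_map hj
  have z : j ≫ f = 0 := by
    refine ObjectProperty.hom_ext _ ?_
    change image.ι i.hom ≫ f.hom = 0
    rw [← cancel_epi (factorThruImage i.hom), image.fac_assoc, comp_zero]
    exact congr_arg (·.hom) h.1
  have key : ∀ {T : P.FullSubcategory} (t : T ⟶ X), t ≫ f = 0 → ∃ l : T ⟶ I, l ≫ j = t := by
    intro T t ht
    obtain ⟨N, π, k, hπ, hk⟩ := h.2 t ht
    have := epi_hom_of_deflation hπ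
    have hk' : π.hom ≫ t.hom = k.hom ≫ i.hom := congr_arg (·.hom) hk
    have sq : CommSq (k.hom ≫ factorThruImage i.hom) π.hom (image.ι i.hom) t.hom :=
      ⟨by rw [Category.assoc, image.fac, hk']⟩
    have := strongEpi_of_epi π.hom
    exact ⟨ObjectProperty.homMk sq.lift, by ext; exact sq.fac_right⟩
  exact ⟨I, j, z, hj, ⟨KernelFork.IsLimit.ofι _ _ (fun t ht => (key t ht).choose)
    (fun t ht => (key t ht).choose_spec)
    (fun t ht m hm => by rw [← cancel_mono j, hm, (key t ht).choose_spec])⟩⟩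

lemma isColimit_image_of_isDCokernel [P.IsClosedUnderIsomorphisms]
    (hs : ∀ {Y Z : A} (i : Y ⟶ Z) [Mono i], P Z → P Y)
    {X Y Q : P.FullSubcategory} {f : X ⟶ Y} {p : Y ⟶ Q}
    (h : IsDCokernel (inducedConflations P) f p) :
    ∃ (I : P.FullSubcategory) (q : Y ⟶ I) (z : f ≫ q = 0),
      Epi q.hom ∧ Nonempty (IsColimit (CokernelCofork.ofπ q z)) := by
  let I : P.FullSubcategory := ⟨image p.hom, hs (image.ι p.hom) Q.property⟩
  let q : Y ⟶ I := ObjectProperty.homMk (factorThruImage p.hom)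
  have hq : Epi q.hom := inferInstanceAs (Epi (factorThruImage p.hom))
  have hq' : Epi q := P.ι.epi_of_epi_map hq
  have z : f ≫ q = 0 := by
    refine ObjectProperty.hom_ext _ ?_
    change f.hom ≫ factorThruImage p.hom = 0
    rw [← cancel_mono (image.ι p.hom), Category.assoc, image.fac, zero_comp]
    exact congr_arg (·.hom) h.1
  have key : ∀ {T : P.FullSubcategory} (t : Y ⟶ T), f ≫ t = 0 → ∃ l : I ⟶ T, q ≫ l = t := by
    intro T t ht
    obtain ⟨N, π, k, hπ, hk⟩ := h.2 t ht
    have := mono_hom_of_inflation hπ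
    have hk' : t.hom ≫ π.hom = p.hom ≫ k.hom := congr_arg (·.hom) hk
    have sq : CommSq t.hom (factorThruImage p.hom) π.hom (image.ι p.hom ≫ k.hom) :=
      ⟨by rw [image.fac_assoc, hk']⟩
    have := strongEpi_of_epi (factorThruImage p.hom)
    exact ⟨ObjectProperty.homMk sq.lift, by ext; exact sq.fac_left⟩
  exact ⟨I, q, z, hq, ⟨CokernelCofork.IsColimit.ofπ _ _ (fun t ht => (key t ht).choose)
    (fun t ht => (key t ht).choose_spec)
    (fun t ht m hm => by rw [← cancel_epi q, hm, (key t ht).choose_spec])⟩⟩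

/-- A cogenerating subcategory which contains its `n`-fold cosyzygies is `n`-quasi-abelian. -/
lemma isNQuasiAbelian_of_cogenerates [P.IsClosedUnderIsomorphisms]
    [HasZeroObject P.FullSubcategory] [HasBinaryBiproducts P.FullSubcategory]
    (hE : IsExactStructure (inducedConflations P))
    (hP : ∀ X : A, ∃ (Y : A) (i : X ⟶ Y), P Y ∧ Mono i) {n : ℕ}
    (hc : ∀ Y Z, IsCosyzygy P n Y Z → P Z) (hk : HasDKernels (inducedConflations P))
    (hk' : HasDCokernels (inducedConflations P)) : IsNQuasiAbelian (inducedConflations P) n := by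
  match n, hc with
  -- Cosyzygies of length `0` are isomorphisms, so `P` contains every object.
  | 0, hc => exact isNQuasiAbelian_zero fun Z => hc Z Z (.zero (Iso.refl _))
  | 1, hc =>
    -- Cosyzygies of length `1` are the quotients of objects of `P`.
    have hq : ∀ {Y Z : A} (p : Y ⟶ Z) [Epi p], P Y → P Z := fun p _ hY =>
      hc _ _ (.succ _ _ _ (shortExact_kernel p) hY (.zero (Iso.refl _)))
    have : HasCokernels P.FullSubcategory :=
      ⟨fun {X Y} f => hasCokernel_of_prop f (hq (cokernel.π f.hom) Y.property)⟩
    have : HasKernels P.FullSubcategory := ⟨fun {X Y} f => by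
      obtain ⟨K, i, h⟩ := hk f
      obtain ⟨I, j, z, _, ⟨hj⟩⟩ := isLimit_image_of_isDKernel hq h
      exact ⟨⟨_, hj⟩⟩⟩
    have hS : ∀ S, IsKernelCokernelPair S → inducedConflations P S := fun S ⟨⟨h₁⟩, ⟨h₂⟩⟩ => by
      refine hE.conf_of_cokernel S.zero ?_ h₂
      rw [isInflation_iff]
      obtain ⟨K, i, h⟩ := hk S.g
      obtain ⟨I, j, z, hj, ⟨hj'⟩⟩ := isLimit_image_of_isDKernel hq h
      let e : S.X₁ ≅ I := h₁.conePointUniqueUpToIso hj'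
      have he : e.hom ≫ j = S.f := h₁.conePointUniqueUpToIso_hom_comp hj' .zero
      refine ⟨?_, hq (cokernel.π S.f.hom) S.X₂.property⟩
      rw [← he]
      have : Mono e.hom.hom := inferInstanceAs (Mono (P.ι.map e.hom))
      exact mono_comp e.hom.hom j.hom
    exact ⟨isQuasiAbelian hE hS, hS⟩
  -- Sequences of `D`-cokernels are exact in `A`, so the cokernel of the last morphism is an `(m +
  -- 2)`-fold cosyzygy.
  | m + 2, hc =>
    exact ⟨hk, hk', Or.inr fun S hS => hasCokernel_of_prop _ (hc _ _
      (isCosyzygy_kernel_cokernel S fun j hj => exact_of_isDCokernel hP (hS j hj)))⟩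

/-- A generating subcategory which contains its `n`-fold syzygies is `n`-quasi-abelian. -/
lemma isNQuasiAbelian_of_generates [P.IsClosedUnderIsomorphisms]
    [HasZeroObject P.FullSubcategory] [HasBinaryBiproducts P.FullSubcategory]
    (hE : IsExactStructure (inducedConflations P))
    (hP : ∀ X : A, ∃ (Y : A) (p : Y ⟶ X), P Y ∧ Epi p) {n : ℕ}
    (hc : ∀ Y Z, IsCosyzygy P n Y Z → P Y) (hk : HasDKernels (inducedConflations P))
    (hk' : HasDCokernels (inducedConflations P)) : IsNQuasiAbelian (inducedConflations P) n := by
  match n, hc with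
  | 0, hc => exact isNQuasiAbelian_zero fun Z => hc Z Z (.zero (Iso.refl _))
  | 1, hc =>
    have hq : ∀ {Y Z : A} (i : Y ⟶ Z) [Mono i], P Z → P Y := fun i _ hZ =>
      hc _ _ (.succ _ _ _ (shortExact_cokernel i) hZ (.zero (Iso.refl _)))
    have : HasKernels P.FullSubcategory :=
      ⟨fun {X Y} f => hasKernel_of_prop f (hq (kernel.ι f.hom) X.property)⟩
    have : HasCokernels P.FullSubcategory := ⟨fun {X Y} f => by
      obtain ⟨K, i, h⟩ := hk' f
      obtain ⟨I, j, z, _, ⟨hj⟩⟩ := isColimit_image_of_isDCokernel hq h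
      exact ⟨⟨_, hj⟩⟩⟩
    have hS : ∀ S, IsKernelCokernelPair S → inducedConflations P S := fun S ⟨⟨h₁⟩, ⟨h₂⟩⟩ => by
      refine hE.conf_of_kernel S.zero ?_ h₁
      rw [isDeflation_iff]
      obtain ⟨K, i, h⟩ := hk' S.f
      obtain ⟨I, j, z, hj, ⟨hj'⟩⟩ := isColimit_image_of_isDCokernel hq h
      let e : I ≅ S.X₃ := hj'.coconePointUniqueUpToIso h₂
      have he : j ≫ e.hom = S.g := hj'.comp_coconePointUniqueUpToIso_hom h₂ .one
      refine ⟨?_, hq (kernel.ι S.g.hom) S.X₂.property⟩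
      rw [← he]
      have : Epi e.hom.hom := inferInstanceAs (Epi (P.ι.map e.hom))
      exact epi_comp j.hom e.hom.hom
    exact ⟨isQuasiAbelian hE hS, hS⟩
  | m + 2, hc =>
    exact ⟨hk, hk', Or.inl fun S hS => hasKernel_of_prop _ (hc _ _
      (isCosyzygy_kernel_cokernel S fun j hj => exact_of_isDKernel hP (hS j hj)))⟩

end

end NQuasiAbelian

/-! ### Opposite exact categories -/

namespace NQuasiAbelian

section

variable {A : Type w} [Category.{w} A] [Abelian A] {P : ObjectProperty A}

lemma prop_of_biprod' [P.IsClosedUnderIsomorphisms] {n : ℕ}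
    (hc : ∀ Y Z, IsCosyzygy P n Y Z → P Y) {B B' : A} (h : P (B ⊞ B')) : P B := by
  have key : ∀ k, (∃ Y, IsCosyzygy P k B Y) ∧ ∃ Y, IsCosyzygy P k B' Y := by
    intro k
    induction k with
    | zero => exact ⟨⟨_, .zero (Iso.refl _)⟩, ⟨_, .zero (Iso.refl _)⟩⟩
    | succ k ih =>
      obtain ⟨⟨Y, hY⟩, ⟨Y', hY'⟩⟩ := ih
      exact ⟨⟨Y', .succ _ _ _ (shortExact_inl_snd B B') h hY'⟩,
        ⟨Y, .succ _ _ _ (shortExact_inl_snd B' B) (P.prop_of_iso (biprod.braiding B B') h) hY⟩⟩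
  obtain ⟨⟨Y, hY⟩, -⟩ := key n
  exact hc _ _ hY

lemma prop_of_isZero [P.IsClosedUnderIsomorphisms] (h : ∀ B B', P (B ⊞ B') → P B) {Y : A}
    (hY : P Y) {Z : A} (hZ : IsZero Z) : P Z :=
  h Z Y (P.prop_of_iso (isoZeroBiprod hZ) hY)

/-- The exact category structure on an extension closed subcategory which is closed under direct
summands. -/
noncomputable def exactCatOf (P : ObjectProperty A) [P.IsClosedUnderIsomorphisms]
    [P.IsClosedUnderExtensions] (h : ∀ B B', P (B ⊞ B') → P B) (h₀ : ∃ Y, P Y) : ExactCat.{w} :=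
  have h₁ : ∀ Z, IsZero Z → P Z := fun _ hZ => prop_of_isZero h h₀.choose_spec hZ
  { E := P.FullSubcategory
    hasZeroObject :=
      have : P.ContainsZero := ⟨_, isZero_zero A, h₁ _ (isZero_zero A)⟩
      inferInstance
    hasBinaryBiproducts := hasBinaryBiproducts_fullSubcategory
    idempotentComplete := isIdempotentComplete_fullSubcategory h
    conf := inducedConflations P
    exact := isExactStructure_inducedConflations h₁ }

lemma exactCatOf_isSubcategory (Z : AbSub.{w}) [Z.P.IsClosedUnderExtensions]
    (h : ∀ B B', Z.P (B ⊞ B') → Z.P B) (h₀ : ∃ Y, Z.P Y) :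
    (exactCatOf Z.P h h₀).IsSubcategory Z := by
  refine ⟨Z.P.ι, inferInstanceAs (ObjectProperty.ι Z.P).Additive, inferInstanceAs Z.P.ι.Full, inferInstanceAs Z.P.ι.Faithful, ?_,
    fun S => Iff.rfl⟩
  ext W
  exact ⟨fun ⟨Y, ⟨e⟩⟩ => Z.P.prop_of_iso e Y.property, fun h => ⟨⟨W, h⟩, ⟨Iso.refl _⟩⟩⟩

end

section

variable {E : Type w} [Category.{w} E] [Preadditive E]

open Opposite

/-- The opposite class of conflations. -/
def opConf (conf : ObjectProperty (ShortComplex E)) : ObjectProperty (ShortComplex Eᵒᵖ) :=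
  fun S => conf S.unop

variable {conf : ObjectProperty (ShortComplex E)}

lemma opConf_isInflation_iff {X Y : Eᵒᵖ} (i : X ⟶ Y) :
    IsInflation (opConf conf) i ↔ IsDeflation conf i.unop :=
  ⟨fun ⟨Z, p, z, h⟩ => ⟨Z.unop, p.unop, congr_arg Quiver.Hom.unop z, h⟩,
    fun ⟨Z, p, z, h⟩ => ⟨op Z, p.op, congr_arg Quiver.Hom.op z, h⟩⟩

lemma opConf_isDeflation_iff {X Y : Eᵒᵖ} (i : X ⟶ Y) :
    IsDeflation (opConf conf) i ↔ IsInflation conf i.unop :=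
  ⟨fun ⟨Z, p, z, h⟩ => ⟨Z.unop, p.unop, congr_arg Quiver.Hom.unop z, h⟩,
    fun ⟨Z, p, z, h⟩ => ⟨op Z, p.op, congr_arg Quiver.Hom.op z, h⟩⟩

lemma IsKernelCokernelPair.op {S : ShortComplex Eᵒᵖ} (h : IsKernelCokernelPair S.unop) :
    IsKernelCokernelPair S := by
  obtain ⟨⟨h₁⟩, ⟨h₂⟩⟩ := h
  exact ⟨⟨CokernelCofork.IsColimit.ofπOp _ _ h₂⟩, ⟨KernelFork.IsLimit.ofιOp _ _ h₁⟩⟩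

lemma IsExactStructure.op [HasZeroObject E] [HasBinaryBiproducts E] (h : IsExactStructure conf) :
    IsExactStructure (opConf conf) where
  of_iso e hS := h.of_iso ((ShortComplex.opEquiv E).inverse.mapIso e).unop.symm hS
  pair hS := (h.pair hS).op
  id_zero {Z} hZ := (opConf_isDeflation_iff _).2 (h.inflation_id Z.unop)
  deflation_comp hp hq := by
    rw [opConf_isDeflation_iff] at hp hq ⊢
    exact h.inflation_comp hq hp
  inflation_comp hp hq := by
    rw [opConf_isInflation_iff] at hp hq ⊢
    exact h.deflation_comp hq hp
  pullback {Y Z Z' p} f hp := by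
    rw [opConf_isDeflation_iff] at hp
    obtain ⟨Y', f', i', sq, hi⟩ := h.pushout f.unop hp
    exact ⟨_, f'.op, i'.op, sq.op.flip, (opConf_isDeflation_iff _).2 hi⟩
  pushout {X Y X' i} f hi := by
    rw [opConf_isInflation_iff] at hi
    obtain ⟨Y', f', i', sq, hi⟩ := h.pullback f.unop hi
    exact ⟨_, f'.op, i'.op, sq.op.flip, (opConf_isInflation_iff _).2 hi⟩

/-- The opposite exact category. -/
def ExactCat.op (X : ExactCat.{w}) : ExactCat.{w} where
  E := X.Eᵒᵖ
  conf := opConf X.conf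
  exact := X.exact.op

lemma hasDKernels_of_opConf (h : HasDCokernels (opConf conf)) : HasDKernels conf := by
  intro A B f
  obtain ⟨K, i, hi₁, hi₂⟩ := h f.op
  refine ⟨K.unop, i.unop, congr_arg Quiver.Hom.unop hi₁, fun X j hj => ?_⟩
  obtain ⟨N, π, k, hπ, hk⟩ := hi₂ j.op (congr_arg Quiver.Hom.op hj)
  exact ⟨N.unop, π.unop, k.unop, (opConf_isInflation_iff _).1 hπ, congr_arg Quiver.Hom.unop hk⟩

end

section

variable {A : Type w} [Category.{w} A] [Abelian A]

lemma IsCosyzygy.unop {P : ObjectProperty A} {P' : ObjectProperty Aᵒᵖ}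
    (hP : ∀ Z, P' Z → P Z.unop) {k : ℕ} {Y Z : Aᵒᵖ} (h : IsCosyzygy P' k Y Z) :
    IsCosyzygy P k Z.unop Y.unop := by
  induction h with
  | zero e => exact .zero e.unop
  | succ i p w' hS hI _ ih =>
    exact ih.snoc p.unop i.unop (congr_arg Quiver.Hom.unop w') hS.unop (hP _ hI)

variable {X : ExactCat.{w}} {J : X.E ⥤ A}

/-- Syzygies become cosyzygies in the opposite category, which reduces torsion-free classes to the
results on coresolving subcategories. -/
lemma isCoresolving_op {n : ℕ} [J.Full] [J.Faithful] [J.Additive]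
    (hc : ∀ S, X.conf S ↔ (S.map J).ShortExact)
    (hg : ∀ Z : A, ∃ (Y : A) (p : Y ⟶ Z), J.essImage Y ∧ Epi p)
    (hJ : ∀ Y Z : A, IsCosyzygy J.essImage n Y Z → J.essImage Y) :
    IsCoresolving X.op (J.op : X.Eᵒᵖ ⥤ Aᵒᵖ) n where
  full := inferInstanceAs J.op.Full
  faithful := inferInstanceAs J.op.Faithful
  additive := inferInstanceAs J.op.Additive
  conf_iff S := (hc S.unop).trans ⟨fun h => h.op, fun h => h.unop⟩
  cogenerates Z := by
    obtain ⟨Y, p, ⟨W, ⟨e⟩⟩, _⟩ := hg Z.unop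
    exact ⟨Opposite.op W, (e.hom ≫ p).op, inferInstance⟩
  closed Y Z h := by
    obtain ⟨W, ⟨e⟩⟩ := hJ _ _ (h.unop (P := J.essImage) fun Z ⟨W, ⟨e⟩⟩ => ⟨W.unop, ⟨e.unop.symm⟩⟩)
    exact ⟨Opposite.op W, ⟨e.op.symm⟩⟩

variable {n : ℕ}

/-- The standard t-structure on the derived category of `A` corresponds to one with coaisle
`X.rightGE 0`. This is why `D`-cokernels need not be required of a tilting torsion class. -/
lemma IsCoresolving.hasDCokernels (hJ : IsCoresolving X J n) : HasDCokernels X.conf := by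
  let _ : HasDerivedCategory.{w} A := HasDerivedCategory.standard A
  have := hJ.additive
  obtain ⟨Φ, _, _, _, -, -, hΦ⟩ := hJ.exists_equivalence
  exact X.hasDCokernels (pullbackT DerivedCategory.TStructure.t Φ) (by
    ext Z
    exact (hΦ 0 Z).symm)

end

end NQuasiAbelian

/-! ### Torsion classes, and recovery of the ambient abelian category -/

namespace NQuasiAbelian

section

variable {n : ℕ}

lemma isCoresolving_of_essImage {X : ExactCat.{w}} {A : Type w} [Category.{w} A] [Abelian A]
    {P : ObjectProperty A} (hP : IsNTiltingTorsionClass n P) (J : X.E ⥤ A) [J.Full] [J.Faithful]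
    [J.Additive] (hJ : J.essImage = P) (hc : ∀ S, X.conf S ↔ (S.map J).ShortExact) :
    IsCoresolving X J n where
  full := inferInstance
  faithful := inferInstance
  additive := inferInstance
  conf_iff := hc
  cogenerates Z := by
    subst hJ
    obtain ⟨Y, i, ⟨W, ⟨e⟩⟩, _⟩ := hP.cogenerates Z
    exact ⟨W, i ≫ e.inv, inferInstance⟩
  closed Y Z h := by
    subst hJ
    exact hP.closed h

lemma isCoresolving_op_of_essImage {X : ExactCat.{w}} {A : Type w} [Category.{w} A] [Abelian A]
    {P : ObjectProperty A} (hP : IsNCotiltingTorsionFreeClass n P) (J : X.E ⥤ A) [J.Full]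
    [J.Faithful] [J.Additive] (hJ : J.essImage = P)
    (hc : ∀ S, X.conf S ↔ (S.map J).ShortExact) :
    IsCoresolving X.op (J.op : X.Eᵒᵖ ⥤ Aᵒᵖ) n := by
  subst hJ
  exact isCoresolving_op hc hP.generates fun Y Z h => hP.closed h

lemma IsNTiltingTorsionClass.exists_isSubcategory (Z : AbSub.{w})
    (hZ : IsNTiltingTorsionClass n Z.P) :
    ∃ X : ExactCat.{w}, IsNQuasiAbelian X.conf n ∧ X.IsSubcategory Z := by
  have := hZ.extensions
  obtain ⟨W, -⟩ := HasZeroObject.zero (C := Z.A)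
  obtain ⟨Y, _, hY, -⟩ := hZ.cogenerates W
  have hX := exactCatOf_isSubcategory Z
    (fun B B' => prop_of_biprod fun Y Z h => hZ.closed h) ⟨Y, hY⟩
  refine ⟨_, ?_, hX⟩
  set X := exactCatOf Z.P (fun B B' => prop_of_biprod fun Y Z h => hZ.closed h) ⟨Y, hY⟩
  obtain ⟨J, _, _, _, hJ, hc⟩ := hX
  have hJ' := isCoresolving_of_essImage hZ J hJ hc
  have : HasZeroObject Z.P.FullSubcategory := X.hasZeroObject
  have : HasBinaryBiproducts Z.P.FullSubcategory := X.hasBinaryBiproducts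
  exact isNQuasiAbelian_of_cogenerates X.exact hZ.cogenerates (fun Y Z h => hZ.closed h)
    hZ.hasDKernels hJ'.hasDCokernels

/-- The missing `D`-kernels are `D`-cokernels of the opposite category, which is coresolving. -/
lemma IsNCotiltingTorsionFreeClass.exists_isSubcategory (Z : AbSub.{w})
    (hZ : IsNCotiltingTorsionFreeClass n Z.P) :
    ∃ X : ExactCat.{w}, IsNQuasiAbelian X.conf n ∧ X.IsSubcategory Z := by
  have := hZ.extensions
  obtain ⟨W, -⟩ := HasZeroObject.zero (C := Z.A)
  obtain ⟨Y, _, hY, -⟩ := hZ.generates W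
  have hX := exactCatOf_isSubcategory Z
    (fun B B' => prop_of_biprod' fun Y Z h => hZ.closed h) ⟨Y, hY⟩
  refine ⟨_, ?_, hX⟩
  set X := exactCatOf Z.P (fun B B' => prop_of_biprod' fun Y Z h => hZ.closed h) ⟨Y, hY⟩
  obtain ⟨J, _, _, _, hJ, hc⟩ := hX
  have hJ' := isCoresolving_op_of_essImage hZ J hJ hc
  have : HasZeroObject Z.P.FullSubcategory := X.hasZeroObject
  have : HasBinaryBiproducts Z.P.FullSubcategory := X.hasBinaryBiproducts
  exact isNQuasiAbelian_of_generates X.exact hZ.generates (fun Y Z h => hZ.closed h)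
    (hasDKernels_of_opConf (conf := X.conf) hJ'.hasDCokernels) hZ.hasDCokernels

end

namespace IsCoresolving

variable {X : ExactCat.{w}} {A : Type w} [Category.{w} A] [Abelian A] {J : X.E ⥤ A} {n : ℕ}

lemma exists_tStructure (hJ : IsCoresolving X J n) :
    ∃ R : TStructure X.Derived, ∀ m, R.ge m = X.rightGE m := by
  let _ : HasDerivedCategory.{w} A := HasDerivedCategory.standard A
  have := hJ.additive
  obtain ⟨Φ, _, _, _, -, -, hΦ⟩ := hJ.exists_equivalence
  exact ⟨pullbackT DerivedCategory.TStructure.t Φ, fun m => by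
    ext Z
    exact (hΦ m Z).symm⟩

/-- The abelian category is the heart of the right t-structure. -/
lemma exists_heart (hJ : IsCoresolving X J n) {R : TStructure X.Derived}
    (hR : ∀ m, R.ge m = X.rightGE m) :
    ∃ (K : A ⥤ X.Derived) (_ : K.Additive), K.Full ∧ K.Faithful ∧ K.essImage = R.heart ∧
      Nonempty (J ⋙ K ≅ X.toDerived) := by
  let _ : HasDerivedCategory.{w} A := HasDerivedCategory.standard A
  have := hJ.additive
  obtain ⟨Φ, _, _, _, -, ⟨e⟩, hΦ⟩ := hJ.exists_equivalence
  have : Φ.Additive := inferInstance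
  have : Φ.asEquivalence.functor.Additive := this
  have : Φ.inv.Additive := Φ.asEquivalence.inverse_additive
  have hge : ∀ m Z, R.ge m Z ↔ DerivedCategory.TStructure.t.ge m (Φ.obj Z) := fun m Z => by
    rw [hR, hΦ]
  have hle := le_iff_of_ge_iff Φ hge
  let S := DerivedCategory.singleFunctor A 0
  refine ⟨S ⋙ Φ.inv, inferInstance, inferInstance, inferInstance, ?_, ⟨?_⟩⟩
  · ext W
    constructor
    · rintro ⟨Y, ⟨e⟩⟩
      refine R.heart.prop_of_iso e ⟨(hle 0 _).2 ?_, (hge 0 _).2 ?_⟩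
      · exact (DerivedCategory.TStructure.t.le 0).prop_of_iso
          (Φ.asEquivalence.counitIso.symm.app (S.obj Y))
            (DerivedCategory.TStructure.t.le_of_isLE (S.obj Y) 0)
      · exact (DerivedCategory.TStructure.t.ge 0).prop_of_iso
          (Φ.asEquivalence.counitIso.symm.app (S.obj Y))
            (DerivedCategory.TStructure.t.ge_of_isGE (S.obj Y) 0)
    · rintro ⟨h₁, h₂⟩
      have : (Φ.obj W).IsLE 0 := ⟨(hle 0 W).1 h₁⟩
      have : (Φ.obj W).IsGE 0 := ⟨(hge 0 W).1 h₂⟩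
      obtain ⟨Y, ⟨e⟩⟩ := DerivedCategory.exists_iso_singleFunctor_obj_of_isGE_of_isLE (Φ.obj W) 0
      exact ⟨Y, ⟨Φ.inv.mapIso e.symm ≪≫ Φ.asEquivalence.unitIso.symm.app W⟩⟩
  · exact (Functor.associator _ _ _).symm ≪≫ Functor.isoWhiskerRight e.symm Φ.inv ≪≫
      Functor.associator _ _ _ ≪≫ Functor.isoWhiskerLeft _ Φ.asEquivalence.unitIso.symm ≪≫
      Functor.rightUnitor _

variable {A' : Type w} [Category.{w} A'] [Abelian A'] {J' : X.E ⥤ A'}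

/-- Both abelian categories are the heart of one and the same t-structure, the one with coaisles
`X.rightGE m`, compatibly with the functors from `X.E`. -/
lemma exists_isEquivalence (hJ : IsCoresolving X J n) (hJ' : IsCoresolving X J' n) :
    ∃ H : A ⥤ A', H.IsEquivalence ∧ ∀ W, J.essImage W ↔ J'.essImage (H.obj W) := by
  obtain ⟨R, hR⟩ := hJ.exists_tStructure
  obtain ⟨K, _, _, _, hK, ⟨e⟩⟩ := hJ.exists_heart hR
  obtain ⟨K', _, _, _, hK', ⟨e'⟩⟩ := hJ'.exists_heart hR
  obtain ⟨H, ⟨i⟩⟩ := exists_comp_iso K K' (fun Z => by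
    rw [hK', ← hK]
    exact K.obj_mem_essImage Z)
  refine ⟨H, isEquivalence_of_comp_iso i (fun Z => by
    rw [hK, ← hK']
    exact K'.obj_mem_essImage Z), fun W => ?_⟩
  rw [essImage_of_comp_iso e, essImage_of_comp_iso e']
  exact X.toDerived.essImage.prop_iff_of_iso (i.symm.app W)

end IsCoresolving

lemma ExactCat.IsSubcategory.isEquivalent_of_tilting {X : ExactCat.{w}} {Z Z' : AbSub.{w}}
    (h : X.IsSubcategory Z) (h' : X.IsSubcategory Z') {n : ℕ} (hZ : IsNTiltingTorsionClass n Z.P)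
    (hZ' : IsNTiltingTorsionClass n Z'.P) : Z.IsEquivalent Z' := by
  obtain ⟨J, _, _, _, hJ, hc⟩ := h
  obtain ⟨J', _, _, _, hJ', hc'⟩ := h'
  obtain ⟨H, h₁, h₂⟩ := (isCoresolving_of_essImage hZ J hJ hc).exists_isEquivalence
    (isCoresolving_of_essImage hZ' J' hJ' hc')
  rw [hJ, hJ'] at h₂
  exact ⟨H, h₁, h₂⟩

lemma ExactCat.IsSubcategory.isEquivalent_of_cotilting {X : ExactCat.{w}} {Z Z' : AbSub.{w}}
    (h : X.IsSubcategory Z) (h' : X.IsSubcategory Z') {n : ℕ}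
    (hZ : IsNCotiltingTorsionFreeClass n Z.P) (hZ' : IsNCotiltingTorsionFreeClass n Z'.P) :
    Z.IsEquivalent Z' := by
  obtain ⟨J, _, _, _, hJ, hc⟩ := h
  obtain ⟨J', _, _, _, hJ', hc'⟩ := h'
  obtain ⟨H, h₁, h₂⟩ := (isCoresolving_op_of_essImage hZ J hJ hc).exists_isEquivalence
    (isCoresolving_op_of_essImage hZ' J' hJ' hc')
  refine ⟨H.unop, H.asEquivalence.unop.isEquivalence_functor, fun W => ?_⟩
  have key : ∀ {A : Type w} [Category.{w} A] (J : X.E ⥤ A) (V : Aᵒᵖ),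
      J.op.essImage V ↔ J.essImage V.unop := fun J V =>
    ⟨fun ⟨W, ⟨e⟩⟩ => ⟨W.unop, ⟨e.unop.symm⟩⟩, fun ⟨W, ⟨e⟩⟩ => ⟨Opposite.op W, ⟨e.op.symm⟩⟩⟩
  rw [← hJ, ← hJ']
  exact (key J (Opposite.op W)).symm.trans ((h₂ (Opposite.op W)).trans (key J' _))

end NQuasiAbelian

/-! ### Hearts as abelian categories with a subcategory -/

namespace NQuasiAbelian

open Pretriangulated

section

variable {C : Type w} [Category.{w} C] [Preadditive C] [HasZeroObject C] [HasShift C ℤ]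
  [∀ n : ℤ, (CategoryTheory.shiftFunctor C n).Additive] [Pretriangulated C] [IsTriangulated C]

/-- An exact category which consists of objects of the heart, with the conflations which are part
of a distinguished triangle, is a subcategory of the heart. -/
lemma exists_lift_heart (X : ExactCat.{w}) (t : TStructure C) (J : X.E ⥤ C) [J.Additive] [J.Full]
    [J.Faithful] (hJ : ∀ Y, t.heart (J.obj Y))
    (hc : ∀ S : ShortComplex X.E, X.conf S ↔ ∃ δ : J.obj S.X₃ ⟶ (J.obj S.X₁)⟦(1 : ℤ)⟧,
      Triangle.mk (J.map S.f) (J.map S.g) δ ∈ distTriang C) :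
    ∃ (J₀ : X.E ⥤ t.heart.FullSubcategory) (_ : J₀.Additive), J₀.Full ∧ J₀.Faithful ∧
      (∀ W, J₀.essImage W ↔ J.essImage W.obj) ∧ (∀ S, X.conf S ↔ (S.map J₀).ShortExact) ∧
      Nonempty (J₀ ⋙ t.heart.ι ≅ J) := by
  let J₀ := t.heart.lift J hJ
  let e : J₀ ⋙ t.heart.ι ≅ J := Iso.refl _
  have := additive_of_comp_iso e
  exact ⟨J₀, this, full_of_comp_iso e, faithful_of_comp_iso e, essImage_of_comp_iso e,
    fun S => (hc S).trans (heart_shortExact_iff t (S.map J₀)).symm, ⟨e⟩⟩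

end

/-- The opposite order of the t-structures. -/
abbrev TPair.swap (Y : TPair.{w}) : TPair.{w} where
  C := Y.C
  D := Y.T
  T := Y.D

/-- The heart of the first t-structure, with its intersection with the second heart. -/
noncomputable def TPair.firstHeart (Y : TPair.{w}) : AbSub.{w} where
  A := Y.D.heart.FullSubcategory
  P := Y.T.heart.inverseImage Y.D.heart.ι

lemma essImage_ι_eq {C : Type w} [Category.{w} C] (P : ObjectProperty C)
    [P.IsClosedUnderIsomorphisms] : P.ι.essImage = P := by
  ext W
  exact ⟨fun ⟨Y, ⟨e⟩⟩ => P.prop_of_iso e Y.property, fun h => ⟨⟨W, h⟩, ⟨Iso.refl _⟩⟩⟩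

lemma TPair.firstHeart_isFirstHeart (Y : TPair.{w}) : Y.firstHeart.IsFirstHeart Y :=
  ⟨Y.D.heart.ι, inferInstanceAs Y.D.heart.ι.Additive, inferInstanceAs Y.D.heart.ι.Full,
    inferInstanceAs Y.D.heart.ι.Faithful, essImage_ι_eq _, fun _ => Iff.rfl⟩

lemma ExactCat.IsIntersectionOfHearts.isSubcategory_firstHeart {X : ExactCat.{w}} {Y : TPair.{w}}
    (h : X.IsIntersectionOfHearts Y) : X.IsSubcategory Y.firstHeart := by
  obtain ⟨J, _, _, _, hJ, hc⟩ := h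
  obtain ⟨J₀, h₁, h₂, h₃, h₄, h₅, -⟩ := exists_lift_heart X Y.D J (fun Z => by
    have := J.obj_mem_essImage Z
    rw [hJ] at this
    exact this.1) hc
  refine ⟨J₀, h₁, h₂, h₃, ?_, h₅⟩
  ext W
  have h₆ := h₄ W
  rw [hJ] at h₆
  exact h₆.trans ⟨fun h => h.2, fun h => ⟨W.property, h⟩⟩

lemma ExactCat.IsIntersectionOfHearts.swap {X : ExactCat.{w}} {Y : TPair.{w}}
    (h : X.IsIntersectionOfHearts Y) : X.IsIntersectionOfHearts Y.swap := by
  obtain ⟨J, h₁, h₂, h₃, hJ, hc⟩ := h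
  exact ⟨J, h₁, h₂, h₃, hJ.trans (inf_comm _ _), hc⟩

lemma TPair.IsEquivalent.swap {Y Y' : TPair.{w}} (h : Y.IsEquivalent Y') :
    Y.swap.IsEquivalent Y'.swap := by
  obtain ⟨F, h₁, h₂, h₃, h₄, h₅⟩ := h
  exact ⟨F, h₁, h₂, h₃, h₅, h₄⟩

namespace AbSub

variable {Z Z' : AbSub.{w}} {Y Y' : TPair.{w}}

lemma IsSecondHeart.swap (h : Z.IsSecondHeart Y) : Z.IsFirstHeart Y.swap := h

lemma IsFirstHeart.swap (h : Z.IsFirstHeart Y.swap) : Z.IsSecondHeart Y := h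

lemma IsFirstHeart.isEquivalent (h : Z.IsFirstHeart Y) (h' : Z'.IsFirstHeart Y) :
    Z.IsEquivalent Z' := by
  obtain ⟨J, _, _, _, hJ, hP⟩ := h
  obtain ⟨J', _, _, _, hJ', hP'⟩ := h'
  obtain ⟨H, ⟨e⟩⟩ := exists_comp_iso J J' (fun W => by
    rw [hJ', ← hJ]
    exact J.obj_mem_essImage W)
  refine ⟨H, isEquivalence_of_comp_iso e (fun W => by
    rw [hJ, ← hJ']
    exact J'.obj_mem_essImage W), fun W => ?_⟩
  rw [hP, hP']
  exact Y.T.heart.prop_iff_of_iso (e.symm.app W)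

lemma IsEquivalent.isFirstHeart (h : Z.IsEquivalent Z') (h' : Z'.IsFirstHeart Y) :
    Z.IsFirstHeart Y := by
  obtain ⟨F, _, hF⟩ := h
  obtain ⟨J, _, _, _, hJ, hP⟩ := h'
  have := preservesBinaryBiproducts_of_preservesBinaryProducts F
  have : F.Additive := Functor.additive_of_preservesBinaryBiproducts F
  exact ⟨F ⋙ J, inferInstance, inferInstance, inferInstance,
    (ExactCat.essImage_comp_of_isEquivalence F J).trans hJ, fun W => (hF W).trans (hP _)⟩

lemma IsFirstHeart.of_isEquivalent (h : Z.IsFirstHeart Y) (h' : Y.IsEquivalent Y') :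
    Z.IsFirstHeart Y' := by
  obtain ⟨J, _, _, _, hJ, hP⟩ := h
  obtain ⟨F, _, _, _, hD, hT⟩ := h'
  refine ⟨J ⋙ F, inferInstance, inferInstance, inferInstance, ?_,
    fun W => (hP W).trans (heart_iff_of_le_zero_iff F hT _)⟩
  ext W
  have h₁ : Y'.D.heart W ↔ Y.D.heart (F.objPreimage W) := by
    refine Iff.trans (Y'.D.heart.prop_iff_of_iso (F.objObjPreimageIso W).symm) ?_
    exact (heart_iff_of_le_zero_iff F hD _).symm
  rw [h₁, ← hJ]
  exact ⟨fun ⟨Y, ⟨e⟩⟩ => ⟨Y, ⟨F.preimageIso (e ≪≫ (F.objObjPreimageIso W).symm)⟩⟩,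
    fun ⟨Y, ⟨e⟩⟩ => ⟨Y, ⟨F.mapIso e ≪≫ F.objObjPreimageIso W⟩⟩⟩

lemma IsFirstHeart.isSubcategory (h : Z.IsFirstHeart Y) {X : ExactCat.{w}}
    (hX : X.IsIntersectionOfHearts Y) : X.IsSubcategory Z :=
  hX.isSubcategory_firstHeart.of_isEquivalent (Y.firstHeart_isFirstHeart.isEquivalent h)

lemma IsSecondHeart.isSubcategory (h : Z.IsSecondHeart Y) {X : ExactCat.{w}}
    (hX : X.IsIntersectionOfHearts Y) : X.IsSubcategory Z :=
  h.swap.isSubcategory hX.swap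

end AbSub

namespace ExactCat

variable (X : ExactCat.{w}) {R L : TStructure X.Derived}

lemma inHeart_isFirstHeart (h : X.toDerived.essImage = R.heart ⊓ L.heart) :
    (X.inHeart R).IsFirstHeart (X.derivedPair R L) := by
  refine ⟨R.heart.ι, inferInstanceAs R.heart.ι.Additive, inferInstanceAs R.heart.ι.Full,
    inferInstanceAs R.heart.ι.Faithful, essImage_ι_eq R.heart, fun W => ?_⟩
  change X.toDerived.essImage W.obj ↔ L.heart W.obj
  rw [h]
  exact ⟨fun h => h.2, fun h => ⟨W.property, h⟩⟩

lemma inHeart_isSecondHeart (h : X.toDerived.essImage = R.heart ⊓ L.heart) :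
    (X.inHeart L).IsSecondHeart (X.derivedPair R L) :=
  X.inHeart_isFirstHeart (R := L) (L := R) (h.trans (inf_comm _ _))

lemma isIntersectionOfHearts_derivedPair (h : X.toDerived.essImage = R.heart ⊓ L.heart) :
    X.IsIntersectionOfHearts (X.derivedPair R L) :=
  ⟨X.toDerived, inferInstanceAs X.toDerived.Additive, inferInstanceAs X.toDerived.Full,
    inferInstanceAs X.toDerived.Faithful, h, X.conf_iff⟩

/-- Of the four conditions that define the two hearts only `L.le 0` and `R.ge 0` matter, as `L.le 0
≤ R.le 0` implies the other two. These are the conditions of `essImage_iff`. -/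
lemma essImage_eq (hR : ∀ m, R.ge m = X.rightGE m) (hL : L.le 0 = X.leftLE 0) :
    X.toDerived.essImage = R.heart ⊓ L.heart := by
  have h := X.le_zero_le hR hL
  ext W
  rw [essImage_iff, ← hL, ← hR]
  exact ⟨fun ⟨h₁, h₂⟩ => ⟨⟨h _ h₁, h₂⟩, h₁, ge_le_of_le_zero_le h 0 _ h₂⟩,
    fun ⟨h₁, h₂⟩ => ⟨h₂.1, h₁.2⟩⟩

end ExactCat

end NQuasiAbelian

/-! ### From tilting pairs to `n`-quasi-abelian categories -/

namespace NQuasiAbelian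

open Pretriangulated

namespace ExactCat

variable {X : ExactCat.{w}} {Y : TPair.{w}} {n : ℕ}

/-- If `X` is the intersection of the hearts of an `n`-tilting pair, then the derived category of
`X` is the ambient triangulated category. -/
theorem IsIntersectionOfHearts.exists_equivalence (h : X.IsIntersectionOfHearts Y)
    (hY : IsNTilting n Y.D Y.T) :
    ∃ (F : X.Derived ⥤ Y.C) (_ : F.CommShift ℤ), F.IsTriangulated ∧ F.IsEquivalence ∧
      (∀ m Z, X.rightGE m Z ↔ Y.D.ge m (F.obj Z)) ∧ ∀ Z, X.leftLE 0 Z ↔ Y.T.le 0 (F.obj Z) := by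
  obtain ⟨J, _, _, _, hJ, hc⟩ := h
  obtain ⟨J₀, _, _, _, hJ₀, hc₀, ⟨e₀⟩⟩ := exists_lift_heart X Y.D J (fun Z => by
    have := J.obj_mem_essImage Z
    rw [hJ] at this
    exact this.1) hc
  have hP : ∀ Z, J₀.essImage Z ↔ Y.T.heart Z.obj := fun Z => by
    rw [hJ₀, hJ]
    exact ⟨fun h => h.2, fun h => ⟨Z.property, h⟩⟩
  have hX : IsCoresolving X J₀ n :=
    { full := inferInstance
      faithful := inferInstance
      additive := inferInstance
      conf_iff := hc₀
      cogenerates := fun Z => by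
        obtain ⟨V, i, hV, _⟩ := hY.cogenerates Z
        obtain ⟨W, ⟨e⟩⟩ := (hP V).2 hV.2
        exact ⟨W, i ≫ e.inv, inferInstance⟩
      closed := fun V Z h => heart_closed hY.le_le hY.le_le' hP h }
  let _ := HasDerivedCategory.standard Y.D.heart.FullSubcategory
  obtain ⟨Φ, _, _, _, -, ⟨e⟩, hΦ⟩ := hX.exists_equivalence
  obtain ⟨F₀, _, _, _, hle, hge, ⟨e'⟩⟩ := hY.derived
  let F := Φ ⋙ F₀
  have hR : ∀ m Z, X.rightGE m Z ↔ Y.D.ge m (F.obj Z) := fun m Z =>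
    (hΦ m Z).trans (ge_iff_of_le_zero_iff F₀ hle m _)
  have hJF : X.toDerived ⋙ F ≅ J :=
    (Functor.associator _ _ _).symm ≪≫ Functor.isoWhiskerRight e F₀ ≪≫
      Functor.associator _ _ _ ≪≫ Functor.isoWhiskerLeft J₀ e' ≪≫ e₀
  refine ⟨F, inferInstance, inferInstance, inferInstance, hR, fun Z => ?_⟩
  -- The coaisles of `Y.D` are known from the coresolution of its heart. The aisle of `Y.T` is then
  -- recovered from the intersection of the hearts.
  have := le_eq_leftLE (pullbackT Y.D F) (pullbackT Y.T F) (fun m => by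
    ext Z
    exact (hR m Z).symm) n (fun Z hZ => hY.le_le _ hZ) (fun Z hZ => hY.le_le' _ hZ) (by
      ext Z
      rw [essImage_of_comp_iso hJF, hJ]
      rfl)
  rw [← this]
  rfl

lemma IsIntersectionOfHearts.hasDKernels (h : X.IsIntersectionOfHearts Y)
    (hY : IsNTilting n Y.D Y.T) : HasDKernels X.conf := by
  obtain ⟨F, _, _, _, -, hF⟩ := h.exists_equivalence hY
  exact X.hasDKernels (pullbackT Y.T F) (by
    ext Z
    exact (hF Z).symm)

lemma IsIntersectionOfHearts.hasDCokernels (h : X.IsIntersectionOfHearts Y)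
    (hY : IsNTilting n Y.D Y.T) : HasDCokernels X.conf := by
  obtain ⟨F, _, _, _, hF, -⟩ := h.exists_equivalence hY
  exact X.hasDCokernels (pullbackT Y.D F) (by
    ext Z
    exact (hF 0 Z).symm)

lemma IsIntersectionOfHearts.isEquivalent (h : X.IsIntersectionOfHearts Y)
    (hY : IsNTilting n Y.D Y.T) {R L : TStructure X.Derived} (hR : ∀ m, R.ge m = X.rightGE m)
    (hL : L.le 0 = X.leftLE 0) : (X.derivedPair R L).IsEquivalent Y := by
  obtain ⟨F, h₁, h₂, h₃, h₄, h₅⟩ := h.exists_equivalence hY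
  refine ⟨F, h₁, h₂, h₃, fun Z => ?_, fun Z => ?_⟩
  · exact le_iff_of_ge_iff (t := R) F (fun m Z => by rw [hR]; exact h₄ m Z) 0 Z
  · refine Iff.trans ?_ (h₅ Z)
    rw [← hL]
    rfl

end ExactCat

lemma isClosedUnderExtensions_firstHeart (Y : TPair.{w}) :
    Y.firstHeart.P.IsClosedUnderExtensions :=
  heart_isClosedUnderExtensions fun _ => Iff.rfl

/-- The intersection of the hearts of an `n`-tilting pair is `n`-quasi-abelian. -/
theorem IsNTilting.exists_isIntersectionOfHearts {n : ℕ} (Y : TPair.{w})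
    (hY : IsNTilting n Y.D Y.T) :
    ∃ X : ExactCat.{w}, IsNQuasiAbelian X.conf n ∧ X.IsIntersectionOfHearts Y := by
  have := isClosedUnderExtensions_firstHeart Y
  have hc : ∀ V Z : Y.firstHeart.A, IsCosyzygy Y.firstHeart.P n V Z → Y.firstHeart.P Z :=
    fun V Z h => heart_closed hY.le_le hY.le_le' (fun _ => Iff.rfl) h
  have hg : ∀ V : Y.firstHeart.A, ∃ (W : Y.firstHeart.A) (i : V ⟶ W), Y.firstHeart.P W ∧ Mono i :=
    fun V => by
      obtain ⟨W, i, hW, hi⟩ := hY.cogenerates V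
      exact ⟨W, i, hW.2, hi⟩
  obtain ⟨V, -⟩ := HasZeroObject.zero (C := Y.firstHeart.A)
  obtain ⟨W, _, hW, -⟩ := hg V
  let X : ExactCat.{w} := exactCatOf Y.firstHeart.P (fun B B' => prop_of_biprod hc) ⟨W, hW⟩
  have hX : X.IsIntersectionOfHearts Y := by
    let J : Y.firstHeart.P.FullSubcategory ⥤ Y.C := Y.firstHeart.P.ι ⋙ Y.D.heart.ι
    have : (Y.firstHeart.P.ι : Y.firstHeart.P.FullSubcategory ⥤ _).Full := inferInstance
    have : (Y.firstHeart.P.ι : Y.firstHeart.P.FullSubcategory ⥤ _).Faithful := inferInstance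
    have hF : Y.D.heart.ι.Full := inferInstance
    have hF' : Y.D.heart.ι.Faithful := inferInstance
    refine ⟨J, ?_, @Functor.Full.comp _ _ _ _ _ _ _ Y.D.heart.ι ‹_› hF,
      @Functor.Faithful.comp _ _ _ _ _ _ _ Y.D.heart.ι this hF', ?_, fun S => ?_⟩
    · have : (Y.firstHeart.P.ι : Y.firstHeart.P.FullSubcategory ⥤ _).Additive := inferInstance
      have : (Y.D.heart.ι).Additive := inferInstance
      exact ⟨rfl⟩
    · ext Z
      exact ⟨fun ⟨V, ⟨e⟩⟩ => (Y.D.heart ⊓ Y.T.heart).prop_of_iso e ⟨V.obj.property, V.property⟩,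
        fun h => ⟨⟨⟨Z, h.1⟩, h.2⟩, ⟨Iso.refl _⟩⟩⟩
    · exact heart_shortExact_iff Y.D _
  refine ⟨X, ?_, hX⟩
  have : HasZeroObject Y.firstHeart.P.FullSubcategory := X.hasZeroObject
  have : HasBinaryBiproducts Y.firstHeart.P.FullSubcategory := X.hasBinaryBiproducts
  exact isNQuasiAbelian_of_cogenerates X.exact hg hc (hX.hasDKernels hY) (hX.hasDCokernels hY)

end NQuasiAbelian

/-! ### Functors determined on a cogenerating subcategory -/

namespace NQuasiAbelian

section

variable {E A : Type w} [Category.{w} E] [Category.{w} A] [Abelian A] {J : E ⥤ A} [J.Full]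

/-- Natural transformations between the functors `Hom(Z, J -)` come from morphisms. -/
lemma exists_hom_of_natural (hJ : ∀ Z, ∃ (Y : E) (i : Z ⟶ J.obj Y), Mono i) {Z Z' : A}
    (φ : ∀ Y, (Z ⟶ J.obj Y) → (Z' ⟶ J.obj Y))
    (hφ : ∀ {Y Y' : E} (f : Z ⟶ J.obj Y) (y : Y ⟶ Y'), φ Y' (f ≫ J.map y) = φ Y f ≫ J.map y) :
    ∃ g : Z' ⟶ Z, ∀ Y f, g ≫ f = φ Y f := by
  have hφ' : ∀ {Y Y' : E} (f : Z ⟶ J.obj Y) (y : J.obj Y ⟶ J.obj Y'), φ Y' (f ≫ y) = φ Y f ≫ y := by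
    intro Y Y' f y
    obtain ⟨y, rfl⟩ := J.map_surjective y
    exact hφ f y
  -- `Z` is the kernel of a morphism between objects in the image of `J`, and naturality makes `φ Y₀
  -- i` factor through this kernel.
  obtain ⟨Y₀, i, _⟩ := hJ Z
  obtain ⟨Y₁, d, _⟩ := hJ (cokernel i)
  have h₁ : i ≫ cokernel.π i ≫ d = i ≫ 0 := by rw [cokernel.condition_assoc, zero_comp, comp_zero]
  have h₀ : φ Y₀ i ≫ cokernel.π i = 0 := by
    rw [← cancel_mono d, Category.assoc, ← hφ', h₁, hφ', comp_zero, zero_comp]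
  obtain ⟨g, hg⟩ : ∃ g : Z' ⟶ Z, g ≫ i = φ Y₀ i := ⟨_, Abelian.monoLift_comp i _ h₀⟩
  refine ⟨g, fun Y f => ?_⟩
  -- An arbitrary `f` is compared with `i` inside an object of the image that contains their
  -- pushout.
  obtain ⟨Y₂, k, _⟩ := hJ (pushout i f)
  have : Mono (pushout.inr i f) := inferInstance
  have : Mono (pushout.inr i f ≫ k) := mono_comp _ _
  rw [← cancel_mono (pushout.inr i f ≫ k), ← hφ', Category.assoc, ← pushout.condition_assoc, hφ',
    ← hg, Category.assoc]

/-- A fully faithful endofunctor of an abelian category which is the identity on a cogenerating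
subcategory is isomorphic to the identity. -/
lemma nonempty_iso_id (hJ : ∀ Z, ∃ (Y : E) (i : Z ⟶ J.obj Y), Mono i) (θ : A ⥤ A) [θ.Full]
    [θ.Faithful] (e : J ⋙ θ ≅ J) : Nonempty (θ ≅ 𝟭 A) := by
  let ε (Y : E) : θ.obj (J.obj Y) ≅ J.obj Y := e.app Y
  have hε : ∀ {Y Y' : E} (y : Y ⟶ Y'), θ.map (J.map y) ≫ (ε Y').hom = (ε Y).hom ≫ J.map y :=
    fun y => e.hom.naturality y
  have hε' : ∀ {Y Y' : E} (y : Y ⟶ Y'), J.map y ≫ (ε Y').inv = (ε Y).inv ≫ θ.map (J.map y) :=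
    fun y => e.inv.naturality y
  have h₁ : ∀ Z, ∃ α : θ.obj Z ⟶ Z, ∀ Y (f : Z ⟶ J.obj Y), α ≫ f = θ.map f ≫ (ε Y).hom :=
    fun Z => exists_hom_of_natural hJ _ (fun {Y Y'} f y => by
      rw [Functor.map_comp, Category.assoc, Category.assoc, hε])
  have h₂ : ∀ Z, ∃ β : Z ⟶ θ.obj Z, ∀ Y (f : θ.obj Z ⟶ J.obj Y),
      β ≫ f = θ.preimage (f ≫ (ε Y).inv) :=
    fun Z => exists_hom_of_natural hJ _ (fun {Y Y'} f y => θ.map_injective (by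
      simp [hε']))
  choose α hα using h₁
  choose β hβ using h₂
  have h₃ : ∀ Z, α Z ≫ β Z = 𝟙 _ := fun Z => by
    obtain ⟨Y, i, _⟩ := hJ (θ.obj Z)
    rw [← cancel_mono i, Category.assoc, hβ, hα]
    simp
  have h₄ : ∀ Z, β Z ≫ α Z = 𝟙 _ := fun Z => by
    obtain ⟨Y, i, _⟩ := hJ Z
    rw [← cancel_mono i, Category.assoc, hα, hβ]
    exact θ.map_injective (by simp)
  refine ⟨NatIso.ofComponents (fun Z => ⟨α Z, β Z, h₃ Z, h₄ Z⟩) (fun {Z Z'} z => ?_)⟩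
  obtain ⟨Y, i, _⟩ := hJ Z'
  rw [← cancel_mono i]
  change (θ.map z ≫ α Z') ≫ i = (α Z ≫ z) ≫ i
  rw [Category.assoc, Category.assoc, hα, hα, Functor.map_comp, Category.assoc]

lemma shortExact_comp_iso {X Y Z Z' : A} {i : X ⟶ Y} {p : Y ⟶ Z} {w' : i ≫ p = 0}
    (h : (ShortComplex.mk i p w').ShortExact) (e : Z ≅ Z') :
    (ShortComplex.mk i (p ≫ e.hom) (by rw [reassoc_of% w', zero_comp])).ShortExact := by
  have ee : ShortComplex.mk i p w' ≅ ShortComplex.mk i (p ≫ e.hom)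
      (by rw [reassoc_of% w', zero_comp]) :=
    ShortComplex.isoMk (Iso.refl _) (Iso.refl _) e (by simp) (by simp)
  exact ShortComplex.shortExact_of_iso ee h

lemma shortExact_iso_comp {X X' Y Z : A} {i : X ⟶ Y} {p : Y ⟶ Z} {w' : i ≫ p = 0}
    (h : (ShortComplex.mk i p w').ShortExact) (e : X ≅ X') :
    (ShortComplex.mk (e.inv ≫ i) p (by rw [Category.assoc, w', comp_zero])).ShortExact := by
  have ee : ShortComplex.mk i p w' ≅ ShortComplex.mk (e.inv ≫ i) p
      (by rw [Category.assoc, w', comp_zero]) :=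
    ShortComplex.isoMk e (Iso.refl _) (Iso.refl _) (by simp) (by simp)
  exact ShortComplex.shortExact_of_iso ee h

end

namespace ExactCat

variable {X : ExactCat.{w}} {Z : AbSub.{w}}

/-- Objects of `Z.P` are only isomorphic to objects in the image of `J`; conjugation by `a`, `b` and
`v` moves the problem to `X.E` and back. -/
lemma IsSubcategory.hasDKernels (h : X.IsSubcategory Z) (hX : HasDKernels X.conf) :
    HasDKernels (inducedConflations Z.P) := by
  obtain ⟨J, _, _, _, hJ, hc⟩ := h
  have hP : ∀ Y, Z.P (J.obj Y) := fun Y => hJ ▸ J.obj_mem_essImage Y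
  have hP' : ∀ Y : Z.P.FullSubcategory, ∃ W, Nonempty (J.obj W ≅ Y.obj) := fun Y => by
    have h := congr_fun hJ Y.obj
    exact h.mpr Y.property
  intro A B f
  obtain ⟨A', ⟨a⟩⟩ := hP' A
  obtain ⟨B', ⟨b⟩⟩ := hP' B
  obtain ⟨K, i, hi₁, hi₂⟩ := hX (J.preimage (a.hom ≫ f.hom ≫ b.inv))
  have hi₁ := congr_arg J.map hi₁
  rw [Functor.map_comp, Functor.map_preimage, Functor.map_zero] at hi₁
  refine ⟨⟨J.obj K, hP K⟩, ObjectProperty.homMk (J.map i ≫ a.hom), ObjectProperty.hom_ext _ ?_,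
    fun V j hj => ?_⟩
  · change (J.map i ≫ a.hom) ≫ f.hom = 0
    rw [← cancel_mono b.inv, zero_comp, Category.assoc, Category.assoc, hi₁]
  · obtain ⟨V', ⟨v⟩⟩ := hP' V
    have hj' : j.hom ≫ f.hom = 0 := congr_arg (·.hom) hj
    obtain ⟨N, π, k, ⟨M, m, z, hm⟩, hk⟩ := hi₂ (J.preimage (v.hom ≫ j.hom ≫ a.inv))
      (J.map_injective (by simp [reassoc_of% hj']))
    have hk := congr_arg J.map hk
    rw [Functor.map_comp, Functor.map_comp, Functor.map_preimage] at hk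
    refine ⟨⟨J.obj N, hP N⟩, ObjectProperty.homMk (J.map π ≫ v.hom),
      ObjectProperty.homMk (J.map k), ⟨⟨J.obj M, hP M⟩, ObjectProperty.homMk (J.map m), ?_, ?_⟩,
      ObjectProperty.hom_ext _ ?_⟩
    · refine ObjectProperty.hom_ext _ ?_
      change J.map m ≫ J.map π ≫ v.hom = 0
      rw [← Functor.map_comp_assoc, z, Functor.map_zero, zero_comp]
    · exact shortExact_comp_iso (i := J.map m) (p := J.map π) ((hc _).1 hm) v
    · change (J.map π ≫ v.hom) ≫ j.hom = J.map k ≫ J.map i ≫ a.hom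
      rw [← Category.assoc (J.map k), ← hk]
      simp

lemma IsSubcategory.hasDCokernels (h : X.IsSubcategory Z) (hX : HasDCokernels X.conf) :
    HasDCokernels (inducedConflations Z.P) := by
  obtain ⟨J, _, _, _, hJ, hc⟩ := h
  have hP : ∀ Y, Z.P (J.obj Y) := fun Y => hJ ▸ J.obj_mem_essImage Y
  have hP' : ∀ Y : Z.P.FullSubcategory, ∃ W, Nonempty (J.obj W ≅ Y.obj) := fun Y => by
    have h := congr_fun hJ Y.obj
    exact h.mpr Y.property
  intro A B f
  obtain ⟨A', ⟨a⟩⟩ := hP' A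
  obtain ⟨B', ⟨b⟩⟩ := hP' B
  obtain ⟨K, i, hi₁, hi₂⟩ := hX (J.preimage (a.hom ≫ f.hom ≫ b.inv))
  have hi₁ := congr_arg J.map hi₁
  rw [Functor.map_comp, Functor.map_preimage, Functor.map_zero] at hi₁
  refine ⟨⟨J.obj K, hP K⟩, ObjectProperty.homMk (b.inv ≫ J.map i), ObjectProperty.hom_ext _ ?_,
    fun V j hj => ?_⟩
  · change f.hom ≫ b.inv ≫ J.map i = 0
    rw [← cancel_epi a.hom, comp_zero, ← hi₁]
    simp
  · obtain ⟨V', ⟨v⟩⟩ := hP' V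
    have hj' : f.hom ≫ j.hom = 0 := congr_arg (·.hom) hj
    obtain ⟨N, π, k, ⟨M, m, z, hm⟩, hk⟩ := hi₂ (J.preimage (b.hom ≫ j.hom ≫ v.inv))
      (J.map_injective (by simp [reassoc_of% hj']))
    have hk := congr_arg J.map hk
    rw [Functor.map_comp, Functor.map_comp, Functor.map_preimage] at hk
    refine ⟨⟨J.obj N, hP N⟩, ObjectProperty.homMk (v.inv ≫ J.map π),
      ObjectProperty.homMk (J.map k), ⟨⟨J.obj M, hP M⟩, ObjectProperty.homMk (J.map m), ?_, ?_⟩,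
      ObjectProperty.hom_ext _ ?_⟩
    · refine ObjectProperty.hom_ext _ ?_
      change (v.inv ≫ J.map π) ≫ J.map m = 0
      rw [Category.assoc, ← Functor.map_comp, z, Functor.map_zero, comp_zero]
    · exact shortExact_iso_comp (i := J.map π) (p := J.map m) ((hc _).1 hm) v
    · change j.hom ≫ v.inv ≫ J.map π = (b.inv ≫ J.map i) ≫ J.map k
      rw [Category.assoc, ← hk]
      simp

end ExactCat

end NQuasiAbelian

/-! ### From `n`-quasi-abelian categories to tilting pairs and torsion classes -/

namespace NQuasiAbelian

open Pretriangulated CochainComplex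

namespace ExactCat

variable {X : ExactCat.{w}} {R L : TStructure X.Derived}

/-- An object of the heart of `R` is a complex in degrees `≥ 0`. Its projection to the term in
degree `0` is a monomorphism of the heart, because the rest of the complex lies in `R.ge 1`. -/
lemma heart_cogenerates (hR : ∀ m, R.ge m = X.rightGE m)
    (hE : X.toDerived.essImage = R.heart ⊓ L.heart) (Z : R.heart.FullSubcategory) :
    ∃ (Y : R.heart.FullSubcategory) (i : Z ⟶ Y), L.heart Y.obj ∧ Mono i := by
  have hZ : X.rightGE 0 Z.obj := hR 0 ▸ Z.property.2
  obtain ⟨K, hK, ⟨e⟩⟩ := hZ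
  obtain ⟨A, B, hA, hB, f, g, δ, H, -, hg⟩ := exists_stupid_triangle K 1
  have hB' : B.IsStrictlyGE 0 := by
    rw [isStrictlyGE_iff]
    intro i hi
    have := hg i (by omega)
    exact (K.isZero_of_isStrictlyGE 0 i hi).of_iso (asIso (g.f i)).symm
  have hB₀ : X.toDerived.essImage (X.Q.obj B) :=
    (essImage_iff _).2 ⟨leftLE_Q (1 - 1) B, rightGE_Q 0 B⟩
  rw [hE] at hB₀
  refine ⟨⟨X.Q.obj B, hB₀.1⟩, ObjectProperty.homMk (e.hom ≫ X.Q.map g), hB₀.2,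
    Preadditive.mono_of_cancel_zero _ fun {W} t ht => ObjectProperty.hom_ext _ ?_⟩
  have ht' : (t.hom ≫ e.hom) ≫ X.Q.map g = 0 :=
    (Category.assoc _ _ _).trans (congr_arg (·.hom) ht)
  obtain ⟨k, hk⟩ : ∃ k : W.obj ⟶ X.Q.obj A, t.hom ≫ e.hom = k ≫ X.Q.map f :=
    Triangle.coyoneda_exact₂ _ H _ ht'
  have h₁ : R.IsLE W.obj 0 := ⟨W.property.1⟩
  have h₂ : R.IsGE (X.Q.obj A) 1 := ⟨by
    rw [hR]
    exact rightGE_Q 1 A⟩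
  have hk' : k = 0 := R.zero k 0 1 (by omega)
  rw [hk', zero_comp] at hk
  exact (cancel_mono e.hom).1 (hk.trans zero_comp.symm)

/-- Dually, an object of the heart of `L` is a complex in degrees `≤ 0`, and its term in degree `0`
maps onto it. -/
lemma heart_generates (hL : ∀ m, L.le m = X.leftLE m)
    (hE : X.toDerived.essImage = R.heart ⊓ L.heart) (Z : L.heart.FullSubcategory) :
    ∃ (Y : L.heart.FullSubcategory) (p : Y ⟶ Z), R.heart Y.obj ∧ Epi p := by
  have hZ : X.leftLE 0 Z.obj := hL 0 ▸ Z.property.1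
  obtain ⟨K, hK, ⟨e⟩⟩ := hZ
  obtain ⟨A, B, hA, hB, f, g, δ, H, hf, -⟩ := exists_stupid_triangle K 0
  have hA' : A.IsStrictlyLE 0 := by
    rw [isStrictlyLE_iff]
    intro i hi
    have := hf i (by omega)
    exact (K.isZero_of_isStrictlyLE 0 i hi).of_iso (asIso (f.f i))
  have hA₀ : X.toDerived.essImage (X.Q.obj A) :=
    (essImage_iff _).2 ⟨leftLE_Q 0 A, rightGE_Q 0 A⟩
  rw [hE] at hA₀
  refine ⟨⟨X.Q.obj A, hA₀.2⟩, ObjectProperty.homMk (X.Q.map f ≫ e.inv), hA₀.1,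
    Preadditive.epi_of_cancel_zero _ fun {W} t ht => ObjectProperty.hom_ext _ ?_⟩
  have ht' : X.Q.map f ≫ e.inv ≫ t.hom = 0 :=
    (Category.assoc _ _ _).symm.trans (congr_arg (·.hom) ht)
  obtain ⟨k, hk⟩ : ∃ k : X.Q.obj B ⟶ W.obj, e.inv ≫ t.hom = X.Q.map g ≫ k :=
    Triangle.yoneda_exact₂ _ H _ ht'
  have h₁ : L.IsLE (X.Q.obj B) (0 - 1) := ⟨by
    rw [hL]
    exact leftLE_Q (0 - 1) B⟩
  have h₂ : L.IsGE W.obj 0 := ⟨W.property.2⟩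
  have hk' : k = 0 := L.zero k (0 - 1) 0 (by omega)
  rw [hk', comp_zero] at hk
  exact (cancel_epi e.inv).1 (hk.trans comp_zero.symm)

variable {n : ℕ}

/-- The equivalence comes from `IsCoresolving.exists_equivalence`. It remains to see that it
restricts to the inclusion of the heart. A priori this is known only on the image of `X.E`;
`nonempty_iso_id` extends it to the heart, which `X.E` cogenerates. -/
lemma isDerivedCategoryOfHeart (hR : ∀ m, R.ge m = X.rightGE m) (h : R.le (-(n : ℤ)) ≤ L.le 0)
    (h' : L.le 0 ≤ R.le 0) (hE : X.toDerived.essImage = R.heart ⊓ L.heart) :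
    IsDerivedCategoryOfHeart R := by
  have hE' : ∀ Y, (R.heart ⊓ L.heart) (X.toDerived.obj Y) := fun Y => hE ▸ X.toDerived.obj_mem_essImage Y
  obtain ⟨J, _, _, _, hJ, hc, ⟨e₀⟩⟩ := exists_lift_heart X R X.toDerived (fun Y => (hE' Y).1) X.conf_iff
  have hP : ∀ Z, J.essImage Z ↔ L.heart Z.obj := fun Z => by
    rw [hJ, hE]
    exact ⟨fun h => h.2, fun h => ⟨Z.property, h⟩⟩
  have hX : IsCoresolving X J n :=
    { full := inferInstance
      faithful := inferInstance
      additive := inferInstance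
      conf_iff := hc
      cogenerates := fun Z => by
        obtain ⟨V, i, hV, _⟩ := heart_cogenerates hR hE Z
        obtain ⟨W, ⟨e⟩⟩ := (hP V).2 hV
        exact ⟨W, i ≫ e.inv, inferInstance⟩
      closed := fun V Z hVZ => heart_closed h h' hP hVZ }
  let _ := HasDerivedCategory.standard R.heart.FullSubcategory
  obtain ⟨Φ, hΦ₁, hΦ₂, _, -, ⟨e⟩, hΦ⟩ := hX.exists_equivalence
  let _ : Φ.asEquivalence.functor.CommShift ℤ := hΦ₁
  let _ : Φ.asEquivalence.inverse.CommShift ℤ := Φ.asEquivalence.commShiftInverse ℤ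
  have : Φ.asEquivalence.CommShift ℤ := Φ.asEquivalence.commShift_of_functor ℤ
  have : Φ.asEquivalence.functor.IsTriangulated := hΦ₂
  have : Φ.asEquivalence.IsTriangulated := Equivalence.IsTriangulated.mk' _ hΦ₂
  have : Φ.asEquivalence.inverse.IsTriangulated := inferInstance
  let F := Φ.asEquivalence.inverse
  have hge : ∀ m Z, R.ge m Z ↔ DerivedCategory.TStructure.t.ge m (Φ.obj Z) := fun m Z => by
    rw [hR, hΦ]
  have hle := le_iff_of_ge_iff Φ hge
  have hge' : ∀ Z, DerivedCategory.TStructure.t.ge 0 Z ↔ R.ge 0 (F.obj Z) := fun Z => by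
    rw [hge]
    exact (DerivedCategory.TStructure.t.ge 0).prop_iff_of_iso
      (Φ.asEquivalence.counitIso.symm.app Z)
  have hle' : ∀ Z, DerivedCategory.TStructure.t.le 0 Z ↔ R.le 0 (F.obj Z) := fun Z => by
    rw [hle]
    exact (DerivedCategory.TStructure.t.le 0).prop_iff_of_iso
      (Φ.asEquivalence.counitIso.symm.app Z)
  let S := DerivedCategory.singleFunctor R.heart.FullSubcategory 0
  -- The restriction of `F` to the heart is an endofunctor `θ` of the heart, fully faithful and
  -- isomorphic to the identity on the image of `X.E`.
  obtain ⟨θ, ⟨i⟩⟩ := exists_comp_iso (S ⋙ F) R.heart.ι (fun Z => by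
    rw [essImage_ι_eq]
    exact ⟨(hle' _).1 (DerivedCategory.TStructure.t.le_of_isLE (S.obj Z) 0),
      (hge' _).1 (DerivedCategory.TStructure.t.ge_of_isGE (S.obj Z) 0)⟩)
  have := full_of_comp_iso i
  have := faithful_of_comp_iso i
  have e₁ : J ⋙ S ⋙ F ≅ X.toDerived :=
    (Functor.associator _ _ _).symm ≪≫ Functor.isoWhiskerRight e.symm F ≪≫
      Functor.associator _ _ _ ≪≫ Functor.isoWhiskerLeft _ Φ.asEquivalence.unitIso.symm ≪≫
      Functor.rightUnitor _
  have e₂ : (J ⋙ θ) ⋙ R.heart.ι ≅ J ⋙ R.heart.ι :=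
    Functor.associator _ _ _ ≪≫ Functor.isoWhiskerLeft J i ≪≫ e₁ ≪≫ e₀.symm
  obtain ⟨e₃⟩ := nonempty_iso_id hX.cogenerates θ (Functor.fullyFaithfulCancelRight _ e₂)
  exact ⟨F, inferInstance, inferInstance, inferInstance, hle', hge',
    ⟨i.symm ≪≫ Functor.isoWhiskerRight e₃ _ ≪≫ Functor.leftUnitor _⟩⟩

/-- The pair of t-structures of an `n`-quasi-abelian category is `n`-tilting. -/
theorem isNTilting (hX : IsNQuasiAbelian X.conf n) (hR : ∀ m, R.ge m = X.rightGE m)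
    (hL : ∀ m, L.le m = X.leftLE m) : IsNTilting n R L where
  le_le := hX.le_le hR (hL 0)
  le_le' := X.le_zero_le hR (hL 0)
  derived := isDerivedCategoryOfHeart hR (hX.le_le hR (hL 0)) (X.le_zero_le hR (hL 0))
    (X.essImage_eq hR (hL 0))
  cogenerates Z := by
    obtain ⟨Y, i, hY, hi⟩ := heart_cogenerates hR (X.essImage_eq hR (hL 0)) Z
    exact ⟨Y, i, ⟨Y.property, hY⟩, hi⟩

lemma inHeart_isSubcategory (hE : X.toDerived.essImage = R.heart ⊓ L.heart) :
    X.IsSubcategory (X.inHeart R) :=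
  (X.inHeart_isFirstHeart hE).isSubcategory (X.isIntersectionOfHearts_derivedPair hE)

lemma inHeart_isSubcategory' (hE : X.toDerived.essImage = R.heart ⊓ L.heart) :
    X.IsSubcategory (X.inHeart L) :=
  (X.inHeart_isSecondHeart hE).isSubcategory (X.isIntersectionOfHearts_derivedPair hE)

lemma inHeart_iff (hE : X.toDerived.essImage = R.heart ⊓ L.heart) (Z : R.heart.FullSubcategory) :
    (X.inHeart R).P Z ↔ L.heart Z.obj := by
  change X.toDerived.essImage Z.obj ↔ _
  rw [hE]
  exact ⟨fun h => h.2, fun h => ⟨Z.property, h⟩⟩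

/-- An `n`-quasi-abelian category is an `n`-tilting torsion class in the right heart. -/
theorem isNTiltingTorsionClass (hX : IsNQuasiAbelian X.conf n) (hR : ∀ m, R.ge m = X.rightGE m)
    (hL : ∀ m, L.le m = X.leftLE m) : IsNTiltingTorsionClass n (X.inHeart R).P := by
  have hE := X.essImage_eq hR (hL 0)
  have hP := inHeart_iff hE
  exact
    { cogenerates := fun Z => by
        obtain ⟨Y, i, hY, hi⟩ := heart_cogenerates hR hE Z
        exact ⟨Y, i, (hP Y).2 hY, hi⟩
      extensions := heart_isClosedUnderExtensions hP
      hasDKernels := (inHeart_isSubcategory hE).hasDKernels hX.hasDKernels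
      last := fun S hS hm he hi => heart_closed (hX.le_le hR (hL 0)) (X.le_zero_le hR (hL 0)) hP
        (isCosyzygy_of_composableArrows S hS hm he hi) }

/-- An `n`-quasi-abelian category is an `n`-cotilting torsion-free class in the left heart. -/
theorem isNCotiltingTorsionFreeClass (hX : IsNQuasiAbelian X.conf n)
    (hR : ∀ m, R.ge m = X.rightGE m) (hL : ∀ m, L.le m = X.leftLE m) :
    IsNCotiltingTorsionFreeClass n (X.inHeart L).P := by
  have hE := X.essImage_eq hR (hL 0)
  have hP := inHeart_iff (R := L) (L := R) (hE.trans (inf_comm _ _))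
  exact
    { generates := fun Z => by
        obtain ⟨Y, p, hY, hp⟩ := heart_generates hL hE Z
        exact ⟨Y, p, (hP Y).2 hY, hp⟩
      extensions := heart_isClosedUnderExtensions hP
      hasDCokernels := (inHeart_isSubcategory' hE).hasDCokernels hX.hasDCokernels
      first := fun S hS hm he hi => heart_closed' (hX.le_le hR (hL 0)) (X.le_zero_le hR (hL 0)) hP
        (isCosyzygy_of_composableArrows S hS hm he hi) }

end ExactCat

end NQuasiAbelian

/-! ### The bijections -/

namespace NQuasiAbelian

/-- A correspondence which is unique up to equivalence on both sides is a bijection between the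
classes up to equivalence. -/
lemma exists_quotient_equiv {α β : Type*} (s : Setoid α) (t : Setoid β) (r : α → β → Prop)
    (h₁ : ∀ a, ∃ b, r a b) (h₂ : ∀ b, ∃ a, r a b) (h₃ : ∀ {a a' b}, r a b → r a' b → s a a')
    (h₄ : ∀ {a b b'}, r a b → r a b' → t b b') (h₅ : ∀ {a b b'}, r a b → t b b' → r a b')
    (h₆ : ∀ {a a' b}, s a a' → r a' b → r a b) :
    ∃ φ : Quotient s ≃ Quotient t, ∀ a b, φ (Quotient.mk _ a) = Quotient.mk _ b ↔ r a b := by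
  choose f hf using h₁
  choose g hg using h₂
  let φ : Quotient s ≃ Quotient t :=
    { toFun := Quotient.lift (fun a => Quotient.mk t (f a))
        fun a a' h => Quotient.sound (h₄ (hf a) (h₆ h (hf a')))
      invFun := Quotient.lift (fun b => Quotient.mk s (g b))
        fun b b' h => Quotient.sound (h₃ (h₅ (hg b) h) (hg b'))
      left_inv := Quotient.ind fun a => Quotient.sound (h₃ (hg (f a)) (hf a))
      right_inv := Quotient.ind fun b => Quotient.sound (h₄ (hf (g b)) (hg b)) }
  exact ⟨φ, fun a b => ⟨fun h => h₅ (hf a) (Quotient.exact h),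
    fun h => Quotient.sound (h₄ (hf a) h)⟩⟩

namespace ExactCat

variable {X : ExactCat.{w}} {n : ℕ}

lemma exists_tStructures (hX : IsNQuasiAbelian X.conf n) :
    ∃ R L : TStructure X.Derived, (∀ m, R.ge m = X.rightGE m) ∧ ∀ m, L.le m = X.leftLE m :=
  ⟨X.rightT hX.hasDCokernels, X.leftT hX.hasDKernels, fun _ => rfl, fun _ => rfl⟩

/-- Both pairs are equivalent to the pair formed by the right and left t-structures of `X`. -/
lemma IsIntersectionOfHearts.isEquivalent_of_tilting (hX : IsNQuasiAbelian X.conf n)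
    {Y Y' : TPair.{w}} (h : X.IsIntersectionOfHearts Y) (h' : X.IsIntersectionOfHearts Y')
    (hY : IsNTilting n Y.D Y.T) (hY' : IsNTilting n Y'.D Y'.T) : Y.IsEquivalent Y' := by
  obtain ⟨R, L, hR, hL⟩ := exists_tStructures hX
  exact TPair.setoid.iseqv.trans (TPair.setoid.iseqv.symm (h.isEquivalent hY hR (hL 0)))
    (h'.isEquivalent hY' hR (hL 0))

/-- A tilting torsion class is determined by its exact category, so `Z` is equivalent to `X.inHeart
R`, which is a first heart by construction. -/
lemma IsIntersectionOfHearts.isSubcategory_iff_isFirstHeart (hX : IsNQuasiAbelian X.conf n)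
    {Y : TPair.{w}} (h : X.IsIntersectionOfHearts Y) (hY : IsNTilting n Y.D Y.T) {Z : AbSub.{w}}
    (hZ : IsNTiltingTorsionClass n Z.P) : X.IsSubcategory Z ↔ Z.IsFirstHeart Y := by
  refine ⟨fun h' => ?_, fun h' => h'.isSubcategory h⟩
  obtain ⟨R, L, hR, hL⟩ := exists_tStructures hX
  have hE := X.essImage_eq hR (hL 0)
  exact ((h'.isEquivalent_of_tilting (inHeart_isSubcategory hE) hZ
    (isNTiltingTorsionClass hX hR hL)).isFirstHeart (X.inHeart_isFirstHeart hE)).of_isEquivalent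
      (h.isEquivalent hY hR (hL 0))

lemma IsIntersectionOfHearts.isSubcategory_iff_isSecondHeart (hX : IsNQuasiAbelian X.conf n)
    {Y : TPair.{w}} (h : X.IsIntersectionOfHearts Y) (hY : IsNTilting n Y.D Y.T) {Z : AbSub.{w}}
    (hZ : IsNCotiltingTorsionFreeClass n Z.P) : X.IsSubcategory Z ↔ Z.IsSecondHeart Y := by
  refine ⟨fun h' => ?_, fun h' => h'.isSubcategory h⟩
  obtain ⟨R, L, hR, hL⟩ := exists_tStructures hX
  have hE := X.essImage_eq hR (hL 0)
  exact (((h'.isEquivalent_of_cotilting (inHeart_isSubcategory' hE) hZ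
    (isNCotiltingTorsionFreeClass hX hR hL)).isFirstHeart
      (X.inHeart_isSecondHeart hE).swap).of_isEquivalent (h.isEquivalent hY hR (hL 0)).swap).swap

end ExactCat

open ExactCat

/-- The correspondence between `n`-quasi-abelian categories and `n`-tilting pairs. -/
theorem exists_equiv_tiltingPairs (n : ℕ) :
    ∃ φ : NQuasiAbelianClass.{w} n ≃ NTiltingPairClass.{w} n,
      ∀ (X : ExactCat.{w}) (hX : IsNQuasiAbelian X.conf n) (Y : TPair.{w})
        (hY : IsNTilting n Y.D Y.T), φ (.mk X hX) = .mk Y hY ↔ X.IsIntersectionOfHearts Y := by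
  obtain ⟨φ, hφ⟩ := exists_quotient_equiv
    (ExactCat.setoid.{w}.comap
      (Subtype.val : {X : ExactCat.{w} // IsNQuasiAbelian X.conf n} → ExactCat.{w}))
    (TPair.setoid.{w}.comap
      (Subtype.val : {X : TPair.{w} // IsNTilting n X.D X.T} → TPair.{w}))
    (fun X Y => X.1.IsIntersectionOfHearts Y.1)
    (fun ⟨X, hX⟩ => by
      obtain ⟨R, L, hR, hL⟩ := exists_tStructures hX
      exact ⟨⟨X.derivedPair R L, isNTilting hX hR hL⟩,
        X.isIntersectionOfHearts_derivedPair (X.essImage_eq hR (hL 0))⟩)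
    (fun ⟨Y, hY⟩ => by
      obtain ⟨X, hX, h⟩ := hY.exists_isIntersectionOfHearts
      exact ⟨⟨X, hX⟩, h⟩)
    (fun h h' => h.unique h')
    (fun {X Y Y'} h h' => h.isEquivalent_of_tilting X.2 h' Y.2 Y'.2)
    (fun h h' => h.of_isEquivalent h') (fun h h' => IsEquivalent.isIntersectionOfHearts h h')
  exact ⟨φ, fun X hX Y hY => hφ ⟨X, hX⟩ ⟨Y, hY⟩⟩

/-- The correspondence between `n`-quasi-abelian categories and `n`-tilting torsion classes. -/
theorem exists_equiv_tiltingTorsionClasses (n : ℕ) :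
    ∃ τ : NQuasiAbelianClass.{w} n ≃ NTiltingTorsionClass.{w} n,
      ∀ (X : ExactCat.{w}) (hX : IsNQuasiAbelian X.conf n) (Z : AbSub.{w})
        (hZ : IsNTiltingTorsionClass n Z.P), τ (.mk X hX) = .mk Z hZ ↔ X.IsSubcategory Z := by
  obtain ⟨τ, hτ⟩ := exists_quotient_equiv
    (ExactCat.setoid.{w}.comap
      (Subtype.val : {X : ExactCat.{w} // IsNQuasiAbelian X.conf n} → ExactCat.{w}))
    (AbSub.setoid.{w}.comap
      (Subtype.val : {X : AbSub.{w} // IsNTiltingTorsionClass n X.P} → AbSub.{w}))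
    (fun X Z => X.1.IsSubcategory Z.1)
    (fun ⟨X, hX⟩ => by
      obtain ⟨R, L, hR, hL⟩ := exists_tStructures hX
      exact ⟨⟨X.inHeart R, isNTiltingTorsionClass hX hR hL⟩,
        inHeart_isSubcategory (X.essImage_eq hR (hL 0))⟩)
    (fun ⟨Z, hZ⟩ => by
      obtain ⟨X, hX, h⟩ := hZ.exists_isSubcategory
      exact ⟨⟨X, hX⟩, h⟩)
    (fun h h' => h.unique h')
    (fun {X Z Z'} h h' => h.isEquivalent_of_tilting h' Z.2 Z'.2)
    (fun h h' => h.of_isEquivalent h') (fun h h' => IsEquivalent.isSubcategory h h')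
  exact ⟨τ, fun X hX Z hZ => hτ ⟨X, hX⟩ ⟨Z, hZ⟩⟩

/-- The correspondence between `n`-quasi-abelian categories and `n`-cotilting torsion-free
classes. -/
theorem exists_equiv_cotiltingTorsionFreeClasses (n : ℕ) :
    ∃ κ : NQuasiAbelianClass.{w} n ≃ NCotiltingTorsionFreeClass.{w} n,
      ∀ (X : ExactCat.{w}) (hX : IsNQuasiAbelian X.conf n) (Z : AbSub.{w})
        (hZ : IsNCotiltingTorsionFreeClass n Z.P), κ (.mk X hX) = .mk Z hZ ↔ X.IsSubcategory Z := by
  obtain ⟨κ, hκ⟩ := exists_quotient_equiv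
    (ExactCat.setoid.{w}.comap
      (Subtype.val : {X : ExactCat.{w} // IsNQuasiAbelian X.conf n} → ExactCat.{w}))
    (AbSub.setoid.{w}.comap
      (Subtype.val : {X : AbSub.{w} // IsNCotiltingTorsionFreeClass n X.P} → AbSub.{w}))
    (fun X Z => X.1.IsSubcategory Z.1)
    (fun ⟨X, hX⟩ => by
      obtain ⟨R, L, hR, hL⟩ := exists_tStructures hX
      exact ⟨⟨X.inHeart L, isNCotiltingTorsionFreeClass hX hR hL⟩,
        inHeart_isSubcategory' (X.essImage_eq hR (hL 0))⟩)
    (fun ⟨Z, hZ⟩ => by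
      obtain ⟨X, hX, h⟩ := hZ.exists_isSubcategory
      exact ⟨⟨X, hX⟩, h⟩)
    (fun h h' => h.unique h')
    (fun {X Z Z'} h h' => h.isEquivalent_of_cotilting h' Z.2 Z'.2)
    (fun h h' => h.of_isEquivalent h') (fun h h' => IsEquivalent.isSubcategory h h')
  exact ⟨κ, fun X hX Z hZ => hκ ⟨X, hX⟩ ⟨Z, hZ⟩⟩

end NQuasiAbelian

open NQuasiAbelian CategoryTheory CategoryTheory.Triangulated

theorem mainTheorem1 (n : ℕ) :
    ∃ (φ : NQuasiAbelianClass.{w} n ≃ NTiltingPairClass.{w} n)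
      (τ : NTiltingPairClass.{w} n ≃ NTiltingTorsionClass.{w} n)
      (κ : NTiltingPairClass.{w} n ≃ NCotiltingTorsionFreeClass.{w} n),
      (∀ (X : ExactCat.{w}) (hX : IsNQuasiAbelian X.conf n),
        X.toDerived.Full ∧ X.toDerived.Faithful ∧
        ∃ R L : TStructure X.Derived,
          (∀ m : ℤ, R.ge m = X.rightGE m) ∧ (∀ m : ℤ, L.le m = X.leftLE m) ∧
          X.toDerived.essImage = R.heart ⊓ L.heart ∧
          ∃ (hRL : IsNTilting n R L) (hR : IsNTiltingTorsionClass n (X.inHeart R).P)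
            (hL : IsNCotiltingTorsionFreeClass n (X.inHeart L).P),
            φ (.mk X hX) = .mk (X.derivedPair R L) hRL ∧
            τ (φ (.mk X hX)) = .mk (X.inHeart R) hR ∧
            κ (φ (.mk X hX)) = .mk (X.inHeart L) hL) ∧
      (∀ (X : ExactCat.{w}) (hX : IsNQuasiAbelian X.conf n)
        (Y : TPair.{w}) (hY : IsNTilting n Y.D Y.T),
        φ (.mk X hX) = .mk Y hY ↔ X.IsIntersectionOfHearts Y) ∧
      (∀ (Y : TPair.{w}) (hY : IsNTilting n Y.D Y.T)
        (Z : AbSub.{w}) (hZ : IsNTiltingTorsionClass n Z.P),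
        τ (.mk Y hY) = .mk Z hZ ↔ Z.IsFirstHeart Y) ∧
      (∀ (Y : TPair.{w}) (hY : IsNTilting n Y.D Y.T)
        (Z : AbSub.{w}) (hZ : IsNCotiltingTorsionFreeClass n Z.P),
        κ (.mk Y hY) = .mk Z hZ ↔ Z.IsSecondHeart Y) ∧
      (∀ (X : ExactCat.{w}) (hX : IsNQuasiAbelian X.conf n)
        (Z : AbSub.{w}) (hZ : IsNTiltingTorsionClass n Z.P),
        τ (φ (.mk X hX)) = .mk Z hZ ↔ X.IsSubcategory Z) ∧
      (∀ (X : ExactCat.{w}) (hX : IsNQuasiAbelian X.conf n)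
        (Z : AbSub.{w}) (hZ : IsNCotiltingTorsionFreeClass n Z.P),
        κ (φ (.mk X hX)) = .mk Z hZ ↔ X.IsSubcategory Z) := by
  obtain ⟨φ, hφ⟩ := exists_equiv_tiltingPairs.{w} n
  obtain ⟨τ, hτ⟩ := exists_equiv_tiltingTorsionClasses.{w} n
  obtain ⟨κ, hκ⟩ := exists_equiv_cotiltingTorsionFreeClasses.{w} n
  have hτ' : ∀ x, (φ.symm.trans τ) (φ x) = τ x := fun x => by simp
  have hκ' : ∀ x, (φ.symm.trans κ) (φ x) = κ x := fun x => by simp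
  -- The correspondences of torsion and torsion-free classes were built from the exact category, so
  -- those starting from pairs are obtained by going back along `φ`.
  refine ⟨φ, φ.symm.trans τ, φ.symm.trans κ, fun X hX => ?_, hφ, fun Y hY Z hZ => ?_,
    fun Y hY Z hZ => ?_, fun X hX Z hZ => ?_, fun X hX Z hZ => ?_⟩
  · obtain ⟨R, L, hR, hL⟩ := ExactCat.exists_tStructures hX
    have hE := X.essImage_eq hR (hL 0)
    refine ⟨inferInstance, inferInstance, R, L, hR, hL, hE, ExactCat.isNTilting hX hR hL,
      ExactCat.isNTiltingTorsionClass hX hR hL, ExactCat.isNCotiltingTorsionFreeClass hX hR hL,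
      ?_, ?_, ?_⟩
    · exact (hφ _ _ _ _).2 (X.isIntersectionOfHearts_derivedPair hE)
    · exact (hτ' _).trans ((hτ _ _ _ _).2 (ExactCat.inHeart_isSubcategory hE))
    · exact (hκ' _).trans ((hκ _ _ _ _).2 (ExactCat.inHeart_isSubcategory' hE))
  -- Every pair comes from the intersection of its hearts, which turns the claim into one about an
  -- exact category.
  · obtain ⟨X, hX, h⟩ := hY.exists_isIntersectionOfHearts
    rw [← (hφ X hX Y hY).2 h, hτ', hτ, h.isSubcategory_iff_isFirstHeart hX hY hZ]
  · obtain ⟨X, hX, h⟩ := hY.exists_isIntersectionOfHearts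
    rw [← (hφ X hX Y hY).2 h, hκ', hκ, h.isSubcategory_iff_isSecondHeart hX hY hZ]
  · rw [hτ', hτ]
  · rw [hκ', hκ]
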